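/- **Setting.** Let $M$ be a smooth manifold of dimension $d$ (Hausdorff, $\sigma$-compact, without boundary) with a Lie filtration: smooth sub-bundles $0=H^0\subseteq H^1\subseteq\dots\subseteq H^N=TM$ of constant ranks ($N\ge 1$, $H^j=TM$ for $j>N$) such that $[X,Y]$ is a section of $H^{j+k}$ whenever $X$, $Y$ are smooth sections of $H^j$, $H^k$. Put $\mathfrak t_HM=\bigoplus_{k=1}^N H^k/H^{k-1}$, with dilations $\delta_t=t^k$ on the $k$-th summand, and $d_H=\sum_{k=1}^N k\,\mathrm{rank}(H^k/H^{k-1})$. Fix a splitting, i.e. a smooth bundle isomorphism $\psi:\mathfrak t_HM\to TM$ whose restriction to each $H^k/H^{k-1}$ is right inverse to the quotient map $H^k\to H^k/H^{k-1}$, and a smooth connection on $\mathfrak t_HM$ commuting with the dilations; let $\exp$ be its geodesic exponential map (transported by $\psi$). The $H$-tangent groupoid is $\mathbb T_HM=(\mathfrak t_HM\times\{0\})\sqcup(M\times M\times\mathbb R^\times)$, with the smooth structure given by that of $M\times M\times\mathbb R^\times$ and by the charts $(x,z,h)\mapsto(x,\exp_x(\delta_hz),h)$ for $h\ne0$, $(x,z,0)\mapsto((x,z),0)$,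 written in local homogeneous frames of $\mathfrak t_HM$. It has the maps $r,s:\mathbb T_HM\to M\times\mathbb R$, $r(x,y,h)=(x,h)$, $s(x,y,h)=(y,h)$, $r((x,z),0)=s((x,z),0)=(x,0)$, and the zoom action $\alpha_\lambda(x,y,h)=(x,y,\lambda^{-1}h)$, $\alpha_\lambda((x,z),0)=((x,\delta_\lambda z),0)$, $\lambda>0$. For a submersion $\pi:X\to Y$, $\mathcal E'_\pi(X)$ is the space of continuous $C^\infty(Y)$-linear maps $\mathbb P:C^\infty(X)\to C^\infty(Y)$, $f\mapsto(\mathbb P,f)$, with the topology of bounded convergence. For $\mathbb P\in\mathcal E'_r(\mathbb T_HM)$ put $((\alpha_\lambda)_*\mathbb P,f)(x,h)=(\mathbb P,f\circ\alpha_\lambda)(x,\lambda h)$ and $\mathcal L_Z\mathbb P=\frac{d}{d\lambda}\big|_{\lambda=1}(\alpha_\lambda)_*\mathbb P$; $\mathbb P_1\in\mathcal E'_r(M\times M)$ (with $r(x,y)=x$) is the restriction of $\mathbb P$ to $h=1$. Let $C_p^\infty(\mathbb T_HM,\Omega_r)\subset\mathcal E'_r(\mathbb T_HM)$ be the space of smooth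 densities along the $r$-fibres with $r$- and $s$-proper support. $\mathbb P$ is a *pseudodifferential kernel of order $m\in\mathbb C$* if $(\mathcal L_Z-m)\mathbb P\in C_p^\infty(\mathbb T_HM,\Omega_r)$. If $\mathbb P$ is given in the exponential charts by continuous densities $a(x,z,h)\,|dz|$ along the $r$-fibres, its *local trace* is the section $\mathrm{tr}_h(\mathbb P)(x)=a(x,0,h)|dz|$, regarded through $\psi$ as a density on $T_xM$. Let $C(M\times\mathbb R,\Omega M)$ be the space of continuous families $(x,h)\mapsto\tau_h(x)$ of densities $\tau_h(x)$ on $T_xM$, with the topology of locally uniform convergence. If $M$ is compact, the *global trace* of $P=\mathbb P_1$, $\mathbb P$ a kernel of order $m$ with $\Re m<-d_H$, is $\mathrm{Tr}(P)=\int_M\mathrm{tr}_1(\mathbb P)$. Let $\Omega\subseteq\mathbb C$ be open and connected and $\mu:\Omega\to\mathbb C$ holomorphic with $\{s\in\Omega:\Re\mu(s)<-d_H\}\ne\emptyset$. A *holomorphic family of kernels with order function $\mu$* is a holomorphic map $\mathbb P:\Omega\to\mathcal E'_r(\mathbb T_HM)$ such that $\mathbb P(s)$ is a pseudodifferential kernel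 of order $\mu(s)$ for every $s\in\Omega$. **(A) Local trace.** Let $\mathbb P$ be such a family. For $\Re\mu(s)<-d_H$ the local trace $\mathrm{tr}(\mathbb P(s))$ exists, is unique, and belongs to $C(M\times\mathbb R,\Omega M)$. The $C(M\times\mathbb R,\Omega M)$-valued function $s\mapsto\mathrm{tr}(\mathbb P(s))$ has a meromorphic continuation to $\Omega$ that is holomorphic off $\mu^{-1}(\{-d_H,-d_H+1,-d_H+2,\dots\})$. If $s_0\in\Omega$ and $\mu(s_0)=-d_H$, then for all $h\in\mathbb R$, at every point of $M$, $$\mathrm{Res}_{s=s_0}\mathrm{tr}_h(\mathbb P(s))=\mathrm{Res}_{s=s_0}\frac{1}{-d_H-\mu(s)}\,\mathrm{tr}_0\big((\mathcal L_Z-\mu(s))\mathbb P(s)\big),$$ and if moreover $\mu'(s_0)\neq0$, then $$\mathrm{Res}_{s=s_0}\mathrm{tr}_h(\mathbb P(s))=-\frac1{\mu'(s_0)}\,\mathrm{tr}_0\big((\mathcal L_Z+d_H)\mathbb P(s_0)\big).$$ **(B) Global trace.** Suppose that $M$ is compact, and let $P(s)\in\mathcal E'_r(M\times M)$, $s\in\Omega$,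 be such that $P(s)=\mathbb P(s)_1$ on $\Omega$ for some holomorphic family of kernels $\mathbb P$ with order function $\mu$. For $\Re\mu(s)<-d_H$ the trace $\mathrm{Tr}(P(s))$ exists and does not depend on the kernel of order $\mu(s)$ used to define it. The function $s\mapsto\mathrm{Tr}(P(s))$ has a meromorphic continuation to $\Omega$ that is holomorphic off $\mu^{-1}(\{-d_H,-d_H+1,\dots\})$. If $s_0\in\Omega$ and $\mu(s_0)=-d_H$, then for every holomorphic family of kernels $\mathbb P$ with order function $\mu$ and $P(s)=\mathbb P(s)_1$ on $\Omega$, $$\mathrm{Res}_{s=s_0}\mathrm{Tr}(P(s))=\mathrm{Res}_{s=s_0}\frac{1}{-d_H-\mu(s)}\int_M\mathrm{tr}_0\big((\mathcal L_Z-\mu(s))\mathbb P(s)\big),$$ and if moreover $\mu'(s_0)\ne0$, then $$\mathrm{Res}_{s=s_0}\mathrm{Tr}(P(s))=-\frac1{\mu'(s_0)}\int_M\mathrm{tr}_0\big((\mathcal L_Z+d_H)\mathbb P(s_0)\big).$$ -/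

import Mathlib

open Set Filter Topology MeasureTheory
open scoped Manifold ContDiff

noncomputable section

namespace Carnot

/-! ### Spaces with a smooth structure given by parametrizations -/

/-- A parametrization of a part of `X` by an open subset of a normed space. -/
structure Plot (𝔼 : Type*) [TopologicalSpace 𝔼] (X : Type*) where
  dom : Set 𝔼
  isOpen_dom : IsOpen dom
  map : 𝔼 → X

section Smooth

variable {𝔼 : Type*} [NormedAddCommGroup 𝔼] [NormedSpace ℝ 𝔼] {X : Type*}
variable {𝔼' : Type*} [NormedAddCommGroup 𝔼'] [NormedSpace ℝ 𝔼'] {Y : Type*}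

/-- The complex functions on `X` that are smooth in all parametrizations of the family `A`. -/
def smoothSubmodule (A : Set (Plot 𝔼 X)) : Submodule ℂ (X → ℂ) where
  carrier := {f | ∀ p ∈ A, ContDiffOn ℝ ∞ (f ∘ p.map) p.dom}
  add_mem' hf hg p hp := (hf p hp).add (hg p hp)
  zero_mem' _ _ := contDiffOn_const
  smul_mem' c _ hf p hp := (hf p hp).const_smul c

/-- The space `C^∞(X)` of smooth complex functions on `X`. -/
def CInf (A : Set (Plot 𝔼 X)) : Type _ := smoothSubmodule A

instance (A : Set (Plot 𝔼 X)) : AddCommGroup (CInf A) :=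
  inferInstanceAs (AddCommGroup (smoothSubmodule A))

instance (A : Set (Plot 𝔼 X)) : Module ℂ (CInf A) :=
  inferInstanceAs (Module ℂ (smoothSubmodule A))

instance (A : Set (Plot 𝔼 X)) : CoeFun (CInf A) (fun _ => X → ℂ) := ⟨fun f => f.1⟩

theorem CInf.contDiffAt {A : Set (Plot 𝔼 X)} (f : CInf A) {p : Plot 𝔼 X} (hp : p ∈ A)
    {u : 𝔼} (hu : u ∈ p.dom) : ContDiffAt ℝ ∞ (f ∘ p.map) u :=
  (f.2 p hp).contDiffAt (p.isOpen_dom.mem_nhds hu)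

/-- The `k`-th derivative of a smooth function in a parametrization, as a continuous function. -/
def jet (A : Set (Plot 𝔼 X)) (p : A) (k : ℕ) :
    CInf A →ₗ[ℂ] C(p.1.dom, ContinuousMultilinearMap ℝ (fun _ : Fin k => 𝔼) ℂ) where
  toFun f := ⟨fun u => iteratedFDeriv ℝ k (f ∘ p.1.map) u.1, by
    have h : ContinuousOn (iteratedFDeriv ℝ k (f ∘ p.1.map)) p.1.dom := by
      intro u hu
      have := (f.contDiffAt p.2 hu)
      exact (ContDiffAt.iteratedFDeriv_right (m := 0) (n := (k : ℕ∞)) (i := k)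
        (this.of_le (by exact_mod_cast le_top)) (by simp)).continuousAt.continuousWithinAt
    exact h.domRestrict⟩
  map_add' f g := by
    ext1 u
    exact iteratedFDeriv_add_apply
      ((f.contDiffAt p.2 u.2).of_le (by exact_mod_cast le_top))
      ((g.contDiffAt p.2 u.2).of_le (by exact_mod_cast le_top))
  map_smul' c f := by
    ext1 u
    exact iteratedFDeriv_const_smul_apply
      ((f.contDiffAt p.2 u.2).of_le (by exact_mod_cast le_top))

/-- The Fréchet topology of `C^∞(X)`: locally uniform convergence of all derivatives in all
parametrizations. -/
instance (A : Set (Plot 𝔼 X)) : TopologicalSpace (CInf A) :=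
  ⨅ i : A × ℕ, TopologicalSpace.induced (jet A i.1 i.2) inferInstance

instance (A : Set (Plot 𝔼 X)) : IsTopologicalAddGroup (CInf A) :=
  topologicalAddGroup_iInf fun i => topologicalAddGroup_induced (jet A i.1 i.2)

instance (A : Set (Plot 𝔼 X)) : ContinuousSMul ℂ (CInf A) :=
  continuousSMul_iInf fun i => continuousSMul_induced (jet A i.1 i.2)

/-- The topology of `X` defined by the parametrizations. -/
@[reducible]
def plotTopology (A : Set (Plot 𝔼 X)) : TopologicalSpace X :=
  ⨆ p : A, TopologicalSpace.coinduced (fun u : p.1.dom => p.1.map u.1) inferInstance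

/-- `φ` is linear in suitable parametrizations. -/
def IsPlotLinear (A : Set (Plot 𝔼 X)) (B : Set (Plot 𝔼' Y)) (φ : X → Y) : Prop :=
  ∀ p ∈ A, ∃ q ∈ B, ∃ L : 𝔼 →L[ℝ] 𝔼', ∀ u ∈ p.dom, L u ∈ q.dom ∧ φ (p.map u) = q.map (L u)

theorem IsPlotLinear.eventuallyEq {p : Plot 𝔼 X} {q : Plot 𝔼' Y}
    {φ : X → Y} {L : 𝔼 →L[ℝ] 𝔼'} (h : ∀ u ∈ p.dom, L u ∈ q.dom ∧ φ (p.map u) = q.map (L u))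
    (f : Y → ℂ) {u : 𝔼} (hu : u ∈ p.dom) :
    (f ∘ φ) ∘ p.map =ᶠ[𝓝 u] (f ∘ q.map) ∘ L := by
  filter_upwards [p.isOpen_dom.mem_nhds hu] with v hv
  simp [(h v hv).2]

/-- The pullback `φ^* : C^∞(Y) → C^∞(X)` as a continuous linear map. -/
def pull (A : Set (Plot 𝔼 X)) (B : Set (Plot 𝔼' Y)) (φ : X → Y) (hφ : IsPlotLinear A B φ) :
    CInf B →L[ℂ] CInf A where
  toFun f := ⟨fun x => f (φ x), by
    intro p hp
    obtain ⟨q, hq, L, hL⟩ := hφ p hp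
    have h : ContDiffOn ℝ ∞ ((f ∘ q.map) ∘ L) p.dom :=
      (f.2 q hq).comp L.contDiff.contDiffOn fun u hu => (hL u hu).1
    exact h.congr fun u hu => by simp [(hL u hu).2]⟩
  map_add' _ _ := rfl
  map_smul' _ _ := rfl
  cont := by
    refine continuous_iInf_rng.2 fun i => continuous_induced_rng.2 ?_
    obtain ⟨⟨p, hp⟩, k⟩ := i
    obtain ⟨q, hq, L, hL⟩ := hφ p hp
    let θ : C(p.dom, q.dom) :=
      ⟨fun u => ⟨L u.1, (hL u.1 u.2).1⟩, (L.continuous.comp continuous_subtype_val).subtype_mk _⟩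
    let Λ : C(ContinuousMultilinearMap ℝ (fun _ : Fin k => 𝔼') ℂ,
        ContinuousMultilinearMap ℝ (fun _ : Fin k => 𝔼) ℂ) :=
      ⟨fun m => m.compContinuousLinearMap fun _ => L,
        (ContinuousMultilinearMap.compContinuousLinearMapL (fun _ => L)).continuous⟩
    have h1 : Continuous (jet B ⟨q, hq⟩ k) :=
      continuous_iInf_dom (i := (⟨⟨q, hq⟩, k⟩ : B × ℕ)) continuous_induced_dom
    have h2 := (ContinuousMap.continuous_postcomp Λ).comp
      ((ContinuousMap.continuous_precomp θ).comp h1)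
    refine h2.congr fun f => ?_
    ext1 u
    have e1 := (IsPlotLinear.eventuallyEq hL f.1 u.2).iteratedFDeriv (𝕜 := ℝ) k
    have e2 : iteratedFDeriv ℝ k ((f.1 ∘ q.map) ∘ L) u.1 =
        (iteratedFDeriv ℝ k (f.1 ∘ q.map) (L u.1)).compContinuousLinearMap fun _ => L :=
        by
      have hq' : L ⁻¹' q.dom ∈ 𝓝 u.1 := (q.isOpen_dom.preimage L.continuous).mem_nhds (hL u.1 u.2).1
      have e3 := L.iteratedFDerivWithin_comp_right (i := k) ((f.2 q hq).of_le (m := k)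
        (by exact_mod_cast le_top)) q.isOpen_dom.uniqueDiffOn
        (q.isOpen_dom.preimage L.continuous).uniqueDiffOn (hL u.1 u.2).1 le_rfl
      rw [iteratedFDerivWithin_of_isOpen k (q.isOpen_dom.preimage L.continuous) (hL u.1 u.2).1,
        iteratedFDerivWithin_of_isOpen k q.isOpen_dom (hL u.1 u.2).1] at e3
      exact e3
    exact e2.symm.trans e1.self_of_nhds.symm

/-- The space `𝓔'_π(X)` of `π`-fibred distributions: continuous `C^∞(Y)`-linear maps
`C^∞(X) → C^∞(Y)`, with the topology of bounded convergence. -/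
def FibredDist (A : Set (Plot 𝔼 X)) (B : Set (Plot 𝔼' Y)) (π : X → Y) :
    Submodule ℂ (CInf A →L[ℂ] CInf B) where
  carrier := {T | ∀ (g : CInf B) (f f' : CInf A), (∀ x, f' x = g (π x) * f x) →
    ∀ y, T f' y = g y * T f y}
  add_mem' {S T} hS hT g f f' h y := by
    have e1 := hS g f f' h y
    have e2 := hT g f f' h y
    change (S f').1 y + (T f').1 y = g y * ((S f).1 y + (T f).1 y)
    rw [e1, e2]; ring
  zero_mem' g f f' _ y := by
    change (0 : ℂ) = g y * 0
    simp
  smul_mem' c T hT g f f' h y := by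
    have e1 := hT g f f' h y
    change c * (T f').1 y = g y * (c * (T f).1 y)
    rw [e1]; ring

end Smooth

/-! ### Holomorphic and meromorphic functions with values in a topological vector space -/

section Holomorphic

variable {V : Type*} [AddCommGroup V] [Module ℂ V] [TopologicalSpace V]

/-- `f` is complex differentiable at all points of the open set `U`. -/
def IsHolomorphicOn (f : ℂ → V) (U : Set ℂ) : Prop :=
  ∀ s ∈ U, ∃ D : V, Tendsto (fun w => (w - s)⁻¹ • (f w - f s)) (𝓝[≠] s) (𝓝 D)

/-- `f` is holomorphic near `s₀` except for at most a pole at `s₀`. -/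
def IsMeromorphicAt (f : ℂ → V) (s₀ : ℂ) : Prop :=
  ∃ (n : ℕ) (U : Set ℂ) (g : ℂ → V), IsOpen U ∧ s₀ ∈ U ∧ IsHolomorphicOn g U ∧
    ∀ w ∈ U, w ≠ s₀ → (w - s₀) ^ n • f w = g w

/-- The scalar function `f` is meromorphic at `s₀` and the coefficient of `(s - s₀)⁻¹` in its
Laurent expansion is `c`. -/
def HasResidue (f : ℂ → ℂ) (s₀ c : ℂ) : Prop :=
  ∃ (n : ℕ) (g : ℂ → ℂ), AnalyticAt ℂ g s₀ ∧
    (∀ᶠ s in 𝓝[≠] s₀, f s = ((s - s₀) ^ (n + 1))⁻¹ * g s) ∧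
    c = iteratedDeriv n g s₀ / (n.factorial : ℂ)

end Holomorphic

/-! ### Carnot manifolds -/

/-- The model space. -/
abbrev Eu (d : ℕ) : Type := EuclideanSpace ℝ (Fin d)

section Manifold

variable (d : ℕ) (M : Type*) [TopologicalSpace M] [ChartedSpace (Eu d) M]

/-- The vector field `X` is smooth on `U`. -/
def SmoothFieldOn {d : ℕ} {M : Type*} [TopologicalSpace M] [ChartedSpace (Eu d) M]
    [IsManifold 𝓘(ℝ, Eu d) ∞ M]
    (X : ∀ x : M, TangentSpace 𝓘(ℝ, Eu d) x) (U : Set M) : Prop :=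
  ContMDiffOn 𝓘(ℝ, Eu d) 𝓘(ℝ, Eu d).tangent ∞
    (fun x => (⟨x, X x⟩ : TangentBundle 𝓘(ℝ, Eu d) M)) U

/-- The charts of the maximal smooth atlas. -/
def charts : Set (OpenPartialHomeomorph M (Eu d)) := IsManifold.maximalAtlas 𝓘(ℝ, Eu d) ∞ M

/-- The smooth structure of `M`. -/
def baseAtlas : Set (Plot (Eu d) M) :=
  {p | ∃ φ ∈ charts d M, p = ⟨φ.target, φ.open_target, φ.symm⟩}

/-- The smooth structure of `M × ℝ`. -/
def cylAtlas : Set (Plot (Eu d × ℝ) (M × ℝ)) :=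
  {p | ∃ φ ∈ charts d M, p = ⟨φ.target ×ˢ univ, φ.open_target.prod isOpen_univ,
    fun q => (φ.symm q.1, q.2)⟩}

/-- The smooth structure of `M × M`. -/
def squareAtlas : Set (Plot (Eu d × Eu d) (M × M)) :=
  {p | ∃ φ ∈ charts d M, ∃ φ' ∈ charts d M,
    p = ⟨φ.target ×ˢ φ'.target, φ.open_target.prod φ'.open_target,
      fun q => (φ.symm q.1, φ'.symm q.2)⟩}

variable [IsManifold 𝓘(ℝ, Eu d) ∞ M]

/-- A Lie filtration `0 = H⁰ ⊆ H¹ ⊆ ⋯ ⊆ H^N = TM` of the tangent bundle by smooth sub-bundles. -/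
structure LieFiltration where
  depth : ℕ
  one_le_depth : 1 ≤ depth
  H : ℕ → ∀ x : M, Submodule ℝ (TangentSpace 𝓘(ℝ, Eu d) x)
  H_zero : ∀ x, H 0 x = ⊥
  H_mono : ∀ j x, H j x ≤ H (j + 1) x
  H_top : ∀ j x, depth ≤ j → H j x = ⊤
  rank : ℕ → ℕ
  /-- Every `H j` is a smooth sub-bundle of rank `rank j`: it has local smooth frames. -/
  exists_frame : ∀ (j : ℕ) (x₀ : M), ∃ U : Set M, IsOpen U ∧ x₀ ∈ U ∧
    ∃ Y : Fin (rank j) → ∀ x : M, TangentSpace 𝓘(ℝ, Eu d) x,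
      (∀ i, SmoothFieldOn (Y i) U) ∧
      ∀ x ∈ U, LinearIndependent ℝ (fun i => Y i x) ∧
        Submodule.span ℝ (range fun i => Y i x) = H j x
  bracket_mem : ∀ (j k : ℕ) (X Y : ∀ x : M, TangentSpace 𝓘(ℝ, Eu d) x),
    SmoothFieldOn X univ → SmoothFieldOn Y univ → (∀ x, X x ∈ H j x) → (∀ x, Y x ∈ H k x) →
    ∀ x, VectorField.mlieBracket 𝓘(ℝ, Eu d) X Y x ∈ H (j + k) x

end Manifold

variable {d : ℕ} {M : Type*} [TopologicalSpace M] [ChartedSpace (Eu d) M]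
  [IsManifold 𝓘(ℝ, Eu d) ∞ M]

namespace LieFiltration

variable (F : LieFiltration d M)

/-- The homogeneous dimension `d_H = ∑ k · rank (H^k / H^(k-1))`. -/
def homDim : ℕ := ∑ k ∈ Finset.range F.depth, (k + 1) * (F.rank (k + 1) - F.rank k)

/-- The summand `H^(k+1) / H^k` of degree `k + 1` of the associated graded bundle at `x`. -/
abbrev Gr (k : ℕ) (x : M) : Type :=
  F.H (k + 1) x ⧸ (F.H k x).submoduleOf (F.H (k + 1) x)

/-- The fibre of the associated graded bundle `𝔱_H M` at `x`. -/
abbrev Osc (x : M) : Type := ∀ k : Fin F.depth, F.Gr k x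

/-- The dilation `δ_t`: multiplication by `t ^ k` in degree `k`. -/
def dil (t : ℝ) (x : M) : F.Osc x →ₗ[ℝ] F.Osc x :=
  LinearMap.pi fun k => t ^ ((k : ℕ) + 1) • LinearMap.proj k

/-- A splitting: a smooth bundle isomorphism `ψ : 𝔱_H M → TM` whose restriction to each graded
component is right inverse to the quotient map. -/
structure Splitting where
  ψ : ∀ x : M, F.Osc x ≃ₗ[ℝ] TangentSpace 𝓘(ℝ, Eu d) x
  right_inv : ∀ (x : M) (k : Fin F.depth) (v : F.H ((k : ℕ) + 1) x),
    ψ x (Pi.single k (Submodule.Quotient.mk v)) - (v : TangentSpace 𝓘(ℝ, Eu d) x) ∈ F.H k x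
  smooth : ∀ (k : Fin F.depth) (Y : ∀ x : M, F.H ((k : ℕ) + 1) x),
    SmoothFieldOn (fun x => (Y x : TangentSpace 𝓘(ℝ, Eu d) x)) univ →
    SmoothFieldOn (fun x => ψ x (Pi.single k (Submodule.Quotient.mk (Y x)))) univ

end LieFiltration

variable {F : LieFiltration d M}

/-- The dilation `δ_t`, transported to `TM` by the splitting. -/
def LieFiltration.Splitting.dilT (S : F.Splitting) (t : ℝ) (x : M) :
    TangentSpace 𝓘(ℝ, Eu d) x →ₗ[ℝ] TangentSpace 𝓘(ℝ, Eu d) x :=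
  (S.ψ x).toLinearMap ∘ₗ F.dil t x ∘ₗ (S.ψ x).symm.toLinearMap

/-- A smooth connection on `𝔱_H M` that commutes with the dilations. It is recorded as the
connection on `TM` to which it corresponds under the bundle isomorphism `ψ`. -/
structure GradedConnection (S : F.Splitting) where
  cov : CovariantDerivative 𝓘(ℝ, Eu d) (Eu d) (fun x : M => TangentSpace 𝓘(ℝ, Eu d) x)
  smooth : CovariantDerivative.ContMDiffCovariantDerivative cov ∞
  cov_dil : ∀ (t : ℝ), 0 < t → ∀ σ : (∀ x : M, TangentSpace 𝓘(ℝ, Eu d) x),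
    SmoothFieldOn σ univ → ∀ (x : M) (v : TangentSpace 𝓘(ℝ, Eu d) x),
      cov (fun y => S.dilT t y (σ y)) x v = S.dilT t x (cov σ x v)

/-- The curve `γ` has velocity `v` at time `t`. -/
def HasVelocity (γ : ℝ → M) (t : ℝ) (v : TangentSpace 𝓘(ℝ, Eu d) (γ t)) : Prop :=
  HasMFDerivAt 𝓘(ℝ, ℝ) 𝓘(ℝ, Eu d) γ t ((1 : ℝ →L[ℝ] ℝ).smulRight v)

/-- The covariant acceleration of `γ` vanishes at all times in `J`: near each of them the velocity
is `∑ i, c i t • X i (γ t)` with vector fields `X i` and scalar functions `c i`, and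
`∑ i, (c i' X i + c i ∇_{γ'} X i) = 0`. -/
def IsGeodesicOn
    (cov : CovariantDerivative 𝓘(ℝ, Eu d) (Eu d) (fun x : M => TangentSpace 𝓘(ℝ, Eu d) x))
    (γ : ℝ → M) (J : Set ℝ) : Prop :=
  ∀ t₀ ∈ J, ∃ (X : Fin d → ∀ x : M, TangentSpace 𝓘(ℝ, Eu d) x) (c : Fin d → ℝ → ℝ) (U : Set M),
    IsOpen U ∧ γ t₀ ∈ U ∧ (∀ i, SmoothFieldOn (X i) U) ∧ (∀ i, DifferentiableAt ℝ (c i) t₀) ∧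
    (∀ᶠ t in 𝓝 t₀, HasVelocity γ t (∑ i, c i t • X i (γ t))) ∧
    ∑ i, (deriv (c i) t₀ • X i (γ t₀) +
      c i t₀ • cov (X i) (γ t₀) (∑ j, c j t₀ • X j (γ t₀))) = 0

/-! ### The `H`-tangent groupoid -/

/-- The set `T_H M × {0} ⊔ M × M × ℝ^×`. -/
inductive HTangent (F : LieFiltration d M) : Type _
  | zero (x : M) (z : F.Osc x) : HTangent F
  | pair (x y : M) (h : ℝ) (hh : h ≠ 0) : HTangent F

namespace HTangent

/-- The range map. -/
def r : HTangent F → M × ℝ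
  | zero x _ => (x, 0)
  | pair x _ h _ => (x, h)

/-- The source map. -/
def s : HTangent F → M × ℝ
  | zero x _ => (x, 0)
  | pair _ y h _ => (y, h)

/-- The zoom action `α_λ`. -/
def zoom (l : ℝ) (hl : 0 < l) : HTangent F → HTangent F
  | zero x z => zero x (F.dil l x z)
  | pair x y h hh => pair x y (l⁻¹ * h) (mul_ne_zero (inv_ne_zero hl.ne') hh)

end HTangent

/-- The dilation of the graded vector space `V = ℝ^d` whose `i`-th coordinate has degree
`w i + 1`. -/
def dilE (w : Fin d → ℕ) (t : ℝ) : Eu d →L[ℝ] Eu d :=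
  LinearMap.toContinuousLinearMap
    { toFun := fun z => WithLp.toLp 2 fun i => t ^ (w i + 1) * z i
      map_add' := fun z z' => by ext i; simp [mul_add]
      map_smul' := fun a z => by ext i; simp; ring }

theorem dilE_apply (w : Fin d → ℕ) (t : ℝ) (z : Eu d) (i : Fin d) :
    dilE w t z i = t ^ (w i + 1) * z i := rfl

theorem dilE_mul (w : Fin d → ℕ) {l : ℝ} (hl : 0 < l) (h : ℝ) (z : Eu d) :
    dilE w (l⁻¹ * h) (dilE w l z) = dilE w h z := by
  ext i
  simp only [dilE_apply]
  rw [← mul_assoc, ← mul_pow]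
  congr 2
  field_simp

theorem continuous_dilE (w : Fin d → ℕ) :
    Continuous fun q : Eu d × ℝ => dilE w q.2 q.1 := by
  have : Continuous fun q : Eu d × ℝ =>
      (WithLp.toLp 2 fun i => q.2 ^ (w i + 1) * q.1 i : Eu d) := by
    refine (PiLp.continuous_toLp 2 _).comp ?_
    fun_prop
  exact this

/-- The data of a local exponential chart: a chart `φ` of `M`, a homogeneous local frame of `𝔱_H M`
on its domain (a local trivialization `U × V` as graded bundle), and the map
`(u, z) ↦ exp_x (∑ i, z i • frame i x)`, `x = φ⁻¹ u`, on a fibrewise star-shaped neighbourhood of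
the zero section so small that `(u, z) ↦ (x, exp_x …)` is there a diffeomorphism onto its image. -/
structure ExpChart {S : F.Splitting} (nab : GradedConnection S) where
  φ : OpenPartialHomeomorph M (Eu d)
  φ_mem : φ ∈ charts d M
  deg : Fin d → Fin F.depth
  frame : Fin d → ∀ x : M, F.Osc x
  frame_homogeneous : ∀ x ∈ φ.source, ∀ (i : Fin d) (k : Fin F.depth), k ≠ deg i → frame i x k = 0
  frame_smooth : ∀ i, SmoothFieldOn (fun x => S.ψ x (frame i x)) φ.source
  frame_indep : ∀ x ∈ φ.source, LinearIndependent ℝ (fun i => frame i x)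
  D : Set (Eu d × Eu d)
  isOpen_D : IsOpen D
  D_subset : ∀ q ∈ D, q.1 ∈ φ.target
  zero_mem_D : ∀ u ∈ φ.target, (u, 0) ∈ D
  star_D : ∀ u z, (u, z) ∈ D → ∀ t ∈ Icc (0 : ℝ) 1, (u, t • z) ∈ D
  e : Eu d × Eu d → M
  e_mapsTo : ∀ q ∈ D, e q ∈ φ.source
  e_smooth : ContMDiffOn 𝓘(ℝ, Eu d × Eu d) 𝓘(ℝ, Eu d) ∞ e D
  e_zero : ∀ u ∈ φ.target, e (u, 0) = φ.symm u
  e_velocity : ∀ q ∈ D, HasMFDerivAt 𝓘(ℝ, ℝ) 𝓘(ℝ, Eu d) (fun t : ℝ => e (q.1, t • q.2)) 0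
    ((1 : ℝ →L[ℝ] ℝ).smulRight
      (S.ψ (φ.symm q.1) (∑ i, q.2 i • frame i (φ.symm q.1)) : Eu d))
  e_geodesic : ∀ q ∈ D, IsGeodesicOn nab.cov (fun t => e (q.1, t • q.2)) (Icc 0 1)
  e_injOn : InjOn (fun q => (q.1, e q)) D
  e_immersive : ∀ q ∈ D, Function.Bijective
    (mfderiv 𝓘(ℝ, Eu d) 𝓘(ℝ, Eu d) (fun z => e (q.1, z)) q.2)

namespace ExpChart

variable {S : F.Splitting} {nab : GradedConnection S} (c : ExpChart nab)

/-- The degrees of the frame, shifted by one. -/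
def wt (i : Fin d) : ℕ := c.deg i

open Classical in
/-- The local exponential chart `Exp (x, z, h) = (x, exp_x (δ_h z), h)` of the `H`-tangent
groupoid, with value `((x, z), 0)` at `h = 0`. -/
def plot : Plot (Eu d × Eu d × ℝ) (HTangent F) where
  dom := {q | (q.1, dilE c.wt q.2.2 q.2.1) ∈ c.D}
  isOpen_dom := c.isOpen_D.preimage
    (continuous_fst.prodMk ((continuous_dilE c.wt).comp continuous_snd))
  map q :=
    if hh : q.2.2 = 0 then
      HTangent.zero (c.φ.symm q.1) (∑ i, q.2.1 i • c.frame i (c.φ.symm q.1))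
    else HTangent.pair (c.φ.symm q.1) (c.e (q.1, dilE c.wt q.2.2 q.2.1)) q.2.2 hh

end ExpChart

open Classical in
/-- The charts of the open part `M × M × ℝ^×` of the `H`-tangent groupoid. -/
def pairPlot (F : LieFiltration d M) (φ φ' : OpenPartialHomeomorph M (Eu d)) :
    Plot (Eu d × Eu d × ℝ) (HTangent F) where
  dom := φ.target ×ˢ φ'.target ×ˢ {0}ᶜ
  isOpen_dom := φ.open_target.prod (φ'.open_target.prod isOpen_compl_singleton)
  map q :=
    if hh : q.2.2 = 0 then HTangent.zero (φ.symm q.1) 0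
    else HTangent.pair (φ.symm q.1) (φ'.symm q.2.1) q.2.2 hh

/-- The smooth structure of the `H`-tangent groupoid. -/
def hAtlas {S : F.Splitting} (nab : GradedConnection S) :
    Set (Plot (Eu d × Eu d × ℝ) (HTangent F)) :=
  {p | ∃ φ ∈ charts d M, ∃ φ' ∈ charts d M, p = pairPlot F φ φ'} ∪ range (ExpChart.plot (nab := nab))

/-- The space `𝓔'_r(𝕋_H M)`. -/
abbrev KernelDist {S : F.Splitting} (nab : GradedConnection S) :=
  FibredDist (hAtlas nab) (cylAtlas d M) (HTangent.r (F := F))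

/-- The space `𝓔'_r(M × M)`. -/
abbrev OperatorDist (d : ℕ) (M : Type*) [TopologicalSpace M] [ChartedSpace (Eu d) M] :=
  FibredDist (squareAtlas d M) (baseAtlas d M) (Prod.fst : M × M → M)


/-! ### The zoom action on distributions and its generator -/

set_option linter.unusedSectionVars false in
theorem isPlotLinear_scale (l : ℝ) :
    IsPlotLinear (cylAtlas d M) (cylAtlas d M) (fun q : M × ℝ => (q.1, l * q.2)) := by
  rintro p ⟨φ, hφ, rfl⟩
  refine ⟨_, ⟨φ, hφ, rfl⟩,
    (ContinuousLinearMap.fst ℝ (Eu d) ℝ).prod (l • ContinuousLinearMap.snd ℝ (Eu d) ℝ), ?_⟩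
  rintro ⟨u, h⟩ hu
  exact ⟨⟨hu.1, trivial⟩, by simp⟩

theorem dil_sum_frame {S : F.Splitting} {nab : GradedConnection S} (c : ExpChart nab)
    {x : M} (hx : x ∈ c.φ.source) (l : ℝ) (z : Eu d) :
    F.dil l x (∑ i, z i • c.frame i x) = ∑ i, dilE c.wt l z i • c.frame i x := by
  rw [map_sum]
  refine Finset.sum_congr rfl fun i _ => ?_
  rw [map_smul, dilE_apply, mul_comm, mul_smul]
  congr 1
  funext k
  change l ^ ((k : ℕ) + 1) • c.frame i x k = l ^ (c.wt i + 1) • c.frame i x k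
  by_cases hk : k = c.deg i
  · subst hk; rfl
  · rw [c.frame_homogeneous x hx i k hk, smul_zero, smul_zero]

theorem isPlotLinear_zoom {S : F.Splitting} (nab : GradedConnection S) (l : ℝ) (hl : 0 < l) :
    IsPlotLinear (hAtlas nab) (hAtlas nab) (HTangent.zoom l hl) := by
  rintro p (⟨φ, hφ, φ', hφ', rfl⟩ | ⟨c, rfl⟩)
  · refine ⟨_, Or.inl ⟨φ, hφ, φ', hφ', rfl⟩,
      (ContinuousLinearMap.fst ℝ (Eu d) (Eu d × ℝ)).prod
        (((ContinuousLinearMap.fst ℝ (Eu d) ℝ).prod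
          (l⁻¹ • ContinuousLinearMap.snd ℝ (Eu d) ℝ)).comp
            (ContinuousLinearMap.snd ℝ (Eu d) (Eu d × ℝ))), ?_⟩
    rintro ⟨u, v, h⟩ ⟨hu, hv, hh⟩
    have hh0 : h ≠ 0 := hh
    have hh1 : l⁻¹ * h ≠ 0 := mul_ne_zero (inv_ne_zero hl.ne') hh0
    refine ⟨⟨hu, hv, hh1⟩, ?_⟩
    simp [pairPlot, hh0, hl.ne', HTangent.zoom]
  · refine ⟨_, Or.inr ⟨c, rfl⟩,
      (ContinuousLinearMap.fst ℝ (Eu d) (Eu d × ℝ)).prod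
        ((((dilE c.wt l).comp (ContinuousLinearMap.fst ℝ (Eu d) ℝ)).prod
          (l⁻¹ • ContinuousLinearMap.snd ℝ (Eu d) ℝ)).comp
            (ContinuousLinearMap.snd ℝ (Eu d) (Eu d × ℝ))), ?_⟩
    rintro ⟨u, z, h⟩ hq
    have hq' : (u, dilE c.wt h z) ∈ c.D := hq
    have hx : c.φ.symm u ∈ c.φ.source := c.φ.map_target (c.D_subset _ hq')
    have e1 : dilE c.wt (l⁻¹ * h) (dilE c.wt l z) = dilE c.wt h z := dilE_mul c.wt hl h z
    refine ⟨?_, ?_⟩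
    · change (u, dilE c.wt (l⁻¹ * h) (dilE c.wt l z)) ∈ c.D
      rw [e1]; exact hq'
    · by_cases hh : h = 0
      · subst hh
        simp [ExpChart.plot, HTangent.zoom, dil_sum_frame c hx]
      · have hh1 : l⁻¹ * h ≠ 0 := mul_ne_zero (inv_ne_zero hl.ne') hh
        simp [ExpChart.plot, HTangent.zoom, hh, hl.ne', e1]

/-- The pushforward `(α_λ)_*` on `r`-fibred distributions:
`((α_λ)_* P, f)(x, h) = (P, f ∘ α_λ)(x, λ h)`. -/
def zoomPush {S : F.Splitting} {nab : GradedConnection S} (l : ℝ) (hl : 0 < l)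
    (P : KernelDist nab) : KernelDist nab :=
  ⟨(pull _ _ _ (isPlotLinear_scale l)).comp (P.1.comp (pull _ _ _ (isPlotLinear_zoom nab l hl))), by
    intro g f f' h y
    have key := P.2 (pull _ _ _ (isPlotLinear_scale l⁻¹) g)
      (pull _ _ _ (isPlotLinear_zoom nab l hl) f) (pull _ _ _ (isPlotLinear_zoom nab l hl) f')
      (fun x => by
        change f' (HTangent.zoom l hl x) = g ((x.r).1, l⁻¹ * (x.r).2) * f (HTangent.zoom l hl x)
        rw [h]
        congr 2
        cases x <;> simp [HTangent.zoom, HTangent.r]) (y.1, l * y.2)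
    refine key.trans ?_
    change g (y.1, l⁻¹ * (l * y.2)) * _ = g y * _
    rw [inv_mul_cancel_left₀ hl.ne']
    rfl⟩

section Calculus

variable {S : F.Splitting} {nab : GradedConnection S}

open Classical in
/-- The difference quotient of `λ ↦ (α_λ)_* P` at `λ = 1`. -/
def zoomSlope (P : KernelDist nab) (l : ℝ) : KernelDist nab :=
  if hl : 0 < l then (((l - 1)⁻¹ : ℝ) : ℂ) • (zoomPush l hl P - P) else 0

/-- The Lie derivative `𝓛_Z P = d/dλ (α_λ)_* P` at `λ = 1`, in the topology of bounded
convergence. -/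
def lieZ (P : KernelDist nab) : KernelDist nab :=
  @limUnder _ _ _ ⟨0⟩ (𝓝[≠] (1 : ℝ)) (zoomSlope P)

/-- The support of an `r`-fibred distribution. -/
def supp (P : KernelDist nab) : Set (HTangent F) :=
  {γ | ∀ W : Set (HTangent F), IsOpen[plotTopology (hAtlas nab)] W → γ ∈ W →
    ∃ f : CInf (hAtlas nab),
      @closure _ (plotTopology (hAtlas nab)) {y | f y ≠ 0} ⊆ W ∧ P.1 f ≠ 0}

/-- In the parametrization `p`, which is fibred over the chart `φ` by
`r (p (u, z, h)) = (φ⁻¹ u, h)`, the distribution `P` is the `r`-fibred density `a(u, z, h) |dz|`. -/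
def IsDensityOn (P : KernelDist nab) (φ : OpenPartialHomeomorph M (Eu d))
    (p : Plot (Eu d × Eu d × ℝ) (HTangent F)) (a : Eu d × Eu d × ℝ → ℂ) : Prop :=
  ∀ f : CInf (hAtlas nab),
    (∃ K : Set (Eu d × Eu d × ℝ), IsCompact K ∧ K ⊆ p.dom ∧ ∀ γ, f γ ≠ 0 → γ ∈ p.map '' K) →
    ∀ u ∈ φ.target, ∀ h : ℝ,
      P.1 f (φ.symm u, h) = ∫ z in {z | (u, z, h) ∈ p.dom}, a (u, z, h) * f (p.map (u, z, h))

/-- `P ∈ C_p^∞(𝕋_H M, Ω_r)`: `P` is a smooth `r`-fibred density with `r`- and `s`-proper support. -/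
structure IsSmoothProperDensity (P : KernelDist nab) : Prop where
  exp : ∀ c : ExpChart nab, ∃ a, ContDiffOn ℝ ∞ a c.plot.dom ∧ IsDensityOn P c.φ c.plot a
  pair : ∀ φ ∈ charts d M, ∀ φ' ∈ charts d M,
    ∃ a, ContDiffOn ℝ ∞ a (pairPlot F φ φ').dom ∧ IsDensityOn P φ (pairPlot F φ φ') a
  r_proper : ∀ K : Set (M × ℝ), IsCompact K →
    @IsCompact _ (plotTopology (hAtlas nab)) (supp P ∩ HTangent.r ⁻¹' K)
  s_proper : ∀ K : Set (M × ℝ), IsCompact K →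
    @IsCompact _ (plotTopology (hAtlas nab)) (supp P ∩ HTangent.s ⁻¹' K)

/-- `P` is a pseudodifferential kernel of order `m`. -/
def IsPsidoKernel (m : ℂ) (P : KernelDist nab) : Prop :=
  (∃ L, Tendsto (zoomSlope P) (𝓝[≠] (1 : ℝ)) (𝓝 L)) ∧ IsSmoothProperDensity (lieZ P - m • P)

/-- `P` is a holomorphic family of pseudodifferential kernels with order function `μ` on `Ω`. -/
structure IsHolomorphicKernelFamily (Ω : Set ℂ) (μ : ℂ → ℂ) (P : ℂ → KernelDist nab) : Prop where
  holomorphic : IsHolomorphicOn P Ω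
  psido : ∀ s ∈ Ω, IsPsidoKernel (μ s) (P s)

/-- `Q ∈ 𝓔'_r(M × M)` is the restriction `P_1` of `P` to `h = 1`. -/
def IsRestriction (P : KernelDist nab) (Q : OperatorDist d M) : Prop :=
  ∀ (f : CInf (hAtlas nab)) (g : CInf (squareAtlas d M)),
    (∀ x y, f (HTangent.pair x y 1 one_ne_zero) = g (x, y)) → ∀ x, Q.1 g x = P.1 f (x, 1)

/-- `P` is a holomorphic family of kernels on `Ω` that represents the family `Q` of operators. -/
def Represents (Ω : Set ℂ) (μ : ℂ → ℂ) (P : ℂ → KernelDist nab) (Q : ℂ → OperatorDist d M) :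
    Prop :=
  IsHolomorphicKernelFamily Ω μ P ∧ ∀ s ∈ Ω, IsRestriction (P s) (Q s)

end Calculus

/-! ### Densities on `M` and the local trace -/

variable (d) in
/-- The fibre at `x` of the density bundle `Ω M` (with complex coefficients). -/
def DensityAt (x : M) : Submodule ℂ ((Fin d → TangentSpace 𝓘(ℝ, Eu d) x) → ℂ) where
  carrier := {ν | ∀ (A : TangentSpace 𝓘(ℝ, Eu d) x →ₗ[ℝ] TangentSpace 𝓘(ℝ, Eu d) x)
    (v : Fin d → TangentSpace 𝓘(ℝ, Eu d) x), ν (fun i => A (v i)) = |LinearMap.det A| * ν v}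
  add_mem' hν hη A v := by simp [hν A v, hη A v, mul_add]
  zero_mem' A v := by simp
  smul_mem' a ν hν A v := by simp [hν A v]; ring

/-- The coefficient of a density with respect to `|du|` in the chart `φ`, at the point `φ⁻¹ u`. -/
def densityCoeff (φ : OpenPartialHomeomorph M (Eu d)) (u : Eu d) (ν : DensityAt d (φ.symm u)) : ℂ :=
  ν.1 fun i => mfderiv 𝓘(ℝ, Eu d) 𝓘(ℝ, Eu d) φ.symm u (EuclideanSpace.single i (1 : ℝ) : Eu d)

variable (d M) in
/-- The continuous sections over `M × ℝ` of the pullback of `Ω M`. -/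
def contSubmodule : Submodule ℂ (∀ x : M, ℝ → DensityAt d x) where
  carrier := {τ | ∀ φ ∈ charts d M, ContinuousOn
    (fun q : Eu d × ℝ => densityCoeff φ q.1 (τ (φ.symm q.1) q.2)) (φ.target ×ˢ univ)}
  add_mem' h h' φ hφ := (h φ hφ).add (h' φ hφ)
  zero_mem' _ _ := continuousOn_const
  smul_mem' a _ h φ hφ := (h φ hφ).const_smul a

variable (d M) in
/-- The space `C(M × ℝ, Ω M)`. -/
def ContDensity : Type _ := contSubmodule d M

instance : AddCommGroup (ContDensity d M) := inferInstanceAs (AddCommGroup (contSubmodule d M))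

instance : Module ℂ (ContDensity d M) := inferInstanceAs (Module ℂ (contSubmodule d M))

instance : CoeFun (ContDensity d M) (fun _ => ∀ x : M, ℝ → DensityAt d x) := ⟨fun τ => τ.1⟩

/-- The coefficient function in the chart `φ`. -/
def ContDensity.coeff (φ : charts d M) (τ : ContDensity d M) :
    C((φ.1.target ×ˢ univ : Set (Eu d × ℝ)), ℂ) :=
  ⟨fun q => densityCoeff φ.1 q.1.1 (τ (φ.1.symm q.1.1) q.1.2), (τ.2 φ.1 φ.2).domRestrict⟩

/-- The topology of locally uniform convergence on `C(M × ℝ, Ω M)`. -/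
instance : TopologicalSpace (ContDensity d M) :=
  ⨅ φ : charts d M, TopologicalSpace.induced (ContDensity.coeff φ) inferInstance

/-- The integral of a density over a compact manifold: the sum over a partition of unity
subordinate to the atlas of the integrals in the charts. -/
def densityIntegral [T2Space M] [SigmaCompactSpace M] (ν : ∀ x : M, DensityAt d x) : ℂ :=
  let ρ := (SmoothPartitionOfUnity.exists_isSubordinate_chartAt_source 𝓘(ℝ, Eu d) M).choose
  ∑ᶠ y : M, ∫ u in (chartAt (Eu d) y).target,
    (ρ y ((chartAt (Eu d) y).symm u) : ℂ) *
      densityCoeff (chartAt (Eu d) y) u (ν ((chartAt (Eu d) y).symm u))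

section Trace

variable {S : F.Splitting} {nab : GradedConnection S}

/-- `τ x h` is the local trace `tr_h P` at `x`: in every exponential chart `P` is a continuous
`r`-fibred density `a(u, z, h) |dz|`, and `τ` is its restriction `a(u, 0, h) |dz|` to the units,
`|dz|` being the density on `T_x M` with value `1` on the frame of the chart. -/
def IsLocalTrace (P : KernelDist nab) (τ : ∀ x : M, ℝ → DensityAt d x) : Prop :=
  ∀ c : ExpChart nab, ∃ a, ContinuousOn a c.plot.dom ∧ IsDensityOn P c.φ c.plot a ∧
    ∀ u ∈ c.φ.target, ∀ h : ℝ,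
      (τ (c.φ.symm u) h).1 (fun i => S.ψ (c.φ.symm u) (c.frame i (c.φ.symm u))) = a (u, 0, h)

open Classical in
/-- The local trace `tr_h P` at `x`, for distributions `P` given by continuous densities. -/
def localTrace (P : KernelDist nab) : ∀ x : M, ℝ → DensityAt d x :=
  if H : ∃ τ, IsLocalTrace P τ then H.choose else 0

/-- `t` is the global trace of the pseudodifferential operator `Q` of order `m`: the integral over
`M` of `tr_1 A`, where `A` is a kernel of order `m` with `A_1 = Q`. -/
def IsGlobalTrace [T2Space M] [SigmaCompactSpace M] (nab : GradedConnection S) (m : ℂ)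
    (Q : OperatorDist d M) (t : ℂ) : Prop :=
  ∃ A : KernelDist nab, IsPsidoKernel m A ∧ IsRestriction A Q ∧
    ∃ τ, IsLocalTrace A τ ∧ t = densityIntegral fun x => τ x 1

end Trace

end Carnot

end

/-!
Let `m` be the order of a kernel `P` and `K = (𝓛_Z - m) P`, a smooth proper density. Solving the
differential equation `𝓛_Z P = m P + K` along the orbits of the zoom action gives, in an exponential
chart in which `K = k |dz|`, the scaling relation `ev_scale_sub`. On test functions that are moved
far out by the zoom action `P` vanishes (this uses only that `P` is continuous and fibred), so
if `Re m < -d_H` the relation can be integrated down to `t = 0`: there `P` is the continuous density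
`∫₀¹ t ^ (-d_H - m - 1) k(δ_{1/t}(u, z, h)) dt` (`isDensityOn_lowDensity`). On the units the
argument of `k` is `(u, 0, t h)`, and with `w = -d_H - m` the local trace of `P` is
`∫₀¹ t ^ (w - 1) ℓ(t h) dt`, where `ℓ(h) = tr_h ((𝓛_Z - m) P)` is smooth in `h`. Splitting off
Taylor polynomials of `ℓ` at `h = 0` continues this integral to all `w`, with simple poles at
`w = 0, -1, -2, …`, and the singular part at `w = 0` is `w⁻¹ ℓ(0)` (`reg`, `regTrace`). That gives
the continuation, its poles and its residues; the global trace follows by integration over `M`,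
and depends only on the operators by the identity theorem.

The substance of the proof is in two facts that make this argument available.

* `ExpChart.exists_jetFamily`: the functions `ℓ`, together with their derivatives in `h`, depend
  holomorphically on the parameter `s`. The hypothesis says only that `s ↦ P(s)` is holomorphic as a
  map to distributions and that each `(𝓛_Z - μ(s)) P(s)` is smooth, without any uniformity in `s`.
  Tested against mollifiers, these densities give sequences of holomorphic functions, and by the
  smoothness of each density the sequences converge geometrically at every single `s`, while
  they are exponentially bounded locally uniformly in `s`. Hartogs' lemma on sequences of subharmonic
  functions turns this into locally uniform convergence (`IsHolFamily.of_tendsto`); applied to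
  Taylor's formula, the same lemma gives the derivatives (`IsJetFamily.of_smooth`).
* `exists_expChart`: exponential charts exist around every point, that is, the geodesic flow is
  smooth. Mathlib has no smooth dependence of flows on initial values, so it is proved here by the
  inverse function theorem in a space of curves. Exponential charts are open embeddings into the
  tangent groupoid, so that test functions in a chart extend by zero; this, with the transition
  maps between charts, makes the densities and hence the local trace unique
  (`ExpChart.density_unique`, `exists_isLocalTrace`).
-/

noncomputable section

set_option linter.unusedSectionVars false

namespace Carnot

/-- Coordinates `(u, z, h)` of the `H`-tangent groupoid. -/
abbrev Coord (d : ℕ) : Type := Eu d × Eu d × ℝ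

/-! ### Smooth dependence of integrals and flows on parameters -/

section Parametric

theorem contDiff_nat_parametric_integral {E : Type} [NormedAddCommGroup E] [NormedSpace ℝ E] (a b : ℝ)
    (n : ℕ) : ∀ {G : Type} [NormedAddCommGroup G] [NormedSpace ℝ G] {F : E × ℝ → G},
    ContDiff ℝ n F → ContDiff ℝ n fun x => ∫ t in a..b, F (x, t) := by
  induction n with
  | zero =>
    intro G _ _ F hF
    rw [Nat.cast_zero, contDiff_zero] at hF ⊢
    exact intervalIntegral.continuous_parametric_intervalIntegral_of_continuous' (by exact hF) a b
  | succ n ih =>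
    intro G _ _ F hF
    have hF1 : ContDiff ℝ (n + 1) F := by exact_mod_cast hF
    have hd : ∀ x t, HasFDerivAt (fun x => F (x, t))
        ((fderiv ℝ F (x, t)).comp (ContinuousLinearMap.inl ℝ E ℝ)) x := fun x t => by
      have h1 : HasFDerivAt F (fderiv ℝ F (x, t)) (x, t) :=
        ((hF1.differentiable (by simp)) (x, t)).hasFDerivAt
      exact h1.comp x (hasFDerivAt_prodMk_left x t)
    have hF' : ContDiff ℝ n fun q : E × ℝ =>
        (fderiv ℝ F q).comp (ContinuousLinearMap.inl ℝ E ℝ) :=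
      (hF1.fderiv_right le_rfl).clm_comp contDiff_const
    have h0 := ih hF'
    have : ContDiff ℝ (n + 1) fun x => ∫ t in a..b, F (x, t) := by
      refine contDiff_succ_iff_hasFDerivAt.2 ⟨_, h0, fun x => ?_⟩
      have hcont := hF'.continuous
      -- a uniform bound for the derivative near the compact set `{x} × [a, b]`
      obtain ⟨C, hC⟩ := (((isCompact_singleton (x := x)).prod
        (isCompact_uIcc (a := a) (b := b))).image hcont.norm).bddAbove
      have hev : ∀ᶠ y in 𝓝 x, ∀ t ∈ uIcc a b,
          ‖(fderiv ℝ F (y, t)).comp (ContinuousLinearMap.inl ℝ E ℝ)‖ < C + 1 := by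
        refine (isCompact_uIcc (a := a) (b := b)).eventually_forall_of_forall_eventually
          (x₀ := x) fun t ht => ?_
        refine (hcont.norm.tendsto (x, t)).eventually (gt_mem_nhds ?_)
        exact (hC (mem_image_of_mem _ (mk_mem_prod rfl ht))).trans_lt (lt_add_one C)
      obtain ⟨s, hs, hs'⟩ := eventually_iff_exists_mem.1 hev
      refine (intervalIntegral.hasFDerivAt_integral_of_dominated_of_fderiv_le
        (F := fun x t => F (x, t))
        (F' := fun x t => (fderiv ℝ F (x, t)).comp (ContinuousLinearMap.inl ℝ E ℝ))
        (bound := fun _ => C + 1) hs ?_ ?_ ?_ ?_ ?_ ?_)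
      · exact Eventually.of_forall fun y =>
          (hF.continuous.comp (by fun_prop : Continuous fun t : ℝ => (y, t))).aestronglyMeasurable
      · exact (hF.continuous.comp
          (by fun_prop : Continuous fun t : ℝ => (x, t))).intervalIntegrable a b
      · exact (hcont.comp (by fun_prop : Continuous fun t : ℝ => (x, t))).aestronglyMeasurable
      · exact ae_of_all _ fun t ht y hy => (hs' y hy t (uIoc_subset_uIcc ht)).le
      · exact intervalIntegrable_const
      · exact ae_of_all _ fun t _ y _ => hd y t
    exact_mod_cast this

/-- Integrals of smooth functions over a compact interval are smooth in the parameters. -/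
theorem contDiff_parametric_integral {E G : Type} [NormedAddCommGroup E] [NormedSpace ℝ E]
    [NormedAddCommGroup G] [NormedSpace ℝ G] {F : E × ℝ → G} (hF : ContDiff ℝ ∞ F) (a b : ℝ) :
    ContDiff ℝ ∞ fun x => ∫ t in a..b, F (x, t) :=
  contDiff_infty.2 fun n => contDiff_nat_parametric_integral a b n (contDiff_infty.1 hF n)

end Parametric

section Flow

/-- Pointwise evaluation of a family of linear maps, given by a parameter space `L` of linear maps, as
a continuous bilinear operation. -/
def applyCLM (K : Type) [TopologicalSpace K] [CompactSpace K] {L E G : Type} [NormedAddCommGroup L]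
    [NormedSpace ℝ L] [NormedAddCommGroup E] [NormedSpace ℝ E] [NormedAddCommGroup G]
    [NormedSpace ℝ G] (b : L →L[ℝ] E →L[ℝ] G) : C(K, L) →L[ℝ] C(K, E) →L[ℝ] C(K, G) :=
  LinearMap.mkContinuous₂
    (LinearMap.mk₂ ℝ (fun (A : C(K, L)) (X : C(K, E)) =>
        (⟨fun t => b (A t) (X t), by fun_prop⟩ : C(K, G)))
      (fun _ _ _ => by ext; simp) (fun _ _ _ => by ext; simp)
      (fun _ _ _ => by ext; simp) (fun _ _ _ => by ext; simp)) ‖b‖ fun A X => by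
    rw [ContinuousMap.norm_le _ (by positivity)]
    intro t
    simp only [LinearMap.mk₂_apply, ContinuousMap.coe_mk]
    exact (b (A t)).le_of_opNorm_le_of_le (b.le_of_opNorm_le_of_le le_rfl (A.norm_coe_le_norm t))
      (X.norm_coe_le_norm t)

/-- The superposition operator `X ↦ f ∘ X` on continuous maps. -/
def superpose (K : Type) [TopologicalSpace K] {E G : Type} [TopologicalSpace E] [TopologicalSpace G]
    (f : E → G) (hf : Continuous f) (X : C(K, E)) : C(K, G) := ⟨fun t => f (X t), by fun_prop⟩

section Superpose

variable {K : Type} [TopologicalSpace K] [CompactSpace K]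
  {E L G : Type} [NormedAddCommGroup E] [NormedSpace ℝ E] [NormedAddCommGroup L] [NormedSpace ℝ L]
  [NormedAddCommGroup G] [NormedSpace ℝ G]

theorem applyCLM_apply (b : L →L[ℝ] E →L[ℝ] G) (A : C(K, L)) (X : C(K, E)) (t : K) :
    applyCLM K b A X t = b (A t) (X t) := rfl

theorem hasFDerivAt_superpose {b : L →L[ℝ] E →L[ℝ] G} {f : E → G} {f' : E → L} (hf : Continuous f)
    (hf' : Continuous f') (h : ∀ x, HasFDerivAt f (b (f' x)) x) (X : C(K, E)) :
    HasFDerivAt (superpose K f hf) (applyCLM K b (superpose K f' hf' X)) X := by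
  have hc : Continuous (superpose K f' hf') := ContinuousMap.continuous_postcomp ⟨f', hf'⟩
  rw [hasFDerivAt_iff_isLittleO, Asymptotics.isLittleO_iff]
  intro c hc0
  obtain ⟨c', hc'0, hc'⟩ : ∃ c' > 0, ‖b‖ * c' ≤ c := by
    refine ⟨c / (‖b‖ + 1), by positivity, ?_⟩
    rw [mul_div_assoc', div_le_iff₀ (by positivity)]
    nlinarith [norm_nonneg b]
  obtain ⟨δ, hδ, hδ'⟩ := Metric.continuous_iff.1 hc X c' hc'0
  filter_upwards [Metric.ball_mem_nhds X hδ] with Y hY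
  rw [ContinuousMap.norm_le _ (by positivity)]
  intro t
  have key := Convex.norm_image_sub_le_of_norm_hasFDerivWithin_le' (𝕜 := ℝ) (f := f)
    (f' := fun x => b (f' x)) (s := Metric.ball (X t) δ) (φ := b (f' (X t))) (C := c)
    (x := X t) (y := Y t)
    (fun e _ => (h e).hasFDerivWithinAt)
    (fun e he => by
      have h1 : dist (X + ContinuousMap.const K (e - X t)) X < δ := by
        rw [dist_eq_norm, add_sub_cancel_left]
        refine lt_of_le_of_lt ((ContinuousMap.norm_le _ (norm_nonneg _)).2 fun _ => le_rfl) ?_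
        exact (dist_eq_norm e (X t)) ▸ he
      have h2 := (ContinuousMap.dist_le hc'0.le).1 (hδ' _ h1).le t
      rw [dist_eq_norm] at h2
      rw [← map_sub]
      refine le_trans (b.le_of_opNorm_le_of_le le_rfl ?_) hc'
      simpa [superpose] using h2)
    (convex_ball _ _) (Metric.mem_ball_self hδ)
    (lt_of_le_of_lt (ContinuousMap.dist_apply_le_dist t) hY)
  refine le_trans (le_of_eq ?_) (key.trans ?_)
  · simp [superpose, applyCLM_apply]
  · have := (Y - X).norm_coe_le_norm t
    gcongr
    simpa using this

theorem contDiff_succ_superpose {b : L →L[ℝ] E →L[ℝ] G} {f : E → G} {f' : E → L} (hf : Continuous f)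
    (hf' : Continuous f') (h : ∀ x, HasFDerivAt f (b (f' x)) x) {n : ℕ}
    (hn : ContDiff ℝ n (superpose K f' hf')) : ContDiff ℝ (n + 1) (superpose K f hf) :=
  contDiff_succ_iff_hasFDerivAt.2 ⟨_, (applyCLM K b).contDiff.comp hn, fun X =>
    hasFDerivAt_superpose hf hf' h X⟩

end Superpose

theorem contDiff_nat_superpose {K : Type} [TopologicalSpace K] [CompactSpace K] {E : Type}
    [NormedAddCommGroup E] [NormedSpace ℝ E] (n : ℕ) :
    ∀ {G : Type} [NormedAddCommGroup G] [NormedSpace ℝ G] {f : E → G} (hf : Continuous f),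
      ContDiff ℝ n f → ContDiff ℝ n (superpose K f hf) := by
  induction n with
  | zero =>
    intro G _ _ f hf _
    exact contDiff_zero.2 (ContinuousMap.continuous_postcomp ⟨f, hf⟩)
  | succ n ih =>
    intro G _ _ f hf hfn
    have hf1 : ContDiff ℝ (n + 1) f := by exact_mod_cast hfn
    have hf' : ContDiff ℝ n (fderiv ℝ f) := hf1.fderiv_right le_rfl
    have := contDiff_succ_superpose (K := K) (L := E →L[ℝ] G)
      (b := ContinuousLinearMap.id ℝ (E →L[ℝ] G)) hf hf'.continuous
      (fun x => (hf1.differentiable (by simp) x).hasFDerivAt) (ih hf'.continuous hf')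
    exact_mod_cast this

variable {K : Type} [TopologicalSpace K] [CompactSpace K]

/-- The superposition operator of a smooth map is smooth. -/
theorem contDiff_superpose {E G : Type} [NormedAddCommGroup E] [NormedSpace ℝ E]
    [NormedAddCommGroup G] [NormedSpace ℝ G] {f : E → G} (hf : ContDiff ℝ ∞ f) :
    ContDiff ℝ ∞ (superpose K f hf.continuous) :=
  contDiff_infty.2 fun n => contDiff_nat_superpose n hf.continuous (contDiff_infty.1 hf n)

variable {E : Type} [NormedAddCommGroup E] [NormedSpace ℝ E]

/-- The interval of definition of the curves. -/
abbrev TimeInterval : Type := Icc (-1 : ℝ) 1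

/-- The extension of a curve on `[-1, 1]` to all times, constant outside the interval. -/
def extendCurve (X : C(TimeInterval, E)) : ℝ → E := IccExtend (by norm_num) X

omit [NormedSpace ℝ E] in
theorem continuous_extendCurve (X : C(TimeInterval, E)) : Continuous (extendCurve X) :=
  X.continuous.Icc_extend'

omit [NormedSpace ℝ E] in
theorem extendCurve_apply (X : C(TimeInterval, E)) (t : TimeInterval) :
    extendCurve X t = X t := IccExtend_val _ _ _

/-- The primitive vanishing at `0` of a curve. -/
def primitiveCLM [CompleteSpace E] : C(TimeInterval, E) →L[ℝ] C(TimeInterval, E) :=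
  LinearMap.mkContinuous
    { toFun := fun X => ⟨fun t => ∫ τ in (0 : ℝ)..t, extendCurve X τ,
        (intervalIntegral.continuous_primitive
          (fun a b => (continuous_extendCurve X).intervalIntegrable a b) 0).comp
          continuous_subtype_val⟩
      map_add' := fun X Y => by
        ext t
        exact intervalIntegral.integral_add ((continuous_extendCurve X).intervalIntegrable _ _)
          ((continuous_extendCurve Y).intervalIntegrable _ _)
      map_smul' := fun c X => by
        ext t
        exact intervalIntegral.integral_smul c _ } 1 fun X => by
    rw [ContinuousMap.norm_le _ (by positivity)]
    intro t
    have h := intervalIntegral.norm_integral_le_of_norm_le_const (a := 0) (b := t) (C := ‖X‖)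
      (f := extendCurve X) fun τ _ => X.norm_coe_le_norm _
    refine h.trans ?_
    rw [one_mul, sub_zero]
    exact mul_le_of_le_one_right (norm_nonneg _) (abs_le.2 t.2)

theorem norm_primitiveCLM_le [CompleteSpace E] : ‖(primitiveCLM : C(TimeInterval, E) →L[ℝ] _)‖ ≤ 1 :=
  LinearMap.mkContinuous_norm_le _ zero_le_one _

/-- Near an equilibrium `p₀` at which the derivative of the vector field is small, the flow of a smooth
vector field exists on `[-1, 1]`, depends smoothly on the initial point, and is unique: the curves are
found by inverting `X ↦ X - ∫ f(X)` near the constant curve. -/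
theorem exists_smooth_flow [CompleteSpace E] {f : E → E} (hf : ContDiff ℝ ∞ f) {p₀ : E}
    (h0 : f p₀ = 0) (hd : ‖fderiv ℝ f p₀‖ ≤ 1 / 2) :
    ∃ ρ > 0, ∀ r > 0, ∃ U : Set E, IsOpen U ∧ p₀ ∈ U ∧ ∃ X : E → C(TimeInterval, E),
      ContDiffOn ℝ ∞ X U ∧ ∀ a ∈ U, (∀ t, dist (X a t) p₀ < r) ∧
        (∀ t, X a t = a + ∫ τ in (0 : ℝ)..t, f (extendCurve (X a) τ)) ∧
        ∀ Y : C(TimeInterval, E), (∀ t, dist (Y t) p₀ < ρ) →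
          (∀ t, Y t = a + ∫ τ in (0 : ℝ)..t, f (extendCurve Y τ)) → Y = X a := by
  obtain ⟨L, _, _, b, f', hf', hff, hbd⟩ : ∃ (L : Type) (_ : NormedAddCommGroup L)
      (_ : NormedSpace ℝ L) (b : L →L[ℝ] E →L[ℝ] E) (f' : E → L), Continuous f' ∧
      (∀ x, HasFDerivAt f (b (f' x)) x) ∧ ‖b (f' p₀)‖ ≤ 1 / 2 :=
    ⟨E →L[ℝ] E, inferInstance, inferInstance, ContinuousLinearMap.id ℝ _, fderiv ℝ f,
      hf.continuous_fderiv (by simp), fun x => (hf.differentiable (by simp) x).hasFDerivAt, hd⟩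
  set N := superpose TimeInterval f hf.continuous with hN
  -- The integral curve from `a` is the solution `X` of `Ψ X = a`.
  set Ψ : C(TimeInterval, E) → C(TimeInterval, E) := fun X => X - primitiveCLM (N X) with hΨ
  set κ : E →L[ℝ] C(TimeInterval, E) := ContinuousLinearMap.const ℝ TimeInterval with hκ
  have hκa : ∀ a t, κ a t = a := fun _ _ => rfl
  have hΨs : ContDiff ℝ ∞ Ψ :=
    contDiff_id.sub (primitiveCLM.contDiff.comp (contDiff_superpose hf))
  set A : C(TimeInterval, E) →L[ℝ] C(TimeInterval, E) :=
    primitiveCLM.comp (applyCLM TimeInterval b (superpose TimeInterval f' hf' (κ p₀))) with hA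
  -- `1 - A`, the derivative of `Ψ` at the constant curve `p₀`, is invertible.
  have hAn : ‖A‖ < 1 := by
    refine lt_of_le_of_lt (ContinuousLinearMap.opNorm_le_bound _ (by norm_num : (0:ℝ) ≤ 1/2)
      fun X => ?_) (by norm_num : (1/2 : ℝ) < 1)
    refine (ContinuousLinearMap.le_of_opNorm_le _ norm_primitiveCLM_le _).trans ?_
    rw [one_mul, ContinuousMap.norm_le _ (by positivity)]
    intro t
    exact (b (f' p₀)).le_of_opNorm_le_of_le hbd (X.norm_coe_le_norm t)
  have hΨd : HasFDerivAt Ψ (ContinuousLinearMap.id ℝ _ - A) (κ p₀) :=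
    (hasFDerivAt_id _).sub (HasFDerivAt.comp (κ p₀) (f := N)
      (primitiveCLM (E := E)).hasFDerivAt (hasFDerivAt_superpose hf.continuous hf' hff _))
  obtain ⟨e, he⟩ : ∃ e : C(TimeInterval, E) ≃L[ℝ] C(TimeInterval, E),
      (e : C(TimeInterval, E) →L[ℝ] C(TimeInterval, E)) = ContinuousLinearMap.id ℝ _ - A := by
    refine ⟨ContinuousLinearEquiv.ofUnit (Units.oneSub A hAn), ?_⟩
    ext1 X
    rfl
  rw [← he] at hΨd
  have hcd : ContDiffAt ℝ ∞ Ψ (κ p₀) := hΨs.contDiffAt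
  set Φ := hcd.toOpenPartialHomeomorph Ψ hΨd (by simp) with hΦ
  have hΦc : ∀ X, Φ X = Ψ X := fun X => rfl
  have hsrc : κ p₀ ∈ Φ.source := hcd.mem_toOpenPartialHomeomorph_source hΨd (by simp)
  have hΨ0 : Ψ (κ p₀) = κ p₀ := by
    have : N (κ p₀) = 0 := by ext t; exact h0
    simp [hΨ, this]
  have hinv : ContDiffAt ℝ ∞ Φ.symm (κ p₀) := by
    have := hcd.to_localInverse hΨd (by simp)
    rwa [hΨ0] at this
  have hsymm0 : Φ.symm (κ p₀) = κ p₀ := by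
    have := Φ.left_inv hsrc
    rwa [hΦc, hΨ0] at this
  have heq : ∀ (a : E) (Y : C(TimeInterval, E)), Ψ Y = κ a ↔
      ∀ t, Y t = a + ∫ τ in (0 : ℝ)..t, f (extendCurve Y τ) := by
    intro a Y
    rw [DFunLike.ext_iff]
    refine forall_congr' fun t => ?_
    have : (primitiveCLM (N Y)) t = ∫ τ in (0 : ℝ)..t, f (extendCurve Y τ) := rfl
    rw [hκa, ← this]
    exact sub_eq_iff_eq_add
  obtain ⟨ρ, hρ, hρs⟩ := Metric.isOpen_iff.1 Φ.open_source _ hsrc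
  have hd' : ∀ (Y : C(TimeInterval, E)) (r : ℝ), 0 < r → ((∀ t, dist (Y t) p₀ < r) ↔ dist Y (κ p₀) < r) :=
    fun Y r hr => (ContinuousMap.dist_lt_iff (f := Y) (g := κ p₀) hr).symm
  refine ⟨ρ, hρ, fun r hr => ?_⟩
  have hκc : ContinuousAt (fun a => Φ.symm (κ a)) p₀ :=
    hinv.continuousAt.comp (f := κ) κ.continuous.continuousAt
  have ev1 : ∀ᶠ a in 𝓝 p₀, dist (Φ.symm (κ a)) (κ p₀) < r := by
    have := hκc.tendsto
    simp only [hsymm0] at this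
    exact this (Metric.ball_mem_nhds _ hr)
  have ev2 : ∀ᶠ a in 𝓝 p₀, κ a ∈ Φ.target := by
    refine κ.continuous.continuousAt.eventually (Φ.open_target.mem_nhds ?_)
    have := Φ.map_source hsrc
    rwa [hΦc, hΨ0] at this
  have ev3 : ∀ᶠ a in 𝓝 p₀, ContDiffAt ℝ ∞ Φ.symm (κ a) := by
    -- the derivative of `Ψ` stays invertible near the constant curve
    have h1 : ∀ᶠ a in 𝓝 p₀, fderiv ℝ Ψ (Φ.symm (κ a)) ∈
        range ((↑) : (C(TimeInterval, E) ≃L[ℝ] C(TimeInterval, E)) → _) := by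
      have hc := (hΨs.continuous_fderiv (by simp)).continuousAt.comp (f := fun a => Φ.symm (κ a)) hκc
      refine hc.eventually ?_
      have he0 : (fderiv ℝ Ψ ∘ fun a => Φ.symm (κ a)) p₀ = e := by
        rw [Function.comp_apply, hsymm0, hΨd.fderiv]
      rw [he0]
      exact e.nhds
    filter_upwards [h1, ev2] with a ⟨e', he'⟩ ha
    refine Φ.contDiffAt_symm (f₀' := e') ha ?_ hΨs.contDiffAt
    rw [he']
    exact (hΨs.differentiable (by simp) _).hasFDerivAt
  obtain ⟨U, hU, hUo, hp⟩ := eventually_nhds_iff.1 ((ev1.and ev2).and ev3)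
  refine ⟨U, hUo, hp, fun a => Φ.symm (κ a), fun a ha =>
    (((hU a ha).2).comp a κ.contDiff.contDiffAt).contDiffWithinAt, fun a ha => ⟨?_, ?_, ?_⟩⟩
  · exact (hd' _ r hr).2 (hU a ha).1.1
  · refine (heq a _).1 ?_
    rw [← hΦc, Φ.right_inv (hU a ha).1.2]
  · intro Y hY hYe
    have := Φ.left_inv (hρs ((hd' Y ρ hρ).1 hY))
    rw [hΦc, (heq a Y).2 hYe] at this
    exact this.symm

end Flow

/-! ### Hartogs' lemma -/

section Hartogs

open Real Metric

theorem log_norm_le_circleAverage {f : ℂ → ℂ} {c : ℂ} {r : ℝ} (hr : 0 < r)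
    (hf : AnalyticOnNhd ℂ f (closedBall c r)) (hc : f c ≠ 0) {ε : ℝ} (hε : 0 < ε) :
    log ‖f c‖ ≤ circleAverage (fun z => log (max ‖f z‖ ε)) c r := by
  have hr' : |r| = r := abs_of_pos hr
  have hf' : AnalyticOnNhd ℂ f (closedBall c |r|) := by rwa [hr']
  have h1 := hf'.circleAverage_log_norm hr.ne' hc
  have h2 : log ‖f c‖ ≤ circleAverage (fun z => log ‖f z‖) c r := by
    rw [h1]
    refine le_add_of_nonneg_left (finsum_nonneg fun u => ?_)
    by_cases hu : u ∈ closedBall c |r|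
    · refine mul_nonneg ?_ ?_
      · exact_mod_cast MeromorphicOn.AnalyticOnNhd.divisor_nonneg hf' u
      · by_cases huc : u = c
        · simp [huc]
        refine log_nonneg ?_
        rw [← div_eq_mul_inv, one_le_div (by simpa [sub_eq_zero] using fun h => huc h.symm)]
        rwa [hr', mem_closedBall, dist_comm, dist_eq_norm] at hu
    · simp [hu]
  -- the convention `log 0 = 0` is harmless: the zeros on the circle are discrete
  have hz : ∀ᶠ z in codiscreteWithin (sphere c |r|), f z ≠ 0 := by
    rcases hf'.eqOn_zero_or_eventually_ne_zero_of_preconnected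
      (convex_closedBall c |r|).isPreconnected with h | h
    · exact (hc (h (mem_closedBall_self (abs_nonneg r)))).elim
    · exact codiscreteWithin_mono sphere_subset_closedBall h
  have hcont : ContinuousOn (fun z => log (max ‖f z‖ ε)) (sphere c r) := by
    refine ContinuousOn.log ?_ fun z _ => (lt_max_of_lt_right hε).ne'
    exact ((hf.continuousOn.mono sphere_subset_closedBall).norm).sup continuousOn_const
  have hint : CircleIntegrable (fun z => log ‖f z‖) c r :=
    (hf'.mono sphere_subset_closedBall).meromorphicOn.circleIntegrable_log_norm
  have heq : (fun z => log ‖f z‖) =ᶠ[codiscreteWithin (sphere c |r|)]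
      fun z => if f z = 0 then log ε else log ‖f z‖ := by
    filter_upwards [hz] with z hz
    rw [if_neg hz]
  rw [circleAverage_congr_codiscreteWithin heq hr.ne'] at h2
  refine h2.trans (circleAverage_mono (hint.congr_codiscreteWithin heq)
    (hcont.circleIntegrable hr.le) fun z _ => ?_)
  by_cases hz : f z = 0
  · rw [if_pos hz]
    exact log_le_log hε (le_max_right _ _)
  · rw [if_neg hz]
    exact log_le_log (norm_pos_iff.2 hz) (le_max_left _ _)

/-- Sub-mean value inequality over a disc for `log |f|`, truncated below. -/
theorem log_norm_mul_le_integral_ball {f : ℂ → ℂ} {c : ℂ} {ρ : ℝ} (hρ : 0 < ρ)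
    (hf : AnalyticOnNhd ℂ f (closedBall c ρ)) (hc : f c ≠ 0) {ε : ℝ} (hε : 0 < ε) :
    log ‖f c‖ * (π * ρ ^ 2) ≤ ∫ z in ball c ρ, log (max ‖f z‖ ε) := by
  set u : ℂ → ℝ := fun z => log (max ‖f z‖ ε) with hu
  have huc : ContinuousOn u (closedBall c ρ) :=
    ContinuousOn.log (hf.continuousOn.norm.sup continuousOn_const)
      fun z _ => (lt_max_of_lt_right hε).ne'
  have hmap : ∀ p : ℝ × ℝ, c + Complex.polarCoord.symm p = circleMap c p.1 p.2 := by
    intro p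
    rw [Complex.polarCoord_symm_apply, circleMap, Complex.exp_mul_I]
    simp
  have e1 : ∫ z in ball c ρ, u z =
      ∫ p in Ioo 0 ρ ×ˢ Ioo (-π) π, p.1 * u (circleMap c p.1 p.2) := by
    rw [← integral_indicator measurableSet_ball, ← integral_add_left_eq_self _ c,
      ← Complex.integral_comp_polarCoord_symm, polarCoord_target,
      ← integral_indicator (measurableSet_Ioi.prod measurableSet_Ioo),
      ← integral_indicator (measurableSet_Ioo.prod measurableSet_Ioo)]
    congr 1
    ext p
    simp only [hmap]
    by_cases hp : p ∈ Ioi (0:ℝ) ×ˢ Ioo (-π) π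
    · rw [indicator_of_mem hp]
      have hp1 : 0 < p.1 := hp.1
      by_cases hp' : p.1 < ρ
      · have h1 : circleMap c p.1 p.2 ∈ ball c ρ := by
          simpa [circleMap, abs_of_pos hp1] using hp'
        have h2 : p ∈ Ioo 0 ρ ×ˢ Ioo (-π) π := ⟨⟨hp1, hp'⟩, hp.2⟩
        rw [indicator_of_mem h1, indicator_of_mem h2, smul_eq_mul]
      · have h1 : circleMap c p.1 p.2 ∉ ball c ρ := by
          simpa [circleMap, abs_of_pos hp1] using hp'
        have h2 : p ∉ Ioo 0 ρ ×ˢ Ioo (-π) π := fun h => hp' h.1.2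
        rw [indicator_of_notMem h1, indicator_of_notMem h2, smul_zero]
    · rw [indicator_of_notMem hp, indicator_of_notMem fun h => hp ⟨h.1.1, h.2⟩]
  have hcont : ContinuousOn (fun p : ℝ × ℝ => p.1 * u (circleMap c p.1 p.2))
      (Icc 0 ρ ×ˢ Icc (-π) π) := by
    refine continuousOn_fst.mul (huc.comp (by fun_prop) fun p hp => ?_)
    simpa [circleMap, abs_of_nonneg hp.1.1] using hp.1.2
  have hint : IntegrableOn (fun p : ℝ × ℝ => p.1 * u (circleMap c p.1 p.2))
      (Ioo 0 ρ ×ˢ Ioo (-π) π) (volume.prod volume) :=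
    (hcont.integrableOn_compact (isCompact_Icc.prod isCompact_Icc)).mono_set
      (prod_mono Ioo_subset_Icc_self Ioo_subset_Icc_self)
  have e3 : ∀ r ∈ Ioo 0 ρ, (2 * π * log ‖f c‖) * r ≤
      ∫ θ in Ioo (-π) π, r * u (circleMap c r θ) := by
    intro r hr
    have h := log_norm_le_circleAverage hr.1 (hf.mono (closedBall_subset_closedBall hr.2.le)) hc hε
    rw [circleAverage_eq_integral_add (-π)] at h
    rw [intervalIntegral.integral_comp_add_right (fun θ ↦ u (circleMap c r θ))] at h
    rw [integral_const_mul, ← integral_Ioc_eq_integral_Ioo,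
      ← intervalIntegral.integral_of_le (by linarith [pi_pos])]
    rw [show (0:ℝ) + -π = -π by ring, show 2 * π + -π = π by ring, smul_eq_mul,
      inv_mul_eq_div, le_div_iff₀ (by positivity)] at h
    nlinarith [hr.1]
  rw [e1, Measure.volume_eq_prod, setIntegral_prod _ hint]
  have e4 : ∫ r in Ioo 0 ρ, (2 * π * log ‖f c‖) * r = log ‖f c‖ * (π * ρ ^ 2) := by
    rw [integral_const_mul, ← integral_Ioc_eq_integral_Ioo,
      ← intervalIntegral.integral_of_le hρ.le, integral_id]
    ring
  rw [← e4]
  refine setIntegral_mono_on ?_ ?_ measurableSet_Ioo e3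
  · exact (continuous_const.mul continuous_id).integrableOn_Icc.mono_set Ioo_subset_Icc_self
  · rw [IntegrableOn, ← Measure.prod_restrict] at hint
    exact hint.integral_prod_left

/-- Hartogs' lemma, in the form of a decay estimate: if holomorphic functions grow at most exponentially
in `n`, locally uniformly, and decay like `2 ^ (-n)` at every point, then they decay exponentially
locally uniformly. -/
theorem hartogs_decay {Y : Type*} {F : ℕ → ℂ → Y → ℂ} {s₀ : ℂ} {R C : ℝ} (hR : 0 < R)
    (hF : ∀ n y, DifferentiableOn ℂ (fun s => F n s y) (ball s₀ R))
    (hC : ∀ n, ∀ s ∈ ball s₀ R, ∀ y, ‖F n s y‖ ≤ exp (C * (n + 1)))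
    (hpt : ∀ s ∈ ball s₀ R, ∃ N : ℝ, ∀ n y, ‖F n s y‖ ≤ N * 2⁻¹ ^ n) :
    ∃ N : ℝ, ∀ n, ∀ s ∈ ball s₀ (R / 4), ∀ y, ‖F n s y‖ ≤ N * exp (-(log 2 / 2)) ^ n := by
  wlog hC1 : 1 ≤ C generalizing C
  · exact this (C := max C 1) (fun n s hs y => (hC n s hs y).trans
      (exp_le_exp.2 (mul_le_mul_of_nonneg_right (le_max_left _ _) (by positivity))))
      (le_max_right _ _)
  have hl2 : 0 < log 2 := log_pos one_lt_two
  -- the sets where the decay holds with the constant `N + 1` exhaust the disc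
  set G : ℕ → Set ℂ := fun N =>
    {s | s ∈ ball s₀ R ∧ ∀ n y, ‖F n s y‖ ≤ (N + 1) * 2⁻¹ ^ n} with hG
  set η : ℝ := log 2 / (4 * C) with hη
  have hη0 : 0 < η := by positivity
  have hη1 : η ≤ 1 / 4 := by
    rw [hη, div_le_iff₀ (by positivity)]
    have := log_two_lt_d9
    nlinarith
  have hGm : ∀ N, MeasurableSet (G N) := by
    intro N
    have : G N = ball s₀ R ∩ ⋂ n, ⋂ y, {s | s ∈ ball s₀ R → ‖F n s y‖ ≤ (N + 1) * 2⁻¹ ^ n} := by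
      ext s
      simp only [hG, mem_ofPred_eq, mem_inter_iff, mem_iInter]
      exact ⟨fun h => ⟨h.1, fun n y _ => h.2 n y⟩, fun h => ⟨h.1, fun n y => h.2 n y h.1⟩⟩
    have h2 : G N = ball s₀ R ∩ (⋃ n, ⋃ y, ball s₀ R ∩ {s | (N + 1) * 2⁻¹ ^ n < ‖F n s y‖})ᶜ := by
      rw [this]
      ext s
      simp only [mem_inter_iff, mem_iInter, mem_ofPred_eq, mem_compl_iff, mem_iUnion, not_exists,
        not_and, not_lt]
    rw [h2]
    refine isOpen_ball.measurableSet.inter (IsOpen.measurableSet ?_).compl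
    refine isOpen_iUnion fun n => isOpen_iUnion fun y => ?_
    exact (hF n y).continuousOn.norm.isOpen_inter_preimage isOpen_ball isOpen_Ioi
  have hGmono : Monotone G := by
    intro N N' h s hs
    refine ⟨hs.1, fun n y => (hs.2 n y).trans ?_⟩
    gcongr
  have hGU : ⋃ N, G N = ball s₀ R := by
    refine Subset.antisymm (iUnion_subset fun N s hs => hs.1) fun s hs => ?_
    obtain ⟨N, hN⟩ := hpt s hs
    refine mem_iUnion.2 ⟨⌈N⌉₊, hs, fun n y => (hN n y).trans ?_⟩
    gcongr
    exact (Nat.le_ceil N).trans (by linarith)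
  have hlim : Tendsto (fun N => volume.real (ball s₀ R \ G N)) atTop (𝓝 0) := by
    have h := tendsto_measure_iInter_atTop (μ := volume) (s := fun N => ball s₀ R \ G N)
      (fun N => (measurableSet_ball.diff (hGm N)).nullMeasurableSet)
      (fun N N' h => sdiff_subset_sdiff_right (hGmono h))
      ⟨0, ((measure_mono sdiff_subset).trans_lt measure_ball_lt_top).ne⟩
    have h0 : ⋂ N, ball s₀ R \ G N = ∅ := by
      rw [← sdiff_iUnion, hGU, Set.sdiff_self]
    rw [h0, measure_empty] at h
    have := (ENNReal.tendsto_toReal ENNReal.zero_ne_top).comp h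
    rw [ENNReal.toReal_zero] at this
    exact this
  -- Off `G N`, a set of small area, only the exponential bound is available.
  obtain ⟨N, hN⟩ := (hlim.eventually (gt_mem_nhds
    (show 0 < η * (π * (R / 2) ^ 2) by positivity))).exists
  refine ⟨exp (log (N + 1) + η * C), fun n s hs y => ?_⟩
  by_cases hz : F n s y = 0
  · rw [hz, norm_zero]; positivity
  have hsub : closedBall s (R / 2) ⊆ ball s₀ R := by
    refine closedBall_subset_ball' ?_
    rw [mem_ball] at hs
    linarith
  set ε : ℝ := (N + 1) * 2⁻¹ ^ n with hε
  have hε0 : 0 < ε := by positivity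
  have hlogε : log ε = log (N + 1) - n * log 2 := by
    rw [hε, log_mul (by positivity) (by positivity), log_pow, log_inv]
    ring
  have han : AnalyticOnNhd ℂ (fun s => F n s y) (closedBall s (R / 2)) :=
    ((hF n y).analyticOnNhd isOpen_ball).mono hsub
  have key := log_norm_mul_le_integral_ball (half_pos hR) han hz hε0
  set B : ℝ := max (C * (n + 1)) (log ε) with hB
  have hu : ∀ z ∈ ball s (R / 2), log (max ‖F n z y‖ ε) ≤
      log ε + (ball s₀ R \ G N).indicator (fun _ => B - log ε) z := by
    intro z hz
    have hzb : z ∈ ball s₀ R := hsub (ball_subset_closedBall hz)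
    by_cases hzG : z ∈ G N
    · rw [indicator_of_notMem (fun h => h.2 hzG), add_zero,
        max_eq_right (hzG.2 n y)]
    · rw [indicator_of_mem (show z ∈ ball s₀ R \ G N from ⟨hzb, hzG⟩), add_sub_cancel]
      rcases max_cases ‖F n z y‖ ε with ⟨h, h'⟩ | ⟨h, h'⟩
      · rw [h]
        refine le_trans ?_ (le_max_left _ _)
        rw [log_le_iff_le_exp (hε0.trans_le h')]
        exact hC n z hzb y
      · rw [h]; exact le_max_right _ _
  have hvol : volume.real (ball s (R / 2)) = π * (R / 2) ^ 2 := by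
    rw [Measure.real, Complex.volume_ball]
    simp [ENNReal.toReal_ofReal (half_pos hR).le]
    ring
  have hBε : 0 ≤ B - log ε := sub_nonneg.2 (le_max_right _ _)
  have hle : ∫ z in ball s (R / 2), log (max ‖F n z y‖ ε) ≤
      (π * (R / 2) ^ 2) * log ε + (η * (π * (R / 2) ^ 2)) * (B - log ε) := by
    have hi1 : IntegrableOn (fun z => log (max ‖F n z y‖ ε)) (ball s (R / 2)) := by
      refine (ContinuousOn.integrableOn_compact (isCompact_closedBall s (R / 2))
        ?_).mono_set ball_subset_closedBall
      exact ContinuousOn.log (han.continuousOn.norm.sup continuousOn_const)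
        fun z _ => (lt_max_of_lt_right hε0).ne'
    have hc : IntegrableOn (fun _ : ℂ => log ε) (ball s (R / 2)) :=
      integrableOn_const (measure_ball_lt_top.ne)
    have hi2 : IntegrableOn ((ball s₀ R \ G N).indicator (fun _ => B - log ε)) (ball s (R / 2)) :=
      (integrableOn_const (measure_ball_lt_top.ne)).indicator (measurableSet_ball.diff (hGm N))
    refine (setIntegral_mono_on hi1 (hc.add hi2) measurableSet_ball hu).trans ?_
    rw [integral_add' hc hi2, setIntegral_const, hvol, smul_eq_mul,
      setIntegral_indicator (measurableSet_ball.diff (hGm N)), setIntegral_const, smul_eq_mul]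
    gcongr
    refine le_trans ?_ hN.le
    exact measureReal_mono inter_subset_right ((measure_mono sdiff_subset).trans_lt measure_ball_lt_top).ne
  have hfin : log ‖F n s y‖ ≤ log ε + η * (B - log ε) := by
    have hp : 0 < π * (R / 2) ^ 2 := by positivity
    have := key.trans hle
    have h3 : (π * (R / 2) ^ 2) * log ‖F n s y‖ ≤ (π * (R / 2) ^ 2) * (log ε + η * (B - log ε)) := by
      linarith
    exact le_of_mul_le_mul_left h3 hp
  have hηC : η * C = log 2 / 4 := by
    rw [hη]; field_simp
  have hN0 : 0 ≤ log ((N : ℝ) + 1) := log_nonneg (by linarith [Nat.cast_nonneg (α := ℝ) N])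
  have hbd : log ε + η * (B - log ε) ≤ log (N + 1) + η * C - n * (log 2 / 2) := by
    have hn : (0:ℝ) ≤ n := Nat.cast_nonneg n
    rcases max_cases (C * ((n:ℝ) + 1)) (log ε) with ⟨h, _⟩ | ⟨h, h'⟩
    · rw [hB, h, hlogε]
      have : η * (C * (n + 1)) = (log 2 / 4) * (n + 1) := by rw [← mul_assoc, hηC]
      have h5 : η * (n * log 2) ≤ 1 / 4 * (n * log 2) := by gcongr
      have h6 : 0 ≤ η * log (N + 1) := by positivity
      nlinarith
    · rw [hB, h, hlogε]
      nlinarith [mul_nonneg hn hl2.le]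
  rw [← exp_nat_mul, ← exp_add, ← log_le_iff_le_exp (norm_pos_iff.2 hz)]
  refine (hfin.trans hbd).trans (le_of_eq (by ring))

end Hartogs

/-! ### Holomorphic families of functions and regularized integrals -/

section HolomorphicIntegral

open Metric

/-- Integrals of holomorphic functions with an integrable majorant are holomorphic. -/
theorem differentiableAt_integral_of_dominated {α : Type*} [MeasurableSpace α] {ν : Measure α}
    {F : ℂ → α → ℂ} {s₀ : ℂ} {R : ℝ} (hR : 0 < R) {bound : α → ℝ}
    (hm : ∀ s ∈ ball s₀ R, AEStronglyMeasurable (F s) ν)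
    (hd : ∀ᵐ a ∂ν, DifferentiableOn ℂ (fun s => F s a) (ball s₀ R))
    (hb : ∀ᵐ a ∂ν, ∀ s ∈ ball s₀ R, ‖F s a‖ ≤ bound a) (hi : Integrable bound ν) :
    DifferentiableAt ℂ (fun s => ∫ a, F s a ∂ν) s₀ := by
  have hR2 : 0 < R / 2 := half_pos hR
  have hsub : ∀ s ∈ ball s₀ (R / 2), closedBall s (R / 4) ⊆ ball s₀ R := fun s hs =>
    closedBall_subset_ball' (by rw [mem_ball] at hs; linarith)
  have h2 : ball s₀ (R / 2) ⊆ ball s₀ R := ball_subset_ball (by linarith)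
  have hder : ∀ᵐ a ∂ν, ∀ s ∈ ball s₀ (R / 2), HasDerivAt (fun s => F s a)
      (deriv (fun s => F s a) s) s := by
    filter_upwards [hd] with a ha s hs
    exact (ha.differentiableAt (isOpen_ball.mem_nhds (h2 hs))).hasDerivAt
  have hlim : ∀ᵐ a ∂ν, Tendsto (fun n : ℕ => ((R / 4 * (1 / (n + 1 : ℝ)) : ℝ) : ℂ)⁻¹ •
      (F (s₀ + (R / 4 * (1 / (n + 1 : ℝ)) : ℝ)) a - F s₀ a)) atTop
      (𝓝 (deriv (fun s => F s a) s₀)) := by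
    filter_upwards [hder] with a ha
    have h := (ha s₀ (mem_ball_self hR2)).tendsto_slope_zero
    refine h.comp (tendsto_nhdsWithin_iff.2 ⟨?_, Eventually.of_forall fun n => ?_⟩)
    · have : Tendsto (fun n : ℕ => R / 4 * (1 / (n + 1 : ℝ))) atTop (𝓝 0) := by
        simpa using tendsto_one_div_add_atTop_nhds_zero_nat.const_mul (R / 4)
      have h0 := (Complex.continuous_ofReal.tendsto 0).comp this
      rw [Complex.ofReal_zero] at h0
      exact h0
    · have : R / 4 * (1 / (n + 1 : ℝ)) ≠ 0 := by positivity
      exact Complex.ofReal_ne_zero.2 this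
  refine (hasDerivAt_integral_of_dominated_loc_of_deriv_le (F := F)
    (F' := fun s a => deriv (fun s => F s a) s) (bound := fun a => bound a / (R / 4))
    (ball_mem_nhds s₀ hR2) ?_ ?_ ?_ ?_ (hi.div_const _) hder).2.differentiableAt
  · filter_upwards [ball_mem_nhds s₀ hR] with s hs using hm s hs
  · refine hi.mono' (hm s₀ (mem_ball_self hR)) ?_
    filter_upwards [hb] with a ha using ha s₀ (mem_ball_self hR)
  · refine aestronglyMeasurable_of_tendsto_ae (u := atTop) (fun n => ?_) hlim
    simp only [smul_eq_mul]
    refine AEStronglyMeasurable.const_mul (f := fun a => _ - F s₀ a)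
      ((hm _ ?_).sub (hm _ (mem_ball_self hR))) _
    rw [mem_ball, dist_eq_norm, add_sub_cancel_left, Complex.norm_real, Real.norm_of_nonneg
      (by positivity)]
    have : 1 / ((n : ℝ) + 1) ≤ 1 := by
      rw [div_le_one (by positivity)]; linarith [Nat.cast_nonneg (α := ℝ) n]
    nlinarith
  · filter_upwards [hd, hb] with a had hab s hs
    refine Complex.norm_deriv_le_of_forall_mem_sphere_norm_le (by positivity) ?_ fun z hz =>
      hab z (hsub s hs (sphere_subset_closedBall hz))
    refine DifferentiableOn.diffContOnCl (had.mono ?_)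
    rw [closure_ball _ (by positivity)]
    exact hsub s hs

/-- Quantitative convergence of difference quotients of bounded holomorphic functions. -/
theorem norm_slope_sub_deriv_le {f : ℂ → ℂ} {s : ℂ} {R C : ℝ} (hR : 0 < R)
    (hf : DifferentiableOn ℂ f (ball s R)) (hC : ∀ z ∈ ball s R, ‖f z‖ ≤ C) {w : ℂ}
    (hw : w ∈ ball s R) (hws : w ≠ s) :
    ‖(w - s)⁻¹ • (f w - f s) - deriv f s‖ ≤ 4 * C / R / R * ‖w - s‖ := by
  have hs : s ∈ ball s R := mem_ball_self hR
  have hm : MapsTo f (ball s R) (closedBall (f s) (2 * C)) := fun z hz => by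
    rw [mem_closedBall, dist_eq_norm]
    exact (norm_sub_le _ _).trans (by linarith [hC z hz, hC s hs])
  have h1 := fun z (hz : z ∈ ball s R) => Complex.norm_dslope_le_div_of_mapsTo_ball hf hm hz
  have hd : DifferentiableOn ℂ (dslope f s) (ball s R) :=
    (Complex.differentiableOn_dslope (isOpen_ball.mem_nhds hs)).2 hf
  have hm2 : MapsTo (dslope f s) (ball s R) (closedBall (dslope f s s) (4 * C / R)) := fun z hz => by
    rw [mem_closedBall, dist_eq_norm]
    refine (norm_sub_le _ _).trans ((add_le_add (h1 z hz) (h1 s hs)).trans (le_of_eq ?_))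
    ring
  have h2 := Complex.dist_le_div_mul_dist_of_mapsTo_ball hd hm2 hw
  rwa [dslope_same, dslope_of_ne _ hws, slope_def_module, dist_eq_norm, dist_eq_norm] at h2

end HolomorphicIntegral

/-- A function that is jointly continuous on `Ω × Y` and holomorphic in the first variable. -/
structure IsHolFamily {Y : Type*} [TopologicalSpace Y] (Ω : Set ℂ) (F : ℂ → Y → ℂ) : Prop where
  cont : ContinuousOn (fun p : ℂ × Y => F p.1 p.2) (Ω ×ˢ univ)
  hol : ∀ y, DifferentiableOn ℂ (fun s => F s y) Ω

namespace IsHolFamily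

variable {Y : Type*} [TopologicalSpace Y] {Ω : Set ℂ} {F G : ℂ → Y → ℂ}

theorem mono {Ω' : Set ℂ} (hF : IsHolFamily Ω F) (h : Ω' ⊆ Ω) : IsHolFamily Ω' F :=
  ⟨hF.cont.mono (prod_mono_left h), fun y => (hF.hol y).mono h⟩

theorem add (hF : IsHolFamily Ω F) (hG : IsHolFamily Ω G) :
    IsHolFamily Ω fun s y => F s y + G s y :=
  ⟨hF.cont.add hG.cont, fun y => (hF.hol y).add (hG.hol y)⟩

theorem mul (hF : IsHolFamily Ω F) (hG : IsHolFamily Ω G) :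
    IsHolFamily Ω fun s y => F s y * G s y :=
  ⟨hF.cont.mul hG.cont, fun y => (hF.hol y).mul (hG.hol y)⟩

theorem of_continuous {f : Y → ℂ} (hf : Continuous f) : IsHolFamily Ω fun _ y => f y :=
  ⟨(hf.comp continuous_snd).continuousOn, fun _ => differentiableOn_const _⟩

theorem of_differentiableOn {f : ℂ → ℂ} (hf : DifferentiableOn ℂ f Ω) :
    IsHolFamily Ω fun s (_ : Y) => f s :=
  ⟨hf.continuousOn.comp continuousOn_fst fun _ h => h.1, fun _ => hf⟩

theorem comp {Z : Type*} [TopologicalSpace Z] (hF : IsHolFamily Ω F) {φ : Z → Y}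
    (hφ : Continuous φ) : IsHolFamily Ω fun s z => F s (φ z) :=
  ⟨hF.cont.comp (f := fun p : ℂ × Z => (p.1, φ p.2)) (by fun_prop) fun p hp => ⟨hp.1, trivial⟩,
    fun z => hF.hol (φ z)⟩

theorem congr (hF : IsHolFamily Ω F) (h : ∀ s ∈ Ω, ∀ y, G s y = F s y) : IsHolFamily Ω G :=
  ⟨hF.cont.congr fun p hp => h p.1 hp.1 p.2, fun y => (hF.hol y).congr fun s hs => h s hs y⟩

theorem continuous (hF : IsHolFamily Ω F) {s : ℂ} (hs : s ∈ Ω) : Continuous (F s) := by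
  have : ContinuousOn (fun y : Y => F s y) univ :=
    hF.cont.comp (f := fun y : Y => (s, y)) (by fun_prop) fun y _ => ⟨hs, trivial⟩
  exact continuousOn_univ.1 this

theorem of_locally (h : ∀ s ∈ Ω, ∀ y, ∃ Ω' ∈ 𝓝 s, ∃ V ∈ 𝓝 y,
    ContinuousOn (fun p : ℂ × Y => F p.1 p.2) (Ω' ×ˢ V) ∧
      ∀ y ∈ V, DifferentiableOn ℂ (fun s => F s y) Ω') : IsHolFamily Ω F := by
  refine ⟨fun p hp => ?_, fun y s hs => ?_⟩
  · obtain ⟨Ω', h1, V, h2, h3, -⟩ := h p.1 hp.1 p.2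
    exact (h3.continuousAt (prod_mem_nhds h1 h2)).continuousWithinAt
  · obtain ⟨Ω', h1, V, h2, -, h3⟩ := h s hs y
    exact ((h3 y (mem_of_mem_nhds h2)).differentiableAt h1).differentiableWithinAt

/-- The difference quotients converge uniformly on compact sets. -/
theorem tendsto_slope (hF : IsHolFamily Ω F) (hΩ : IsOpen Ω) {s : ℂ} (hs : s ∈ Ω) {L : Set Y}
    (hL : IsCompact L) :
    TendstoUniformlyOn (fun w y => (w - s)⁻¹ • (F w y - F s y)) (fun y => deriv (fun s => F s y) s)
      (𝓝[≠] s) L := by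
  obtain ⟨R, hR, hRΩ⟩ := Metric.isOpen_iff.1 hΩ s hs
  have hc : IsCompact (Metric.closedBall s (R / 2) ×ˢ L) := (isCompact_closedBall _ _).prod hL
  have hsub : Metric.closedBall s (R / 2) ⊆ Ω :=
    (Metric.closedBall_subset_ball (by linarith)).trans hRΩ
  obtain ⟨C, hC⟩ := (hc.image_of_continuousOn
    (hF.cont.norm.mono (prod_mono hsub (subset_univ _)))).bddAbove
  have hC' : ∀ z ∈ Metric.ball s (R / 2), ∀ y ∈ L, ‖F z y‖ ≤ C := fun z hz y hy =>
    hC (mem_image_of_mem _ (mk_mem_prod (Metric.ball_subset_closedBall hz) hy))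
  rw [Metric.tendstoUniformlyOn_iff]
  intro ε hε
  have hlim : Tendsto (fun w => 4 * C / (R / 2) / (R / 2) * ‖w - s‖) (𝓝[≠] s) (𝓝 0) := by
    have : Continuous fun w : ℂ => 4 * C / (R / 2) / (R / 2) * ‖w - s‖ := by fun_prop
    simpa using (this.tendsto s).mono_left nhdsWithin_le_nhds
  filter_upwards [hlim.eventually (gt_mem_nhds hε), self_mem_nhdsWithin,
    mem_nhdsWithin_of_mem_nhds (Metric.ball_mem_nhds s (half_pos hR))] with w hw hws hwb y hy
  rw [dist_comm, dist_eq_norm]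
  exact (norm_slope_sub_deriv_le (half_pos hR)
    ((hF.hol y).mono (Metric.ball_subset_closedBall.trans hsub))
    (fun z hz => hC' z hz y hy) hwb hws).trans_lt hw

theorem continuous_deriv [LocallyCompactSpace Y] (hF : IsHolFamily Ω F) (hΩ : IsOpen Ω) {s : ℂ}
    (hs : s ∈ Ω) : Continuous fun y => deriv (fun s => F s y) s := by
  refine continuous_iff_continuousAt.2 fun y => ?_
  obtain ⟨L, hL, hy⟩ := exists_compact_mem_nhds y
  refine ContinuousOn.continuousAt (s := L) ?_ hy
  refine (hF.tendsto_slope hΩ hs hL).continuousOn ?_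
  refine Eventually.frequently ?_
  filter_upwards [mem_nhdsWithin_of_mem_nhds (hΩ.mem_nhds hs)] with w hw
  exact (((hF.continuous hw).sub (hF.continuous hs)).const_smul (w - s)⁻¹).continuousOn

end IsHolFamily

/-- A sequence `g 0, g 1, …` of functions on `Ω × Y × ℝ`, jointly continuous and holomorphic in the
first variable, each of which is the derivative of its predecessor in the last variable. -/
structure IsJetFamily {Y : Type*} [TopologicalSpace Y] (Ω : Set ℂ) (g : ℕ → ℂ → Y × ℝ → ℂ) :
    Prop where
  hol : ∀ j, IsHolFamily Ω (g j)
  deriv : ∀ j, ∀ s ∈ Ω, ∀ y h, HasDerivAt (fun h => g j s (y, h)) (g (j + 1) s (y, h)) h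

/-- The iterated Hadamard quotient: `hadQuot g 0 s (y, h) = (g 0 s (y, h) - g 0 s (y, 0)) / h`,
written as an integral, together with its derivatives. -/
def hadQuot {Y : Type*} (g : ℕ → ℂ → Y × ℝ → ℂ) (j : ℕ) (s : ℂ) (q : Y × ℝ) : ℂ :=
  ∫ t in (0 : ℝ)..1, (t : ℂ) ^ j * g (j + 1) s (q.1, t * q.2)

/-- `∫₀¹ t ^ (z - 1) q(t h) dt`. -/
def mellinPart {Y : Type*} (z : ℂ) (g : Y × ℝ → ℂ) (q : Y × ℝ) : ℂ :=
  ∫ t in (0 : ℝ)..1, (t : ℂ) ^ (z - 1) * g (q.1, t * q.2)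

section Regularize

variable {Y : Type*} [TopologicalSpace Y] [FirstCountableTopology Y] {Ω : Set ℂ}

omit [FirstCountableTopology Y] in
theorem mellinPart_locally {F : ℂ → Y × ℝ → ℂ} (hF : IsHolFamily Ω F) (hΩ : IsOpen Ω) {ζ : ℂ → ℂ}
    (hζ : DifferentiableOn ℂ ζ Ω) {s₀ : ℂ} (hs : s₀ ∈ Ω) (hre : 0 < (ζ s₀).re) (q : Y × ℝ) :
    ∃ R > 0, Metric.ball s₀ R ⊆ Ω ∧ (∀ s ∈ Metric.ball s₀ R, (ζ s₀).re / 2 < (ζ s).re) ∧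
      ∃ C, ∃ V ∈ 𝓝 q, ∀ s ∈ Metric.ball s₀ R, ∀ p ∈ V, ∀ t ∈ Icc (0 : ℝ) 1,
        ‖F s (p.1, t * p.2)‖ ≤ C := by
  have h1 : ∀ᶠ s in 𝓝 s₀, (ζ s₀).re / 2 < (ζ s).re :=
    (Complex.continuous_re.continuousAt.comp
      (hζ.differentiableAt (hΩ.mem_nhds hs)).continuousAt).eventually
      (lt_mem_nhds (by simpa using half_lt_self hre))
  set φ : (ℂ × Y × ℝ) × ℝ → ℂ × Y × ℝ := fun p => (p.1.1, p.1.2.1, p.2 * p.1.2.2) with hφ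
  have hφc : Continuous φ := by fun_prop
  have hc : ContinuousOn (fun p => ‖F (φ p).1 (φ p).2‖) (φ ⁻¹' (Ω ×ˢ univ)) :=
    (hF.cont.comp hφc.continuousOn fun _ h => h).norm
  have hsubs : {(s₀, q)} ×ˢ Icc (0 : ℝ) 1 ⊆ φ ⁻¹' (Ω ×ˢ univ) := by
    rintro ⟨_, t⟩ ⟨rfl, -⟩; exact ⟨hs, trivial⟩
  obtain ⟨C, hC⟩ := ((isCompact_singleton.prod isCompact_Icc).image_of_continuousOn
    (hc.mono hsubs)).bddAbove
  have hev : ∀ᶠ p in 𝓝 (s₀, q), ∀ t ∈ Icc (0 : ℝ) 1, ‖F (φ (p, t)).1 (φ (p, t)).2‖ < C + 1 := by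
    refine isCompact_Icc.eventually_forall_of_forall_eventually (x₀ := (s₀, q)) fun t ht => ?_
    have hmem : ((s₀, q), t) ∈ φ ⁻¹' (Ω ×ˢ univ) := ⟨hs, trivial⟩
    have hca := (hc.continuousAt (((hΩ.prod isOpen_univ).preimage hφc).mem_nhds
      hmem))
    exact hca.eventually (gt_mem_nhds ((hC (mem_image_of_mem _
      (mk_mem_prod rfl ht))).trans_lt (lt_add_one C)))
  rw [nhds_prod_eq] at hev
  obtain ⟨pa, ha, pb, hb, hab⟩ := eventually_prod_iff.1 hev
  obtain ⟨R, hR, hRs⟩ := Metric.eventually_nhds_iff_ball.1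
    ((ha.and h1).and (hΩ.mem_nhds hs))
  exact ⟨R, hR, fun s h => (hRs s h).2, fun s h => (hRs s h).1.2, C + 1, {p | pb p}, hb,
    fun s h p hp t ht => (hab (hRs s h).1.1 hp t ht).le⟩

theorem IsHolFamily.mellinPart {F : ℂ → Y × ℝ → ℂ} (hF : IsHolFamily Ω F) (hΩ : IsOpen Ω) {ζ : ℂ → ℂ}
    (hζ : DifferentiableOn ℂ ζ Ω) (hre : ∀ s ∈ Ω, 0 < (ζ s).re) :
    IsHolFamily Ω fun s q => Carnot.mellinPart (ζ s) (F s) q := by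
  have hmeas : ∀ s ∈ Ω, ∀ q : Y × ℝ, AEStronglyMeasurable
      (fun t : ℝ => (t : ℂ) ^ (ζ s - 1) * F s (q.1, t * q.2)) (volume.restrict (uIoc 0 1)) := by
    intro s hs q
    refine ContinuousOn.aestronglyMeasurable ?_ measurableSet_uIoc
    refine ContinuousOn.mul (fun t ht => ?_) ?_
    · rw [uIoc_of_le zero_le_one] at ht
      refine ((continuousAt_cpow_const ?_).comp
        Complex.continuous_ofReal.continuousAt).continuousWithinAt
      exact Or.inl (by simpa using ht.1)
    · exact ((hF.continuous hs).comp (by fun_prop)).continuousOn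
  have hnorm : ∀ (z : ℂ) (σ : ℝ), σ < z.re → ∀ t ∈ uIoc (0 : ℝ) 1,
      ‖(t : ℂ) ^ (z - 1)‖ ≤ t ^ (σ - 1) := by
    intro z σ hz t ht
    rw [uIoc_of_le zero_le_one] at ht
    rw [Complex.norm_cpow_eq_rpow_re_of_pos ht.1]
    exact Real.rpow_le_rpow_of_exponent_ge ht.1 ht.2 (by simp; linarith)
  have hint : ∀ σ C : ℝ, 0 < σ → IntervalIntegrable (fun t : ℝ => t ^ (σ - 1) * C) volume 0 1 :=
    fun σ C hσ => (intervalIntegral.intervalIntegrable_rpow' (by linarith)).mul_const C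
  refine ⟨fun p hp => ?_, fun q s₀ hs₀ => ?_⟩
  · obtain ⟨R, hR, hRΩ, hRre, C, V, hV, hC⟩ := mellinPart_locally hF hΩ hζ hp.1 (hre _ hp.1) p.2
    have hnb : Metric.ball p.1 R ×ˢ V ∈ 𝓝 p := prod_mem_nhds (Metric.ball_mem_nhds _ hR) hV
    refine ContinuousAt.continuousWithinAt ?_
    refine intervalIntegral.continuousAt_of_dominated_interval
      (bound := fun t => t ^ ((ζ p.1).re / 2 - 1) * C)
      (F := fun (p : ℂ × Y × ℝ) (t : ℝ) => (t : ℂ) ^ (ζ p.1 - 1) * F p.1 (p.2.1, t * p.2.2))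
      ?_ ?_ (hint _ _ (half_pos (hre _ hp.1))) ?_
    · filter_upwards [hnb] with p' hp'
      exact hmeas _ (hRΩ hp'.1) _
    · filter_upwards [hnb] with p' hp'
      refine ae_of_all _ fun t ht => ?_
      have ht' : t ∈ Icc (0 : ℝ) 1 := by
        rw [uIoc_of_le zero_le_one] at ht; exact ⟨ht.1.le, ht.2⟩
      rw [norm_mul]
      refine mul_le_mul (hnorm _ _ (hRre _ hp'.1) t ht) (hC _ hp'.1 _ hp'.2 t ht') (norm_nonneg _)
        (Real.rpow_nonneg ht'.1 _)
    · refine ae_of_all _ fun t ht => ?_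
      rw [uIoc_of_le zero_le_one] at ht
      refine ContinuousAt.mul ?_ ?_
      · have : ContinuousAt (fun p : ℂ × Y × ℝ => ζ p.1 - 1) p :=
          (((hζ.differentiableAt (hΩ.mem_nhds hp.1)).continuousAt.comp continuousAt_fst)).sub
            continuousAt_const
        exact continuousAt_const.cpow this (Or.inl (by simpa using ht.1))
      · have h1 : ContinuousAt (fun p : ℂ × Y × ℝ => F p.1 p.2) (p.1, p.2.1, t * p.2.2) :=
          hF.cont.continuousAt ((hΩ.prod isOpen_univ).mem_nhds ⟨hp.1, trivial⟩)
        exact ContinuousAt.comp (f := fun p : ℂ × Y × ℝ => (p.1, p.2.1, t * p.2.2)) h1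
          (by fun_prop)
  · obtain ⟨R, hR, hRΩ, hRre, C, V, hV, hC⟩ := mellinPart_locally hF hΩ hζ hs₀ (hre _ hs₀) q
    refine DifferentiableAt.differentiableWithinAt ?_
    simp only [Carnot.mellinPart, intervalIntegral.integral_of_le zero_le_one]
    have hI : Ioc (0 : ℝ) 1 = uIoc 0 1 := (uIoc_of_le zero_le_one).symm
    refine differentiableAt_integral_of_dominated hR
      (bound := fun t => t ^ ((ζ s₀).re / 2 - 1) * C) ?_ ?_ ?_ ?_
    · intro s hs
      rw [hI]; exact hmeas s (hRΩ hs) q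
    · refine (ae_restrict_mem measurableSet_Ioc).mono fun t ht => ?_
      refine DifferentiableOn.mul ?_ ((hF.hol _).mono hRΩ)
      exact ((hζ.mono hRΩ).sub_const 1).const_cpow (Or.inl (by simpa using ht.1.ne'))
    · refine (ae_restrict_mem measurableSet_Ioc).mono fun t ht s hs => ?_
      rw [norm_mul]
      refine mul_le_mul (hnorm _ _ (hRre s hs) t (hI ▸ ht))
        (hC s hs q (mem_of_mem_nhds hV) t ⟨ht.1.le, ht.2⟩) (norm_nonneg _)
        (Real.rpow_nonneg ht.1.le _)
    · exact (intervalIntegrable_iff_integrableOn_Ioc_of_le zero_le_one).1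
        (hint _ _ (half_pos (hre _ hs₀)))

theorem mellinPart_one_pow {Y : Type*} (j : ℕ) (g : Y × ℝ → ℂ) (q : Y × ℝ) :
    mellinPart (j + 1) g q = ∫ t in (0 : ℝ)..1, (t : ℂ) ^ j * g (q.1, t * q.2) := by
  simp [mellinPart]

theorem IsJetFamily.hadQuot {g : ℕ → ℂ → Y × ℝ → ℂ} (hg : IsJetFamily Ω g) (hΩ : IsOpen Ω) :
    IsJetFamily Ω (hadQuot g) := by
  refine ⟨fun j => ?_, fun j s hs y h => ?_⟩
  · refine ((hg.hol (j + 1)).mellinPart hΩ (ζ := fun _ => (j : ℂ) + 1) (differentiableOn_const _)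
      fun s _ => ?_).congr fun s _ q => ?_
    · simp only [Complex.add_re, Complex.natCast_re, Complex.one_re]; positivity
    · rw [mellinPart_one_pow]; rfl
  · have hc : Continuous fun p : ℝ × ℝ => (p.2 : ℂ) ^ j * g (j + 1) s (y, p.2 * p.1) :=
      (by fun_prop : Continuous fun p : ℝ × ℝ => (p.2 : ℂ) ^ j).mul
        (((hg.hol (j + 1)).continuous hs).comp (by fun_prop))
    have hc' : Continuous fun p : ℝ × ℝ => (p.2 : ℂ) ^ (j + 1) * g (j + 2) s (y, p.2 * p.1) :=
      (by fun_prop : Continuous fun p : ℝ × ℝ => (p.2 : ℂ) ^ (j + 1)).mul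
        (((hg.hol (j + 2)).continuous hs).comp (by fun_prop))
    obtain ⟨C, hC⟩ := ((isCompact_closedBall h 1).prod (isCompact_uIcc (a := (0 : ℝ)) (b := 1))
      |>.image hc'.norm).bddAbove
    have hC' : ∀ x ∈ Metric.closedBall h 1, ∀ t ∈ uIcc (0 : ℝ) 1,
        ‖(t : ℂ) ^ (j + 1) * g (j + 2) s (y, t * x)‖ ≤ C := fun x hx t ht =>
      hC ⟨(x, t), ⟨hx, ht⟩, rfl⟩
    have := (intervalIntegral.hasDerivAt_integral_of_dominated_loc_of_deriv_le
      (F := fun (x t : ℝ) => (t : ℂ) ^ j * g (j + 1) s (y, t * x))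
      (F' := fun (x t : ℝ) => (t : ℂ) ^ (j + 1) * g (j + 2) s (y, t * x))
      (bound := fun _ => C) (a := 0) (b := 1) (x₀ := h) (μ := volume)
      (Metric.closedBall_mem_nhds h one_pos) ?_ ?_ ?_ ?_ ?_ ?_).2
    · exact this
    · exact Eventually.of_forall fun x =>
        (hc.comp (by fun_prop : Continuous fun t : ℝ => (x, t))).aestronglyMeasurable
    · exact (hc.comp (by fun_prop : Continuous fun t : ℝ => (h, t))).intervalIntegrable _ _
    · exact (hc'.comp (by fun_prop : Continuous fun t : ℝ => (h, t))).aestronglyMeasurable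
    · exact ae_of_all _ fun t ht x hx => hC' x hx t (uIoc_subset_uIcc ht)
    · exact intervalIntegrable_const
    · refine ae_of_all _ fun t _ x _ => ?_
      have h1 := (hg.deriv (j + 1) s hs y (t * x)).scomp x ((hasDerivAt_id x).const_mul t)
      have h2 := h1.const_mul ((t : ℂ) ^ j)
      refine h2.congr_deriv ?_
      simp only [mul_one, Complex.real_smul]
      ring

omit [FirstCountableTopology Y] in
theorem IsJetFamily.eq_add_hadQuot {g : ℕ → ℂ → Y × ℝ → ℂ} (hg : IsJetFamily Ω g) {s : ℂ}
    (hs : s ∈ Ω) (y : Y) (h : ℝ) :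
    g 0 s (y, h) = g 0 s (y, 0) + h * Carnot.hadQuot g 0 s (y, h) := by
  have hd : ∀ t ∈ uIcc (0 : ℝ) 1, HasDerivAt (fun t : ℝ => g 0 s (y, t * h))
      ((h : ℂ) * g 1 s (y, t * h)) t := fun t _ => by
    have := (hg.deriv 0 s hs y (t * h)).scomp t ((hasDerivAt_id t).mul_const h)
    refine this.congr_deriv ?_
    simp
  have hc : Continuous fun t : ℝ => (h : ℂ) * g 1 s (y, t * h) :=
    continuous_const.mul (((hg.hol 1).continuous hs).comp (by fun_prop))
  have h1 := intervalIntegral.integral_eq_sub_of_hasDerivAt hd (hc.intervalIntegrable _ _)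
  rw [one_mul, zero_mul, intervalIntegral.integral_const_mul] at h1
  simp only [Carnot.hadQuot, pow_zero, one_mul]
  rw [h1]; ring

/-- One step of the Taylor expansion at `h = 0` under the regularized integral. -/
theorem IsJetFamily.mellinPart_eq {g : ℕ → ℂ → Y × ℝ → ℂ} (hg : IsJetFamily Ω g) (hΩ : IsOpen Ω)
    {s : ℂ} (hs : s ∈ Ω) {z : ℂ} (hz : 0 < z.re) (y : Y) (h : ℝ) :
    mellinPart z (g 0 s) (y, h) = z⁻¹ * g 0 s (y, 0) +
      h * mellinPart (z + 1) (Carnot.hadQuot g 0 s) (y, h) := by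
  have hz0 : z ≠ 0 := by rintro rfl; simp at hz
  have hi1 : IntervalIntegrable (fun t : ℝ => (t : ℂ) ^ (z - 1)) volume 0 1 :=
    intervalIntegral.intervalIntegrable_cpow' (by simpa using hz)
  have hi2 : IntervalIntegrable (fun t : ℝ => (t : ℂ) ^ (z + 1 - 1)) volume 0 1 :=
    intervalIntegral.intervalIntegrable_cpow' (by simp; linarith)
  have hq : Continuous fun t : ℝ => Carnot.hadQuot g 0 s (y, t * h) :=
    (((hg.hadQuot hΩ).hol 0).continuous hs).comp (by fun_prop)
  have e : ∀ t ∈ Ioo (0 : ℝ) 1, (t : ℂ) ^ (z - 1) * g 0 s (y, t * h) =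
      (t : ℂ) ^ (z - 1) * g 0 s (y, 0) +
        h * ((t : ℂ) ^ (z + 1 - 1) * Carnot.hadQuot g 0 s (y, t * h)) := fun t ht => by
    have ht0 : (t : ℂ) ≠ 0 := by exact_mod_cast ht.1.ne'
    rw [hg.eq_add_hadQuot hs, add_sub_right_comm, Complex.cpow_add _ _ ht0, Complex.cpow_one]
    push_cast
    ring
  have e' : ∫ t in (0 : ℝ)..1, (t : ℂ) ^ (z - 1) * g 0 s (y, t * h) =
      ∫ t in (0 : ℝ)..1, ((t : ℂ) ^ (z - 1) * g 0 s (y, 0) +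
        h * ((t : ℂ) ^ (z + 1 - 1) * Carnot.hadQuot g 0 s (y, t * h))) := by
    rw [intervalIntegral.integral_of_le zero_le_one, intervalIntegral.integral_of_le zero_le_one,
      integral_Ioc_eq_integral_Ioo, integral_Ioc_eq_integral_Ioo]
    exact setIntegral_congr_fun measurableSet_Ioo e
  simp only [Carnot.mellinPart]
  rw [e', intervalIntegral.integral_add (hi1.mul_const _)
    ((hi2.mul_continuousOn hq.continuousOn).const_mul _), intervalIntegral.integral_mul_const,
    intervalIntegral.integral_const_mul, integral_cpow (Or.inl (by simpa using hz))]
  simp [hz0]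

end Regularize

section Residue

theorem HasResidue.congr {f f' : ℂ → ℂ} {s₀ c : ℂ} (h : HasResidue f s₀ c)
    (hf : ∀ᶠ s in 𝓝[≠] s₀, f' s = f s) : HasResidue f' s₀ c := by
  obtain ⟨n, g, hg, he, hc⟩ := h
  exact ⟨n, g, hg, by filter_upwards [hf, he] with s h1 h2 using h1.trans h2, hc⟩

theorem HasResidue.add_analytic {f e : ℂ → ℂ} {s₀ c : ℂ} (h : HasResidue f s₀ c)
    (he : AnalyticAt ℂ e s₀) : HasResidue (fun s => f s + e s) s₀ c := by
  obtain ⟨n, g, hg, hfg, hc⟩ := h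
  set p : ℂ → ℂ := fun s => (s - s₀) ^ (n + 1) * e s with hp
  have hpa : AnalyticAt ℂ p s₀ := by fun_prop
  refine ⟨n, fun s => g s + p s, hg.add hpa, ?_, ?_⟩
  · filter_upwards [hfg, self_mem_nhdsWithin] with s h1 hs
    have : s - s₀ ≠ 0 := sub_ne_zero.2 hs
    rw [h1, hp]
    field_simp
  · have hz : iteratedDeriv n p s₀ = 0 := by
      have h1 : ((n + 1 : ℕ) : ℕ∞) ≤ analyticOrderAt p s₀ :=
        (natCast_le_analyticOrderAt hpa).2 ⟨e, he, Eventually.of_forall fun z => by simp [hp]⟩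
      exact (natCast_le_analyticOrderAt_iff_iteratedDeriv_eq_zero hpa).1 h1 n (by omega)
    have h2 := iteratedDeriv_fun_add (n := n) (f := g) (g := p) (x := s₀)
      hg.contDiffAt hpa.contDiffAt
    rw [h2, hz, add_zero, hc]

/-- The residue of `A / w` at a zero of `w`. -/
theorem exists_hasResidue_div {A w : ℂ → ℂ} {s₀ : ℂ} (hA : AnalyticAt ℂ A s₀)
    (hw : AnalyticAt ℂ w s₀) (hw0 : w s₀ = 0) (hne : ¬ ∀ᶠ s in 𝓝 s₀, w s = 0) :
    ∃ c, HasResidue (fun s => (w s)⁻¹ * A s) s₀ c := by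
  obtain ⟨k, u, hu, hu0, hwu⟩ := hw.exists_eventuallyEq_pow_smul_nonzero_iff.2 hne
  obtain ⟨n, rfl⟩ : ∃ n, k = n + 1 := by
    refine Nat.exists_eq_succ_of_ne_zero fun hk => hu0 ?_
    have := hwu.self_of_nhds
    simpa [hk, hw0] using this.symm
  refine ⟨_, n, fun s => (u s)⁻¹ * A s, (hu.inv hu0).mul hA, ?_, rfl⟩
  filter_upwards [hwu.filter_mono nhdsWithin_le_nhds] with s hs
  rw [hs, smul_eq_mul, mul_inv, mul_assoc]

theorem hasResidue_div_of_deriv_ne_zero {A w : ℂ → ℂ} {s₀ : ℂ} (hA : AnalyticAt ℂ A s₀)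
    (hw : AnalyticAt ℂ w s₀) (hw0 : w s₀ = 0) (hd : deriv w s₀ ≠ 0) :
    HasResidue (fun s => (w s)⁻¹ * A s) s₀ ((deriv w s₀)⁻¹ * A s₀) := by
  have hds : AnalyticAt ℂ (dslope w s₀) s₀ := by
    obtain ⟨p, hp⟩ := hw
    exact ⟨_, hp.has_fpower_series_dslope_fslope⟩
  refine ⟨0, fun s => (dslope w s₀ s)⁻¹ * A s, (hds.inv (by simpa using hd)).mul hA, ?_, by simp⟩
  filter_upwards [self_mem_nhdsWithin] with s hs
  have hs0 : s - s₀ ≠ 0 := sub_ne_zero.2 hs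
  rw [dslope_of_ne _ hs, slope_def_field, hw0, sub_zero, zero_add, pow_one, inv_div]
  rw [← mul_assoc, mul_div_assoc', inv_mul_cancel₀ hs0, one_div]

end Residue

section HartogsFamily

open Real Metric

variable {Y : Type*} [TopologicalSpace Y] [LocallyCompactSpace Y] {Ω : Set ℂ}

/-- A limit of holomorphic families `F n` is a holomorphic family if the convergence is exponentially
fast for every single parameter `s`, and the differences grow at most exponentially in `n`, locally
uniformly in `s`. -/
theorem IsHolFamily.of_tendsto {F : ℕ → ℂ → Y → ℂ} {G : ℂ → Y → ℂ}
    (hF : ∀ n, IsHolFamily Ω (F n)) (hΩ : IsOpen Ω)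
    (hb : ∀ s ∈ Ω, ∀ L : Set Y, IsCompact L → ∃ R > 0, ∃ C : ℝ, ∀ n, ∀ z ∈ ball s R, ∀ y ∈ L,
      ‖F n z y‖ ≤ exp (C * (n + 1)))
    (hpt : ∀ s ∈ Ω, ∀ L : Set Y, IsCompact L → ∃ N : ℝ, ∀ n, ∀ y ∈ L,
      ‖F n s y - G s y‖ ≤ N * 2⁻¹ ^ n) : IsHolFamily Ω G := by
  refine IsHolFamily.of_locally fun s hs y => ?_
  obtain ⟨L, hL, hy⟩ := exists_compact_mem_nhds y
  obtain ⟨R₁, hR₁, C, hC⟩ := hb s hs L hL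
  obtain ⟨R₂, hR₂, hRΩ⟩ := Metric.isOpen_iff.1 hΩ s hs
  set R := min R₁ R₂ with hR
  have hR0 : 0 < R := lt_min hR₁ hR₂
  have hsub : ball s R ⊆ Ω := (ball_subset_ball (min_le_right _ _)).trans hRΩ
  have hd : ∀ n (y : L), DifferentiableOn ℂ (fun s => F (n + 1) s y - F n s y) (ball s R) :=
    fun n y => (((hF (n + 1)).hol y).mono hsub).sub (((hF n).hol y).mono hsub)
  obtain ⟨N, hN⟩ := hartogs_decay (F := fun n s (y : L) => F (n + 1) s y - F n s y)
    (C := 2 * |C| + 1) hR0 hd (fun n z hz y => by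
      have hz' := ball_subset_ball (min_le_left _ _) hz
      have h1 : ∀ m : ℕ, m ≤ n + 1 → ‖F m z y‖ ≤ exp (2 * |C| * (n + 1)) := fun m hm => by
        refine (hC m z hz' y y.2).trans (exp_le_exp.2 ?_)
        have hm' : (m : ℝ) ≤ n + 1 := by exact_mod_cast hm
        have hn : (0 : ℝ) ≤ n := Nat.cast_nonneg n
        have := mul_le_mul_of_nonneg_right (le_abs_self C) (by positivity : (0 : ℝ) ≤ m + 1)
        nlinarith [abs_nonneg C, mul_nonneg (abs_nonneg C) hn]
      calc ‖F (n + 1) z y - F n z y‖ ≤ ‖F (n + 1) z y‖ + ‖F n z y‖ := norm_sub_le _ _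
        _ ≤ exp (2 * |C| * (n + 1)) + exp (2 * |C| * (n + 1)) :=
          add_le_add (h1 _ le_rfl) (h1 _ (Nat.le_succ n))
        _ = exp (2 * |C| * (n + 1)) * 2 := by ring
        _ ≤ exp (2 * |C| * (n + 1)) * exp ((n : ℝ) + 1) := by
          gcongr
          have := add_one_le_exp ((n : ℝ) + 1)
          linarith [Nat.cast_nonneg (α := ℝ) n]
        _ = exp ((2 * |C| + 1) * (n + 1)) := by rw [← exp_add]; ring_nf)
    (fun z hz => by
      obtain ⟨N, hN⟩ := hpt z (hsub hz) L hL
      refine ⟨N * (2⁻¹ + 1), fun n y => ?_⟩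
      calc ‖F (n + 1) z y - F n z y‖ ≤ ‖F (n + 1) z y - G z y‖ + ‖F n z y - G z y‖ := by
            have := norm_sub_le (F (n + 1) z y - G z y) (F n z y - G z y)
            simpa using this
        _ ≤ N * 2⁻¹ ^ (n + 1) + N * 2⁻¹ ^ n := add_le_add (hN _ _ y.2) (hN _ _ y.2)
        _ = N * (2⁻¹ + 1) * 2⁻¹ ^ n := by ring)
  set θ : ℝ := exp (-(log 2 / 2)) with hθ
  have hθ1 : θ < 1 := by
    rw [hθ, ← exp_zero, exp_lt_exp]; linarith [log_pos one_lt_two]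
  have hθ0 : 0 ≤ θ := (exp_pos _).le
  have hR4 : ball s (R / 4) ⊆ ball s R := ball_subset_ball (by linarith)
  -- uniform convergence on a neighbourhood
  have hlim : ∀ z ∈ ball s (R / 4), ∀ y ∈ L, Tendsto (fun n => F n z y) atTop (𝓝 (G z y)) := by
    intro z hz y hy
    obtain ⟨N, hN⟩ := hpt z (hsub (hR4 hz)) L hL
    rw [tendsto_iff_norm_sub_tendsto_zero]
    refine squeeze_zero (fun _ => norm_nonneg _) (fun n => hN n y hy) ?_
    simpa using (tendsto_pow_atTop_nhds_zero_of_lt_one (by norm_num : (0 : ℝ) ≤ 2⁻¹)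
      (by norm_num)).const_mul N
  have hu : TendstoUniformlyOn (fun n (p : ℂ × Y) => F n p.1 p.2) (fun p => G p.1 p.2) atTop
      (ball s (R / 4) ×ˢ L) := by
    rw [Metric.tendstoUniformlyOn_iff]
    intro ε hε
    have hg : Tendsto (fun n : ℕ => N * θ ^ n / (1 - θ)) atTop (𝓝 0) := by
      simpa using ((tendsto_pow_atTop_nhds_zero_of_lt_one hθ0 hθ1).const_mul N).div_const (1 - θ)
    filter_upwards [hg.eventually (gt_mem_nhds hε)] with n hn p hp
    rw [dist_comm]
    exact (dist_le_of_le_geometric_of_tendsto θ N hθ1 (fun n => by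
      rw [dist_comm, dist_eq_norm]; exact hN n p.1 hp.1 ⟨p.2, hp.2⟩) (hlim p.1 hp.1 p.2 hp.2) n).trans_lt hn
  refine ⟨ball s (R / 4), ball_mem_nhds s (by linarith), L, hy, ?_, fun y hy => ?_⟩
  · exact hu.continuousOn (Frequently.of_forall fun n =>
      (hF n).cont.mono (prod_mono (hR4.trans hsub) (subset_univ _)))
  · have h2 : TendstoUniformlyOn (fun n z => F n z y) (fun z => G z y) atTop (ball s (R / 4)) :=
      fun v hv => (hu v hv).mono fun n hn z hz => hn (z, y) ⟨hz, hy⟩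
    exact h2.tendstoLocallyUniformlyOn.differentiableOn
      (Eventually.of_forall fun n => ((hF n).hol y).mono (hR4.trans hsub)) isOpen_ball

omit [LocallyCompactSpace Y] in
theorem IsHolFamily.exists_bound {F : ℂ → Y → ℂ} (hF : IsHolFamily Ω F) (hΩ : IsOpen Ω) {s : ℂ}
    (hs : s ∈ Ω) {L : Set Y} (hL : IsCompact L) :
    ∃ R > 0, ∃ C : ℝ, ∀ z ∈ ball s R, ∀ y ∈ L, ‖F z y‖ ≤ C := by
  obtain ⟨R, hR, hRΩ⟩ := Metric.isOpen_iff.1 hΩ s hs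
  have hc : IsCompact (closedBall s (R / 2) ×ˢ L) := (isCompact_closedBall _ _).prod hL
  obtain ⟨C, hC⟩ := (hc.image_of_continuousOn (hF.cont.norm.mono (prod_mono
    ((closedBall_subset_ball (by linarith)).trans hRΩ) (subset_univ _)))).bddAbove
  exact ⟨R / 2, half_pos hR, C, fun z hz y hy => hC ⟨(z, y), ⟨ball_subset_closedBall hz, hy⟩, rfl⟩⟩

/-- If a holomorphic family is smooth in a real variable for every fixed parameter `s`, then the
derivatives are holomorphic families: they are limits of difference quotients to which
`IsHolFamily.of_tendsto` applies. -/
theorem IsJetFamily.of_smooth {g : ℕ → ℂ → Y × ℝ → ℂ} (hΩ : IsOpen Ω) (h0 : IsHolFamily Ω (g 0))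
    (hc : ∀ j, ∀ s ∈ Ω, Continuous (g j s))
    (hd : ∀ j, ∀ s ∈ Ω, ∀ y h, HasDerivAt (fun h => g j s (y, h)) (g (j + 1) s (y, h)) h) :
    IsJetFamily Ω g := by
  refine ⟨fun j => ?_, hd⟩
  induction j with
  | zero => exact h0
  | succ j ih =>
    have hpow : ∀ n : ℕ, (2⁻¹ : ℝ) ^ n ∈ Icc (0 : ℝ) 1 := fun n =>
      ⟨by positivity, pow_le_one₀ (by norm_num) (by norm_num)⟩
    set sh : (Y × ℝ) × ℝ → Y × ℝ := fun p => (p.1.1, p.1.2 + p.2) with hsh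
    have hshc : Continuous sh := by fun_prop
    refine IsHolFamily.of_tendsto (F := fun n s (q : Y × ℝ) =>
      (2 : ℂ) ^ n * (g j s (q.1, q.2 + 2⁻¹ ^ n) + (-1) * g j s q)) (fun n => ?_) hΩ ?_ ?_
    · refine (IsHolFamily.of_continuous continuous_const).mul ((ih.comp (by fun_prop)).add
        ((IsHolFamily.of_continuous continuous_const).mul ih))
    · intro s hs L hL
      -- Difference quotients with step `2⁻ⁿ` are exponentially bounded in `n`.
      obtain ⟨R, hR, C, hC⟩ := ih.exists_bound hΩ hs ((hL.prod (isCompact_Icc (a := (0 : ℝ))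
        (b := 1))).image hshc)
      refine ⟨R, hR, 1 + 2 * |C|, fun n z hz q hq => ?_⟩
      have h1 : ∀ t ∈ Icc (0 : ℝ) 1, ‖g j z (q.1, q.2 + t)‖ ≤ |C| := fun t ht =>
        (hC z hz _ ⟨(q, t), ⟨hq, ht⟩, rfl⟩).trans (le_abs_self C)
      have h2 := h1 0 ⟨le_rfl, zero_le_one⟩
      rw [add_zero] at h2
      have h3 := h1 _ (hpow n)
      have hn : (0 : ℝ) ≤ n := Nat.cast_nonneg n
      calc ‖(2 : ℂ) ^ n * (g j z (q.1, q.2 + 2⁻¹ ^ n) + (-1) * g j z q)‖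
          ≤ 2 ^ n * (|C| + |C|) := by
            rw [norm_mul, norm_pow, Complex.norm_ofNat]
            gcongr
            refine (norm_add_le _ _).trans (add_le_add h3 ?_)
            simpa using h2
        _ ≤ exp n * exp (2 * |C|) := by
            have e1 : (2 : ℝ) ^ n ≤ exp n := by
              rw [← mul_one (n : ℝ), exp_nat_mul]
              gcongr
              linarith [add_one_le_exp (1 : ℝ)]
            have e2 : |C| + |C| ≤ exp (2 * |C|) := by linarith [add_one_le_exp (2 * |C|)]
            gcongr
        _ = exp (n + 2 * |C|) := (exp_add _ _).symm
        _ ≤ exp ((1 + 2 * |C|) * (n + 1)) := by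
            refine exp_le_exp.2 ?_
            nlinarith [mul_nonneg (abs_nonneg C) hn]
    · intro s hs L hL
      -- For fixed `s` they converge at rate `2⁻ⁿ`, by Taylor's formula.
      obtain ⟨C, hC⟩ := (((hL.prod (isCompact_Icc (a := (0 : ℝ)) (b := 1))).image hshc).image
        (hc (j + 2) s hs).norm).bddAbove
      have hC' : ∀ q ∈ L, ∀ t ∈ Icc (0 : ℝ) 1, ‖g (j + 2) s (q.1, q.2 + t)‖ ≤ C := fun q hq t ht =>
        hC ⟨_, ⟨(q, t), ⟨hq, ht⟩, rfl⟩, rfl⟩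
      refine ⟨C, fun n q hq => ?_⟩
      set τ : ℝ := 2⁻¹ ^ n with hτ
      have hτ' := hpow n
      have hd1 : ∀ t ∈ Icc (0 : ℝ) 1, HasDerivAt (fun t => g (j + 1) s (q.1, q.2 + t))
          (g (j + 2) s (q.1, q.2 + t)) t := fun t _ =>
        (hd (j + 1) s hs q.1 (q.2 + t)).comp_const_add q.2 t
      have hl : ∀ t ∈ Icc (0 : ℝ) 1,
          ‖g (j + 1) s (q.1, q.2 + t) - g (j + 1) s (q.1, q.2 + 0)‖ ≤ C * t := fun t ht => by
        have := (convex_Icc (0 : ℝ) t).norm_image_sub_le_of_norm_hasDerivWithin_le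
          (f := fun t => g (j + 1) s (q.1, q.2 + t)) (x := 0) (y := t) (C := C)
          (fun t' ht' => (hd1 t' ⟨ht'.1, ht'.2.trans ht.2⟩).hasDerivWithinAt)
          (fun t' ht' => hC' q hq t' ⟨ht'.1, ht'.2.trans ht.2⟩) ⟨le_rfl, ht.1⟩ ⟨ht.1, le_rfl⟩
        simpa [abs_of_nonneg ht.1] using this
      have h2 := (convex_Icc (0 : ℝ) τ).norm_image_sub_le_of_norm_hasDerivWithin_le
        (f := fun t => g j s (q.1, q.2 + t) - (t : ℂ) * g (j + 1) s (q.1, q.2 + 0)) (x := 0) (y := τ)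
        (C := C * τ)
        (f' := fun t => g (j + 1) s (q.1, q.2 + t) - g (j + 1) s (q.1, q.2 + 0))
        (fun t ht => by
          have e1 := (hd j s hs q.1 (q.2 + t)).comp_const_add q.2 t
          have e2 := (Complex.ofRealCLM.hasDerivAt (x := t)).mul_const
            (g (j + 1) s (q.1, q.2 + 0))
          refine (HasDerivAt.sub e1 e2).hasDerivWithinAt.congr_deriv ?_
          simp)
        (fun t ht => (hl t ⟨ht.1, ht.2.trans hτ'.2⟩).trans (by
          have hC0 : 0 ≤ C := (norm_nonneg _).trans (hC' q hq 0 ⟨le_rfl, zero_le_one⟩)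
          exact mul_le_mul_of_nonneg_left ht.2 hC0)) ⟨le_rfl, hτ'.1⟩ ⟨hτ'.1, le_rfl⟩
      have hτ2 : (2 : ℝ) ^ n * τ = 1 := by rw [hτ, inv_pow]; field_simp
      have hτ2' : (2 : ℂ) ^ n * (τ : ℂ) = 1 := by exact_mod_cast hτ2
      have hτ0 : 0 ≤ τ := hτ'.1
      calc ‖(2 : ℂ) ^ n * (g j s (q.1, q.2 + τ) + (-1) * g j s q) - g (j + 1) s q‖
          = ‖(2 : ℂ) ^ n * (g j s (q.1, q.2 + τ) - (τ : ℂ) * g (j + 1) s (q.1, q.2 + 0) -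
              (g j s (q.1, q.2 + 0) - ((0 : ℝ) : ℂ) * g (j + 1) s (q.1, q.2 + 0)))‖ := by
            congr 1
            rw [add_zero, Complex.ofReal_zero, zero_mul, sub_zero]
            linear_combination (g (j + 1) s q) * hτ2'
        _ ≤ 2 ^ n * (C * τ * ‖τ - 0‖) := by
            rw [norm_mul, norm_pow, Complex.norm_ofNat]
            gcongr
        _ = C * τ := by
            rw [sub_zero, Real.norm_of_nonneg hτ0]
            linear_combination (C * τ) * hτ2

end HartogsFamily

/-! ### Test functions supported in one parametrization -/

section FunctionSpaces

variable {𝔼 : Type*} [NormedAddCommGroup 𝔼] [NormedSpace ℝ 𝔼] {X : Type*} {A : Set (Plot 𝔼 X)}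
variable {𝔹 : Type*} [NormedAddCommGroup 𝔹] [NormedSpace ℝ 𝔹] {Y : Type*} {B : Set (Plot 𝔹 Y)}

theorem CInf.ext {f g : CInf A} (h : ∀ x, f x = g x) : f = g := Subtype.ext (funext h)

theorem CInf.smul_apply (a : ℂ) (f : CInf A) (x : X) : (a • f) x = a * f x := rfl

theorem CInf.add_apply (f g : CInf A) (x : X) : (f + g) x = f x + g x := rfl

theorem CInf.continuous_jet (p : A) (k : ℕ) : Continuous (jet A p k) :=
  continuous_iInf_dom (i := ((p, k) : A × ℕ)) continuous_induced_dom

theorem CInf.lt_mem_nhds_zero {p : Plot 𝔼 X} (hp : p ∈ A) {L : Set 𝔼} (hL : IsCompact L)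
    (hsub : L ⊆ p.dom) {ε : ℝ} (hε : 0 < ε) :
    {f : CInf A | ∀ u ∈ L, ‖f (p.map u)‖ < ε} ∈ 𝓝 0 := by
  have hL' : IsCompact ((↑) ⁻¹' L : Set p.dom) := by
    rw [Subtype.isCompact_iff, Subtype.image_preimage_coe, inter_eq_right.2 hsub]
    exact hL
  have h1 : {g : C(p.dom, ContinuousMultilinearMap ℝ (fun _ : Fin 0 => 𝔼) ℂ) |
      MapsTo g ((↑) ⁻¹' L) (Metric.ball 0 ε)} ∈ 𝓝 (jet A ⟨p, hp⟩ 0 0) := by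
    refine (ContinuousMap.isOpen_setOfPred_mapsTo hL' Metric.isOpen_ball).mem_nhds fun u _ => ?_
    rw [map_zero]
    simpa using hε
  filter_upwards [(CInf.continuous_jet ⟨p, hp⟩ 0).continuousAt.preimage_mem_nhds h1] with f hf u hu
  have := hf (x := ⟨u, hsub hu⟩) hu
  rw [mem_ball_zero_iff] at this
  have h2 : ‖iteratedFDeriv ℝ 0 (f ∘ p.map) u‖ < ε := this
  rwa [norm_iteratedFDeriv_zero] at h2

/-- A family of smooth functions is bounded if its derivatives are locally uniformly bounded. -/
theorem CInf.isVonNBounded_of_jets {S : Set (CInf A)}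
    (h : ∀ p ∈ A, ∀ k : ℕ, ∀ K : Set 𝔼, IsCompact K → K ⊆ p.dom → ∃ C : ℝ, ∀ f ∈ S, ∀ u ∈ K,
      ‖iteratedFDeriv ℝ k (f ∘ p.map) u‖ ≤ C) : Bornology.IsVonNBounded ℂ S := by
  have hlim : Tendsto (fun n : ℕ => (((n : ℝ) + 1)⁻¹ : ℝ)) atTop (𝓝 0) := by
    simpa using tendsto_one_div_add_atTop_nhds_zero_nat (𝕜 := ℝ)
  refine Bornology.isVonNBounded_of_smul_tendsto_zero (ι := ℕ) (l := atTop)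
    (𝕜 := ℂ) (ε := fun n => ((((n : ℝ) + 1)⁻¹ : ℝ) : ℂ))
    (Eventually.of_forall fun n => by exact_mod_cast (by positivity : ((n : ℝ) + 1)⁻¹ ≠ 0))
    fun x hx => ?_
  rw [nhds_iInf, tendsto_iInf]
  rintro ⟨⟨p, hp⟩, k⟩
  rw [nhds_induced, tendsto_comap_iff, map_zero,
    ContinuousMap.tendsto_iff_forall_isCompact_tendstoUniformlyOn]
  intro K hK
  obtain ⟨C, hC⟩ := h p hp k _ (hK.image continuous_subtype_val)
    (by rintro _ ⟨u, -, rfl⟩; exact u.2)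
  rw [Metric.tendstoUniformlyOn_iff]
  intro ε hε
  have h2 : ∀ᶠ n : ℕ in atTop, (((n : ℝ) + 1)⁻¹ : ℝ) * |C| < ε := by
    have := hlim.mul_const |C|
    rw [zero_mul] at this
    exact this.eventually_lt_const hε
  filter_upwards [h2] with n hn u hu
  have e : (jet A ⟨p, hp⟩ k (((((n : ℝ) + 1)⁻¹ : ℝ) : ℂ) • x n)) u =
      ((((n : ℝ) + 1)⁻¹ : ℝ) : ℂ) • iteratedFDeriv ℝ k ((x n) ∘ p.map) u.1 := by
    rw [map_smul]; rfl
  rw [dist_comm]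
  change dist ((jet A ⟨p, hp⟩ k (((((n : ℝ) + 1)⁻¹ : ℝ) : ℂ) • x n)) u) 0 < ε
  rw [dist_zero_right, e, norm_smul, Complex.norm_real, Real.norm_of_nonneg (by positivity)]
  refine lt_of_le_of_lt ?_ hn
  gcongr
  exact (hC _ (hx n) u.1 ⟨u, hu, rfl⟩).trans (le_abs_self C)

/-- Operators that depend continuously on a parameter, in the topology of bounded convergence, are
locally uniformly bounded on bounded sets. -/
theorem exists_bound_of_continuousAt {Z : Type*} [TopologicalSpace Z] {T : Z → CInf A →L[ℂ] CInf B}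
    {z₀ : Z} (hT : ContinuousAt T z₀) {S : Set (CInf A)} (hS : Bornology.IsVonNBounded ℂ S)
    {q : Plot 𝔹 Y} (hq : q ∈ B) {L : Set 𝔹} (hL : IsCompact L) (hsub : L ⊆ q.dom) :
    ∃ C : ℝ, ∀ᶠ z in 𝓝 z₀, ∀ f ∈ S, ∀ v ∈ L, ‖T z f (q.map v)‖ ≤ C := by
  have hV := CInf.lt_mem_nhds_zero hq hL hsub one_pos
  have h1 : ∃ C : ℝ, ∀ f ∈ S, ∀ v ∈ L, ‖T z₀ f (q.map v)‖ ≤ C := by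
    have h := (hS.image (T z₀)) hV
    obtain ⟨r, hr, h⟩ := h.exists_pos
    refine ⟨r, fun f hf v hv => ?_⟩
    have h' := h (r : ℂ) (by rw [Complex.norm_real]; exact le_abs_self r)
    obtain ⟨g, hg, hgf⟩ := h' ⟨f, hf, rfl⟩
    have : T z₀ f (q.map v) = r * g (q.map v) := by rw [← hgf]; rfl
    rw [this, norm_mul, Complex.norm_real, Real.norm_of_nonneg hr.le]
    have := (hg v hv).le
    nlinarith
  obtain ⟨C, hC⟩ := h1
  refine ⟨C + 1, ?_⟩
  have h2 : {R : CInf A →L[ℂ] CInf B | ∀ f ∈ S, R f ∈ {f : CInf B | ∀ u ∈ L, ‖f (q.map u)‖ < 1}} ∈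
      𝓝 (0 : CInf A →L[ℂ] CInf B) :=
    ContinuousLinearMap.hasBasis_nhds_zero.mem_of_mem (i := (S, _)) ⟨hS, hV⟩
  have h3 : Tendsto (fun z => T z - T z₀) (𝓝 z₀) (𝓝 0) := by
    have := hT.tendsto.sub_const (T z₀)
    rwa [sub_self] at this
  filter_upwards [h3 h2] with z hz f hf v hv
  have e : T z f (q.map v) = (T z - T z₀) f (q.map v) + T z₀ f (q.map v) := by
    change _ = (T z f (q.map v) - T z₀ f (q.map v)) + _
    ring
  rw [e]
  refine (norm_add_le _ _).trans ?_
  have := (hz f hf v hv).le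
  have := hC f hf v hv
  linarith

/-- Evaluation at a test function, locally uniformly on the target. -/
theorem tendstoUniformlyOn_eval {Z : Type*} {l : Filter Z} {T : Z → CInf A →L[ℂ] CInf B}
    {T₀ : CInf A →L[ℂ] CInf B} (hT : Tendsto T l (𝓝 T₀)) (f : CInf A)
    {q : Plot 𝔹 Y} (hq : q ∈ B) {L : Set 𝔹} (hL : IsCompact L) (hsub : L ⊆ q.dom) :
    TendstoUniformlyOn (fun z v => T z f (q.map v)) (fun v => T₀ f (q.map v)) l L := by
  rw [Metric.tendstoUniformlyOn_iff]
  intro ε hε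
  have hV := CInf.lt_mem_nhds_zero hq hL hsub hε
  have h2 : {R : CInf A →L[ℂ] CInf B | ∀ f' ∈ ({f} : Set (CInf A)),
      R f' ∈ {f : CInf B | ∀ u ∈ L, ‖f (q.map u)‖ < ε}} ∈ 𝓝 (0 : CInf A →L[ℂ] CInf B) :=
    ContinuousLinearMap.hasBasis_nhds_zero.mem_of_mem (i := ({f}, _))
      ⟨Bornology.isVonNBounded_singleton f, hV⟩
  have h3 : Tendsto (fun z => T z - T₀) l (𝓝 0) := by
    have := hT.sub_const T₀
    rwa [sub_self] at this
  filter_upwards [h3 h2] with z hz v hv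
  rw [dist_comm, dist_eq_norm]
  exact hz f rfl v hv

/-- The parametrization `p` is an open embedding for the smooth structure `A`: it is injective, its
inverse is smooth in all parametrizations in `A`, and compact subsets of its domain have closed
images. -/
structure IsGoodPlot (A : Set (Plot 𝔼 X)) (p : Plot 𝔼 X) : Prop where
  injOn : InjOn p.map p.dom
  transition : ∀ q ∈ A, ∀ v ∈ q.dom, q.map v ∈ p.map '' p.dom →
    ∃ θ : 𝔼 → 𝔼, ContDiffAt ℝ ∞ θ v ∧ ∀ᶠ w in 𝓝 v, θ w ∈ p.dom ∧ p.map (θ w) = q.map w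
  closed : ∀ q ∈ A, ∀ K : Set 𝔼, IsCompact K → K ⊆ p.dom → ∀ v ∈ q.dom,
    v ∈ closure {w | w ∈ q.dom ∧ q.map w ∈ p.map '' K} → q.map v ∈ p.map '' K

/-- Smooth functions with compact support in the domain of the parametrization `p`. -/
structure IsTest (p : Plot 𝔼 X) (F : 𝔼 → ℂ) : Prop where
  contDiff : ContDiff ℝ ∞ F
  compact : HasCompactSupport F
  subset : tsupport F ⊆ p.dom

namespace IsTest

variable {p : Plot 𝔼 X} {F G : 𝔼 → ℂ}

theorem smooth_mul {η : 𝔼 → ℂ} (hF : IsTest p F) (hη : ContDiff ℝ ∞ η) :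
    IsTest p fun v => η v * F v :=
  ⟨hη.mul hF.contDiff, hF.compact.mul_left, (tsupport_mul_subset_right).trans hF.subset⟩

theorem add (hF : IsTest p F) (hG : IsTest p G) : IsTest p fun v => F v + G v :=
  ⟨hF.contDiff.add hG.contDiff, hF.compact.add hG.compact,
    (tsupport_add F G).trans (union_subset hF.subset hG.subset)⟩

theorem neg (hF : IsTest p F) : IsTest p fun v => -F v := by
  simpa using hF.smooth_mul (η := fun _ => -1) contDiff_const

end IsTest

open Classical in
/-- The function on `X` that is `F` in the parametrization `p` and vanishes off its image. -/
def pushFun (p : Plot 𝔼 X) (F : 𝔼 → ℂ) (x : X) : ℂ :=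
  if x ∈ p.map '' p.dom then F (Function.invFunOn p.map p.dom x) else 0

namespace IsGoodPlot

variable {p : Plot 𝔼 X} {F : 𝔼 → ℂ}

theorem pushFun_map (hp : IsGoodPlot A p) (F : 𝔼 → ℂ) {v : 𝔼} (hv : v ∈ p.dom) :
    pushFun p F (p.map v) = F v := by
  rw [pushFun, if_pos ⟨v, hv, rfl⟩, hp.injOn.leftInvOn_invFunOn hv]

omit [NormedSpace ℝ 𝔼] in
theorem mem_of_pushFun_ne_zero {x : X} (h : pushFun p F x ≠ 0) :
    x ∈ p.map '' (Function.support F ∩ p.dom) := by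
  by_cases hx : x ∈ p.map '' p.dom
  · rw [pushFun, if_pos hx] at h
    exact ⟨_, ⟨h, Function.invFunOn_mem hx⟩, Function.invFunOn_eq hx⟩
  · rw [pushFun, if_neg hx] at h
    exact absurd rfl h

/-- The transition map from the parametrization `q` to `p`. -/
def trans (p q : Plot 𝔼 X) (v : 𝔼) : 𝔼 := Function.invFunOn p.map p.dom (q.map v)

theorem trans_spec (hp : IsGoodPlot A p) {q : Plot 𝔼 X} (hq : q ∈ A) {v : 𝔼} (hv : v ∈ q.dom)
    (h : q.map v ∈ p.map '' p.dom) : ContDiffAt ℝ ∞ (trans p q) v ∧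
      ∀ᶠ w in 𝓝 v, trans p q w ∈ p.dom ∧ p.map (trans p q w) = q.map w := by
  obtain ⟨θ, hθ, hev⟩ := hp.transition q hq v hv h
  have h1 : trans p q =ᶠ[𝓝 v] θ := by
    filter_upwards [hev] with w hw
    rw [trans, ← hw.2, hp.injOn.leftInvOn_invFunOn hw.1]
  refine ⟨hθ.congr_of_eventuallyEq h1, ?_⟩
  filter_upwards [hev, h1] with w hw h2
  rwa [h2]

theorem pushFun_comp_eventuallyEq (hp : IsGoodPlot A p) (F : 𝔼 → ℂ) {q : Plot 𝔼 X} (hq : q ∈ A)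
    {v : 𝔼} (hv : v ∈ q.dom) (h : q.map v ∈ p.map '' p.dom) :
    pushFun p F ∘ q.map =ᶠ[𝓝 v] F ∘ trans p q := by
  filter_upwards [(hp.trans_spec hq hv h).2] with w hw
  rw [Function.comp_apply, ← hw.2, hp.pushFun_map F hw.1, Function.comp_apply]

theorem pushFun_comp_eventuallyEq_zero (hp : IsGoodPlot A p) {K : Set 𝔼} (hK : IsCompact K)
    (hKp : K ⊆ p.dom) (hF : Function.support F ⊆ K) {q : Plot 𝔼 X} (hq : q ∈ A)
    {v : 𝔼} (hv : v ∈ q.dom) (h : q.map v ∉ p.map '' K) :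
    pushFun p F ∘ q.map =ᶠ[𝓝 v] fun _ => 0 := by
  have h1 : (closure {w | w ∈ q.dom ∧ q.map w ∈ p.map '' K})ᶜ ∈ 𝓝 v :=
    isClosed_closure.isOpen_compl.mem_nhds fun hc => h (hp.closed q hq K hK hKp v hv hc)
  filter_upwards [h1, q.isOpen_dom.mem_nhds hv] with w hw hwq
  by_contra hne
  obtain ⟨v', hv', e⟩ := mem_of_pushFun_ne_zero hne
  exact hw (subset_closure ⟨hwq, v', hF hv'.1, e⟩)

theorem pushFun_mem (hp : IsGoodPlot A p) (hF : IsTest p F) : pushFun p F ∈ smoothSubmodule A := by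
  intro q hq v hv
  by_cases h : q.map v ∈ p.map '' tsupport F
  · have h' : q.map v ∈ p.map '' p.dom := image_mono hF.subset h
    have := (hF.contDiff.contDiffAt.comp v (hp.trans_spec hq hv h').1).congr_of_eventuallyEq
      (hp.pushFun_comp_eventuallyEq F hq hv h')
    exact this.contDiffWithinAt
  · have := (contDiffAt_const (𝕜 := ℝ) (E := 𝔼) (c := (0 : ℂ)) (n := ∞) (x := v)).congr_of_eventuallyEq
      (hp.pushFun_comp_eventuallyEq_zero hF.compact hF.subset (subset_tsupport F) hq hv h)
    exact this.contDiffWithinAt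

/-- The smooth function on `X` that is `F` in the parametrization `p` and vanishes off its
image. -/
def push (hp : IsGoodPlot A p) (hF : IsTest p F) : CInf A := ⟨pushFun p F, hp.pushFun_mem hF⟩

theorem push_map (hp : IsGoodPlot A p) (hF : IsTest p F) {v : 𝔼} (hv : v ∈ p.dom) :
    hp.push hF (p.map v) = F v := hp.pushFun_map F hv

theorem push_of_notMem (hp : IsGoodPlot A p) (hF : IsTest p F) {x : X} (hx : x ∉ p.map '' p.dom) :
    hp.push hF x = 0 := if_neg hx

theorem push_add (hp : IsGoodPlot A p) {G : 𝔼 → ℂ} (hF : IsTest p F) (hG : IsTest p G)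
    (hFG : IsTest p fun v => F v + G v) : hp.push hFG = hp.push hF + hp.push hG := by
  refine CInf.ext fun x => ?_
  rw [CInf.add_apply]
  by_cases hx : x ∈ p.map '' p.dom
  · obtain ⟨v, hv, rfl⟩ := hx
    rw [push_map _ _ hv, push_map _ _ hv, push_map _ _ hv]
  · rw [push_of_notMem _ _ hx, push_of_notMem _ _ hx, push_of_notMem _ _ hx, add_zero]

theorem push_const_mul (hp : IsGoodPlot A p) (hF : IsTest p F) (a : ℂ)
    (haF : IsTest p fun v => a * F v) : hp.push haF = a • hp.push hF := by
  refine CInf.ext fun x => ?_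
  rw [CInf.smul_apply]
  by_cases hx : x ∈ p.map '' p.dom
  · obtain ⟨v, hv, rfl⟩ := hx
    rw [push_map _ _ hv, push_map _ _ hv]
  · rw [push_of_notMem _ _ hx, push_of_notMem _ _ hx, mul_zero]

theorem push_support (hp : IsGoodPlot A p) (hF : IsTest p F) :
    ∃ K : Set 𝔼, IsCompact K ∧ K ⊆ p.dom ∧ ∀ x, hp.push hF x ≠ 0 → x ∈ p.map '' K :=
  ⟨_, hF.compact, hF.subset, fun _ hx =>
    image_mono (inter_subset_left.trans (subset_tsupport F)) (mem_of_pushFun_ne_zero hx)⟩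

/-- The `k`-th derivatives of a test function in another parametrization are controlled by those of
order up to `k`, uniformly for supports in a fixed compact set. -/
theorem exists_jet_bound (hp : IsGoodPlot A p) {K : Set 𝔼} (hK : IsCompact K) (hKp : K ⊆ p.dom)
    {q : Plot 𝔼 X} (hq : q ∈ A) (k : ℕ) {L : Set 𝔼} (hL : IsCompact L) (hLq : L ⊆ q.dom) :
    ∃ C : ℝ, 0 ≤ C ∧ ∀ (F : 𝔼 → ℂ) (hF : IsTest p F), tsupport F ⊆ K → ∀ a : ℝ, 0 ≤ a →
      (∀ i ≤ k, ∀ v, ‖iteratedFDeriv ℝ i F v‖ ≤ a) →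
      ∀ v ∈ L, ‖iteratedFDeriv ℝ k (hp.push hF ∘ q.map) v‖ ≤ C * a := by
  set Z : Set 𝔼 := {w | w ∈ L ∧ q.map w ∈ p.map '' K} with hZ
  have hZc : IsCompact Z := by
    refine hL.of_isClosed_subset (isClosed_of_closure_subset fun v hv => ?_) fun w hw => hw.1
    have hvL : v ∈ L := hL.isClosed.closure_subset_iff.2 (fun w hw => hw.1) hv
    exact ⟨hvL, hp.closed q hq K hK hKp v (hLq hvL)
      (closure_mono (s := Z) (t := {w | w ∈ q.dom ∧ q.map w ∈ p.map '' K})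
        (fun w hw => ⟨hLq hw.1, hw.2⟩) hv)⟩
  set O : Set 𝔼 := {w | w ∈ q.dom ∧ q.map w ∈ p.map '' p.dom} with hO
  have hOo : IsOpen O := by
    rw [isOpen_iff_mem_nhds]
    intro v hv
    filter_upwards [q.isOpen_dom.mem_nhds hv.1, (hp.trans_spec hq hv.1 hv.2).2] with w hw hw'
    exact ⟨hw, _, hw'⟩
  have hZO : Z ⊆ O := fun w hw => ⟨hLq hw.1, image_mono hKp hw.2⟩
  have hsm : ContDiffOn ℝ ∞ (trans p q) O := fun v hv =>
    (hp.trans_spec hq hv.1 hv.2).1.contDiffWithinAt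
  have hD : ∀ i : ℕ, ∃ D : ℝ, ∀ v ∈ Z, ‖iteratedFDerivWithin ℝ i (trans p q) O v‖ ≤ D := fun i => by
    obtain ⟨D, hD⟩ := (hZc.exists_bound_of_continuousOn
      ((hsm.continuousOn_iteratedFDerivWithin (m := i) (by exact_mod_cast le_top)
        hOo.uniqueDiffOn).mono hZO))
    exact ⟨D, hD⟩
  choose D hD using hD
  set D' : ℝ := 1 + ∑ i ∈ Finset.range (k + 1), |D i| with hD'
  have hD'1 : 1 ≤ D' := by
    have : 0 ≤ ∑ i ∈ Finset.range (k + 1), |D i| := Finset.sum_nonneg fun _ _ => abs_nonneg _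
    linarith
  refine ⟨k.factorial * D' ^ k, by positivity, fun F hF hFK a ha hFa v hv => ?_⟩
  by_cases hvZ : v ∈ Z
  · have hvO := hZO hvZ
    have e : iteratedFDeriv ℝ k (hp.push hF ∘ q.map) v =
        iteratedFDerivWithin ℝ k (F ∘ trans p q) O v := by
      rw [iteratedFDerivWithin_of_isOpen k hOo hvO]
      exact ((hp.pushFun_comp_eventuallyEq F hq hvO.1 hvO.2).iteratedFDeriv (𝕜 := ℝ) k).self_of_nhds
    rw [e]
    have := norm_iteratedFDerivWithin_comp_le (g := F) (f := trans p q) (n := k) (N := ∞) (s := O)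
      (t := univ) hF.contDiff.contDiffOn hsm (by exact_mod_cast le_top) uniqueDiffOn_univ
      hOo.uniqueDiffOn (mapsTo_univ _ _) hvO (C := a) (D := D')
      (fun i hi => by rw [iteratedFDerivWithin_univ]; exact hFa i hi _)
      (fun i hi1 hi => by
        have h1 : |D i| ≤ ∑ i ∈ Finset.range (k + 1), |D i| :=
          Finset.single_le_sum (f := fun i => |D i|) (fun _ _ => abs_nonneg _)
            (Finset.mem_range.2 (by omega))
        calc _ ≤ |D i| := (hD i v hvZ).trans (le_abs_self _)
          _ ≤ D' := by linarith
          _ ≤ D' ^ i := le_self_pow₀ hD'1 (by omega))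
    calc _ ≤ _ := this
      _ = _ := by ring
  · have h0 := (hp.pushFun_comp_eventuallyEq_zero hK hKp ((subset_tsupport F).trans hFK) hq (hLq hv)
      fun h => hvZ ⟨hv, h⟩).iteratedFDeriv (𝕜 := ℝ) k
    have h0' : iteratedFDeriv ℝ k (hp.push hF ∘ q.map) v = 0 :=
      h0.self_of_nhds.trans (by rw [iteratedFDeriv_fun_zero]; rfl)
    rw [h0', norm_zero]
    positivity

/-- Test functions with supports in a fixed compact set whose derivatives are bounded form a bounded
set. -/
theorem isVonNBounded_push (hp : IsGoodPlot A p) {K : Set 𝔼} (hK : IsCompact K) (hKp : K ⊆ p.dom)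
    {ι : Type*} {F : ι → 𝔼 → ℂ} (hF : ∀ j, IsTest p (F j)) (hFK : ∀ j, tsupport (F j) ⊆ K)
    (hb : ∀ i : ℕ, ∃ a : ℝ, ∀ j v, ‖iteratedFDeriv ℝ i (F j) v‖ ≤ a) :
    Bornology.IsVonNBounded ℂ (range fun j => hp.push (hF j)) := by
  choose a ha using hb
  refine CInf.isVonNBounded_of_jets fun q hq k L hL hLq => ?_
  obtain ⟨C, hC0, hC⟩ := hp.exists_jet_bound hK hKp hq k hL hLq
  refine ⟨C * ∑ i ∈ Finset.range (k + 1), |a i|, ?_⟩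
  rintro _ ⟨j, rfl⟩ v hv
  refine hC (F j) (hF j) (hFK j) _ (Finset.sum_nonneg fun _ _ => abs_nonneg _)
    (fun i hi v => ?_) v hv
  exact ((ha i j v).trans (le_abs_self _)).trans (Finset.single_le_sum (f := fun i => |a i|)
    (fun _ _ => abs_nonneg _) (Finset.mem_range.2 (by omega)))

end IsGoodPlot

end FunctionSpaces

/-! ### Vector fields and geodesics in charts -/

section Charts

variable {d : ℕ} {M : Type*} [TopologicalSpace M] [ChartedSpace (Eu d) M]
  [IsManifold 𝓘(ℝ, Eu d) ∞ M]

/-- The coordinates in the chart `φ` of the tangent vector `v` at `x`. -/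
def coordVec (φ : OpenPartialHomeomorph M (Eu d)) (x : M) :
    TangentSpace 𝓘(ℝ, Eu d) x →L[ℝ] Eu d :=
  mfderiv 𝓘(ℝ, Eu d) 𝓘(ℝ, Eu d) φ x

/-- The vector field with constant coordinates `w` in the chart `φ`. -/
def chartField (φ : OpenPartialHomeomorph M (Eu d)) (w : Eu d) (x : M) :
    TangentSpace 𝓘(ℝ, Eu d) x :=
  (mfderiv 𝓘(ℝ, Eu d) 𝓘(ℝ, Eu d) φ.symm (φ x) w : Eu d)

variable {φ : OpenPartialHomeomorph M (Eu d)}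

theorem charts.mdifferentiable (hφ : φ ∈ charts d M) :
    φ.MDifferentiable 𝓘(ℝ, Eu d) 𝓘(ℝ, Eu d) :=
  ⟨(contMDiffOn_of_mem_maximalAtlas hφ).mdifferentiableOn (by simp),
    (contMDiffOn_symm_of_mem_maximalAtlas hφ).mdifferentiableOn (by simp)⟩

theorem coordVec_chartField (hφ : φ ∈ charts d M) {x : M} (hx : x ∈ φ.source) (w : Eu d) :
    coordVec φ x (chartField φ w x) = w := by
  have h := (charts.mdifferentiable hφ).comp_symm_deriv (φ.map_source hx)
  rw [φ.left_inv hx] at h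
  exact DFunLike.congr_fun h w

theorem chartField_coordVec (hφ : φ ∈ charts d M) {x : M} (hx : x ∈ φ.source)
    (v : TangentSpace 𝓘(ℝ, Eu d) x) : chartField φ (coordVec φ x v) x = v :=
  DFunLike.congr_fun ((charts.mdifferentiable hφ).symm_comp_deriv hx) v

theorem coordVec_injective (hφ : φ ∈ charts d M) {x : M} (hx : x ∈ φ.source) :
    Function.Injective (coordVec φ x) :=
  Function.LeftInverse.injective (chartField_coordVec hφ hx)

theorem chartField_smul (a : ℝ) (w : Eu d) (x : M) :
    chartField φ (a • w) x = a • chartField φ w x :=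
  map_smul (mfderiv 𝓘(ℝ, Eu d) 𝓘(ℝ, Eu d) φ.symm (φ x)) a w

/-- A vector field on `U` with smooth coordinates. -/
theorem smoothFieldOn_chartField (hφ : φ ∈ charts d M) {V : Eu d → Eu d}
    (hV : ContDiffOn ℝ ∞ V φ.target) :
    SmoothFieldOn (fun x => chartField φ (V (φ x)) x) φ.source := by
  have h1 := (contMDiffOn_symm_of_mem_maximalAtlas hφ).contMDiffOn_tangentMapWithin (m := ∞)
    (by simp) φ.open_target.uniqueMDiffOn
  have h2 : ContMDiffOn 𝓘(ℝ, Eu d) 𝓘(ℝ, Eu d).tangent ∞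
      (fun u => (⟨u, V u⟩ : TangentBundle 𝓘(ℝ, Eu d) (Eu d))) φ.target :=
    contMDiffOn_vectorSpace_iff_contDiffOn.2 hV
  have h3 := (h1.comp h2 (fun u hu => hu)).comp (contMDiffOn_of_mem_maximalAtlas hφ) φ.mapsTo
  refine h3.congr fun x hx => ?_
  have e : φ.symm (φ x) = x := φ.left_inv hx
  have : tangentMapWithin 𝓘(ℝ, Eu d) 𝓘(ℝ, Eu d) φ.symm φ.target ⟨φ x, V (φ x)⟩ =
      (⟨φ.symm (φ x), (mfderiv 𝓘(ℝ, Eu d) 𝓘(ℝ, Eu d) φ.symm (φ x) (V (φ x)) : Eu d)⟩ :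
        TangentBundle 𝓘(ℝ, Eu d) M) := by
    rw [tangentMapWithin, mfderivWithin_of_isOpen φ.open_target (φ.map_source hx)]
  refine Eq.trans ?_ this.symm
  exact (congrArg (fun y : M => (⟨y, (mfderiv 𝓘(ℝ, Eu d) 𝓘(ℝ, Eu d) φ.symm (φ x) (V (φ x)) : Eu d)⟩ :
        TangentBundle 𝓘(ℝ, Eu d) M)) e).symm

/-- The coordinates of a smooth vector field are smooth. -/
theorem SmoothFieldOn.contDiffOn_coordVec {X : ∀ x : M, TangentSpace 𝓘(ℝ, Eu d) x} {U : Set M}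
    (hX : SmoothFieldOn X U) (hφ : φ ∈ charts d M) :
    ContDiffOn ℝ ∞ (fun u => coordVec φ (φ.symm u) (X (φ.symm u))) (φ.target ∩ φ.symm ⁻¹' U) := by
  have h1 := (contMDiffOn_of_mem_maximalAtlas hφ).contMDiffOn_tangentMapWithin (m := ∞)
    (by simp) φ.open_source.uniqueMDiffOn
  have h2 := hX.comp ((contMDiffOn_symm_of_mem_maximalAtlas hφ).mono inter_subset_left)
    (s := φ.target ∩ φ.symm ⁻¹' U) (fun u hu => hu.2)
  have h3 := (contMDiff_snd_tangentBundle_modelSpace (Eu d) 𝓘(ℝ, Eu d)).comp_contMDiffOn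
    (h1.comp h2 fun u hu => φ.map_target hu.1)
  refine (contMDiffOn_iff_contDiffOn.1 h3).congr fun u hu => ?_
  have e : mfderivWithin 𝓘(ℝ, Eu d) 𝓘(ℝ, Eu d) φ φ.source (φ.symm u) = coordVec φ (φ.symm u) :=
    mfderivWithin_of_isOpen φ.open_source (φ.map_target hu.1)
  exact (DFunLike.congr_fun e (X (φ.symm u))).symm

theorem SmoothFieldOn.bump {X : ∀ x : M, TangentSpace 𝓘(ℝ, Eu d) x} {U : Set M}
    (hX : SmoothFieldOn X U) (hU : IsOpen U) {χ : M → ℝ}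
    (hχ : ContMDiff 𝓘(ℝ, Eu d) 𝓘(ℝ, ℝ) ∞ χ) (hs : tsupport χ ⊆ U) :
    SmoothFieldOn (fun x => χ x • X x) univ :=
  contMDiffOn_univ.2 (ContMDiffOn.smul_section_of_tsupport hχ.contMDiffOn hU hs hX)

theorem exists_smooth_bump [T2Space M] {U : Set M} (hU : IsOpen U) {x₀ : M} (hx : x₀ ∈ U) :
    ∃ χ : M → ℝ, ContMDiff 𝓘(ℝ, Eu d) 𝓘(ℝ, ℝ) ∞ χ ∧ tsupport χ ⊆ U ∧ χ =ᶠ[𝓝 x₀] 1 := by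
  obtain ⟨f, -, hf⟩ := (SmoothBumpFunction.nhds_basis_tsupport (I := 𝓘(ℝ, Eu d)) x₀).mem_iff.1
    (hU.mem_nhds hx)
  exact ⟨f, f.contMDiff, hf, f.eventuallyEq_one⟩

variable (cov : CovariantDerivative 𝓘(ℝ, Eu d) (Eu d) (fun x : M => TangentSpace 𝓘(ℝ, Eu d) x))

theorem SmoothFieldOn.mdifferentiableAt {X : ∀ x : M, TangentSpace 𝓘(ℝ, Eu d) x} {U : Set M}
    (hX : SmoothFieldOn X U) (hU : IsOpen U) {x : M} (hx : x ∈ U) :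
    MDifferentiableAt 𝓘(ℝ, Eu d) 𝓘(ℝ, Eu d).tangent
      (fun x => (⟨x, X x⟩ : TangentBundle 𝓘(ℝ, Eu d) M)) x :=
  ((hX x hx).contMDiffAt (hU.mem_nhds hx)).mdifferentiableAt (by simp)

/-- Covariant derivatives of smooth vector fields on open sets are smooth. -/
theorem smoothFieldOn_cov [T2Space M] (hcov : CovariantDerivative.ContMDiffCovariantDerivative cov ∞)
    {X Y : ∀ x : M, TangentSpace 𝓘(ℝ, Eu d) x} {U : Set M} (hU : IsOpen U)
    (hX : SmoothFieldOn X U) (hY : SmoothFieldOn Y U) :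
    SmoothFieldOn (fun x => cov X x (Y x)) U := by
  intro x₀ hx₀
  obtain ⟨χ, hχ, hs, h1⟩ := exists_smooth_bump (d := d) hU hx₀
  have hX' := hX.bump hU hχ hs
  have h2 := hcov.contMDiff.contMDiff (σ := fun x => χ x • X x) hX'
  have h3 := ContMDiffOn.clm_bundle_apply (h2.mono (subset_univ U)) hY
  refine ((h3 x₀ hx₀).contMDiffAt (hU.mem_nhds hx₀)).congr_of_eventuallyEq ?_
    |>.contMDiffWithinAt
  filter_upwards [h1.eventuallyEq_nhds, hU.mem_nhds hx₀] with x hx hxU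
  have : cov X x = cov (fun x => χ x • X x) x := by
    refine cov.isCovariantDerivativeOnUniv.congr_of_eventuallyEq (hX.mdifferentiableAt hU hxU)
      (hX'.mdifferentiableAt isOpen_univ (mem_univ x)) univ_mem ?_
    filter_upwards [hx] with y hy
    rw [hy, Pi.one_apply, one_smul]
  rw [this]

/-- The geodesic spray of a connection in the chart `φ`: a curve `y` in the chart is a geodesic if
`y'' = -spray (y, y')`. -/
def spray (φ : OpenPartialHomeomorph M (Eu d)) (q : Eu d × Eu d) : Eu d :=
  ∑ b, q.2 b • coordVec φ (φ.symm q.1)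
    (cov (chartField φ (EuclideanSpace.single b 1)) (φ.symm q.1) (chartField φ q.2 (φ.symm q.1)))

theorem sum_smul_single (w : Eu d) : ∑ b, w b • EuclideanSpace.single b (1 : ℝ) = w := by
  ext i
  simp [Finset.sum_apply, Pi.single_apply]

theorem chartField_eq_sum (w : Eu d) (x : M) :
    chartField φ w x = ∑ b, w b • chartField φ (EuclideanSpace.single b (1 : ℝ)) x := by
  conv_lhs => rw [← sum_smul_single w]
  have := map_sum (mfderiv 𝓘(ℝ, Eu d) 𝓘(ℝ, Eu d) φ.symm (φ x))
    (fun b => w b • EuclideanSpace.single b (1 : ℝ)) Finset.univ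
  refine this.trans (Finset.sum_congr rfl fun b _ => ?_)
  exact map_smul (mfderiv 𝓘(ℝ, Eu d) 𝓘(ℝ, Eu d) φ.symm (φ x)) (w b) _

theorem contDiffOn_spray [T2Space M]
    (hcov : CovariantDerivative.ContMDiffCovariantDerivative cov ∞) (hφ : φ ∈ charts d M) :
    ContDiffOn ℝ ∞ (spray cov φ) (φ.target ×ˢ univ) := by
  have h1 : ∀ a b : Fin d, ContDiffOn ℝ ∞ (fun u => coordVec φ (φ.symm u)
      (cov (chartField φ (EuclideanSpace.single b 1)) (φ.symm u)
        (chartField φ (EuclideanSpace.single a 1) (φ.symm u)))) φ.target := fun a b => by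
    have := (smoothFieldOn_cov cov hcov φ.open_source
      (smoothFieldOn_chartField hφ (V := fun _ => EuclideanSpace.single b 1) contDiffOn_const)
      (smoothFieldOn_chartField hφ (V := fun _ => EuclideanSpace.single a 1) contDiffOn_const)
      ).contDiffOn_coordVec hφ
    exact this.mono fun u hu => ⟨hu, φ.map_target hu⟩
  have h2 : ∀ q : Eu d × Eu d, spray cov φ q = ∑ b, q.2 b • ∑ a, q.2 a • coordVec φ (φ.symm q.1)
      (cov (chartField φ (EuclideanSpace.single b 1)) (φ.symm q.1)
        (chartField φ (EuclideanSpace.single a 1) (φ.symm q.1))) := fun q => by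
    rw [spray]
    refine Finset.sum_congr rfl fun b _ => ?_
    rw [chartField_eq_sum q.2, map_sum, map_sum]
    simp only [map_smul]
  have hc : ∀ b : Fin d, ContDiffOn ℝ ∞ (fun q : Eu d × Eu d => q.2 b) (φ.target ×ˢ univ) := fun b => by
    have : ContDiff ℝ ∞ (fun q : Eu d × Eu d => (EuclideanSpace.proj b : Eu d →L[ℝ] ℝ) q.2) := by
      fun_prop
    exact this.contDiffOn
  refine ContDiffOn.congr (ContDiffOn.sum fun b _ => (hc b).smul (ContDiffOn.sum fun a _ =>
    (hc a).smul ?_)) fun q _ => h2 q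
  exact (h1 a b).comp contDiffOn_fst fun q hq => hq.1

/-- Local formula for the covariant derivative. -/
theorem coordVec_cov (hφ : φ ∈ charts d M) {X : ∀ x : M, TangentSpace 𝓘(ℝ, Eu d) x} {U : Set M}
    (hU : IsOpen U) (hX : SmoothFieldOn X U) {x : M} (hx : x ∈ φ.source) (hxU : x ∈ U)
    (v : TangentSpace 𝓘(ℝ, Eu d) x) :
    coordVec φ x (cov X x v) =
      fderiv ℝ (fun u => coordVec φ (φ.symm u) (X (φ.symm u))) (φ x) (coordVec φ x v) +
      ∑ b, (coordVec φ x (X x)) b •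
        coordVec φ x (cov (chartField φ (EuclideanSpace.single b 1)) x v) := by
  set V : Eu d → Eu d := fun u => coordVec φ (φ.symm u) (X (φ.symm u)) with hV
  have hopen : IsOpen (φ.target ∩ φ.symm ⁻¹' U) := φ.isOpen_inter_preimage_symm hU
  have hmem : φ x ∈ φ.target ∩ φ.symm ⁻¹' U :=
    ⟨φ.map_source hx, by rw [mem_preimage, φ.left_inv hx]; exact hxU⟩
  have hVd : DifferentiableAt ℝ V (φ x) :=
    (((hX.contDiffOn_coordVec hφ) _ hmem).contDiffAt (hopen.mem_nhds hmem)).differentiableAt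
      (by simp)
  have hVx : V (φ x) = coordVec φ x (X x) := by
    have := φ.left_inv hx
    simp only [hV]
    rw [this]
  have hφd : HasMFDerivAt 𝓘(ℝ, Eu d) 𝓘(ℝ, Eu d) φ x (coordVec φ x) :=
    ((charts.mdifferentiable hφ).mdifferentiableAt hx).hasMFDerivAt
  have hfd : ∀ b : Fin d, HasMFDerivAt 𝓘(ℝ, Eu d) 𝓘(ℝ, ℝ) (fun y : M => V (φ y) b) x
      (((EuclideanSpace.proj b : Eu d →L[ℝ] ℝ).comp (fderiv ℝ V (φ x))).comp (coordVec φ x)) :=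
    fun b => by
      have h1 : HasFDerivAt (fun u => V u b)
          ((EuclideanSpace.proj b : Eu d →L[ℝ] ℝ).comp (fderiv ℝ V (φ x))) (φ x) :=
        (EuclideanSpace.proj b : Eu d →L[ℝ] ℝ).hasFDerivAt.comp (φ x) hVd.hasFDerivAt
      exact HasMFDerivAt.comp x h1.hasMFDerivAt hφd
  have hE : ∀ b : Fin d, MDifferentiableAt 𝓘(ℝ, Eu d) 𝓘(ℝ, Eu d).tangent
      (fun y => (⟨y, chartField φ (EuclideanSpace.single b (1 : ℝ)) y⟩ :
        TangentBundle 𝓘(ℝ, Eu d) M)) x := fun b =>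
    (smoothFieldOn_chartField hφ (V := fun _ => EuclideanSpace.single b 1)
      contDiffOn_const).mdifferentiableAt φ.open_source hx
  have hterm : ∀ b : Fin d, MDifferentiableAt 𝓘(ℝ, Eu d) 𝓘(ℝ, Eu d).tangent
      (fun y => (⟨y, ((fun y => V (φ y) b) • chartField φ (EuclideanSpace.single b (1 : ℝ))) y⟩ :
        TangentBundle 𝓘(ℝ, Eu d) M)) x := fun b =>
    MDifferentiableAt.smul_section (hfd b).mdifferentiableAt (hE b)
  have hsum : ∀ s : Finset (Fin d),
      MDifferentiableAt 𝓘(ℝ, Eu d) 𝓘(ℝ, Eu d).tangent (fun y => (⟨y, (∑ b ∈ s,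
        (fun y => V (φ y) b) • chartField φ (EuclideanSpace.single b (1 : ℝ))) y⟩ :
          TangentBundle 𝓘(ℝ, Eu d) M)) x ∧
      cov (∑ b ∈ s, (fun y => V (φ y) b) • chartField φ (EuclideanSpace.single b (1 : ℝ))) x =
        ∑ b ∈ s, (V (φ x) b • cov (chartField φ (EuclideanSpace.single b (1 : ℝ))) x +
          (((EuclideanSpace.proj b : Eu d →L[ℝ] ℝ).comp (fderiv ℝ V (φ x))).comp
            (coordVec φ x)).smulRight (chartField φ (EuclideanSpace.single b (1 : ℝ)) x)) := by
    intro s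
    classical
    induction s using Finset.induction_on with
    | empty =>
      refine ⟨?_, ?_⟩
      · simp only [Finset.sum_empty]
        exact Bundle.mdifferentiableAt_zeroSection ..
      · simp only [Finset.sum_empty]
        exact cov.isCovariantDerivativeOnUniv.zero
    | insert b s hb ih =>
      rw [Finset.sum_insert hb, Finset.sum_insert hb]
      refine ⟨mdifferentiableAt_add_section (hterm b) ih.1, ?_⟩
      have := cov.isCovariantDerivativeOnUniv.add (hterm b) ih.1
      rw [this, ih.2]
      congr 1
      have := cov.isCovariantDerivativeOnUniv.leibniz (hE b) (hfd b).mdifferentiableAt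
      rw [this]
      congr 2
      exact (hfd b).mfderiv
  have hev : ∀ᶠ y in 𝓝 x, X y =
      (∑ b, (fun y => V (φ y) b) • chartField φ (EuclideanSpace.single b (1 : ℝ))) y := by
    filter_upwards [φ.open_source.mem_nhds hx] with y hy
    have e : V (φ y) = coordVec φ y (X y) := by
      have := φ.left_inv hy
      simp only [hV]
      rw [this]
    rw [Finset.sum_apply]
    simp only [Pi.smul_apply']
    rw [← chartField_eq_sum (V (φ y)) y, e, chartField_coordVec hφ hy]
  have hcov : cov X x = _ := (cov.isCovariantDerivativeOnUniv.congr_of_eventuallyEq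
    (hX.mdifferentiableAt hU hxU) (hsum Finset.univ).1 univ_mem hev).trans (hsum Finset.univ).2
  rw [hcov, sum_apply, map_sum, ← hVx, add_comm]
  simp only [add_apply, map_add, Finset.sum_add_distrib]
  congr 1
  · refine Finset.sum_congr rfl fun b _ => ?_
    exact map_smul (coordVec φ x) _ _
  · conv_rhs => rw [← sum_smul_single (fderiv ℝ V (φ x) (coordVec φ x v))]
    refine Finset.sum_congr rfl fun b _ => ?_
    refine (map_smul (coordVec φ x) _ _).trans ?_
    rw [coordVec_chartField hφ hx]
    rfl

end Charts

section Geodesics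

variable {d : ℕ} {M : Type*} [TopologicalSpace M] [ChartedSpace (Eu d) M]
  [IsManifold 𝓘(ℝ, Eu d) ∞ M] {φ : OpenPartialHomeomorph M (Eu d)}
  {cov : CovariantDerivative 𝓘(ℝ, Eu d) (Eu d) (fun x : M => TangentSpace 𝓘(ℝ, Eu d) x)}
  {γ : ℝ → M} {J : Set ℝ}

theorem hasDerivAt_of_hasVelocity (hφ : φ ∈ charts d M) {t : ℝ} (hx : γ t ∈ φ.source)
    {v : TangentSpace 𝓘(ℝ, Eu d) (γ t)} (h : HasVelocity γ t v) :
    HasDerivAt (fun t => φ (γ t)) (coordVec φ (γ t) v) t := by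
  have h1 : HasMFDerivAt 𝓘(ℝ, Eu d) 𝓘(ℝ, Eu d) φ (γ t) (coordVec φ (γ t)) :=
    ((charts.mdifferentiable hφ).mdifferentiableAt hx).hasMFDerivAt
  have h2 := HasMFDerivAt.comp t h1 h
  have e : (coordVec φ (γ t)).comp ((1 : ℝ →L[ℝ] ℝ).smulRight v) =
      (1 : ℝ →L[ℝ] ℝ).smulRight (coordVec φ (γ t) v) :=
    ContinuousLinearMap.ext fun a => map_smul (coordVec φ (γ t)) a v
  have h3 : HasFDerivAt (fun t => φ (γ t))
      ((1 : ℝ →L[ℝ] ℝ).smulRight (coordVec φ (γ t) v)) t := (e ▸ h2 : HasMFDerivAt 𝓘(ℝ, ℝ)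
        𝓘(ℝ, Eu d) (φ ∘ γ) t ((1 : ℝ →L[ℝ] ℝ).smulRight (coordVec φ (γ t) v))).hasFDerivAt
  simpa using h3.hasDerivAt

theorem hasVelocity_symm (hφ : φ ∈ charts d M) {y : ℝ → Eu d} {t : ℝ} (hy : y t ∈ φ.target)
    {w : Eu d} (h : HasDerivAt y w t) :
    HasVelocity (fun t => φ.symm (y t)) t (chartField φ w (φ.symm (y t))) := by
  have h1 : HasMFDerivAt 𝓘(ℝ, Eu d) 𝓘(ℝ, Eu d) φ.symm (y t)
      (mfderiv 𝓘(ℝ, Eu d) 𝓘(ℝ, Eu d) φ.symm (y t)) :=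
    ((charts.mdifferentiable hφ).symm.mdifferentiableAt hy).hasMFDerivAt
  have h2 : HasMFDerivAt 𝓘(ℝ, ℝ) 𝓘(ℝ, Eu d) y t ((1 : ℝ →L[ℝ] ℝ).smulRight w) :=
    h.hasFDerivAt.hasMFDerivAt
  have h3 := HasMFDerivAt.comp t h1 h2
  have e : chartField φ w (φ.symm (y t)) =
      (mfderiv 𝓘(ℝ, Eu d) 𝓘(ℝ, Eu d) φ.symm (y t) w : Eu d) := by
    rw [chartField, φ.right_inv hy]
  have e2 : (mfderiv 𝓘(ℝ, Eu d) 𝓘(ℝ, Eu d) φ.symm (y t)).comp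
      ((1 : ℝ →L[ℝ] ℝ).smulRight w) =
      (1 : ℝ →L[ℝ] ℝ).smulRight (mfderiv 𝓘(ℝ, Eu d) 𝓘(ℝ, Eu d) φ.symm (y t) w) :=
    ContinuousLinearMap.ext fun a => map_smul (mfderiv 𝓘(ℝ, Eu d) 𝓘(ℝ, Eu d) φ.symm (y t)) a w
  rw [e]
  have h4 : HasMFDerivAt 𝓘(ℝ, ℝ) 𝓘(ℝ, Eu d) (φ.symm ∘ y) t
      ((1 : ℝ →L[ℝ] ℝ).smulRight (mfderiv 𝓘(ℝ, Eu d) 𝓘(ℝ, Eu d) φ.symm (y t) w)) := e2 ▸ h3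
  exact h4

/-- The geodesic equation in a chart. -/
theorem IsGeodesicOn.hasDerivAt (h : IsGeodesicOn cov γ J) {t₀ : ℝ} (ht : t₀ ∈ J)
    (hφ : φ ∈ charts d M) (hx : γ t₀ ∈ φ.source) :
    ContinuousAt γ t₀ ∧ HasDerivAt (fun t => φ (γ t)) (deriv (fun t => φ (γ t)) t₀) t₀ ∧
      HasDerivAt (deriv fun t => φ (γ t))
        (-spray cov φ (φ (γ t₀), deriv (fun t => φ (γ t)) t₀)) t₀ := by
  obtain ⟨X, c, U, hU, hγU, hX, hc, hv, hacc⟩ := h t₀ ht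
  have hγc : ContinuousAt γ t₀ := hv.self_of_nhds.continuousAt
  set y : ℝ → Eu d := fun t => φ (γ t) with hy
  set W : Fin d → Eu d → Eu d := fun i u => coordVec φ (φ.symm u) (X i (φ.symm u)) with hW
  have hWx : ∀ i, ∀ x ∈ φ.source, W i (φ x) = coordVec φ x (X i x) := fun i x hx => by
    have := φ.left_inv hx
    simp only [hW]
    rw [this]
  have hev : ∀ᶠ t in 𝓝 t₀, HasDerivAt y (∑ i, c i t • W i (y t)) t := by
    filter_upwards [hv, hγc (φ.open_source.mem_nhds hx)] with t ht hxt
    have h1 := hasDerivAt_of_hasVelocity hφ hxt ht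
    convert h1 using 1
    rw [map_sum]
    refine Finset.sum_congr rfl fun i _ => ?_
    rw [map_smul, hWx i _ hxt]
  have hd0 := hev.self_of_nhds
  have hV : deriv y =ᶠ[𝓝 t₀] fun t => ∑ i, c i t • W i (y t) := hev.mono fun t ht => ht.deriv
  have hopen : IsOpen (φ.target ∩ φ.symm ⁻¹' U) := φ.isOpen_inter_preimage_symm hU
  have hmem : y t₀ ∈ φ.target ∩ φ.symm ⁻¹' U :=
    ⟨φ.map_source hx, by rw [mem_preimage, hy, φ.left_inv hx]; exact hγU⟩
  have hWd : ∀ i, HasFDerivAt (W i) (fderiv ℝ (W i) (y t₀)) (y t₀) := fun i =>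
    ((((hX i).contDiffOn_coordVec hφ) _ hmem).contDiffAt (hopen.mem_nhds hmem)).differentiableAt
      (by simp) |>.hasFDerivAt
  set v₀ : TangentSpace 𝓘(ℝ, Eu d) (γ t₀) := ∑ j, c j t₀ • X j (γ t₀) with hv₀
  have hdy : deriv y t₀ = coordVec φ (γ t₀) v₀ := by
    rw [hd0.deriv, hv₀, map_sum]
    refine Finset.sum_congr rfl fun i _ => ?_
    rw [map_smul, hWx i _ hx]
  have h2 : HasDerivAt (fun t => ∑ i, c i t • W i (y t))
      (∑ i, (c i t₀ • fderiv ℝ (W i) (y t₀) (deriv y t₀) + deriv (c i) t₀ • W i (y t₀))) t₀ := by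
    refine HasDerivAt.fun_sum fun i _ => ?_
    have h3 := (hWd i).comp_hasDerivAt t₀ hd0
    rw [← hd0.deriv] at h3
    exact (hc i).hasDerivAt.smul h3
  refine ⟨hγc, ?_, ?_⟩
  · rw [hd0.deriv]; exact hd0
  refine (h2.congr_of_eventuallyEq hV).congr_deriv ?_
  have h4 := congrArg (coordVec φ (γ t₀)) hacc
  rw [map_zero, map_sum] at h4
  have h5 : ∀ i, coordVec φ (γ t₀) (deriv (c i) t₀ • X i (γ t₀) +
      c i t₀ • cov (X i) (γ t₀) v₀) = (c i t₀ • fderiv ℝ (W i) (y t₀) (deriv y t₀) +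
        deriv (c i) t₀ • W i (y t₀)) + c i t₀ • ∑ b, (W i (y t₀)) b •
          coordVec φ (γ t₀) (cov (chartField φ (EuclideanSpace.single b 1)) (γ t₀) v₀) := fun i => by
    rw [map_add, map_smul, map_smul, coordVec_cov cov hφ hU (hX i) hx hγU v₀, ← hdy, hWx i _ hx,
      smul_add]
    abel
  simp only [h5] at h4
  rw [Finset.sum_add_distrib] at h4
  rw [eq_neg_iff_add_eq_zero, ← h4, spray]
  congr 1
  simp only [Finset.smul_sum]
  rw [Finset.sum_comm]
  refine Finset.sum_congr rfl fun b _ => ?_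
  simp only [smul_smul]
  have e : φ.symm (φ (γ t₀)) = γ t₀ := φ.left_inv hx
  have e2 : (chartField φ (deriv y t₀) (γ t₀)) = v₀ := by
    rw [hdy, chartField_coordVec hφ hx]
  rw [← Finset.sum_smul, e, e2]
  congr 1
  rw [hd0.deriv]
  simp [Finset.sum_apply]

/-- Solutions of the geodesic equation in a chart are geodesics. -/
theorem isGeodesicOn_of_hasDerivAt (hφ : φ ∈ charts d M) {y V : ℝ → Eu d}
    (h : ∀ t₀ ∈ J, y t₀ ∈ φ.target ∧ (∀ᶠ t in 𝓝 t₀, HasDerivAt y (V t) t) ∧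
      HasDerivAt V (-spray cov φ (y t₀, V t₀)) t₀) :
    IsGeodesicOn cov (fun t => φ.symm (y t)) J := by
  intro t₀ ht₀
  obtain ⟨hy, hd, hV⟩ := h t₀ ht₀
  have hx : φ.symm (y t₀) ∈ φ.source := φ.map_target hy
  have hVb : ∀ b : Fin d, HasDerivAt (fun t => V t b) ((-spray cov φ (y t₀, V t₀)) b) t₀ := fun b =>
    (EuclideanSpace.proj b : Eu d →L[ℝ] ℝ).hasFDerivAt.comp_hasDerivAt t₀ hV
  have hsum : ∀ t, ∑ b, V t b • chartField φ (EuclideanSpace.single b 1) (φ.symm (y t)) =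
      chartField φ (V t) (φ.symm (y t)) := fun t => (chartField_eq_sum _ _).symm
  refine ⟨fun b => chartField φ (EuclideanSpace.single b 1), fun b t => V t b, φ.source,
    φ.open_source, hx, fun b => smoothFieldOn_chartField hφ
      (V := fun _ => EuclideanSpace.single b 1) contDiffOn_const,
    fun b => (hVb b).differentiableAt, ?_, ?_⟩
  · filter_upwards [hd, hd.self_of_nhds.continuousAt (φ.open_target.mem_nhds hy)] with t ht hyt
    rw [hsum]
    exact hasVelocity_symm hφ hyt ht
  · apply coordVec_injective hφ hx
    rw [hsum, Finset.sum_add_distrib, map_add, map_zero]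
    have e1 : ∑ b, deriv (fun t => V t b) t₀ •
        chartField φ (EuclideanSpace.single b 1) (φ.symm (y t₀)) =
        chartField φ (-spray cov φ (y t₀, V t₀)) (φ.symm (y t₀)) := by
      rw [chartField_eq_sum (-spray cov φ (y t₀, V t₀))]
      exact Finset.sum_congr rfl fun b _ => by rw [(hVb b).deriv]
    rw [e1, coordVec_chartField hφ hx, map_sum, neg_add_eq_zero, spray]
    exact Finset.sum_congr rfl fun b _ => (map_smul (coordVec φ (φ.symm (y t₀))) _ _).symm

/-- Geodesics with the same position and velocity at `t₀` agree for a short time. -/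
theorem IsGeodesicOn.eq_locally [T2Space M]
    (hcov : CovariantDerivative.ContMDiffCovariantDerivative cov ∞) {γ' : ℝ → M}
    (h : IsGeodesicOn cov γ (Icc 0 1)) (h' : IsGeodesicOn cov γ' (Icc 0 1)) {t₀ : ℝ}
    (ht : t₀ ∈ Icc (0 : ℝ) 1) (hφ : φ ∈ charts d M) (hx : γ t₀ ∈ φ.source) (he : γ t₀ = γ' t₀)
    (hde : deriv (fun t => φ (γ t)) t₀ = deriv (fun t => φ (γ' t)) t₀) :
    ∃ ε > 0, ∀ t ∈ Icc t₀ (t₀ + ε), t ≤ 1 → γ t = γ' t := by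
  have hx' : γ' t₀ ∈ φ.source := he ▸ hx
  set f : Eu d × Eu d → Eu d × Eu d := fun q => (q.2, -spray cov φ q) with hf
  have hfs : ContDiffAt ℝ 1 f (φ (γ t₀), deriv (fun t => φ (γ t)) t₀) := by
    have h1 : ContDiffOn ℝ ∞ f (φ.target ×ˢ univ) :=
      contDiffOn_snd.prodMk (contDiffOn_spray cov hcov hφ).neg
    exact ((h1 _ ⟨φ.map_source hx, mem_univ _⟩).contDiffAt
      ((φ.open_target.prod isOpen_univ).mem_nhds ⟨φ.map_source hx, mem_univ _⟩)).of_le (by simp)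
  obtain ⟨K, s, hs, hK⟩ := hfs.exists_lipschitzOnWith
  set Y : ℝ → Eu d × Eu d := fun t => (φ (γ t), deriv (fun t => φ (γ t)) t) with hY
  set Y' : ℝ → Eu d × Eu d := fun t => (φ (γ' t), deriv (fun t => φ (γ' t)) t) with hY'
  have key : ∀ g : ℝ → M, IsGeodesicOn cov g (Icc 0 1) → ∀ t ∈ Icc (0 : ℝ) 1, g t ∈ φ.source →
      HasDerivAt (fun t => ((φ (g t), deriv (fun t => φ (g t)) t) : Eu d × Eu d))
        (f (φ (g t), deriv (fun t => φ (g t)) t)) t := fun g hg t ht hgt => by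
    obtain ⟨-, h1, h2⟩ := hg.hasDerivAt ht hφ hgt
    exact h1.prodMk h2
  have hc := (key γ h t₀ ht hx).continuousAt
  have hc' := (key γ' h' t₀ ht hx').continuousAt
  have hYe : Y t₀ = Y' t₀ := by simp only [hY, hY']; rw [he, hde]
  have hs' : s ∈ 𝓝 (Y' t₀) := hYe ▸ hs
  have hev : ∀ᶠ t in 𝓝 t₀, (Y t ∈ s ∧ γ t ∈ φ.source) ∧ (Y' t ∈ s ∧ γ' t ∈ φ.source) := by
    filter_upwards [hc hs, hc' hs', (h.hasDerivAt ht hφ hx).1 (φ.open_source.mem_nhds hx),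
      (h'.hasDerivAt ht hφ hx').1 (φ.open_source.mem_nhds hx')] with t h1 h2 h3 h4
    exact ⟨⟨h1, h3⟩, h2, h4⟩
  obtain ⟨ε, hε, hball⟩ := Metric.eventually_nhds_iff.1 hev
  refine ⟨ε / 2, by positivity, fun t htt ht1 => ?_⟩
  have hin : ∀ τ ∈ Icc t₀ t, (Y τ ∈ s ∧ γ τ ∈ φ.source) ∧ (Y' τ ∈ s ∧ γ' τ ∈ φ.source) :=
    fun τ hτ => hball (by
      rw [Real.dist_eq, abs_of_nonneg (by linarith [hτ.1])]
      linarith [hτ.2, htt.2])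
  have h01 : ∀ τ ∈ Icc t₀ t, τ ∈ Icc (0 : ℝ) 1 := fun τ hτ =>
    ⟨ht.1.trans hτ.1, hτ.2.trans ht1⟩
  have hd1 : ∀ τ ∈ Icc t₀ t, HasDerivAt Y (f (Y τ)) τ := fun τ hτ =>
    key γ h τ (h01 τ hτ) (hin τ hτ).1.2
  have hd2 : ∀ τ ∈ Icc t₀ t, HasDerivAt Y' (f (Y' τ)) τ := fun τ hτ =>
    key γ' h' τ (h01 τ hτ) (hin τ hτ).2.2
  have := ODE_solution_unique_of_mem_Icc_right (v := fun _ => f) (s := fun _ => s) (K := K)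
    (f := Y) (g := Y') (a := t₀) (b := t) (fun _ _ => hK)
    (fun τ hτ => (hd1 τ hτ).continuousAt.continuousWithinAt)
    (fun τ hτ => (hd1 τ ⟨hτ.1, hτ.2.le⟩).hasDerivWithinAt)
    (fun τ hτ => (hin τ ⟨hτ.1, hτ.2.le⟩).1.1)
    (fun τ hτ => (hd2 τ hτ).continuousAt.continuousWithinAt)
    (fun τ hτ => (hd2 τ ⟨hτ.1, hτ.2.le⟩).hasDerivWithinAt)
    (fun τ hτ => (hin τ ⟨hτ.1, hτ.2.le⟩).2.1) hYe
  have htt' : t ∈ Icc t₀ t := ⟨htt.1, le_rfl⟩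
  exact φ.injOn (hin t htt').1.2 (hin t htt').2.2 (congrArg Prod.fst (this htt'))

/-- Geodesics are determined by their initial position and velocity. -/
theorem IsGeodesicOn.eqOn [T2Space M]
    (hcov : CovariantDerivative.ContMDiffCovariantDerivative cov ∞) {γ' : ℝ → M}
    (h : IsGeodesicOn cov γ (Icc 0 1)) (h' : IsGeodesicOn cov γ' (Icc 0 1))
    (hφ : φ ∈ charts d M) (hx : γ 0 ∈ φ.source) (he : γ 0 = γ' 0)
    (hde : deriv (fun t => φ (γ t)) 0 = deriv (fun t => φ (γ' t)) 0) : EqOn γ γ' (Icc 0 1) := by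
  set s : Set ℝ := {t | ∀ τ ∈ Icc (0 : ℝ) t, γ τ = γ' τ} with hs
  have hcont : ∀ g : ℝ → M, IsGeodesicOn cov g (Icc 0 1) → ∀ t ∈ Icc (0 : ℝ) 1, ContinuousAt g t :=
    fun g hg t ht => (hg.hasDerivAt ht (IsManifold.chart_mem_maximalAtlas (g t))
      (mem_chart_source (Eu d) (g t))).1
  have hE : IsClosed {t : ℝ | t ∈ Icc (0 : ℝ) 1 ∧ γ t = γ' t} := by
    have h1 : ContinuousOn γ (Icc 0 1) := fun t ht => (hcont γ h t ht).continuousWithinAt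
    have h2 : ContinuousOn γ' (Icc 0 1) := fun t ht => (hcont γ' h' t ht).continuousWithinAt
    exact (h1.prodMk h2).preimage_isClosed_of_isClosed isClosed_Icc isClosed_diagonal
  have hclosed : IsClosed (s ∩ Icc 0 1) := by
    refine isClosed_of_closure_subset fun t ht => ?_
    have ht01 : t ∈ Icc (0 : ℝ) 1 :=
      isClosed_Icc.closure_subset_iff.2 inter_subset_right ht
    refine ⟨fun τ hτ => ?_, ht01⟩
    rcases lt_or_eq_of_le hτ.2 with hlt | heq
    · obtain ⟨t', ht', hts⟩ := mem_closure_iff.1 ht (Ioi τ) isOpen_Ioi hlt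
      exact hts.1 τ ⟨hτ.1, le_of_lt ht'⟩
    · subst heq
      have : τ ∈ {t : ℝ | t ∈ Icc (0 : ℝ) 1 ∧ γ t = γ' t} :=
        hE.closure_subset_iff.2 (fun t' ht' => ⟨ht'.2, ht'.1 t' ⟨ht'.2.1, le_rfl⟩⟩) ht
      exact this.2
  have h0 : (0 : ℝ) ∈ s := fun τ hτ => by
    rw [Icc_self, mem_singleton_iff] at hτ
    rw [hτ, he]
  have hsub := hclosed.Icc_subset_of_forall_exists_gt h0 (fun t ht y hy => by
    have ht01 : t ∈ Icc (0 : ℝ) 1 := ⟨ht.2.1, ht.2.2.le⟩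
    have hte : γ t = γ' t := ht.1 t ⟨ht.2.1, le_rfl⟩
    have hloc : ∃ ε > 0, ∀ τ ∈ Icc t (t + ε), τ ≤ 1 → γ τ = γ' τ := by
      rcases eq_or_lt_of_le ht.2.1 with h00 | hpos
      · subst h00
        exact h.eq_locally hcov h' ht01 hφ hx he hde
      · set φ' := chartAt (Eu d) (γ t)
        have hφ' : φ' ∈ charts d M := IsManifold.chart_mem_maximalAtlas (γ t)
        have hxt : γ t ∈ φ'.source := mem_chart_source (Eu d) (γ t)
        refine h.eq_locally hcov h' ht01 hφ' hxt hte ?_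
        have d1 := (h.hasDerivAt ht01 hφ' hxt).2.1.hasDerivWithinAt (s := Icc 0 t)
        have d2 := (h'.hasDerivAt ht01 hφ' (hte ▸ hxt)).2.1.hasDerivWithinAt (s := Icc 0 t)
        have d3 := d2.congr (f₁ := fun t => φ' (γ t)) (fun τ hτ => by
          rw [ht.1 τ hτ]) (by rw [hte])
        exact (uniqueDiffOn_Icc hpos t ⟨hpos.le, le_rfl⟩).eq_deriv _ d1 d3
    obtain ⟨ε, hε, hloc⟩ := hloc
    have hlt : t < min (min y 1) (t + ε) := lt_min (lt_min hy ht.2.2) (by linarith)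
    refine ⟨min (min y 1) (t + ε), fun τ hτ => ?_, hlt, (min_le_left _ _).trans (min_le_left _ _)⟩
    rcases le_total τ t with hle | hle
    · exact ht.1 τ ⟨hτ.1, hle⟩
    · exact hloc τ ⟨hle, hτ.2.trans (min_le_right _ _)⟩
        (hτ.2.trans ((min_le_left _ _).trans (min_le_right _ _))))
  exact fun t ht => hsub ht t ⟨ht.1, le_rfl⟩

end Geodesics

section SprayFlow

variable {E : Type} [NormedAddCommGroup E] [NormedSpace ℝ E] [CompleteSpace E]

theorem hasDerivAt_extendCurve {f : E → E} (hf : Continuous f) {a : E} {X : C(TimeInterval, E)}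
    (hX : ∀ t, X t = a + ∫ τ in (0 : ℝ)..t, f (extendCurve X τ)) {t : ℝ} (ht : t ∈ Ioo (-1 : ℝ) 1) :
    HasDerivAt (extendCurve X) (f (extendCurve X t)) t := by
  have hc : Continuous fun τ => f (extendCurve X τ) := hf.comp (continuous_extendCurve X)
  have h1 : HasDerivAt (fun t => a + ∫ τ in (0 : ℝ)..t, f (extendCurve X τ))
      (f (extendCurve X t)) t :=
    (intervalIntegral.integral_hasDerivAt_right (hc.intervalIntegrable _ _)
      (hc.stronglyMeasurableAtFilter _ _) hc.continuousAt).const_add a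
  refine h1.congr_of_eventuallyEq ?_
  filter_upwards [isOpen_Ioo.mem_nhds ht] with τ hτ
  have := hX ⟨τ, hτ.1.le, hτ.2.le⟩
  rw [← extendCurve_apply] at this
  exact this

/-- The flow of a smooth spray `σ`, i.e. of the equation `y'' = -σ (y, y')`, near the zero section:
`e (u, ζ)` is the value at time `1` of the solution with initial velocity `ζ` at `u`. -/
theorem exists_spray_flow [FiniteDimensional ℝ E] {σ : E × E → E} {T : Set E} (hT : IsOpen T)
    (hσ : ContDiffOn ℝ ∞ σ (T ×ˢ univ)) (hq : ∀ u v, ∀ c : ℝ, σ (u, c • v) = c ^ 2 • σ (u, v))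
    {u₀ : E} (hu₀ : u₀ ∈ T) :
    ∃ e : E × E → E, ∃ N : Set (E × E), IsOpen N ∧ (u₀, 0) ∈ N ∧ ContDiffOn ℝ ∞ e N ∧
      ∀ u ζ, (u, ζ) ∈ N → e (u, 0) = u ∧ ∃ V : ℝ → E, V 0 = ζ ∧ ∀ t ∈ Icc (0 : ℝ) 1,
        e (u, t • ζ) ∈ T ∧ (∀ᶠ τ in 𝓝 t, HasDerivAt (fun τ => e (u, τ • ζ)) (V τ) τ) ∧
          HasDerivAt V (-σ (e (u, t • ζ), V t)) t := by
  obtain ⟨R, hR, hRT⟩ := Metric.isOpen_iff.1 hT u₀ hu₀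
  let χ : ContDiffBump u₀ := ⟨R / 4, R / 2, by positivity, by linarith⟩
  have hχs : tsupport χ ⊆ T := by
    rw [χ.tsupport_eq]
    exact (Metric.closedBall_subset_ball (by change R / 2 < R; linarith)).trans hRT
  set g : E × E → E := fun q => χ q.1 • σ q with hg
  have hgs : ContDiff ℝ ∞ g := by
    rw [contDiff_iff_contDiffAt]
    rintro ⟨u, w⟩
    by_cases hu : u ∈ T
    · exact ((χ.contDiff.comp contDiff_fst).contDiffAt).smul ((hσ _ ⟨hu, mem_univ _⟩).contDiffAt
        ((hT.prod isOpen_univ).mem_nhds ⟨hu, mem_univ _⟩))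
    · have h0 : g =ᶠ[𝓝 (u, w)] fun _ => 0 := by
        have h1 : (tsupport χ)ᶜ ∈ 𝓝 u := (isClosed_tsupport _).isOpen_compl.mem_nhds fun h => hu (hχs h)
        filter_upwards [continuous_fst.continuousAt h1] with q hq
        have : χ q.1 = 0 := image_eq_zero_of_notMem_tsupport hq
        simp only [hg]
        rw [this, zero_smul]
      exact contDiffAt_const.congr_of_eventuallyEq h0
  have hgq : ∀ u w, ∀ c : ℝ, g (u, c • w) = c ^ 2 • g (u, w) := fun u w c => by
    simp only [hg]; rw [hq, smul_comm]
  have hg1 : ∀ u ∈ Metric.ball u₀ (R / 4), ∀ w, g (u, w) = σ (u, w) := fun u hu w => by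
    simp only [hg]
    rw [χ.one_of_mem_closedBall (Metric.ball_subset_closedBall hu), one_smul]
  -- The factor `1 / 2` makes the derivative at `(u₀, 0)` small; doubling
  -- the velocity undoes it below.
  set f : E × E → E × E := fun q => ((1 / 2 : ℝ) • q.2, -((1 / 2 : ℝ) • g q)) with hf
  have hfs : ContDiff ℝ ∞ f := (contDiff_snd.const_smul _).prodMk (hgs.const_smul _).neg
  set p₀ : E × E := (u₀, 0) with hp₀
  have hg0 : ∀ u, g (u, 0) = 0 := fun u => by
    have := hgq u 0 0
    simpa using this
  have hf0 : f p₀ = 0 := by simp [hf, hp₀, hg0]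
  -- `g` is quadratic in the velocity.
  have hgd : fderiv ℝ g p₀ = 0 := by
    refine ContinuousLinearMap.ext fun ab => ?_
    obtain ⟨a, b⟩ := ab
    have hl : HasDerivAt (fun t : ℝ => ((u₀ + t • a, t • b) : E × E)) (a, b) 0 := by
      have h1 := (((hasDerivAt_id (0 : ℝ)).smul_const a).const_add u₀).prodMk
        ((hasDerivAt_id (0 : ℝ)).smul_const b)
      simpa using h1
    have hl' : HasDerivAt (fun t : ℝ => ((u₀ + t • a, b) : E × E)) (a, 0) 0 := by
      have h1 := (((hasDerivAt_id (0 : ℝ)).smul_const a).const_add u₀).prodMk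
        (hasDerivAt_const (0 : ℝ) b)
      simpa using h1
    have h2 : HasDerivAt (fun t : ℝ => g (u₀ + t • a, t • b)) (fderiv ℝ g p₀ (a, b)) 0 := by
      have h3 : HasFDerivAt g (fderiv ℝ g p₀) ((u₀ + (0 : ℝ) • a, (0 : ℝ) • b) : E × E) := by
        have := (hgs.differentiable (by simp) p₀).hasFDerivAt
        simpa [hp₀] using this
      exact h3.comp_hasDerivAt (0 : ℝ) hl
    have h4 : HasDerivAt (fun t : ℝ => t ^ 2 • g (u₀ + t • a, b)) 0 0 := by
      have h5 : HasDerivAt (fun t : ℝ => g (u₀ + t • a, b))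
          (fderiv ℝ g (u₀ + (0 : ℝ) • a, b) (a, 0)) 0 :=
        (hgs.differentiable (by simp) _).hasFDerivAt.comp_hasDerivAt (0 : ℝ) hl'
      exact ((hasDerivAt_pow 2 (0 : ℝ)).smul h5).congr_deriv (by simp)
    have h6 : (fun t : ℝ => g (u₀ + t • a, t • b)) = fun t : ℝ => t ^ 2 • g (u₀ + t • a, b) :=
      funext fun t => hgq _ _ _
    rw [h6] at h2
    exact h2.unique h4
  have hfd : ‖fderiv ℝ f p₀‖ ≤ 1 / 2 := by
    have h1 : HasFDerivAt f (((1 / 2 : ℝ) • ContinuousLinearMap.snd ℝ E E).prod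
        (-((1 / 2 : ℝ) • fderiv ℝ g p₀))) p₀ :=
      (hasFDerivAt_snd.const_smul (1 / 2 : ℝ)).prodMk
        (((hgs.differentiable (by simp) p₀).hasFDerivAt.const_smul (1 / 2 : ℝ)).neg)
    rw [h1.fderiv, hgd]
    refine ContinuousLinearMap.opNorm_le_bound _ (by norm_num) fun q => ?_
    rw [smul_zero, neg_zero, ContinuousLinearMap.prod_apply, Prod.norm_def]
    simp only [ContinuousLinearMap.coe_snd', FunLike.coe_smul, Pi.smul_apply,
      zero_apply, norm_zero, norm_smul]
    refine max_le ?_ (by positivity)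
    rw [Real.norm_of_nonneg (by norm_num)]
    gcongr
    exact norm_snd_le q
  obtain ⟨ρ, hρ, hflow⟩ := exists_smooth_flow hfs hf0 hfd
  obtain ⟨U, hU, hpU, X, hX, hXU⟩ := hflow (min ρ (R / 4)) (lt_min hρ (by positivity))
  obtain ⟨r₂, hr₂, hball⟩ := Metric.isOpen_iff.1 hU p₀ hpU
  have hmem : ∀ (u ζ : E), (u, ζ) ∈ Metric.ball p₀ r₂ ↔ dist u u₀ < r₂ ∧ ‖ζ‖ < r₂ := fun u ζ => by
    rw [Metric.mem_ball, Prod.dist_eq, max_lt_iff]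
    simp [hp₀]
  have hshrink : ∀ (c : ℝ) (u ζ : E), |c| ≤ 1 → ∀ r, (u, ζ) ∈ Metric.ball p₀ r →
      (u, c • ζ) ∈ Metric.ball p₀ r := fun c u ζ hc r h => by
    rw [Metric.mem_ball, Prod.dist_eq, max_lt_iff] at h ⊢
    refine ⟨h.1, lt_of_le_of_lt ?_ h.2⟩
    simp only [hp₀, dist_zero_right, norm_smul, Real.norm_eq_abs]
    exact mul_le_of_le_one_left (norm_nonneg _) hc
  let t1 : TimeInterval := ⟨1, by norm_num, le_rfl⟩
  -- rescaling a solution in time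
  have hscale : ∀ (u ζ : E), (u, ζ) ∈ Metric.ball p₀ r₂ → ∀ c ∈ Icc (-1 : ℝ) 1,
      (X (u, c • ζ) t1).1 = (extendCurve (X (u, ζ)) c).1 := by
    intro u ζ h c hc
    have hc1 : |c| ≤ 1 := abs_le.2 hc
    obtain ⟨hXd, hXi, -⟩ := hXU _ (hball h)
    obtain ⟨-, -, huniq⟩ := hXU _ (hball (hshrink c u ζ hc1 _ h))
    let Sc : E × E →L[ℝ] E × E :=
      (ContinuousLinearMap.fst ℝ E E).prod (c • ContinuousLinearMap.snd ℝ E E)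
    have hSc : ∀ q, Sc q = (q.1, c • q.2) := fun q => rfl
    have hfS : ∀ q, f (Sc q) = c • Sc (f q) := fun q => by
      simp only [hSc, hf, hgq, Prod.smul_mk]
      refine Prod.ext ?_ ?_
      · exact smul_comm _ _ _
      · simp only [smul_neg, smul_smul]; congr 2; ring
    set Z : ℝ → E × E := fun τ => Sc (extendCurve (X (u, ζ)) (c * τ)) with hZ
    have hZc : Continuous Z :=
      Sc.continuous.comp ((continuous_extendCurve _).comp (continuous_const.mul continuous_id))
    let Y : C(TimeInterval, E × E) := ⟨fun τ => Z τ, hZc.comp continuous_subtype_val⟩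
    have hct : ∀ τ : TimeInterval, c * τ ∈ Icc (-1 : ℝ) 1 := fun τ => by
      rw [mem_Icc, ← abs_le, abs_mul]
      exact mul_le_one₀ hc1 (abs_nonneg _) (abs_le.2 τ.2)
    have hYX : ∀ τ : TimeInterval, Y τ = Sc (X (u, ζ) ⟨c * τ, hct τ⟩) := fun τ => by
      change Sc (extendCurve (X (u, ζ)) (c * τ)) = _
      rw [← extendCurve_apply]
    have hYe := huniq Y (fun τ => by
      rw [hYX]
      have h1 := (hXd ⟨c * τ, hct τ⟩).trans_le (min_le_left _ _)
      exact Metric.mem_ball.1 (hshrink c _ _ hc1 _ (Metric.mem_ball.2 h1))) (fun τ => by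
      have e1 : ∫ τ' in (0 : ℝ)..τ, f (extendCurve Y τ') = ∫ τ' in (0 : ℝ)..τ, f (Z τ') := by
        refine intervalIntegral.integral_congr fun τ' hτ' => ?_
        have : τ' ∈ Icc (-1 : ℝ) 1 := by
          have h0 : (0 : ℝ) ∈ Icc (-1 : ℝ) 1 := ⟨by norm_num, by norm_num⟩
          exact (convex_Icc (-1 : ℝ) 1).ordConnected.uIcc_subset h0 τ.2 hτ'
        exact congrArg f (extendCurve_apply Y ⟨τ', this⟩)
      have e2 : ∀ τ' : ℝ, f (Z τ') = Sc (c • f (extendCurve (X (u, ζ)) (c * τ'))) := fun τ' => by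
        rw [hZ, hfS, map_smul]
      have hfc : Continuous fun τ' : ℝ => f (extendCurve (X (u, ζ)) τ') :=
        hfs.continuous.comp (continuous_extendCurve _)
      have e4 : ∫ τ' in (0 : ℝ)..τ, Sc (c • f (extendCurve (X (u, ζ)) (c * τ'))) =
          Sc (∫ τ' in (0 : ℝ)..τ, c • f (extendCurve (X (u, ζ)) (c * τ'))) :=
        Sc.intervalIntegral_comp_comm (((hfc.comp
          (continuous_const.mul continuous_id)).const_smul c).intervalIntegrable _ _)
      rw [e1]
      simp only [e2]
      rw [e4, intervalIntegral.integral_smul, intervalIntegral.smul_integral_comp_mul_left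
          (fun τ' => f (extendCurve (X (u, ζ)) τ')), mul_zero, hYX]
      have e3 := hXi ⟨c * τ, hct τ⟩
      rw [e3, map_add]
      rfl)
    rw [← hYe]
    change (Sc (extendCurve (X (u, ζ)) (c * 1))).1 = _
    rw [mul_one]
    rfl
  set e : E × E → E := fun q => (X (q.1, (2 : ℝ) • q.2) t1).1 with he
  set N : Set (E × E) := (fun q : E × E => (q.1, (4 : ℝ) • q.2)) ⁻¹' Metric.ball p₀ r₂ with hN
  have hNo : IsOpen N := Metric.isOpen_ball.preimage (by fun_prop)
  refine ⟨e, N, hNo, ?_, ?_, ?_⟩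
  · rw [hN, mem_preimage, smul_zero]
    exact Metric.mem_ball_self hr₂
  · have h1 : ContDiffOn ℝ ∞ (fun q : E × E => X (q.1, (2 : ℝ) • q.2)) N := by
      refine hX.comp (contDiff_fst.prodMk (contDiff_snd.const_smul _)).contDiffOn fun q hq => ?_
      have := hshrink (1 / 2) _ _ (by rw [abs_of_pos] <;> norm_num) _ hq
      rw [smul_smul] at this
      norm_num at this
      exact hball this
    let ev : C(TimeInterval, E × E) →L[ℝ] E :=
      (ContinuousLinearMap.fst ℝ E E).comp (ContinuousMap.evalCLM ℝ t1)
    exact ev.contDiff.comp_contDiffOn h1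
  · intro u ζ h
    set a : E × E := (u, (4 : ℝ) • ζ) with ha
    have haU : a ∈ Metric.ball p₀ r₂ := h
    obtain ⟨hXd, hXi, -⟩ := hXU _ (hball haU)
    have hes : ∀ τ ∈ Icc (-2 : ℝ) 2, e (u, τ • ζ) = (extendCurve (X a) (τ / 2)).1 := fun τ hτ => by
      have := hscale u ((4 : ℝ) • ζ) haU (τ / 2) ⟨by linarith [hτ.1], by linarith [hτ.2]⟩
      have e5 : (2 : ℝ) • τ • ζ = (τ / 2) • (4 : ℝ) • ζ := by
        simp only [smul_smul]
        congr 1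
        ring
      rw [← this, ← e5]
    have h00 : extendCurve (X a) 0 = a := by
      have h1 := hXi ⟨0, by norm_num, by norm_num⟩
      rw [← extendCurve_apply] at h1
      simpa using h1
    have hdX : ∀ τ ∈ Ioo (-2 : ℝ) 2, HasDerivAt (fun τ => extendCurve (X a) (τ / 2))
        ((1 / 2 : ℝ) • f (extendCurve (X a) (τ / 2))) τ := fun τ hτ => by
      have h1 := hasDerivAt_extendCurve hfs.continuous hXi (t := τ / 2)
        ⟨by linarith [hτ.1], by linarith [hτ.2]⟩
      have h2 : HasDerivAt (fun τ : ℝ => τ / 2) (1 / 2) τ := (hasDerivAt_id τ).div_const 2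
      exact h1.scomp τ h2
    refine ⟨?_, fun τ => (1 / 4 : ℝ) • (extendCurve (X a) (τ / 2)).2, ?_, fun t ht => ?_⟩
    · have := hes 0 ⟨by norm_num, by norm_num⟩
      rw [zero_smul, zero_div, h00] at this
      exact this
    · change (1 / 4 : ℝ) • (extendCurve (X a) (0 / 2)).2 = ζ
      rw [zero_div, h00, ha, smul_smul]
      norm_num
    · have ht2 : t ∈ Ioo (-2 : ℝ) 2 := ⟨by linarith [ht.1], by linarith [ht.2]⟩
      have hb : extendCurve (X a) (t / 2) ∈ Metric.ball p₀ (R / 4) := by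
        have := hXd ⟨t / 2, by linarith [ht.1], by linarith [ht.2]⟩
        rw [← extendCurve_apply] at this
        exact this.trans_le (min_le_right _ _)
      have hb1 : (extendCurve (X a) (t / 2)).1 ∈ Metric.ball u₀ (R / 4) := by
        rw [Metric.mem_ball, Prod.dist_eq, max_lt_iff] at hb
        exact hb.1
      have het := hes t ⟨ht2.1.le, ht2.2.le⟩
      refine ⟨?_, ?_, ?_⟩
      · rw [het]
        exact hRT (Metric.ball_subset_ball (by linarith) hb1)
      · filter_upwards [isOpen_Ioo.mem_nhds ht2] with τ hτ
        have h1 := (ContinuousLinearMap.fst ℝ E E).hasFDerivAt.comp_hasDerivAt τ (hdX τ hτ)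
        have h2 : HasDerivAt (fun τ => (extendCurve (X a) (τ / 2)).1)
            ((1 / 4 : ℝ) • (extendCurve (X a) (τ / 2)).2) τ := by
          refine h1.congr_deriv ?_
          simp only [ContinuousLinearMap.coe_fst', hf, Prod.smul_fst, smul_smul]
          norm_num
        refine h2.congr_of_eventuallyEq ?_
        filter_upwards [isOpen_Ioo.mem_nhds hτ] with τ' hτ'
        exact hes τ' ⟨hτ'.1.le, hτ'.2.le⟩
      · have h1 := ((ContinuousLinearMap.snd ℝ E E).hasFDerivAt.comp_hasDerivAt t
          (hdX t ht2)).const_smul (1 / 4 : ℝ)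
        refine h1.congr_deriv ?_
        simp only [ContinuousLinearMap.coe_snd', hf, Prod.smul_snd, smul_smul, smul_neg]
        rw [hg1 _ hb1, het, hq]
        norm_num

end SprayFlow

/-! ### Homogeneous frames -/

section Frames

variable {d : ℕ} {M : Type*} [TopologicalSpace M] [ChartedSpace (Eu d) M]
  [IsManifold 𝓘(ℝ, Eu d) ∞ M] {φ : OpenPartialHomeomorph M (Eu d)}
  {Y : Fin d → ∀ x : M, TangentSpace 𝓘(ℝ, Eu d) x}

/-- The linear map that sends `z` to the coordinates in the chart `φ` of the tangent vector with
coefficients `z` with respect to the vector fields `Y`. -/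
def frameMap (φ : OpenPartialHomeomorph M (Eu d)) (Y : Fin d → ∀ x : M, TangentSpace 𝓘(ℝ, Eu d) x)
    (u : Eu d) : Eu d →L[ℝ] Eu d :=
  ∑ i, (EuclideanSpace.proj i : Eu d →L[ℝ] ℝ).smulRight (coordVec φ (φ.symm u) (Y i (φ.symm u)))

theorem frameMap_apply (u z : Eu d) :
    frameMap φ Y u z = coordVec φ (φ.symm u) (∑ i, z i • Y i (φ.symm u)) := by
  rw [frameMap, sum_apply, map_sum]
  refine Finset.sum_congr rfl fun i _ => ?_
  rw [map_smul]
  rfl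

theorem contDiffOn_frameMap {U : Set M} (hY : ∀ i, SmoothFieldOn (Y i) U) (hφ : φ ∈ charts d M) :
    ContDiffOn ℝ ∞ (frameMap φ Y) (φ.target ∩ φ.symm ⁻¹' U) := by
  refine ContDiffOn.sum fun i _ => ?_
  exact (ContinuousLinearMap.smulRightL ℝ (Eu d) (Eu d)
    (EuclideanSpace.proj i : Eu d →L[ℝ] ℝ)).contDiff.comp_contDiffOn ((hY i).contDiffOn_coordVec hφ)

theorem isUnit_frameMap_iff (hφ : φ ∈ charts d M) {u : Eu d} (hu : u ∈ φ.target) :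
    IsUnit (frameMap φ Y u) ↔ LinearIndependent ℝ fun i => Y i (φ.symm u) := by
  have hx := φ.map_target hu
  rw [ContinuousLinearMap.isUnit_iff_bijective, Fintype.linearIndependent_iff]
  have h1 : Function.Bijective (frameMap φ Y u) ↔ Function.Injective (frameMap φ Y u) :=
    ⟨fun h => h.1, fun h => ⟨h, (frameMap φ Y u).toLinearMap.injective_iff_surjective.1 h⟩⟩
  have h2 : Function.Injective (frameMap φ Y u) ↔ ∀ z, frameMap φ Y u z = 0 → z = 0 :=
    injective_iff_map_eq_zero _
  rw [h1, h2]
  constructor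
  · intro h g hg i
    have := h (WithLp.toLp 2 g) (by
      rw [frameMap_apply]
      change coordVec φ (φ.symm u) (∑ i, g i • Y i (φ.symm u)) = 0
      rw [hg, map_zero])
    exact congrArg (fun z : Eu d => z i) this
  · intro h z hz
    rw [frameMap_apply, ← map_zero (coordVec φ (φ.symm u))] at hz
    have := h (fun i => z i) (coordVec_injective hφ hx hz)
    ext i
    exact this i

/-- Near every point there is a homogeneous frame of the graded bundle. -/
theorem exists_homogeneous_frame [T2Space M] {F : LieFiltration d M} (S : F.Splitting) (x₀ : M) :
    ∃ (deg : Fin d → Fin F.depth) (frame : Fin d → ∀ x : M, F.Osc x),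
      (∀ x i k, k ≠ deg i → frame i x k = 0) ∧
      (∀ i, SmoothFieldOn (fun x => S.ψ x (frame i x)) univ) ∧
      LinearIndependent ℝ fun i => frame i x₀ := by
  classical
  have hF := fun k : Fin F.depth => F.exists_frame ((k : ℕ) + 1) x₀
  choose U hU hxU Y hYs hY using hF
  choose χ hχ hχs hχ1 using fun k => exists_smooth_bump (d := d) (hU k) (hxU k)
  have hmem : ∀ (k : Fin F.depth) (i : Fin (F.rank ((k : ℕ) + 1))) (x : M),
      χ k x • Y k i x ∈ F.H ((k : ℕ) + 1) x := fun k i x => by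
    by_cases hx : x ∈ U k
    · refine Submodule.smul_mem _ _ ?_
      rw [← (hY k x hx).2]
      exact Submodule.subset_span ⟨i, rfl⟩
    · have : χ k x = 0 := image_eq_zero_of_notMem_tsupport fun h => hx (hχs k h)
      rw [this, zero_smul]
      exact Submodule.zero_mem _
  let Z : ∀ (k : Fin F.depth), Fin (F.rank ((k : ℕ) + 1)) → ∀ x, F.H ((k : ℕ) + 1) x :=
    fun k i x => ⟨χ k x • Y k i x, hmem k i x⟩
  let fam : (Σ k : Fin F.depth, Fin (F.rank ((k : ℕ) + 1))) → ∀ x, F.Osc x :=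
    fun j x => Pi.single j.1 (Submodule.Quotient.mk (Z j.1 j.2 x))
  have hχx : ∀ k, χ k x₀ = 1 := fun k => (hχ1 k).self_of_nhds
  have hspan : Submodule.span ℝ (range fun j => fam j x₀) = ⊤ := by
    rw [eq_top_iff]
    intro w _
    rw [← Finset.univ_sum_single w]
    refine Submodule.sum_mem _ fun k _ => ?_
    obtain ⟨v, hv⟩ := Submodule.Quotient.mk_surjective _ (w k)
    rw [← hv]
    have hv1 : (v : TangentSpace 𝓘(ℝ, Eu d) x₀) ∈ Submodule.span ℝ (range fun i => Y k i x₀) := by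
      rw [(hY k x₀ (hxU k)).2]; exact v.2
    obtain ⟨c, hc⟩ := (Submodule.mem_span_range_iff_exists_fun ℝ).1 hv1
    have hvZ : v = ∑ i, c i • Z k i x₀ := by
      apply Subtype.ext
      rw [← hc, Submodule.coe_sum]
      refine Finset.sum_congr rfl fun i _ => ?_
      change _ = c i • (χ k x₀ • Y k i x₀)
      rw [hχx, one_smul]
    let ℓ : F.H ((k : ℕ) + 1) x₀ →ₗ[ℝ] F.Osc x₀ :=
      (LinearMap.single ℝ (fun k : Fin F.depth => F.Gr k x₀) k).comp (Submodule.mkQ _)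
    have : (Pi.single k (Submodule.Quotient.mk v) : F.Osc x₀) = ℓ v := rfl
    rw [this, hvZ, map_sum]
    refine Submodule.sum_mem _ fun i _ => ?_
    rw [map_smul]
    exact Submodule.smul_mem _ _ (Submodule.subset_span ⟨⟨k, i⟩, rfl⟩)
  obtain ⟨κ, a, ha, hsp, hli⟩ := exists_linearIndependent' ℝ fun j => fam j x₀
  have := Finite.of_injective a ha
  have := Fintype.ofFinite κ
  rw [hspan] at hsp
  have hfr : Module.finrank ℝ (F.Osc x₀) = d := by
    rw [(S.ψ x₀).finrank_eq]
    exact finrank_euclideanSpace_fin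
  have hcard : Fintype.card κ = d := by
    rw [← hfr]
    exact (Module.finrank_eq_card_basis (Module.Basis.mk hli hsp.ge)).symm
  let eq : Fin d ≃ κ := (finCongr hcard.symm).trans (Fintype.equivFin κ).symm
  refine ⟨fun i => (a (eq i)).1, fun i => fam (a (eq i)), fun x i k hk => ?_, fun i => ?_,
    hli.comp eq eq.injective⟩
  · exact Pi.single_eq_of_ne hk _
  · exact S.smooth _ (Z (a (eq i)).1 (a (eq i)).2) ((hYs _ _).bump (hU _) (hχ _) (hχs _))

end Frames

/-! ### Existence of exponential charts -/

section ExistsExpChart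

variable {d : ℕ} {M : Type*} [TopologicalSpace M] [ChartedSpace (Eu d) M]
  [IsManifold 𝓘(ℝ, Eu d) ∞ M]

theorem spray_smul
    (cov : CovariantDerivative 𝓘(ℝ, Eu d) (Eu d) (fun x : M => TangentSpace 𝓘(ℝ, Eu d) x))
    (φ : OpenPartialHomeomorph M (Eu d)) (u v : Eu d) (a : ℝ) :
    spray cov φ (u, a • v) = a ^ 2 • spray cov φ (u, v) := by
  simp only [spray, chartField_smul, map_smul, PiLp.smul_apply, Finset.smul_sum, smul_smul]
  refine Finset.sum_congr rfl fun b _ => ?_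
  congr 1
  simp only [smul_eq_mul]
  ring

/-- Around every point there is an exponential chart. -/
theorem exists_expChart [T2Space M] {F : LieFiltration d M} {S : F.Splitting}
    (nab : GradedConnection S) (x₀ : M) : ∃ c : ExpChart nab, x₀ ∈ c.φ.source := by
  set φ₀ := chartAt (Eu d) x₀ with hφ₀
  have hφ : φ₀ ∈ charts d M := IsManifold.chart_mem_maximalAtlas x₀
  have hx₀ : x₀ ∈ φ₀.source := mem_chart_source (Eu d) x₀
  set u₀ := φ₀ x₀ with hu₀
  have hu₀t : u₀ ∈ φ₀.target := φ₀.map_source hx₀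
  obtain ⟨deg, frame, hdeg, hfs, hfi⟩ := exists_homogeneous_frame S x₀
  obtain ⟨E, N, hN, hN0, hE, hflow⟩ := exists_spray_flow φ₀.open_target
    (contDiffOn_spray nab.cov nab.smooth hφ) (spray_smul nab.cov φ₀) hu₀t
  set Y : Fin d → ∀ x : M, TangentSpace 𝓘(ℝ, Eu d) x := fun i x => S.ψ x (frame i x) with hY
  set B := frameMap φ₀ Y with hB
  have hψ : ∀ (x : M) (z : Eu d), S.ψ x (∑ i, z i • frame i x) = ∑ i, z i • Y i x := fun x z => by
    rw [map_sum]
    exact Finset.sum_congr rfl fun i _ => map_smul _ _ _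
  have hBs : ContDiffOn ℝ ∞ B φ₀.target :=
    (contDiffOn_frameMap hfs hφ).mono fun u hu => ⟨hu, mem_univ _⟩
  have hBc : ContinuousAt B u₀ := (hBs.continuousOn _ hu₀t).continuousAt (φ₀.open_target.mem_nhds hu₀t)
  have hB0 : IsUnit (B u₀) := by
    rw [hB, isUnit_frameMap_iff hφ hu₀t, hu₀, φ₀.left_inv hx₀]
    exact hfi.map' (S.ψ x₀).toLinearMap (S.ψ x₀).ker
  set N' : Set (Eu d × Eu d) := {q | q.1 ∈ φ₀.target ∧ (q.1, B q.1 q.2) ∈ N} with hN'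
  have hBsm : ∀ q : Eu d × Eu d, q.1 ∈ φ₀.target →
      ContDiffAt ℝ ∞ (fun q : Eu d × Eu d => (q.1, B q.1 q.2)) q := fun q hq => by
    have h1 : ContDiffAt ℝ ∞ B q.1 := (hBs _ hq).contDiffAt (φ₀.open_target.mem_nhds hq)
    exact contDiffAt_fst.prodMk ((h1.comp q contDiffAt_fst).clm_apply contDiffAt_snd)
  have hN'o : IsOpen N' := by
    rw [isOpen_iff_mem_nhds]
    intro q hq
    filter_upwards [(φ₀.open_target.preimage continuous_fst).mem_nhds hq.1,
      (hBsm q hq.1).continuousAt (hN.mem_nhds hq.2)] with w h1 h2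
    exact ⟨h1, h2⟩
  have hN'0 : (u₀, (0 : Eu d)) ∈ N' := ⟨hu₀t, by simpa using hN0⟩
  set e : Eu d × Eu d → Eu d := fun q => E (q.1, B q.1 q.2) with he
  have hes : ∀ q ∈ N', ContDiffAt ℝ ∞ e q := fun q hq =>
    ((hE _ hq.2).contDiffAt (hN.mem_nhds hq.2)).comp q (hBsm q hq.1)
  have he0 : ∀ u z, (u, z) ∈ N' → e (u, 0) = u := fun u z h => by
    simp only [he, map_zero]
    exact (hflow _ _ h.2).1
  -- the derivative of `e` in the fibre direction
  have hder : ∀ q ∈ N', HasFDerivAt (fun z => e (q.1, z))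
      ((fderiv ℝ e q).comp (ContinuousLinearMap.inr ℝ (Eu d) (Eu d))) q.2 := fun q hq => by
    have h1 : HasFDerivAt e (fderiv ℝ e q) (q.1, q.2) :=
      ((hes q hq).differentiableAt (by simp)).hasFDerivAt
    exact h1.comp q.2 (hasFDerivAt_prodMk_right q.1 q.2)
  have hlin : ∀ z : Eu d, fderiv ℝ e (u₀, 0) (0, z) = B u₀ z := fun z => by
    have hN'z : ∀ᶠ t : ℝ in 𝓝 0, (u₀, t • z) ∈ N' := by
      have : ContinuousAt (fun t : ℝ => (u₀, t • z)) 0 := by fun_prop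
      exact this (hN'o.mem_nhds (by simpa using hN'0))
    obtain ⟨t, ht, ht0⟩ := (hN'z.filter_mono nhdsWithin_le_nhds).and
      (self_mem_nhdsWithin (s := {(0 : ℝ)}ᶜ)) |>.exists
    have ht0 : t ≠ 0 := ht0
    obtain ⟨-, V, hV0, hV⟩ := hflow _ _ ht.2
    have h1 := (hV 0 ⟨le_rfl, zero_le_one⟩).2.1.self_of_nhds
    rw [hV0] at h1
    have h2 : HasDerivAt (fun τ : ℝ => e (u₀, τ • t • z)) (fderiv ℝ e (u₀, 0) (0, t • z)) 0 := by
      have h3 := hder (u₀, 0) hN'0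
      have h4 : HasDerivAt (fun τ : ℝ => τ • t • z) (t • z) 0 := by
        simpa using (hasDerivAt_id (0 : ℝ)).smul_const (t • z)
      have h5 : HasFDerivAt (fun z => e (u₀, z)) ((fderiv ℝ e (u₀, 0)).comp
        (ContinuousLinearMap.inr ℝ (Eu d) (Eu d))) ((0 : ℝ) • t • z) := by simpa using h3
      have h10 := HasFDerivAt.comp_hasDerivAt (0 : ℝ) h5 h4
      exact h10
    have h6 : (fun τ : ℝ => e (u₀, τ • t • z)) = fun τ : ℝ => E (u₀, τ • B u₀ (t • z)) := by
      funext τ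
      simp only [he, map_smul]
    rw [h6] at h2
    have h7 := h2.unique h1
    have h8 : ((0 : Eu d), t • z) = t • ((0 : Eu d), z) := by simp
    have h9 : t • fderiv ℝ e (u₀, 0) (0, z) = t • B u₀ z := by
      rw [← map_smul, ← h8, ← map_smul]; exact h7
    exact smul_right_injective _ ht0 h9
  have hlin' : (fderiv ℝ e (u₀, 0)).comp (ContinuousLinearMap.inr ℝ (Eu d) (Eu d)) = B u₀ := by
    ext1 z
    exact hlin z
  have hunit : ∀ᶠ q in 𝓝 (u₀, (0 : Eu d)),
      IsUnit ((fderiv ℝ e q).comp (ContinuousLinearMap.inr ℝ (Eu d) (Eu d))) := by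
    have h1 : ContinuousAt (fderiv ℝ e) (u₀, 0) :=
      ((hes _ hN'0).fderiv_right (m := 0) (by simp)).continuousAt
    have h2 : ContinuousAt (fun q => (fderiv ℝ e q).comp (ContinuousLinearMap.inr ℝ (Eu d) (Eu d)))
        (u₀, 0) := h1.clm_comp continuousAt_const
    refine h2.eventually (Units.isOpen.mem_nhds ?_)
    change IsUnit ((fderiv ℝ e (u₀, 0)).comp (ContinuousLinearMap.inr ℝ (Eu d) (Eu d)))
    rw [hlin']
    exact hB0
  have hunitB : ∀ᶠ q in 𝓝 (u₀, (0 : Eu d)), IsUnit (B q.1) := by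
    have h1 : ContinuousAt (fun q : Eu d × Eu d => B q.1) (u₀, 0) :=
      ContinuousAt.comp (f := Prod.fst) (g := B) hBc continuousAt_fst
    exact h1.eventually (Units.isOpen.mem_nhds hB0)
  -- injectivity on the fibres
  obtain ⟨s, hs, hinj⟩ : ∃ s ∈ 𝓝 (u₀, (0 : Eu d)), ∀ u z z', (u, z) ∈ s → (u, z') ∈ s →
      e (u, z) = e (u, z') → z = z' := by
    obtain ⟨Bu, hBu⟩ := hB0
    set b : ℝ := ‖(↑Bu⁻¹ : Eu d →L[ℝ] Eu d)‖ with hb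
    have hb0 : 0 ≤ b := norm_nonneg _
    obtain ⟨c₀, hc₀⟩ : ∃ c₀ : NNReal, (c₀ : ℝ) = (b + 1)⁻¹ := ⟨⟨(b + 1)⁻¹, by positivity⟩, rfl⟩
    obtain ⟨s, hs, hap⟩ := ((hes _ hN'0).hasStrictFDerivAt (by simp)).approximates_deriv_on_nhds
      (c := c₀) (Or.inr (by
        rw [← NNReal.coe_pos, hc₀]; exact inv_pos.2 (by positivity)))
    refine ⟨s, hs, fun u z z' hz hz' hzz => ?_⟩
    have h1 := hap (u, z) hz (u, z') hz'
    rw [hc₀, hzz, sub_self, zero_sub, norm_neg] at h1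
    have h2 : ((u, z) - (u, z') : Eu d × Eu d) = (0, z - z') := by simp
    rw [h2, hlin, Prod.norm_mk, norm_zero, max_eq_right (norm_nonneg _)] at h1
    have h1' : ‖B u₀ (z - z')‖ ≤ (b + 1)⁻¹ * ‖z - z'‖ := h1
    have h3 : z - z' = (↑Bu⁻¹ : Eu d →L[ℝ] Eu d) (B u₀ (z - z')) := by
      rw [← hBu]
      have : ((↑Bu⁻¹ : Eu d →L[ℝ] Eu d) * (Bu : Eu d →L[ℝ] Eu d)) (z - z') = z - z' := by
        rw [Units.inv_mul]; rfl
      exact this.symm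
    have h4 : ‖z - z'‖ ≤ b * ((b + 1)⁻¹ * ‖z - z'‖) := by
      calc ‖z - z'‖ = ‖(↑Bu⁻¹ : Eu d →L[ℝ] Eu d) (B u₀ (z - z'))‖ := by rw [← h3]
        _ ≤ b * ‖B u₀ (z - z')‖ := ContinuousLinearMap.le_opNorm _ _
        _ ≤ _ := by gcongr
    have h5 : b * ((b + 1)⁻¹ * ‖z - z'‖) = ‖z - z'‖ - (b + 1)⁻¹ * ‖z - z'‖ := by
      field_simp; ring
    have h6 : 0 ≤ (b + 1)⁻¹ * ‖z - z'‖ := by positivity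
    have h7 : (b + 1)⁻¹ * ‖z - z'‖ = 0 := by linarith
    rcases mul_eq_zero.1 h7 with h8 | h8
    · exact absurd h8 (by positivity)
    · exact sub_eq_zero.1 (norm_eq_zero.1 h8)
  obtain ⟨K, L, hL, hK⟩ := ((hes _ hN'0).of_le (m := 1) (by simp)).exists_lipschitzOnWith
  have hall : ∀ᶠ q in 𝓝 (u₀, (0 : Eu d)), ((q ∈ N' ∧ q ∈ s) ∧ q ∈ L) ∧
      IsUnit ((fderiv ℝ e q).comp (ContinuousLinearMap.inr ℝ (Eu d) (Eu d))) ∧ IsUnit (B q.1) := by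
    filter_upwards [hN'o.mem_nhds hN'0, hs, hL, hunit, hunitB] with q h1 h2 h3 h4 h5
    exact ⟨⟨⟨h1, h2⟩, h3⟩, h4, h5⟩
  obtain ⟨r, hr, hball⟩ := Metric.eventually_nhds_iff_ball.1 hall
  have hball0 : ∀ u ∈ Metric.ball u₀ r, (u, (0 : Eu d)) ∈ Metric.ball (u₀, (0 : Eu d)) r := fun u hu => by
    rw [Metric.mem_ball, Prod.dist_eq, dist_self, max_lt_iff]
    exact ⟨hu, hr⟩
  have hDb : ∀ q : Eu d × Eu d, dist q.1 u₀ + (K + 1) * ‖q.2‖ < r →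
      q ∈ Metric.ball (u₀, (0 : Eu d)) r ∧ q.1 ∈ Metric.ball u₀ r := fun q hq => by
    have h1 : 0 ≤ (K : ℝ) * ‖q.2‖ := by positivity
    have h2 := norm_nonneg q.2
    have h3 := dist_nonneg (x := q.1) (y := u₀)
    have h4 : dist q.1 u₀ < r := by linarith
    refine ⟨?_, h4⟩
    rw [Metric.mem_ball, Prod.dist_eq, max_lt_iff, dist_zero_right]
    exact ⟨h4, by linarith⟩
  set φ : OpenPartialHomeomorph M (Eu d) := (φ₀.symm.restrOpen (Metric.ball u₀ r) Metric.isOpen_ball).symm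
    with hφdef
  have htarget : φ.target = φ₀.target ∩ Metric.ball u₀ r := rfl
  have hsource : φ.source = φ₀.source ∩ φ₀ ⁻¹' Metric.ball u₀ r := rfl
  have hcoe : ∀ x, φ x = φ₀ x := fun _ => rfl
  have hsymm : ∀ u, φ.symm u = φ₀.symm u := fun _ => rfl
  have hφc : φ ∈ charts d M := by
    rw [charts, IsManifold.mem_maximalAtlas_iff_contMDiffOn]
    exact ⟨(contMDiffOn_of_mem_maximalAtlas hφ).mono inter_subset_left,
      (contMDiffOn_symm_of_mem_maximalAtlas hφ).mono inter_subset_left⟩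
  -- The Lipschitz constant `K` keeps `e` inside the ball of radius `r`.
  set D : Set (Eu d × Eu d) := {q | dist q.1 u₀ + (K + 1) * ‖q.2‖ < r} with hD
  have hDN : ∀ q ∈ D, q ∈ N' := fun q hq => (hball q (hDb q hq).1).1.1.1
  have hDo : IsOpen D := isOpen_lt (by fun_prop) continuous_const
  have hDt : ∀ q ∈ D, e q ∈ φ.target := fun q hq => by
    have hq' := hDb q hq
    have h0 := hball0 q.1 hq'.2
    have h1 := hK.dist_le_mul q (hball q hq'.1).1.2 (q.1, 0) (hball _ h0).1.2
    rw [he0 q.1 q.2 (hDN q hq), Prod.dist_eq, dist_self, dist_zero_right,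
      max_eq_right (norm_nonneg _)] at h1
    have h2 : e q ∈ Metric.ball u₀ r := by
      rw [Metric.mem_ball]
      have h3 := dist_triangle (e q) q.1 u₀
      have h4 : dist q.1 u₀ + (K + 1) * ‖q.2‖ < r := hq
      have h5 := norm_nonneg q.2
      nlinarith
    refine ⟨?_, h2⟩
    exact (hball _ (hball0 _ h2)).1.1.1.1
  have hflow' : ∀ q ∈ D, ∃ V : ℝ → Eu d, V 0 = B q.1 q.2 ∧ ∀ t ∈ Icc (0 : ℝ) 1,
      e (q.1, t • q.2) ∈ φ₀.target ∧
        (∀ᶠ τ in 𝓝 t, HasDerivAt (fun τ => e (q.1, τ • q.2)) (V τ) τ) ∧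
          HasDerivAt V (-spray nab.cov φ₀ (e (q.1, t • q.2), V t)) t := fun q hq => by
    obtain ⟨-, V, hV0, hV⟩ := hflow _ _ (hDN q hq).2
    have h6 : ∀ τ : ℝ, E (q.1, τ • B q.1 q.2) = e (q.1, τ • q.2) := fun τ => by
      simp only [he, map_smul]
    simp only [h6] at hV
    exact ⟨V, hV0, hV⟩
  refine ⟨{ φ := φ, φ_mem := hφc, deg := deg, frame := frame
            frame_homogeneous := fun x _ i k hk => hdeg x i k hk
            frame_smooth := fun i => (hfs i).mono (subset_univ _)
            frame_indep := ?_
            D := D, isOpen_D := hDo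
            D_subset := fun q hq => ⟨(hDN q hq).1, (hDb q hq).2⟩
            zero_mem_D := fun u hu => ?_
            star_D := ?_
            e := fun q => φ₀.symm (e q)
            e_mapsTo := fun q hq => φ.map_target (hDt q hq)
            e_smooth := ?_
            e_zero := fun u hu => ?_
            e_velocity := ?_
            e_geodesic := ?_
            e_injOn := ?_
            e_immersive := ?_ }, ?_⟩
  · intro x hx
    have h1 : IsUnit (frameMap φ₀ Y (φ₀ x)) := (hball _ (hball0 _ hx.2)).2.2
    rw [isUnit_frameMap_iff hφ (φ₀.map_source hx.1), φ₀.left_inv hx.1] at h1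
    exact LinearIndependent.of_comp (S.ψ x).toLinearMap h1
  · have : dist u u₀ + (K + 1) * ‖(0 : Eu d)‖ < r := by
      rw [norm_zero, mul_zero, add_zero]; exact hu.2
    exact this
  · intro u z hz t ht
    have h1 : dist u u₀ + (K + 1) * ‖z‖ < r := hz
    have h2 : dist u u₀ + (K + 1) * ‖t • z‖ < r := by
      refine lt_of_le_of_lt ?_ h1
      rw [norm_smul, Real.norm_of_nonneg ht.1]
      gcongr
      exact mul_le_of_le_one_left (norm_nonneg _) ht.2
    exact h2
  · have h1 : ContMDiffOn 𝓘(ℝ, Eu d × Eu d) 𝓘(ℝ, Eu d) ∞ e D := fun q hq =>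
      (hes q (hDN q hq)).contMDiffAt.contMDiffWithinAt
    exact (contMDiffOn_symm_of_mem_maximalAtlas hφ).comp h1 fun q hq => (hDt q hq).1
  · change φ₀.symm (e (u, 0)) = φ₀.symm u
    rw [he0 u 0 (hball _ (hball0 u hu.2)).1.1.1]
  · intro q hq
    obtain ⟨V, hV0, hV⟩ := hflow' q hq
    have h0 := hV 0 ⟨le_rfl, zero_le_one⟩
    have h1 := hasVelocity_symm hφ h0.1 h0.2.1.self_of_nhds
    have hq1 : q.1 ∈ φ₀.target := (hDN q hq).1
    have h2 : chartField φ₀ (V 0) (φ₀.symm (e (q.1, (0 : ℝ) • q.2))) =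
        (S.ψ (φ₀.symm q.1) (∑ i, q.2 i • frame i (φ₀.symm q.1)) : Eu d) := by
      rw [zero_smul, he0 q.1 q.2 (hDN q hq), hV0, hB, frameMap_apply,
        chartField_coordVec hφ (φ₀.map_target hq1), hψ]
    rw [h2] at h1
    exact h1
  · intro q hq
    obtain ⟨V, hV0, hV⟩ := hflow' q hq
    exact isGeodesicOn_of_hasDerivAt hφ hV
  · rintro ⟨u, z⟩ hq ⟨u', z'⟩ hq' heq
    obtain ⟨rfl, h2⟩ := Prod.ext_iff.1 heq
    have h3 : e (u, z) = e (u, z') := φ₀.symm.injOn (hDt _ hq).1 (hDt _ hq').1 h2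
    rw [hinj u z z' (hball _ (hDb _ hq).1).1.1.2 (hball _ (hDb _ hq').1).1.1.2 h3]
  · intro q hq
    have h1 := (hder q (hDN q hq)).hasMFDerivAt
    have h2 : HasMFDerivAt 𝓘(ℝ, Eu d) 𝓘(ℝ, Eu d) φ₀.symm (e q)
        (mfderiv 𝓘(ℝ, Eu d) 𝓘(ℝ, Eu d) φ₀.symm (e q)) :=
      ((charts.mdifferentiable hφ).symm.mdifferentiableAt (hDt q hq).1).hasMFDerivAt
    have h3 := (HasMFDerivAt.comp q.2 h2 h1).mfderiv
    have h4 : Function.Bijective (mfderiv 𝓘(ℝ, Eu d) 𝓘(ℝ, Eu d) φ₀.symm (e q)) :=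
      (charts.mdifferentiable hφ).symm.mfderiv_bijective (hDt q hq).1
    have h5 : Function.Bijective ((fderiv ℝ e q).comp (ContinuousLinearMap.inr ℝ (Eu d) (Eu d))) :=
      ContinuousLinearMap.isUnit_iff_bijective.1 (hball _ (hDb q hq).1).2.1
    have h6 : mfderiv 𝓘(ℝ, Eu d) 𝓘(ℝ, Eu d) (fun z => φ₀.symm (e (q.1, z))) q.2 =
        (mfderiv 𝓘(ℝ, Eu d) 𝓘(ℝ, Eu d) φ₀.symm (e q)).comp
          ((fderiv ℝ e q).comp (ContinuousLinearMap.inr ℝ (Eu d) (Eu d))) := h3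
    rw [h6]
    exact h4.comp h5
  · exact ⟨hx₀, Metric.mem_ball_self hr⟩

end ExistsExpChart

/-! ### Transition maps between exponential charts -/

section ExpTransitions

variable {d : ℕ} {M : Type*} [TopologicalSpace M] [ChartedSpace (Eu d) M]
  [IsManifold 𝓘(ℝ, Eu d) ∞ M] {F : LieFiltration d M} {S : F.Splitting} {nab : GradedConnection S}

namespace ExpChart

variable (c c' : ExpChart nab)

/-- The element of the graded bundle with coordinates `z` in the frame of the chart. -/
def vec (x : M) (z : Eu d) : F.Osc x := ∑ i, z i • c.frame i x

/-- The frame of the chart, as a family of vector fields. -/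
def field (i : Fin d) (x : M) : TangentSpace 𝓘(ℝ, Eu d) x := S.ψ x (c.frame i x)

theorem ψ_vec (x : M) (z : Eu d) : S.ψ x (c.vec x z) = ∑ i, z i • c.field i x := by
  simp only [vec, field, map_sum, map_smul]

theorem field_indep {x : M} (hx : x ∈ c.φ.source) : LinearIndependent ℝ fun i => c.field i x :=
  (c.frame_indep x hx).map' (S.ψ x).toLinearMap (S.ψ x).ker

theorem vec_injective {x : M} (hx : x ∈ c.φ.source) : Function.Injective (c.vec x) := by
  intro z z' h
  have h1 := Fintype.linearIndependent_iff.1 (c.frame_indep x hx) (fun i => z i - z' i) (by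
    simp only [sub_smul, Finset.sum_sub_distrib]
    exact sub_eq_zero.2 h)
  ext i
  exact sub_eq_zero.1 (h1 i)

theorem dil_vec {x : M} (hx : x ∈ c.φ.source) (t : ℝ) (z : Eu d) :
    F.dil t x (c.vec x z) = c.vec x (dilE c.wt t z) := dil_sum_frame c hx t z

/-- The change of frame from the chart `c'` to the chart `c`, over the point with coordinate `u` in
the base chart of `c`. -/
def change (u : Eu d) : Eu d →L[ℝ] Eu d :=
  Ring.inverse (frameMap c.φ c.field u) * frameMap c.φ c'.field u

theorem isUnit_frameMap {u : Eu d} (hu : u ∈ c.φ.target) (hu' : c.φ.symm u ∈ c'.φ.source) :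
    IsUnit (frameMap c.φ c'.field u) :=
  (isUnit_frameMap_iff c.φ_mem hu).2 (c'.field_indep hu')

theorem vec_change {u : Eu d} (hu : u ∈ c.φ.target) (z : Eu d) :
    c.vec (c.φ.symm u) (c.change c' u z) = c'.vec (c.φ.symm u) z := by
  apply (S.ψ (c.φ.symm u)).injective
  apply coordVec_injective c.φ_mem (c.φ.map_target hu)
  rw [ψ_vec, ψ_vec, ← frameMap_apply, ← frameMap_apply]
  have h := Ring.mul_inverse_cancel _ (c.isUnit_frameMap c hu (c.φ.map_target hu))
  exact DFunLike.congr_fun (show frameMap c.φ c.field u * c.change c' u = _ by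
    rw [change, ← mul_assoc, h, one_mul]) z

theorem isUnit_change {u : Eu d} (hu : u ∈ c.φ.target) (hu' : c.φ.symm u ∈ c'.φ.source) :
    IsUnit (c.change c' u) := by
  obtain ⟨a, ha⟩ := c.isUnit_frameMap c hu (c.φ.map_target hu)
  rw [change, ← ha, Ring.inverse_unit]
  exact (Units.isUnit _).mul (c.isUnit_frameMap c' hu hu')

theorem contDiffAt_change {u : Eu d} (hu : u ∈ c.φ.target) (hu' : c.φ.symm u ∈ c'.φ.source) :
    ContDiffAt ℝ ∞ (c.change c') u := by
  have h : ∀ b : ExpChart nab, c.φ.symm u ∈ b.φ.source →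
      ContDiffAt ℝ ∞ (frameMap c.φ b.field) u := fun b hb =>
    (contDiffOn_frameMap b.frame_smooth c.φ_mem).contDiffAt
      ((c.φ.isOpen_inter_preimage_symm b.φ.open_source).mem_nhds ⟨hu, hb⟩)
  obtain ⟨a, ha⟩ := c.isUnit_frameMap c hu (c.φ.map_target hu)
  have h1 := contDiffAt_ringInverse ℝ (n := ∞) a
  rw [ha] at h1
  have h2 := ContDiffAt.comp u h1 (h c (c.φ.map_target hu))
  exact ContDiffAt.clm_comp h2 (h c' hu')

theorem change_dilE {u : Eu d} (hu : u ∈ c.φ.target) (hu' : c.φ.symm u ∈ c'.φ.source) (t : ℝ)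
    (z : Eu d) : c.change c' u (dilE c'.wt t z) = dilE c.wt t (c.change c' u z) := by
  apply c.vec_injective (c.φ.map_target hu)
  rw [vec_change c c' hu, ← c.dil_vec (c.φ.map_target hu), vec_change c c' hu,
    c'.dil_vec hu']

theorem dilE_zero_left (w : Fin d → ℕ) (z : Eu d) : dilE w 0 z = 0 := by
  ext i; simp [dilE_apply]

theorem dilE_injective (w : Fin d → ℕ) {t : ℝ} (ht : t ≠ 0) : Function.Injective (dilE w t) := by
  intro z z' h
  ext i
  have := congrArg (fun y : Eu d => y i) h
  simp only [dilE_apply] at this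
  exact mul_left_cancel₀ (pow_ne_zero _ ht) this

theorem dilE_dilE (w : Fin d → ℕ) (t t' : ℝ) (z : Eu d) :
    dilE w t (dilE w t' z) = dilE w (t * t') z := by
  ext i; simp [dilE_apply, mul_pow, mul_assoc]

theorem dilE_one (w : Fin d → ℕ) (z : Eu d) : dilE w 1 z = z := by
  ext i; simp [dilE_apply]

theorem mem_plot_dom {q : Coord d} :
    q ∈ c.plot.dom ↔ (q.1, dilE c.wt q.2.2 q.2.1) ∈ c.D := Iff.rfl

theorem plot_map_zero {q : Coord d} (h : q.2.2 = 0) :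
    c.plot.map q = HTangent.zero (c.φ.symm q.1) (c.vec (c.φ.symm q.1) q.2.1) := dif_pos h

theorem plot_map_pair {q : Coord d} (h : q.2.2 ≠ 0) :
    c.plot.map q = HTangent.pair (c.φ.symm q.1) (c.e (q.1, dilE c.wt q.2.2 q.2.1)) q.2.2 h :=
  dif_neg h

theorem r_plot (q : Coord d) : (c.plot.map q).r = (c.φ.symm q.1, q.2.2) := by
  by_cases h : q.2.2 = 0
  · rw [plot_map_zero c h, h]; rfl
  · rw [plot_map_pair c h]; rfl

theorem mem_target {q : Coord d} (hq : q ∈ c.plot.dom) : q.1 ∈ c.φ.target :=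
  c.D_subset _ hq

theorem injOn_plot : InjOn c.plot.map c.plot.dom := by
  rintro ⟨u, z, h⟩ hq ⟨u', z', h'⟩ hq' heq
  have h1 := congrArg HTangent.r heq
  rw [r_plot, r_plot, Prod.mk.injEq] at h1
  obtain ⟨h1, rfl⟩ := h1
  obtain rfl : u = u' := c.φ.symm.injOn (c.mem_target hq) (c.mem_target hq') h1
  by_cases h0 : h = 0
  · rw [plot_map_zero c h0, plot_map_zero c h0] at heq
    have := (HTangent.zero.inj heq).2
    have h4 : z = z' := c.vec_injective (c.φ.map_target (c.mem_target hq)) (eq_of_heq this)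
    rw [h4]
  · rw [plot_map_pair c h0, plot_map_pair c h0] at heq
    have h2 := (HTangent.pair.inj heq).2.1
    have h3 := c.e_injOn hq hq' (Prod.ext rfl h2)
    have h4 : z = z' := dilE_injective _ h0 (Prod.ext_iff.1 h3).2
    rw [h4]

/-- Exponential maps of two charts agree where both are defined, since both are given by
geodesics. -/
theorem e_eq_e [T2Space M] {q q' : Eu d × Eu d} (hq : q ∈ c.D) (hq' : q' ∈ c'.D)
    (hx : c.φ.symm q.1 = c'.φ.symm q'.1)
    (hv : c.vec (c.φ.symm q.1) q.2 = c'.vec (c.φ.symm q.1) q'.2) : c.e q = c'.e q' := by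
  have hs : ∀ (b : ExpChart nab) (p : Eu d × Eu d), p ∈ b.D →
      b.e (p.1, (0 : ℝ) • p.2) = b.φ.symm p.1 := fun b p hp => by
    rw [zero_smul, b.e_zero _ (b.D_subset p hp)]
  have hx0 : c.φ.symm q.1 ∈ c.φ.source := c.φ.map_target (c.D_subset q hq)
  have hd : ∀ (b : ExpChart nab) (p : Eu d × Eu d), p ∈ b.D → b.φ.symm p.1 ∈ c.φ.source →
      deriv (fun t : ℝ => c.φ (b.e (p.1, t • p.2))) 0 =
        coordVec c.φ (b.φ.symm p.1) (S.ψ (b.φ.symm p.1) (b.vec (b.φ.symm p.1) p.2)) :=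
    fun b p hp hb => by
    have h1 := hasDerivAt_of_hasVelocity (γ := fun t : ℝ => b.e (p.1, t • p.2)) c.φ_mem
      (by rw [hs b p hp]; exact hb) (b.e_velocity p hp)
    rw [h1.deriv]
    have : ∀ y : M, y = b.φ.symm p.1 → ∀ w : Eu d,
        coordVec c.φ y w = coordVec c.φ (b.φ.symm p.1) w := by rintro _ rfl w; rfl
    exact this _ (hs b p hp) _
  have h1 := IsGeodesicOn.eqOn nab.smooth (c.e_geodesic q hq) (c'.e_geodesic q' hq') c.φ_mem
    (by rw [hs c q hq]; exact hx0) (by rw [hs c q hq, hs c' q' hq', hx]) (by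
      rw [hd c q hq hx0, hd c' q' hq' (hx ▸ hx0), hv]
      have : ∀ y : M, y = c'.φ.symm q'.1 →
        coordVec c.φ y (S.ψ y (c'.vec y q'.2)) = coordVec c.φ (c'.φ.symm q'.1)
          (S.ψ (c'.φ.symm q'.1) (c'.vec (c'.φ.symm q'.1) q'.2)) := by rintro _ rfl; rfl
      exact this _ hx)
  have h2 := h1 (⟨zero_le_one, le_rfl⟩ : (1 : ℝ) ∈ Icc (0 : ℝ) 1)
  simpa using h2

/-- The transition from the exponential chart `c'` to `c` near the zero fibre. -/
def transZero (q : Coord d) : Coord d :=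
  (c.φ (c'.φ.symm q.1), c.change c' (c.φ (c'.φ.symm q.1)) q.2.1, q.2.2)

theorem plot_map_transZero [T2Space M] {q : Coord d} (hq : q ∈ c'.plot.dom)
    (hx : c'.φ.symm q.1 ∈ c.φ.source) (hD : c.transZero c' q ∈ c.plot.dom) :
    c.plot.map (c.transZero c' q) = c'.plot.map q := by
  have e0 : c.φ.symm (c.φ (c'.φ.symm q.1)) = c'.φ.symm q.1 := c.φ.left_inv hx
  have hu : c.φ (c'.φ.symm q.1) ∈ c.φ.target := c.φ.map_source hx
  have hx' : c.φ.symm (c.φ (c'.φ.symm q.1)) ∈ c'.φ.source := by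
    rw [e0]; exact c'.φ.map_target (c'.mem_target hq)
  by_cases h : q.2.2 = 0
  · rw [plot_map_zero c (q := c.transZero c' q) h, plot_map_zero c' h]
    change HTangent.zero (c.φ.symm (c.φ (c'.φ.symm q.1)))
      (c.vec (c.φ.symm (c.φ (c'.φ.symm q.1))) (c.change c' (c.φ (c'.φ.symm q.1)) q.2.1)) = _
    rw [vec_change c c' hu, e0]
  · rw [plot_map_pair c (q := c.transZero c' q) h, plot_map_pair c' h]
    have : c.e ((c.transZero c' q).1,
        dilE c.wt (c.transZero c' q).2.2 (c.transZero c' q).2.1) =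
        c'.e (q.1, dilE c'.wt q.2.2 q.2.1) := by
      refine e_eq_e c c' hD hq e0 ?_
      change c.vec (c.φ.symm (c.φ (c'.φ.symm q.1)))
        (dilE c.wt q.2.2 (c.change c' (c.φ (c'.φ.symm q.1)) q.2.1)) = _
      rw [← change_dilE c c' hu hx', vec_change c c' hu]
      rfl
    simp only [this]
    change HTangent.pair (c.φ.symm (c.φ (c'.φ.symm q.1))) _ q.2.2 h = _
    simp only [e0]

theorem contDiffAt_transZero {q : Coord d} (hq : q ∈ c'.plot.dom)
    (hx : c'.φ.symm q.1 ∈ c.φ.source) : ContDiffAt ℝ ∞ (c.transZero c') q := by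
  have hu' := c'.mem_target hq
  have h1 : ContDiffAt ℝ ∞ (fun u => c.φ (c'.φ.symm u)) q.1 := by
    have := (contMDiffOn_of_mem_maximalAtlas c.φ_mem).contMDiffAt (c.φ.open_source.mem_nhds hx)
    exact (this.comp q.1 ((contMDiffOn_symm_of_mem_maximalAtlas c'.φ_mem).contMDiffAt
      (c'.φ.open_target.mem_nhds hu'))).contDiffAt
  have h2 : ContDiffAt ℝ ∞ (fun q : Coord d => c.φ (c'.φ.symm q.1)) q :=
    ContDiffAt.comp (f := Prod.fst) q h1 contDiffAt_fst
  have h3 : ContDiffAt ℝ ∞ (c.change c') (c.φ (c'.φ.symm q.1)) :=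
    contDiffAt_change c c' (c.φ.map_source hx) (by
      rw [c.φ.left_inv hx]; exact c'.φ.map_target hu')
  exact h2.prodMk (((ContDiffAt.comp (f := fun q : Coord d => c.φ (c'.φ.symm q.1)) q h3 h2).clm_apply
    (contDiffAt_fst.comp q contDiffAt_snd)).prodMk (contDiffAt_snd.comp q contDiffAt_snd))

theorem transZero_mem {q : Coord d} (hx : c'.φ.symm q.1 ∈ c.φ.source) (h : q.2.2 = 0) :
    c.transZero c' q ∈ c.plot.dom := by
  change (c.φ (c'.φ.symm q.1), dilE c.wt q.2.2 _) ∈ c.D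
  rw [h, dilE_zero_left]
  exact c.zero_mem_D _ (c.φ.map_source hx)

theorem eventually_transZero [T2Space M] {q : Coord d} (hq : q ∈ c'.plot.dom)
    (hx : c'.φ.symm q.1 ∈ c.φ.source) (hD : c.transZero c' q ∈ c.plot.dom) :
    ∀ᶠ w in 𝓝 q, c.transZero c' w ∈ c.plot.dom ∧
      c.plot.map (c.transZero c' w) = c'.plot.map w := by
  have h1 : ∀ᶠ w : Coord d in 𝓝 q, c'.φ.symm w.1 ∈ c.φ.source :=
    ((c'.φ.continuousAt_symm (c'.mem_target hq)).comp continuousAt_fst).eventually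
      (c.φ.open_source.mem_nhds hx)
  filter_upwards [h1, c'.plot.isOpen_dom.mem_nhds hq,
    (contDiffAt_transZero c c' hq hx).continuousAt.eventually (c.plot.isOpen_dom.mem_nhds hD)]
    with w hw1 hw2 hw3
  exact ⟨hw3, plot_map_transZero c c' hw2 hw1 hw3⟩

end ExpChart

/-! ### Exponential charts are open embeddings -/

namespace HTangent

/-- Base point and end point of an element; both are the base point over the zero fibre. -/
def endpoints : HTangent F → M × M
  | zero x _ => (x, x)
  | pair x y _ _ => (x, y)

theorem eq_of_endpoints {γ γ' : HTangent F} (h : γ.r.2 = γ'.r.2) (h0 : γ.r.2 ≠ 0)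
    (he : γ.endpoints = γ'.endpoints) : γ = γ' := by
  cases γ with
  | zero x z => exact absurd rfl h0
  | pair x y t ht =>
    cases γ' with
    | zero x z => exact absurd h h0
    | pair x' y' t' ht' =>
      simp only [endpoints, Prod.mk.injEq] at he
      obtain ⟨rfl, rfl⟩ := he
      obtain rfl : t = t' := h
      rfl

end HTangent

/-- In a chart of the `H`-tangent groupoid `r` is the projection to the base, and the end points
depend smoothly on the coordinates. -/
structure IsFibredPlot (φ : OpenPartialHomeomorph M (Eu d))
    (q : Plot (Coord d) (HTangent F)) : Prop where
  chart : φ ∈ charts d M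
  target : ∀ v ∈ q.dom, v.1 ∈ φ.target
  r_eq : ∀ v, (q.map v).r = (φ.symm v.1, v.2.2)
  smooth : ContMDiffOn 𝓘(ℝ, Coord d) 𝓘(ℝ, Eu d) ∞
    (fun v => (q.map v).endpoints.2) q.dom

theorem IsFibredPlot.endpoints_fst {φ : OpenPartialHomeomorph M (Eu d)}
    {q : Plot (Coord d) (HTangent F)} (hq : IsFibredPlot φ q) (v : Coord d) :
    (q.map v).endpoints.1 = φ.symm v.1 := by
  have h := hq.r_eq v
  revert h
  cases q.map v with
  | zero x z => exact fun h => congrArg Prod.fst h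
  | pair x y t ht => exact fun h => congrArg Prod.fst h

theorem isFibredPlot_pairPlot {φ φ' : OpenPartialHomeomorph M (Eu d)} (hφ : φ ∈ charts d M)
    (hφ' : φ' ∈ charts d M) : IsFibredPlot φ (pairPlot F φ φ') where
  chart := hφ
  target v hv := hv.1
  r_eq v := by
    by_cases h : v.2.2 = 0
    · simp only [pairPlot, dif_pos h, HTangent.r]; rw [h]
    · simp only [pairPlot, dif_neg h, HTangent.r]
  smooth := by
    have h1 : ContMDiffOn 𝓘(ℝ, Coord d) 𝓘(ℝ, Eu d) ∞
        (fun v : Coord d => φ'.symm v.2.1) (pairPlot F φ φ').dom :=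
      (contMDiffOn_symm_of_mem_maximalAtlas hφ').comp
        (contDiff_fst.comp contDiff_snd).contMDiff.contMDiffOn fun v hv => hv.2.1
    refine h1.congr fun v hv => ?_
    have h : v.2.2 ≠ 0 := hv.2.2
    simp only [pairPlot, dif_neg h, HTangent.endpoints]

theorem contDiff_dilE (w : Fin d → ℕ) : ContDiff ℝ ∞ fun q : ℝ × Eu d => dilE w q.1 q.2 := by
  rw [contDiff_euclidean]
  intro i
  simp only [dilE_apply]
  exact (contDiff_fst.pow _).mul ((EuclideanSpace.proj i : Eu d →L[ℝ] ℝ).contDiff.comp contDiff_snd)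

namespace ExpChart

variable (c : ExpChart nab)

theorem isFibredPlot : IsFibredPlot c.φ c.plot where
  chart := c.φ_mem
  target _ hv := c.mem_target hv
  r_eq := c.r_plot
  smooth := by
    have h1 : ContMDiffOn 𝓘(ℝ, Coord d) 𝓘(ℝ, Eu d) ∞
        (fun v : Coord d => c.e (v.1, dilE c.wt v.2.2 v.2.1)) c.plot.dom :=
      c.e_smooth.comp (contDiff_fst.prodMk ((contDiff_dilE c.wt).comp
        ((contDiff_snd.comp contDiff_snd).prodMk
          (contDiff_fst.comp contDiff_snd)))).contMDiff.contMDiffOn fun v hv => hv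
    refine h1.congr fun v hv => ?_
    by_cases h : v.2.2 = 0
    · rw [plot_map_zero c h, h, dilE_zero_left, c.e_zero _ (c.mem_target hv)]; rfl
    · rw [plot_map_pair c h]; rfl

theorem endpoints_plot {v : Coord d} (hv : v ∈ c.plot.dom) :
    (c.plot.map v).endpoints = (c.φ.symm v.1, c.e (v.1, dilE c.wt v.2.2 v.2.1)) := by
  by_cases h : v.2.2 = 0
  · rw [plot_map_zero c h, h, dilE_zero_left, c.e_zero _ (c.mem_target hv)]; rfl
  · rw [plot_map_pair c h]; rfl

/-- The exponential map has smooth local inverses. -/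
theorem exists_localInverse {q : Eu d × Eu d} (hq : q ∈ c.D) :
    ∃ g : Eu d × Eu d → Eu d × Eu d, g (q.1, c.φ (c.e q)) = q ∧
      ContDiffAt ℝ ∞ g (q.1, c.φ (c.e q)) ∧
      ∀ᶠ y in 𝓝 (q.1, c.φ (c.e q)), ((g y).1, c.φ (c.e (g y))) = y := by
  set G : Eu d × Eu d → Eu d × Eu d := fun p => (p.1, c.φ (c.e p)) with hG
  have h1 : ContMDiffAt 𝓘(ℝ, Eu d × Eu d) 𝓘(ℝ, Eu d) ∞ (fun p => c.φ (c.e p)) q :=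
    ((contMDiffOn_of_mem_maximalAtlas c.φ_mem).contMDiffAt
      (c.φ.open_source.mem_nhds (c.e_mapsTo q hq))).comp q
      (c.e_smooth.contMDiffAt (c.isOpen_D.mem_nhds hq))
  have hGs : ContDiffAt ℝ ∞ G q := contDiffAt_fst.prodMk h1.contDiffAt
  have hder : HasFDerivAt G ((ContinuousLinearMap.fst ℝ (Eu d) (Eu d)).prod
      (fderiv ℝ (fun p => c.φ (c.e p)) q)) q :=
    hasFDerivAt_fst.prodMk (h1.contDiffAt.differentiableAt (by simp)).hasFDerivAt
  set A := (ContinuousLinearMap.fst ℝ (Eu d) (Eu d)).prod (fderiv ℝ (fun p => c.φ (c.e p)) q)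
  have hin : HasFDerivAt (fun z : Eu d => (q.1, z)) (ContinuousLinearMap.inr ℝ (Eu d) (Eu d)) q.2 :=
    hasFDerivAt_prodMk_right q.1 q.2
  have hvert : ∀ z : Eu d, fderiv ℝ (fun p => c.φ (c.e p)) q (0, z) =
      coordVec c.φ (c.e q)
        (mfderiv 𝓘(ℝ, Eu d) 𝓘(ℝ, Eu d) (fun z => c.e (q.1, z)) q.2 z) := by
    intro z
    have e1 : HasFDerivAt (fun z : Eu d => c.φ (c.e (q.1, z)))
        ((fderiv ℝ (fun p => c.φ (c.e p)) q).comp (ContinuousLinearMap.inr ℝ (Eu d) (Eu d))) q.2 :=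
      HasFDerivAt.comp (g := fun p => c.φ (c.e p)) q.2
        (h1.contDiffAt.differentiableAt (by simp)).hasFDerivAt hin
    have e2 : MDifferentiableAt 𝓘(ℝ, Eu d) 𝓘(ℝ, Eu d) (fun z => c.e (q.1, z)) q.2 := by
      have := (c.e_smooth.contMDiffAt (c.isOpen_D.mem_nhds hq)).mdifferentiableAt (by simp)
      exact MDifferentiableAt.comp (g := c.e) q.2 this hin.hasMFDerivAt.mdifferentiableAt
    have e3 : HasMFDerivAt 𝓘(ℝ, Eu d) 𝓘(ℝ, Eu d) (fun z : Eu d => c.φ (c.e (q.1, z))) q.2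
        ((coordVec c.φ (c.e q)).comp (mfderiv 𝓘(ℝ, Eu d) 𝓘(ℝ, Eu d) (fun z => c.e (q.1, z)) q.2)) :=
      HasMFDerivAt.comp (g := c.φ) q.2
        ((charts.mdifferentiable c.φ_mem).mdifferentiableAt (c.e_mapsTo q hq)).hasMFDerivAt
        e2.hasMFDerivAt
    have e4 := e1.unique (hasMFDerivAt_iff_hasFDerivAt.1 e3)
    exact DFunLike.congr_fun e4 z
  have hinj : Function.Injective A := by
    rw [injective_iff_map_eq_zero]
    rintro ⟨y, z⟩ h
    have e1 : y = 0 := (Prod.ext_iff.1 h).1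
    subst e1
    have e2 : fderiv ℝ (fun p => c.φ (c.e p)) q (0, z) = 0 := (Prod.ext_iff.1 h).2
    rw [hvert, ← map_zero (coordVec c.φ (c.e q))] at e2
    have e3 := coordVec_injective c.φ_mem (c.e_mapsTo q hq) e2
    have e4 : z = 0 := (c.e_immersive q hq).1 (e3.trans (map_zero _).symm)
    rw [e4]; rfl
  have hker : A.toLinearMap.ker = ⊥ := LinearMap.ker_eq_bot.2 hinj
  have hsurj : A.toLinearMap.range = ⊤ :=
    LinearMap.range_eq_top.2 (LinearMap.injective_iff_surjective.1 hinj)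
  set A' := ContinuousLinearEquiv.ofBijective A hker hsurj
  have hder' : HasFDerivAt G (A' : Eu d × Eu d →L[ℝ] Eu d × Eu d) q := by
    rw [ContinuousLinearEquiv.coe_ofBijective]; exact hder
  have hn : (∞ : WithTop ℕ∞) ≠ 0 := by simp
  refine ⟨hGs.localInverse hder' hn, ?_, hGs.to_localInverse hder' hn, ?_⟩
  · exact (hGs.hasStrictFDerivAt' hder' hn).localInverse_apply_image
  · exact (hGs.hasStrictFDerivAt' hder' hn).eventually_right_inverse

theorem mem_hAtlas : c.plot ∈ hAtlas nab := Or.inr ⟨c, rfl⟩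

end ExpChart

theorem exists_isFibredPlot {q : Plot (Coord d) (HTangent F)} (hq : q ∈ hAtlas nab) :
    ∃ φ, IsFibredPlot φ q := by
  obtain ⟨φ, hφ, φ', hφ', rfl⟩ | ⟨c, rfl⟩ := hq
  · exact ⟨φ, isFibredPlot_pairPlot hφ hφ'⟩
  · exact ⟨c.φ, c.isFibredPlot⟩

theorem exists_expChart_of_mem {q : Plot (Coord d) (HTangent F)} (hq : q ∈ hAtlas nab)
    {v : Coord d} (hv : v ∈ q.dom) (h : v.2.2 = 0) : ∃ c : ExpChart nab, q = c.plot := by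
  obtain ⟨φ, hφ, φ', hφ', rfl⟩ | ⟨c, rfl⟩ := hq
  · exact absurd h hv.2.2
  · exact ⟨c, rfl⟩

namespace ExpChart

variable (c : ExpChart nab)

theorem dilE_inv_cancel (w : Fin d → ℕ) {h : ℝ} (h0 : h ≠ 0) (z : Eu d) :
    dilE w h (dilE w h⁻¹ z) = z := by
  rw [dilE_dilE, mul_inv_cancel₀ h0, dilE_one]

/-- Over `h ≠ 0` the inverse of an exponential chart is smooth in all charts. -/
theorem transition_of_ne_zero {q : Plot (Coord d) (HTangent F)}
    {φ : OpenPartialHomeomorph M (Eu d)} (hq : IsFibredPlot φ q) {v p : Coord d}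
    (hv : v ∈ q.dom) (hp : p ∈ c.plot.dom) (hpv : c.plot.map p = q.map v) (h0 : v.2.2 ≠ 0) :
    ∃ θ : Coord d → Coord d, ContDiffAt ℝ ∞ θ v ∧
      ∀ᶠ w in 𝓝 v, θ w ∈ c.plot.dom ∧ c.plot.map (θ w) = q.map w := by
  obtain ⟨g, hg0, hgs, hg⟩ := c.exists_localInverse hp
  have hr : p.2.2 = v.2.2 := by
    have := congrArg (fun γ => (HTangent.r γ).2) hpv
    simpa only [c.r_plot, hq.r_eq] using this
  have hx : φ.symm v.1 = c.φ.symm p.1 := by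
    rw [← hq.endpoints_fst, ← hpv, c.endpoints_plot hp]
  have hy : (q.map v).endpoints.2 = c.e (p.1, dilE c.wt p.2.2 p.2.1) := by
    rw [← hpv, c.endpoints_plot hp]
  have hxs : φ.symm v.1 ∈ c.φ.source := hx ▸ c.φ.map_target (c.mem_target hp)
  have hys : (q.map v).endpoints.2 ∈ c.φ.source := hy ▸ c.e_mapsTo _ hp
  have hX : ContMDiffAt 𝓘(ℝ, Coord d) 𝓘(ℝ, Eu d) ∞
      (fun w : Coord d => φ.symm w.1) v :=
    ((contMDiffOn_symm_of_mem_maximalAtlas hq.chart).contMDiffAt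
      (φ.open_target.mem_nhds (hq.target v hv))).comp v contDiffAt_fst.contMDiffAt
  have hY := hq.smooth.contMDiffAt (q.isOpen_dom.mem_nhds hv)
  set y : Coord d → Eu d × Eu d := fun w =>
    (c.φ (φ.symm w.1), c.φ (q.map w).endpoints.2) with hydef
  have hc := fun {x : M} (hx : x ∈ c.φ.source) =>
    (contMDiffOn_of_mem_maximalAtlas c.φ_mem).contMDiffAt (c.φ.open_source.mem_nhds hx)
  have hys' : ContDiffAt ℝ ∞ y v :=
    (ContMDiffAt.comp (g := c.φ) v (hc hxs) hX).contDiffAt.prodMk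
      (ContMDiffAt.comp (g := c.φ) v (hc hys) hY).contDiffAt
  have hyv : y v = (p.1, c.φ (c.e (p.1, dilE c.wt p.2.2 p.2.1))) := by
    rw [hydef]
    refine Prod.ext ?_ ?_
    · change c.φ (φ.symm v.1) = p.1
      rw [hx, c.φ.right_inv (c.mem_target hp)]
    · change c.φ (q.map v).endpoints.2 = _
      rw [hy]
  rw [← hyv] at hg0 hgs hg
  have hgy : ContDiffAt ℝ ∞ (fun w => g (y w)) v := hgs.comp v hys'
  refine ⟨fun w => ((g (y w)).1, dilE c.wt w.2.2⁻¹ (g (y w)).2, w.2.2), ?_, ?_⟩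
  · have h1 : ContDiffAt ℝ ∞ (fun w : Coord d => w.2.2⁻¹) v :=
      (contDiffAt_snd.comp v contDiffAt_snd).inv h0
    exact (contDiffAt_fst.comp v hgy).prodMk
      (((contDiff_dilE c.wt).contDiffAt.comp v (h1.prodMk (contDiffAt_snd.comp v hgy))).prodMk
        (contDiffAt_snd.comp v contDiffAt_snd))
  · have e1 : ∀ᶠ w in 𝓝 v, g (y w) ∈ c.D :=
      hgy.continuousAt.eventually (c.isOpen_D.mem_nhds (by change g (y v) ∈ c.D; rw [hg0]; exact hp))
    have e2 : ∀ᶠ w : Coord d in 𝓝 v, w.2.2 ≠ 0 :=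
      (continuous_snd.comp continuous_snd).continuousAt.eventually_ne h0
    filter_upwards [e1, e2, q.isOpen_dom.mem_nhds hv, hys'.continuousAt.eventually hg,
      hX.continuousAt.eventually (c.φ.open_source.mem_nhds hxs),
      hY.continuousAt.eventually (c.φ.open_source.mem_nhds hys)] with w hw1 hw2 hw3 hw4 hw5 hw6
    have hmem : (((g (y w)).1, dilE c.wt w.2.2⁻¹ (g (y w)).2, w.2.2) : Coord d) ∈
        c.plot.dom := by
      change ((g (y w)).1, dilE c.wt w.2.2 (dilE c.wt w.2.2⁻¹ (g (y w)).2)) ∈ c.D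
      rw [dilE_inv_cancel _ hw2]; exact hw1
    refine ⟨hmem, HTangent.eq_of_endpoints ?_ ?_ ?_⟩
    · rw [c.r_plot, hq.r_eq]
    · rw [c.r_plot]; exact hw2
    · rw [c.endpoints_plot hmem]
      simp only [dilE_inv_cancel _ hw2]
      have e3 : (g (y w)).1 = c.φ (φ.symm w.1) := (Prod.ext_iff.1 hw4).1
      have e4 : c.φ (c.e (g (y w))) = c.φ (q.map w).endpoints.2 := (Prod.ext_iff.1 hw4).2
      refine Prod.ext ?_ ?_
      · rw [hq.endpoints_fst]
        change c.φ.symm (g (y w)).1 = _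
        rw [e3, c.φ.left_inv hw5]
      · exact c.φ.injOn (c.e_mapsTo _ hw1) hw6 e4

theorem tendsto_dilE (w : Fin d → ℕ) {ι : Type*} {l : Filter ι} {f : ι → ℝ} {z : ι → Eu d}
    {ζ : Eu d} {h : ℝ} (hh : Tendsto f l (𝓝 h)) (hz : Tendsto z l (𝓝 ζ)) :
    Tendsto (fun n => dilE w (f n) (z n)) l (𝓝 (dilE w h ζ)) := by
  have h1 := (continuous_dilE w).tendsto (ζ, h)
  have h2 := h1.comp (hz.prodMk_nhds hh)
  exact h2

theorem tendsto_of_tendsto_dilE (w : Fin d → ℕ) {ι : Type*} {l : Filter ι}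
    {p : ι → Coord d} {ζ : Eu d × Eu d} {h : ℝ} (h0 : h ≠ 0)
    (hh : Tendsto (fun n => (p n).2.2) l (𝓝 h))
    (hp : Tendsto (fun n => ((p n).1, dilE w (p n).2.2 (p n).2.1)) l (𝓝 ζ)) :
    Tendsto p l (𝓝 (ζ.1, dilE w h⁻¹ ζ.2, h)) := by
  have e1 : Tendsto (fun n => dilE w (p n).2.2 (p n).2.1) l (𝓝 ζ.2) :=
    (continuous_snd.tendsto ζ).comp hp
  have h1 := tendsto_dilE w (hh.inv₀ h0) e1
  have h2 : Tendsto (fun n => (p n).2.1) l (𝓝 (dilE w h⁻¹ ζ.2)) := by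
    refine h1.congr' ?_
    filter_upwards [hh.eventually_ne h0] with n hn
    rw [dilE_dilE, inv_mul_cancel₀ hn, dilE_one]
  have h3 : Tendsto (fun n => (p n).1) l (𝓝 ζ.1) := (continuous_fst.tendsto ζ).comp hp
  exact h3.prodMk_nhds (h2.prodMk_nhds hh)

/-- Limits of points in an exponential chart whose images converge in some chart. In particular the
coordinates `z` do not escape to infinity as `h` tends to `0`. -/
theorem tendsto_of_tendsto [T2Space M] {ι : Type*} {l : Filter ι} [l.NeBot]
    {q : Plot (Coord d) (HTangent F)} (hq : q ∈ hAtlas nab) {k p : ι → Coord d}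
    {k₀ : Coord d} {ζ : Eu d × Eu d} (hk₀ : k₀ ∈ q.dom) (hζ : ζ ∈ c.D)
    (hk : Tendsto k l (𝓝 k₀)) (hp : ∀ n, p n ∈ c.plot.dom) (hkp : ∀ n, c.plot.map (p n) = q.map (k n))
    (hpζ : Tendsto (fun n => ((p n).1, dilE c.wt (p n).2.2 (p n).2.1)) l (𝓝 ζ)) :
    ∃ p₀ ∈ c.plot.dom, Tendsto p l (𝓝 p₀) ∧ c.plot.map p₀ = q.map k₀ := by
  obtain ⟨φ, hφ⟩ := exists_isFibredPlot hq
  have hr : ∀ n, (p n).2.2 = (k n).2.2 := fun n => by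
    have := congrArg (fun γ => (HTangent.r γ).2) (hkp n)
    simpa only [c.r_plot, hφ.r_eq] using this
  have hx : ∀ n, c.φ.symm (p n).1 = φ.symm (k n).1 := fun n => by
    have := congrArg (fun γ => (HTangent.r γ).1) (hkp n)
    simpa only [c.r_plot, hφ.r_eq] using this
  have hp1 : Tendsto (fun n => (p n).1) l (𝓝 ζ.1) := (continuous_fst.tendsto _).comp hpζ
  have hkh : Tendsto (fun n => (k n).2.2) l (𝓝 k₀.2.2) :=
    ((continuous_snd.comp continuous_snd).tendsto _).comp hk
  have hζt := c.D_subset ζ hζ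
  have hx0 : c.φ.symm ζ.1 = φ.symm k₀.1 := by
    have h1 : Tendsto (fun n => c.φ.symm (p n).1) l (𝓝 (c.φ.symm ζ.1)) :=
      (c.φ.continuousAt_symm hζt).tendsto.comp hp1
    have h2 : Tendsto (fun n => φ.symm (k n).1) l (𝓝 (φ.symm k₀.1)) :=
      (φ.continuousAt_symm (hφ.target _ hk₀)).tendsto.comp
        ((continuous_fst.tendsto _).comp hk)
    simp only [← hx] at h2
    exact tendsto_nhds_unique h1 h2
  have hev : ∀ᶠ n in l, k n ∈ q.dom := hk.eventually (q.isOpen_dom.mem_nhds hk₀)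
  have hy0 : c.e ζ = (q.map k₀).endpoints.2 := by
    have h1 : Tendsto (fun n => c.e ((p n).1, dilE c.wt (p n).2.2 (p n).2.1)) l (𝓝 (c.e ζ)) :=
      (c.e_smooth.contMDiffAt (c.isOpen_D.mem_nhds hζ)).continuousAt.tendsto.comp hpζ
    have h2 : Tendsto (fun n => (q.map (k n)).endpoints.2) l (𝓝 (q.map k₀).endpoints.2) :=
      (hφ.smooth.contMDiffAt (q.isOpen_dom.mem_nhds hk₀)).continuousAt.tendsto.comp hk
    refine tendsto_nhds_unique h1 (h2.congr fun n => ?_)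
    rw [← hkp, c.endpoints_plot (hp n)]
  by_cases h0 : k₀.2.2 = 0
  · obtain ⟨c', rfl⟩ := exists_expChart_of_mem hq hk₀ h0
    have hs : c'.φ.symm k₀.1 ∈ c.φ.source := by
      have : φ.symm k₀.1 = c'.φ.symm k₀.1 := by
        rw [← hφ.endpoints_fst, c'.isFibredPlot.endpoints_fst]
      rw [← this, ← hx0]; exact c.φ.map_target hζt
    have hmem := c.transZero_mem c' hs h0
    refine ⟨c.transZero c' k₀, hmem, ?_, c.plot_map_transZero c' hk₀ hs hmem⟩
    have h1 : Tendsto (fun n => c.transZero c' (k n)) l (𝓝 (c.transZero c' k₀)) :=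
      (c.contDiffAt_transZero c' hk₀ hs).continuousAt.tendsto.comp hk
    refine h1.congr' ?_
    filter_upwards [hk.eventually (c.eventually_transZero c' hk₀ hs hmem)] with n hn
    exact c.injOn_plot hn.1 (hp n) (hn.2.trans (hkp n).symm)
  · have hmem : ((ζ.1, dilE c.wt k₀.2.2⁻¹ ζ.2, k₀.2.2) : Coord d) ∈ c.plot.dom := by
      change (ζ.1, dilE c.wt k₀.2.2 (dilE c.wt k₀.2.2⁻¹ ζ.2)) ∈ c.D
      rw [dilE_inv_cancel _ h0]; exact hζ
    refine ⟨(ζ.1, dilE c.wt k₀.2.2⁻¹ ζ.2, k₀.2.2), hmem, ?_, ?_⟩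
    · exact tendsto_of_tendsto_dilE c.wt h0 (by simpa only [hr] using hkh) hpζ
    · refine HTangent.eq_of_endpoints ?_ ?_ ?_
      · rw [c.r_plot, hφ.r_eq]
      · rw [c.r_plot]; exact h0
      · rw [c.endpoints_plot hmem]
        simp only [dilE_inv_cancel _ h0]
        exact Prod.ext (by rw [hφ.endpoints_fst]; exact hx0) hy0

theorem isGoodPlot [T2Space M] : IsGoodPlot (hAtlas nab) c.plot where
  injOn := c.injOn_plot
  transition q hq v hv := by
    rintro ⟨p, hp, hpv⟩
    by_cases h0 : v.2.2 = 0
    · obtain ⟨c', rfl⟩ := exists_expChart_of_mem hq hv h0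
      have hs : c'.φ.symm v.1 ∈ c.φ.source := by
        rw [← c'.isFibredPlot.endpoints_fst, ← hpv, c.isFibredPlot.endpoints_fst]
        exact c.φ.map_target (c.mem_target hp)
      exact ⟨_, c.contDiffAt_transZero c' hv hs,
        c.eventually_transZero c' hv hs (c.transZero_mem c' hs h0)⟩
    · obtain ⟨φ, hφ⟩ := exists_isFibredPlot hq
      exact c.transition_of_ne_zero hφ hv hp hpv h0
  closed q hq K hK hKc v hv hcl := by
    obtain ⟨k, hk, hkv⟩ := mem_closure_iff_seq_limit.1 hcl
    choose p hpK hpk using fun n => (hk n).2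
    obtain ⟨p₀, hp₀, σ, hσ, hlim⟩ := hK.tendsto_subseq hpK
    have hc : Continuous fun p : Coord d => (p.1, dilE c.wt p.2.2 p.2.1) :=
      continuous_fst.prodMk ((continuous_dilE c.wt).comp continuous_snd)
    obtain ⟨p₁, -, h1, h2⟩ := c.tendsto_of_tendsto hq (p := p ∘ σ) (k := k ∘ σ) hv (hKc hp₀)
      (hkv.comp hσ.tendsto_atTop) (fun n => hKc (hpK _)) (fun n => hpk _)
      ((hc.tendsto p₀).comp hlim)
    exact ⟨p₀, hp₀, by rw [tendsto_nhds_unique hlim h1]; exact h2⟩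

/-- The points `(u, z, h)` with `|h| ≤ R` for which `(u, δ_h z)` lies in `C`. -/
def slab (C : Set (Eu d × Eu d)) (R : ℝ) : Set (Coord d) :=
  {q | (q.1, dilE c.wt q.2.2 q.2.1) ∈ C ∧ |q.2.2| ≤ R}

theorem slab_subset {C : Set (Eu d × Eu d)} (hC : C ⊆ c.D) (R : ℝ) : c.slab C R ⊆ c.plot.dom :=
  fun _ hq => hC hq.1

theorem isCompact_slab {C : Set (Eu d × Eu d)} (hC : IsCompact C) (R ρ : ℝ) :
    IsCompact (c.slab C R ∩ {q | ‖q.2.1‖ ≤ ρ}) := by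
  have h1 : IsCompact ((Prod.fst '' C) ×ˢ (Metric.closedBall (0 : Eu d) ρ) ×ˢ Icc (-R) R) :=
    (hC.image continuous_fst).prod ((isCompact_closedBall _ _).prod isCompact_Icc)
  refine h1.of_isClosed_subset ?_ ?_
  · refine (IsClosed.inter ?_ ?_).inter ?_
    · exact hC.isClosed.preimage
        (continuous_fst.prodMk ((continuous_dilE c.wt).comp continuous_snd))
    · exact isClosed_le (continuous_snd.comp continuous_snd).abs continuous_const
    · exact isClosed_le (continuous_fst.comp continuous_snd).norm continuous_const
  · rintro ⟨u, z, h⟩ ⟨⟨h1, h2⟩, h3⟩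
    exact ⟨⟨_, h1, rfl⟩, by simpa using h3, abs_le.1 h2⟩

/-- A compact set in a chart meets each slab in a set on which `z` is bounded. -/
theorem exists_bound_slab [T2Space M] {C : Set (Eu d × Eu d)} (hC : IsCompact C) (hCD : C ⊆ c.D)
    (R : ℝ) {q : Plot (Coord d) (HTangent F)} (hq : q ∈ hAtlas nab)
    {K : Set (Coord d)} (hK : IsCompact K) (hKq : K ⊆ q.dom) :
    ∃ ρ : ℝ, ∀ p ∈ c.slab C R, c.plot.map p ∈ q.map '' K → ‖p.2.1‖ ≤ ρ := by
  by_contra! hcon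
  choose p hp hpK hpn using fun n : ℕ => hcon n
  choose k hk hkp using hpK
  obtain ⟨k₀, hk₀, σ, hσ, hlim⟩ := hK.tendsto_subseq hk
  obtain ⟨ζ, hζ, τ, hτ, hlim'⟩ := hC.tendsto_subseq fun n => (hp (σ n)).1
  obtain ⟨p₀, -, h1, -⟩ := c.tendsto_of_tendsto hq (p := p ∘ σ ∘ τ) (k := k ∘ σ ∘ τ) (hKq hk₀)
    (hCD hζ) (hlim.comp hτ.tendsto_atTop) (fun n => c.slab_subset hCD R (hp _))
    (fun n => (hkp _).symm) hlim'
  have h2 : Tendsto (fun n => ‖(p (σ (τ n))).2.1‖) atTop (𝓝 ‖p₀.2.1‖) :=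
    ((continuous_fst.comp continuous_snd).norm.tendsto p₀).comp h1
  have h3 : Tendsto (fun n => ‖(p (σ (τ n))).2.1‖) atTop atTop := by
    refine tendsto_atTop_mono (fun n => (hpn (σ (τ n))).le) ?_
    exact tendsto_natCast_atTop_atTop.comp (hσ.comp hτ).tendsto_atTop
  exact not_tendsto_nhds_of_tendsto_atTop h3 _ h2

end ExpChart

/-- The parametrization of `M × ℝ` given by a chart of `M`. -/
def cylPlot (φ : OpenPartialHomeomorph M (Eu d)) : Plot (Eu d × ℝ) (M × ℝ) :=
  ⟨φ.target ×ˢ univ, φ.open_target.prod isOpen_univ, fun q => (φ.symm q.1, q.2)⟩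

theorem cylPlot_mem {φ : OpenPartialHomeomorph M (Eu d)} (hφ : φ ∈ charts d M) :
    cylPlot φ ∈ cylAtlas d M := ⟨φ, hφ, rfl⟩

theorem isGoodPlot_cyl [T2Space M] {φ : OpenPartialHomeomorph M (Eu d)} (hφ : φ ∈ charts d M) :
    IsGoodPlot (cylAtlas d M) (cylPlot φ) where
  injOn := by
    rintro ⟨u, h⟩ hu ⟨u', h'⟩ hu' he
    have h1 : u = u' := φ.symm.injOn hu.1 hu'.1 (Prod.ext_iff.1 he).1
    have h2 : h = h' := (Prod.ext_iff.1 he).2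
    rw [h1, h2]
  transition := by
    rintro _ ⟨φ', hφ', rfl⟩ v hv ⟨p, hp, hpv⟩
    have hs : φ'.symm v.1 ∈ φ.source := by
      have : φ.symm p.1 = φ'.symm v.1 := (Prod.ext_iff.1 hpv).1
      rw [← this]; exact φ.map_target hp.1
    have h1 : ContDiffAt ℝ ∞ (fun u => φ (φ'.symm u)) v.1 := by
      have := (contMDiffOn_of_mem_maximalAtlas hφ).contMDiffAt (φ.open_source.mem_nhds hs)
      exact (this.comp v.1 ((contMDiffOn_symm_of_mem_maximalAtlas hφ').contMDiffAt
        (φ'.open_target.mem_nhds hv.1))).contDiffAt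
    refine ⟨fun w => (φ (φ'.symm w.1), w.2),
      (ContDiffAt.comp (f := Prod.fst) v h1 contDiffAt_fst).prodMk contDiffAt_snd, ?_⟩
    have h2 : ∀ᶠ w : Eu d × ℝ in 𝓝 v, φ'.symm w.1 ∈ φ.source :=
      ((φ'.continuousAt_symm hv.1).comp continuousAt_fst).eventually (φ.open_source.mem_nhds hs)
    filter_upwards [h2] with w hw
    exact ⟨⟨φ.map_source hw, trivial⟩, Prod.ext (φ.left_inv hw) rfl⟩
  closed := by
    rintro _ ⟨φ', hφ', rfl⟩ K hK hKp v hv hcl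
    have hc : ContinuousOn (fun q : Eu d × ℝ => (φ.symm q.1, q.2)) K := fun q hq =>
      (((φ.continuousAt_symm (hKp hq).1).comp continuousAt_fst).prodMk
        continuousAt_snd).continuousWithinAt
    have hcl' : IsClosed ((fun q : Eu d × ℝ => (φ.symm q.1, q.2)) '' K) :=
      (hK.image_of_continuousOn hc).isClosed
    have hc' : ContinuousAt (fun q : Eu d × ℝ => (φ'.symm q.1, q.2)) v :=
      ((φ'.continuousAt_symm hv.1).comp continuousAt_fst).prodMk continuousAt_snd
    have h1 := hc'.continuousWithinAt.mem_closure_image hcl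
    exact hcl'.closure_subset_iff.2 (by rintro _ ⟨w, hw, rfl⟩; exact hw.2) h1

end ExpTransitions

/-! ### Families of test functions and fibred distributions -/

section TestFamilies

variable {E : Type*} [NormedAddCommGroup E] [NormedSpace ℝ E]
variable {E' : Type*} [NormedAddCommGroup E'] [NormedSpace ℝ E']

theorem exists_bump [FiniteDimensional ℝ E] {K U : Set E} (hK : IsCompact K) (hU : IsOpen U)
    (hKU : K ⊆ U) : ∃ χ : E → ℂ, ContDiff ℝ ∞ χ ∧ HasCompactSupport χ ∧ tsupport χ ⊆ U ∧
      ∀ᶠ v in 𝓝ˢ K, χ v = 1 := by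
  have : ProperSpace E := FiniteDimensional.proper ℝ E
  obtain ⟨L, hL, hKL, hLU⟩ := exists_compact_between hK hU hKU
  obtain ⟨f, h1, h0, -⟩ := exists_contMDiffMap_one_nhds_of_subset_interior (n := ⊤) 𝓘(ℝ, E)
    hK.isClosed hKL
  have hsupp : Function.support (fun v => (f v : ℂ)) ⊆ L := fun v hv => by
    by_contra h
    exact hv (by simp [h0 v h])
  have hts : tsupport (fun v => (f v : ℂ)) ⊆ L := closure_minimal hsupp hL.isClosed
  refine ⟨fun v => (f v : ℂ), Complex.ofRealCLM.contDiff.comp f.contMDiff.contDiff,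
    hL.of_isClosed_subset (isClosed_tsupport _) hts, hts.trans hLU, ?_⟩
  filter_upwards [h1] with v hv
  rw [hv, Complex.ofReal_one]

theorem exists_bound_iteratedFDeriv {F : E → ℂ} (hF : ContDiff ℝ ∞ F) (hc : HasCompactSupport F)
    (i : ℕ) : ∃ a : ℝ, ∀ v, ‖iteratedFDeriv ℝ i F v‖ ≤ a := by
  obtain ⟨a, ha⟩ := (hc.iteratedFDeriv (𝕜 := ℝ) i).exists_bound_of_continuous
    (hF.continuous_iteratedFDeriv (m := i) (by exact_mod_cast le_top))
  exact ⟨a, ha⟩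

theorem norm_iteratedFDeriv_comp_clm_le {F : E → ℂ} (hF : ContDiff ℝ ∞ F) (A : E' →L[ℝ] E) (i : ℕ)
    (v : E') : ‖iteratedFDeriv ℝ i (fun v => F (A v)) v‖ ≤ ‖iteratedFDeriv ℝ i F (A v)‖ * ‖A‖ ^ i := by
  have h := A.iteratedFDeriv_comp_right hF v (i := i) (by exact_mod_cast le_top)
  change ‖iteratedFDeriv ℝ i (F ∘ A) v‖ ≤ _
  rw [h]
  refine (ContinuousMultilinearMap.norm_compContinuousLinearMap_le _ _).trans ?_
  simp

/-- All derivatives of the functions `F j` are bounded by exponentials of the weights `W j`. -/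
def ExpJets {ι : Type*} (W : ι → ℝ) (F : ι → E → ℂ) : Prop :=
  ∀ i : ℕ, ∃ a : ℝ, ∀ j v, ‖iteratedFDeriv ℝ i (F j) v‖ ≤ Real.exp (a * W j)

namespace ExpJets

variable {ι : Type*} {W : ι → ℝ} {F G : ι → E → ℂ}

theorem of_test (hW : ∀ j, 1 ≤ W j) {f : E → ℂ} (hf : ContDiff ℝ ∞ f) (hc : HasCompactSupport f) :
    ExpJets W fun _ : ι => f := by
  intro i
  obtain ⟨a, ha⟩ := exists_bound_iteratedFDeriv hf hc i
  refine ⟨|a|, fun j v => (ha v).trans ((le_abs_self a).trans ?_)⟩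
  have h1 : |a| ≤ |a| * W j := le_mul_of_one_le_right (abs_nonneg a) (hW j)
  linarith [Real.add_one_le_exp (|a| * W j)]

theorem comp (hF : ExpJets W F) (hFs : ∀ j, ContDiff ℝ ∞ (F j)) (A : ι → E' →L[ℝ] E) {b : ℝ}
    (hA : ∀ j, ‖A j‖ ≤ Real.exp (b * W j)) : ExpJets W fun j v => F j (A j v) := by
  intro i
  obtain ⟨a, ha⟩ := hF i
  refine ⟨a + i * b, fun j v => ?_⟩
  refine (norm_iteratedFDeriv_comp_clm_le (hFs j) (A j) i v).trans ?_
  have h1 : ‖A j‖ ^ i ≤ Real.exp (b * W j) ^ i := pow_le_pow_left₀ (norm_nonneg _) (hA j) i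
  have h2 : Real.exp ((a + i * b) * W j) = Real.exp (a * W j) * Real.exp (b * W j) ^ i := by
    rw [← Real.exp_nat_mul, ← Real.exp_add]; ring_nf
  rw [h2]
  exact mul_le_mul (ha j _) h1 (by positivity) (by positivity)

theorem mul (hW : ∀ j, 1 ≤ W j) (hF : ExpJets W F) (hG : ExpJets W G)
    (hFs : ∀ j, ContDiff ℝ ∞ (F j)) (hGs : ∀ j, ContDiff ℝ ∞ (G j)) :
    ExpJets W fun j v => F j v * G j v := by
  intro i
  choose a ha using hF
  choose b hb using hG
  set α := ∑ k ∈ Finset.range (i + 1), |a k|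
  set β := ∑ k ∈ Finset.range (i + 1), |b k|
  have hα : ∀ k ∈ Finset.range (i + 1), a k ≤ α := fun k hk => (le_abs_self _).trans
    (Finset.single_le_sum (f := fun k => |a k|) (fun _ _ => abs_nonneg _) hk)
  have hβ : ∀ k ∈ Finset.range (i + 1), b k ≤ β := fun k hk => (le_abs_self _).trans
    (Finset.single_le_sum (f := fun k => |b k|) (fun _ _ => abs_nonneg _) hk)
  refine ⟨i + α + β, fun j v => ?_⟩
  have hW0 : 0 ≤ W j := zero_le_one.trans (hW j)
  refine (norm_iteratedFDeriv_mul_le (hFs j) (hGs j) v (n := i) (by exact_mod_cast le_top)).trans ?_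
  calc _ ≤ ∑ k ∈ Finset.range (i + 1), (i.choose k : ℝ) * Real.exp (α * W j) * Real.exp (β * W j) := by
        refine Finset.sum_le_sum fun k hk => ?_
        have h1 := (ha k j v).trans (Real.exp_le_exp.2 (mul_le_mul_of_nonneg_right (hα k hk) hW0))
        have h2 := (hb (i - k) j v).trans (Real.exp_le_exp.2 (mul_le_mul_of_nonneg_right
          (hβ (i - k) (Finset.mem_range.2 (by omega))) hW0))
        gcongr
    _ = 2 ^ i * Real.exp (α * W j) * Real.exp (β * W j) := by
        rw [← Finset.sum_mul, ← Finset.sum_mul]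
        congr 2
        exact_mod_cast Nat.sum_range_choose i
    _ ≤ Real.exp (i * W j) * Real.exp (α * W j) * Real.exp (β * W j) := by
        have h3 : (2 : ℝ) ^ i ≤ Real.exp (i * W j) := by
          rw [Real.exp_nat_mul]
          exact pow_le_pow_left₀ (by norm_num) (by linarith [Real.add_one_le_exp (W j), hW j]) i
        gcongr
    _ = _ := by rw [← Real.exp_add, ← Real.exp_add]; ring_nf

theorem const_mul (hF : ExpJets W F) (hFs : ∀ j, ContDiff ℝ ∞ (F j)) {a : ι → ℂ} {b : ℝ}
    (ha : ∀ j, ‖a j‖ ≤ Real.exp (b * W j)) : ExpJets W fun j v => a j * F j v := by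
  intro i
  obtain ⟨c, hc⟩ := hF i
  refine ⟨b + c, fun j v => ?_⟩
  have : iteratedFDeriv ℝ i (fun v => a j * F j v) v = a j • iteratedFDeriv ℝ i (F j) v :=
    iteratedFDeriv_const_smul_apply (a := a j) ((hFs j).contDiffAt.of_le (by exact_mod_cast le_top))
  rw [this, norm_smul, add_mul, Real.exp_add]
  exact mul_le_mul (ha j) (hc j v) (norm_nonneg _) (by positivity)

end ExpJets

end TestFamilies

section Operators

variable {𝔼 : Type*} [NormedAddCommGroup 𝔼] [NormedSpace ℝ 𝔼] {X : Type*} {A : Set (Plot 𝔼 X)}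
variable {𝔹 : Type*} [NormedAddCommGroup 𝔹] [NormedSpace ℝ 𝔹] {Y : Type*} {B : Set (Plot 𝔹 Y)}
variable {p : Plot 𝔼 X}

/-- A smooth function that vanishes off the image of a compact set in the domain of a
parametrization is the push-forward of a test function. -/
theorem IsGoodPlot.exists_eq_push (hp : IsGoodPlot A p) (hpA : p ∈ A) (f : CInf A) {K : Set 𝔼}
    (hK : IsCompact K) (hKp : K ⊆ p.dom) (hf : ∀ x, f x ≠ 0 → x ∈ p.map '' K) :
    ∃ (F : 𝔼 → ℂ) (hF : IsTest p F), tsupport F ⊆ K ∧ f = hp.push hF ∧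
      ∀ v ∈ p.dom, F v = f (p.map v) := by
  classical
  set F : 𝔼 → ℂ := p.dom.indicator fun v => f (p.map v) with hF
  have hFv : ∀ v ∈ p.dom, F v = f (p.map v) := fun v hv => indicator_of_mem hv _
  have hsupp : Function.support F ⊆ K := fun v hv => by
    have hvd : v ∈ p.dom := by
      by_contra h
      exact hv (indicator_of_notMem h _)
    have h1 : f (p.map v) ≠ 0 := by rw [← hFv v hvd]; exact hv
    obtain ⟨w, hw, e⟩ := hf _ h1
    rw [← hp.injOn (hKp hw) hvd e]; exact hw
  have hts : tsupport F ⊆ K := closure_minimal hsupp hK.isClosed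
  have hFs : ContDiff ℝ ∞ F := by
    refine contDiff_iff_contDiffAt.2 fun v => ?_
    by_cases hv : v ∈ p.dom
    · refine (f.contDiffAt hpA hv).congr_of_eventuallyEq ?_
      filter_upwards [p.isOpen_dom.mem_nhds hv] with w hw
      exact hFv w hw
    · refine contDiffAt_const.congr_of_eventuallyEq (f := fun _ => (0 : ℂ)) ?_
      filter_upwards [hK.isClosed.isOpen_compl.mem_nhds fun h => hv (hKp h)] with w hw
      by_contra h
      exact hw (hsupp h)
  have hFt : IsTest p F := ⟨hFs, hK.of_isClosed_subset (isClosed_tsupport F) hts, hts.trans hKp⟩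
  refine ⟨F, hFt, hts, CInf.ext fun x => ?_, hFv⟩
  by_cases hx : x ∈ p.map '' p.dom
  · obtain ⟨v, hv, rfl⟩ := hx
    rw [hp.push_map hFt hv, hFv v hv]
  · rw [hp.push_of_notMem hFt hx]
    by_contra h
    exact hx (image_mono hKp (hf x h))

/-- A family of operators that is continuous at `s₀` grows at most exponentially, locally uniformly
near `s₀`, on test functions whose derivatives grow at most exponentially: otherwise suitable
multiples of some of the test functions form a bounded set on which the operators near `s₀` are
unbounded. -/
theorem exists_exp_bound {T : ℂ → CInf A →L[ℂ] CInf B} {s₀ : ℂ} (hT : ContinuousAt T s₀)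
    (hp : IsGoodPlot A p) {K : Set 𝔼} (hK : IsCompact K) (hKp : K ⊆ p.dom) {F : ℕ → 𝔼 → ℂ}
    (hF : ∀ n, IsTest p (F n)) (hFK : ∀ n, tsupport (F n) ⊆ K)
    (hj : ExpJets (fun n : ℕ => (n : ℝ) + 1) F) {q : Plot 𝔹 Y} (hq : q ∈ B) {L : Set 𝔹}
    (hL : IsCompact L) (hsub : L ⊆ q.dom) :
    ∃ R > 0, ∃ C : ℝ, ∀ n, ∀ z ∈ Metric.ball s₀ R, ∀ y ∈ L,
      ‖T z (hp.push (hF n)) (q.map y)‖ ≤ Real.exp (C * (n + 1)) := by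
  by_contra! hcon
  have h1 := fun j : ℕ => hcon ((j : ℝ) + 1)⁻¹ (by positivity) (2 * j)
  choose n s hs y hy hbig using h1
  set a : ℕ → ℝ := fun j => Real.exp (-(j * ((n j : ℝ) + 1))) with ha
  have ha0 : ∀ j, 0 < a j := fun j => Real.exp_pos _
  have hG : ∀ j, IsTest p fun v => (a j : ℂ) * F (n j) v := fun j =>
    (hF (n j)).smooth_mul (η := fun _ => (a j : ℂ)) contDiff_const
  have hbd : Bornology.IsVonNBounded ℂ (range fun j => hp.push (hG j)) := by
    refine hp.isVonNBounded_push hK hKp hG (fun j => ?_) fun i => ?_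
    · exact (tsupport_mul_subset_right).trans (hFK (n j))
    · obtain ⟨c, hc⟩ := hj i
      obtain ⟨N, hN⟩ := exists_nat_ge c
      have hle : ∀ j v, ‖iteratedFDeriv ℝ i (fun v => (a j : ℂ) * F (n j) v) v‖ ≤
          Real.exp ((c - j) * ((n j : ℝ) + 1)) := fun j v => by
        have e : iteratedFDeriv ℝ i (fun v => (a j : ℂ) * F (n j) v) v =
            (a j : ℂ) • iteratedFDeriv ℝ i (F (n j)) v :=
          iteratedFDeriv_const_smul_apply (a := (a j : ℂ))
            ((hF (n j)).contDiff.contDiffAt.of_le (by exact_mod_cast le_top))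
        rw [e, norm_smul, Complex.norm_real, Real.norm_of_nonneg (ha0 j).le]
        calc _ ≤ a j * Real.exp (c * ((n j : ℝ) + 1)) :=
              mul_le_mul_of_nonneg_left (hc _ _) (ha0 j).le
          _ = _ := by rw [ha, ← Real.exp_add]; ring_nf
      refine ⟨1 + ∑ j ∈ Finset.range N, Real.exp ((c - j) * ((n j : ℝ) + 1)), fun j v => ?_⟩
      refine (hle j v).trans ?_
      have hpos : ∀ j ∈ Finset.range N, 0 ≤ Real.exp ((c - j) * ((n j : ℝ) + 1)) :=
        fun j _ => (Real.exp_pos _).le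
      by_cases hjN : j < N
      · have := Finset.single_le_sum hpos (Finset.mem_range.2 hjN)
        linarith
      · have hcj : c - j ≤ 0 := by
          have : (N : ℝ) ≤ j := by exact_mod_cast not_lt.1 hjN
          linarith
        have h2 : Real.exp ((c - j) * ((n j : ℝ) + 1)) ≤ 1 :=
          Real.exp_le_one_iff.2 (mul_nonpos_of_nonpos_of_nonneg hcj (by positivity))
        linarith [Finset.sum_nonneg hpos]
  obtain ⟨C, hC⟩ := exists_bound_of_continuousAt hT hbd hq hL hsub
  have hslim : Tendsto s atTop (𝓝 s₀) := by
    rw [tendsto_iff_dist_tendsto_zero]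
    have h0 : Tendsto (fun j : ℕ => ((j : ℝ) + 1)⁻¹) atTop (𝓝 0) := by
      simpa using tendsto_one_div_add_atTop_nhds_zero_nat (𝕜 := ℝ)
    exact squeeze_zero (fun _ => dist_nonneg) (fun j => (hs j).le) h0
  obtain ⟨N, hN⟩ := exists_nat_gt C
  obtain ⟨j, hj1, hj2⟩ := ((hslim.eventually hC).and (eventually_ge_atTop N)).exists
  have h3 := hj1 _ ⟨j, rfl⟩ (y j) (hy j)
  simp only at h3
  rw [hp.push_const_mul (hF (n j)) _ (hG j), map_smul, CInf.smul_apply, norm_mul, Complex.norm_real,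
    Real.norm_of_nonneg (ha0 j).le] at h3
  have h4 : Real.exp (j * ((n j : ℝ) + 1)) < a j * ‖T (s j) (hp.push (hF (n j))) (q.map (y j))‖ := by
    have h5 := mul_lt_mul_of_pos_left (hbig j) (ha0 j)
    refine lt_of_eq_of_lt ?_ h5
    rw [ha, ← Real.exp_add]
    ring_nf
  have h6 : (j : ℝ) ≤ j * ((n j : ℝ) + 1) := le_mul_of_one_le_right (by positivity) (by linarith [Nat.cast_nonneg (α := ℝ) (n j)])
  have h7 : (N : ℝ) ≤ j := by exact_mod_cast hj2
  linarith [Real.add_one_le_exp (j * ((n j : ℝ) + 1))]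

end Operators

/-! ### Locality of fibred distributions -/

section Locality

variable {𝔼 : Type} [NormedAddCommGroup 𝔼] [NormedSpace ℝ 𝔼] {X : Type*} {A : Set (Plot 𝔼 X)}
variable {𝔹 : Type} [NormedAddCommGroup 𝔹] [NormedSpace ℝ 𝔹] {Y : Type*} {B : Set (Plot 𝔹 Y)}
variable {p : Plot 𝔼 X} {q : Plot 𝔹 Y}

/-- Functions that vanish on the fibre over a point are combinations of functions pulled back from
the base that vanish at the point. -/
theorem exists_eq_sum_of_vanish [FiniteDimensional ℝ 𝔹] [FiniteDimensional ℝ 𝔼] (π : 𝔼 →L[ℝ] 𝔹)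
    (σ : 𝔹 →L[ℝ] 𝔼) (hπσ : ∀ b, π (σ b) = b) {F : 𝔼 → ℂ} (hF : ContDiff ℝ ∞ F) {y₀ : 𝔹}
    (h0 : ∀ v, π v = y₀ → F v = 0) :
    ∃ (n : ℕ) (ℓ : Fin n → 𝔹 →L[ℝ] ℝ) (H : Fin n → 𝔼 → ℂ), (∀ j, ContDiff ℝ ∞ (H j)) ∧
      ∀ v, F v = ∑ j, (ℓ j (π v - y₀) : ℂ) * H j v := by
  set b := Module.finBasis ℝ 𝔹
  set γ : 𝔼 × ℝ → 𝔼 := fun r => r.1 - (1 - r.2) • σ (π r.1 - y₀) with hγ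
  have hγs : ContDiff ℝ ∞ γ := by
    refine contDiff_fst.sub ((contDiff_const.sub contDiff_snd).smul ?_)
    exact σ.contDiff.comp ((π.contDiff.comp contDiff_fst).sub contDiff_const)
  have hDF : ContDiff ℝ ∞ (fderiv ℝ F) := hF.fderiv_right (m := ∞) (by simp)
  refine ⟨_, fun j => (b.coord j).toContinuousLinearMap,
    fun j v => ∫ t in (0 : ℝ)..1, fderiv ℝ F (γ (v, t)) (σ (b j)), fun j => ?_, fun v => ?_⟩
  · exact contDiff_parametric_integral (F := fun r : 𝔼 × ℝ => fderiv ℝ F (γ r) (σ (b j)))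
      ((hDF.comp hγs).clm_apply contDiff_const) 0 1
  · have hcont : ∀ w : 𝔼, Continuous fun t : ℝ => fderiv ℝ F (γ (v, t)) w := fun w =>
      ((hDF.continuous.comp hγs.continuous).comp (by fun_prop : Continuous fun t : ℝ => (v, t))).clm_apply
        continuous_const
    have hd : ∀ t : ℝ, HasDerivAt (fun t : ℝ => F (γ (v, t)))
        (fderiv ℝ F (γ (v, t)) (σ (π v - y₀))) t := fun t => by
      have h1 : HasDerivAt (fun t : ℝ => γ (v, t)) (σ (π v - y₀)) t := by
        have h2 := (((hasDerivAt_id t).const_sub 1).smul_const (σ (π v - y₀))).const_sub v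
        simpa [hγ] using h2
      exact ((hF.differentiable (by simp) _).hasFDerivAt).comp_hasDerivAt t h1
    have h3 := intervalIntegral.integral_eq_sub_of_hasDerivAt (fun t _ => hd t)
      ((hcont _).intervalIntegrable 0 1)
    have h4 : F (γ (v, 0)) = 0 := h0 _ (by simp [hγ, hπσ])
    have h5 : γ (v, 1) = v := by simp [hγ]
    simp only [h4, h5, sub_zero] at h3
    rw [← h3]
    have h6 : ∀ t : ℝ, fderiv ℝ F (γ (v, t)) (σ (π v - y₀)) =
        ∑ j, (b.coord j (π v - y₀) : ℂ) * fderiv ℝ F (γ (v, t)) (σ (b j)) := fun t => by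
      conv_lhs => rw [← b.sum_repr (π v - y₀)]
      simp only [map_sum, map_smul, Complex.real_smul, Module.Basis.coord_apply]
    simp only [h6]
    rw [intervalIntegral.integral_finsetSum fun j _ =>
      ((hcont _).const_mul _).intervalIntegrable 0 1]
    exact Finset.sum_congr rfl fun j _ => intervalIntegral.integral_const_mul _ _

/-- The value of a fibred distribution at a point depends only on the restriction of the test
function to the fibre over the point. -/
theorem FibredDist.apply_push_eq_zero [FiniteDimensional ℝ 𝔹] [FiniteDimensional ℝ 𝔼] {pr : X → Y}
    {T : CInf A →L[ℂ] CInf B} (hT : T ∈ FibredDist A B pr) (hp : IsGoodPlot A p)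
    (hq : IsGoodPlot B q) (π : 𝔼 →L[ℝ] 𝔹) (σ : 𝔹 →L[ℝ] 𝔼) (hπσ : ∀ b, π (σ b) = b)
    (hmap : ∀ v ∈ p.dom, π v ∈ q.dom ∧ pr (p.map v) = q.map (π v)) {F : 𝔼 → ℂ} (hF : IsTest p F)
    {y₀ : 𝔹} (hy₀ : y₀ ∈ q.dom) (h0 : ∀ v, π v = y₀ → F v = 0) :
    T (hp.push hF) (q.map y₀) = 0 := by
  obtain ⟨n, ℓ, H, hH, hsum⟩ := exists_eq_sum_of_vanish π σ hπσ hF.contDiff h0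
  obtain ⟨Θ, hΘs, hΘc, hΘp, hΘ1⟩ := exists_bump hF.compact p.isOpen_dom hF.subset
  have hΘ1' : ∀ v ∈ tsupport F, Θ v = 1 := fun v hv => hΘ1.self_of_nhdsSet v hv
  have hΘ : IsTest p Θ := ⟨hΘs, hΘc, hΘp⟩
  obtain ⟨β, hβs, hβc, hβq, hβ1⟩ := exists_bump ((show IsCompact (tsupport Θ) from hΘc).image
    π.continuous) q.isOpen_dom (by rintro _ ⟨v, hv, rfl⟩; exact (hmap v (hΘp hv)).1)
  have hβ1' : ∀ v ∈ tsupport Θ, β (π v) = 1 := fun v hv => hβ1.self_of_nhdsSet _ ⟨v, hv, rfl⟩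
  have hβ : IsTest q β := ⟨hβs, hβc, hβq⟩
  have hℓ : ∀ j, ContDiff ℝ ∞ fun y : 𝔹 => (ℓ j (y - y₀) : ℂ) := fun j =>
    Complex.ofRealCLM.contDiff.comp ((ℓ j).contDiff.comp (contDiff_id.sub contDiff_const))
  have hg : ∀ j, IsTest q fun y => (ℓ j (y - y₀) : ℂ) * β y := fun j => hβ.smooth_mul (hℓ j)
  have hHΘ : ∀ j, IsTest p fun v => H j v * Θ v := fun j => hΘ.smooth_mul (hH j)
  have hf' : ∀ j, IsTest p fun v => (ℓ j (π v - y₀) : ℂ) * (H j v * Θ v) := fun j =>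
    (hHΘ j).smooth_mul ((hℓ j).comp π.contDiff)
  have hkill : ∀ j, T (hp.push (hf' j)) (q.map y₀) = 0 := fun j => by
    rw [hT (hq.push (hg j)) (hp.push (hHΘ j)) (hp.push (hf' j)) (fun x => ?_)]
    · rw [hq.push_map (hg j) hy₀, sub_self, map_zero, Complex.ofReal_zero, zero_mul, zero_mul]
    · by_cases hx : x ∈ p.map '' p.dom
      · obtain ⟨v, hv, rfl⟩ := hx
        rw [hp.push_map _ hv, hp.push_map _ hv, (hmap v hv).2, hq.push_map _ (hmap v hv).1]
        by_cases hvΘ : v ∈ tsupport Θ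
        · rw [hβ1' v hvΘ, mul_one]
        · rw [image_eq_zero_of_notMem_tsupport hvΘ]; simp
      · rw [hp.push_of_notMem _ hx, hp.push_of_notMem _ hx, mul_zero]
  have hev : ∀ x, ∃ e : CInf A →+ ℂ, ∀ f, e f = f x := fun x =>
    ⟨⟨⟨fun f => f x, rfl⟩, fun _ _ => rfl⟩, fun _ => rfl⟩
  have heq : hp.push hF = ∑ j, hp.push (hf' j) := by
    refine CInf.ext fun x => ?_
    obtain ⟨e, he⟩ := hev x
    rw [← he (∑ j, hp.push (hf' j)), map_sum]
    simp only [he]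
    by_cases hx : x ∈ p.map '' p.dom
    · obtain ⟨v, hv, rfl⟩ := hx
      rw [hp.push_map _ hv]
      simp only [hp.push_map _ hv]
      by_cases hvF : v ∈ tsupport F
      · simp only [hΘ1' v hvF, mul_one]; exact hsum v
      · have h1 := hsum v
        rw [image_eq_zero_of_notMem_tsupport hvF] at h1 ⊢
        simp only [← mul_assoc, ← Finset.sum_mul, ← h1, zero_mul]
    · rw [hp.push_of_notMem _ hx]
      simp only [hp.push_of_notMem _ hx, Finset.sum_const_zero]
  obtain ⟨e, he⟩ : ∃ e : CInf B →+ ℂ, ∀ f, e f = f (q.map y₀) :=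
    ⟨⟨⟨fun f => f (q.map y₀), rfl⟩, fun _ _ => rfl⟩, fun _ => rfl⟩
  rw [heq, map_sum, ← he, map_sum]
  exact Finset.sum_eq_zero fun j _ => by rw [he, hkill j]

end Locality

/-! ### Dilations and the homogeneous dimension -/

section Dilations

variable {d : ℕ}

theorem det_dilE (w : Fin d → ℕ) (t : ℝ) :
    (dilE w t).det = t ^ ∑ i, (w i + 1) := by
  have h : LinearMap.toMatrix (EuclideanSpace.basisFun (Fin d) ℝ).toBasis
      (EuclideanSpace.basisFun (Fin d) ℝ).toBasis (dilE w t : Eu d →ₗ[ℝ] Eu d) =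
      Matrix.diagonal fun i => t ^ (w i + 1) := by
    ext i j
    rw [LinearMap.toMatrix_apply]
    simp only [OrthonormalBasis.coe_toBasis, OrthonormalBasis.coe_toBasis_repr_apply,
      EuclideanSpace.basisFun_apply, EuclideanSpace.basisFun_repr, ContinuousLinearMap.coe_coe,
      dilE_apply, Matrix.diagonal_apply, PiLp.single_apply]
    split_ifs with h1 <;> simp_all
  rw [ContinuousLinearMap.det, ← LinearMap.det_toMatrix
    (EuclideanSpace.basisFun (Fin d) ℝ).toBasis, h, Matrix.det_diagonal, Finset.prod_pow_eq_pow_sum]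

theorem integral_comp_dilE (w : Fin d → ℕ) {t : ℝ} (ht : 0 < t) (f : Eu d → ℂ) :
    ∫ z, f (dilE w t z) = (((t ^ ∑ i, (w i + 1))⁻¹ : ℝ) : ℂ) * ∫ z, f z := by
  have hdet : LinearMap.det (dilE w t : Eu d →ₗ[ℝ] Eu d) = t ^ ∑ i, (w i + 1) := det_dilE w t
  have hpos : 0 < t ^ ∑ i, (w i + 1) := pow_pos ht _
  have hmap := Measure.map_linearMap_addHaar_eq_smul_addHaar (volume : Measure (Eu d))
    (f := (dilE w t : Eu d →ₗ[ℝ] Eu d)) (by rw [hdet]; exact hpos.ne')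
  have hemb : MeasurableEmbedding (dilE w t) :=
    (LinearMap.isClosedEmbedding_of_injective (f := (dilE w t : Eu d →ₗ[ℝ] Eu d))
      (LinearMap.ker_eq_bot.2 (ExpChart.dilE_injective w ht.ne'))).measurableEmbedding
  have h1 := hemb.integral_map (μ := volume) f
  rw [← h1]
  change Measure.map (dilE w t) volume = _ at hmap
  rw [hmap, hdet, integral_smul_measure, abs_of_pos (inv_pos.2 hpos),
    ENNReal.toReal_ofReal (inv_pos.2 hpos).le, Complex.real_smul]

end Dilations

section HomogeneousDimension

variable {d : ℕ} {M : Type*} [TopologicalSpace M] [ChartedSpace (Eu d) M]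
  [IsManifold 𝓘(ℝ, Eu d) ∞ M] {F : LieFiltration d M} {S : F.Splitting} {nab : GradedConnection S}

theorem LieFiltration.finrank_H (F : LieFiltration d M) (j : ℕ) (x : M) :
    Module.finrank ℝ (F.H j x) = F.rank j := by
  obtain ⟨U, -, hx, Y, -, hY⟩ := F.exists_frame j x
  obtain ⟨h1, h2⟩ := hY x hx
  rw [← h2, finrank_span_eq_card h1, Fintype.card_fin]

instance finiteDimensional_tangentSpace (x : M) :
    FiniteDimensional ℝ (TangentSpace 𝓘(ℝ, Eu d) x) :=
  inferInstanceAs (FiniteDimensional ℝ (Eu d))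

theorem LieFiltration.finrank_Gr (F : LieFiltration d M) (k : ℕ) (x : M) :
    Module.finrank ℝ (F.Gr k x) = F.rank (k + 1) - F.rank k := by
  have h1 := Submodule.finrank_quotient_add_finrank ((F.H k x).submoduleOf (F.H (k + 1) x))
  have h2 := (Submodule.submoduleOfEquivOfLe (F.H_mono k x)).finrank_eq
  rw [h2, F.finrank_H, F.finrank_H] at h1
  exact Nat.eq_sub_of_add_eq h1

/-- The homogeneous dimension is the sum of the degrees of a homogeneous frame. -/
theorem ExpChart.homDim_eq (c : ExpChart nab) {x : M} (hx : x ∈ c.φ.source) :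
    F.homDim = ∑ i, (c.wt i + 1) := by
  classical
  have hcard : ∀ k : Fin F.depth, (Finset.univ.filter fun i => c.deg i = k).card ≤
      F.rank (k + 1) - F.rank k := fun k => by
    have hli : LinearIndependent ℝ fun i : {i // c.deg i = k} => c.frame i x k := by
      rw [Fintype.linearIndependent_iff]
      intro g hg
      have h1 := Fintype.linearIndependent_iff.1 ((c.frame_indep x hx).comp
        (Subtype.val : {i // c.deg i = k} → Fin d) Subtype.val_injective) g (by
          funext k'
          rw [Finset.sum_apply]
          by_cases hk : k' = k
          · subst hk; exact hg
          · refine Finset.sum_eq_zero fun i _ => ?_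
            change g i • c.frame i x k' = 0
            rw [c.frame_homogeneous x hx i k' (by rw [i.2]; exact hk), smul_zero])
      exact h1
    have h2 := hli.fintype_card_le_finrank
    rw [F.finrank_Gr, Fintype.card_subtype] at h2
    exact h2
  have hsum : ∑ k : Fin F.depth, (F.rank ((k : ℕ) + 1) - F.rank k) = d := by
    have h1 : Module.finrank ℝ (F.Osc x) = d := by
      rw [(S.ψ x).finrank_eq]
      exact finrank_euclideanSpace_fin
    rw [Module.finrank_pi_fintype] at h1
    simpa only [F.finrank_Gr] using h1
  have hsum' : ∑ k : Fin F.depth, (Finset.univ.filter fun i => c.deg i = k).card = d := by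
    rw [← Finset.card_eq_sum_card_fiberwise (fun i _ => Finset.mem_univ _), Finset.card_univ,
      Fintype.card_fin]
  have heq : ∀ k ∈ Finset.univ, (Finset.univ.filter fun i => c.deg i = k).card =
      F.rank ((k : ℕ) + 1) - F.rank k :=
    (Finset.sum_eq_sum_iff_of_le fun k _ => hcard k).1 (hsum'.trans hsum.symm)
  rw [LieFiltration.homDim, Finset.sum_range, ← Finset.sum_fiberwise Finset.univ c.deg]
  refine Finset.sum_congr rfl fun k hk => ?_
  rw [← heq k hk, Finset.sum_congr rfl (g := fun _ => (k : ℕ) + 1), Finset.sum_const, smul_eq_mul,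
    mul_comm]
  intro i hi
  rw [ExpChart.wt, (Finset.mem_filter.1 hi).2]

end HomogeneousDimension

/-! ### Kernels in an exponential chart -/

section KernelsInCharts

variable {d : ℕ} {M : Type*} [TopologicalSpace M] [T2Space M] [ChartedSpace (Eu d) M]
  [IsManifold 𝓘(ℝ, Eu d) ∞ M] {F : LieFiltration d M} {S : F.Splitting} {nab : GradedConnection S}

namespace ExpChart

variable (c : ExpChart nab) {f g : Coord d → ℂ}

open Classical in
/-- The value of the kernel `P` on the function that is `f` in the exponential chart, at the point
with coordinates `b`. -/
def ev (P : KernelDist nab) (f : Coord d → ℂ) (b : Eu d × ℝ) : ℂ :=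
  if hf : IsTest c.plot f then P.1 (c.isGoodPlot.push hf) (c.φ.symm b.1, b.2) else 0

theorem ev_eq (P : KernelDist nab) (hf : IsTest c.plot f) (b : Eu d × ℝ) :
    c.ev P f b = P.1 (c.isGoodPlot.push hf) (c.φ.symm b.1, b.2) := dif_pos hf

theorem ev_add_left (P Q : KernelDist nab) (hf : IsTest c.plot f) (b : Eu d × ℝ) :
    c.ev (P + Q) f b = c.ev P f b + c.ev Q f b := by
  rw [ev_eq c _ hf, ev_eq c _ hf, ev_eq c _ hf]; rfl

theorem ev_smul_left (a : ℂ) (P : KernelDist nab) (hf : IsTest c.plot f) (b : Eu d × ℝ) :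
    c.ev (a • P) f b = a * c.ev P f b := by
  rw [ev_eq c _ hf, ev_eq c _ hf]; rfl

theorem ev_add (P : KernelDist nab) (hf : IsTest c.plot f) (hg : IsTest c.plot g) (b : Eu d × ℝ) :
    c.ev P (fun v => f v + g v) b = c.ev P f b + c.ev P g b := by
  rw [ev_eq c _ (hf.add hg), ev_eq c _ hf, ev_eq c _ hg, c.isGoodPlot.push_add hf hg, map_add,
    CInf.add_apply]

theorem ev_const_mul (P : KernelDist nab) (hf : IsTest c.plot f) (a : ℂ) (b : Eu d × ℝ) :
    c.ev P (fun v => a * f v) b = a * c.ev P f b := by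
  rw [ev_eq c _ (hf.smooth_mul contDiff_const), ev_eq c _ hf,
    c.isGoodPlot.push_const_mul hf a (hf.smooth_mul contDiff_const), map_smul, CInf.smul_apply]

theorem ev_eq_zero (P : KernelDist nab) (hf : IsTest c.plot f) {b : Eu d × ℝ}
    (hb : b.1 ∈ c.φ.target) (h0 : ∀ z, f (b.1, z, b.2) = 0) : c.ev P f b = 0 := by
  rw [ev_eq c _ hf]
  refine FibredDist.apply_push_eq_zero (q := cylPlot c.φ) (y₀ := b) P.2 c.isGoodPlot
    (isGoodPlot_cyl c.φ_mem)
    ((ContinuousLinearMap.fst ℝ (Eu d) (Eu d × ℝ)).prod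
      ((ContinuousLinearMap.snd ℝ (Eu d) ℝ).comp (ContinuousLinearMap.snd ℝ (Eu d) (Eu d × ℝ))))
    ((ContinuousLinearMap.fst ℝ (Eu d) ℝ).prod
      ((0 : Eu d × ℝ →L[ℝ] Eu d).prod (ContinuousLinearMap.snd ℝ (Eu d) ℝ)))
    (fun b => rfl) (fun v hv => ⟨⟨c.mem_target hv, trivial⟩, c.r_plot v⟩) hf ⟨hb, trivial⟩ ?_
  rintro ⟨u, z, h⟩ hv
  obtain rfl : (u, h) = b := hv
  exact h0 z

/-- The value of a kernel at a point depends only on the test function along the fibre. -/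
theorem ev_congr (P : KernelDist nab) (hf : IsTest c.plot f) (hg : IsTest c.plot g) {b : Eu d × ℝ}
    (hb : b.1 ∈ c.φ.target) (h : ∀ z, f (b.1, z, b.2) = g (b.1, z, b.2)) :
    c.ev P f b = c.ev P g b := by
  have h1 := c.ev_eq_zero P (hf.add hg.neg) hb fun z => by rw [h z, add_neg_cancel]
  rw [c.ev_add P hf hg.neg] at h1
  have h2 := c.ev_const_mul P hg (-1) b
  simp only [neg_mul, one_mul] at h2
  rw [h2] at h1
  linear_combination h1

/-- The zoom action in the chart. -/
def scale (t : ℝ) : (Coord d) →L[ℝ] Coord d :=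
  (ContinuousLinearMap.fst ℝ (Eu d) (Eu d × ℝ)).prod
    (((dilE c.wt t).prodMap (t⁻¹ • ContinuousLinearMap.id ℝ ℝ)).comp
      (ContinuousLinearMap.snd ℝ (Eu d) (Eu d × ℝ)))

theorem scale_apply (t : ℝ) (v : Coord d) :
    c.scale t v = (v.1, dilE c.wt t v.2.1, t⁻¹ * v.2.2) := rfl

theorem scale_scale (t l : ℝ) (v : Coord d) :
    c.scale t (c.scale l v) = c.scale (t * l) v := by
  simp only [scale_apply, dilE_dilE, mul_inv, mul_assoc]

theorem scale_one (v : Coord d) : c.scale 1 v = v := by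
  simp [scale_apply, dilE_one]

theorem scale_injective {t : ℝ} (ht : t ≠ 0) : Function.Injective (c.scale t) := by
  intro v w h
  have := congrArg (c.scale t⁻¹) h
  rwa [scale_scale, scale_scale, inv_mul_cancel₀ ht, scale_one, scale_one] at this

theorem scale_mem {t : ℝ} (ht : 0 < t) {v : Coord d} :
    c.scale t v ∈ c.plot.dom ↔ v ∈ c.plot.dom := by
  change (v.1, dilE c.wt (t⁻¹ * v.2.2) (dilE c.wt t v.2.1)) ∈ c.D ↔ (v.1, dilE c.wt v.2.2 v.2.1) ∈ c.D
  rw [dilE_mul c.wt ht]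

theorem zoom_plot {t : ℝ} (ht : 0 < t) {v : Coord d} (hv : v ∈ c.plot.dom) :
    HTangent.zoom t ht (c.plot.map v) = c.plot.map (c.scale t v) := by
  by_cases h : v.2.2 = 0
  · rw [c.plot_map_zero h, c.plot_map_zero (q := c.scale t v) (by simp [scale_apply, h])]
    change HTangent.zero _ _ = HTangent.zero _ _
    rw [c.dil_vec (c.φ.map_target (c.mem_target hv))]
    rfl
  · have h1 : (c.scale t v).2.2 ≠ 0 := mul_ne_zero (inv_ne_zero ht.ne') h
    rw [c.plot_map_pair h, c.plot_map_pair h1]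
    simp only [HTangent.zoom, scale_apply, dilE_mul c.wt ht]

theorem _root_.Carnot.IsTest.scale (hf : IsTest c.plot f) {t : ℝ} (ht : 0 < t) :
    IsTest c.plot fun v => f (c.scale t v) := by
  have hemb := LinearMap.isClosedEmbedding_of_injective (f := (c.scale t).toLinearMap)
      (LinearMap.ker_eq_bot.2 (c.scale_injective ht.ne'))
  exact ⟨hf.contDiff.comp (c.scale t).contDiff, hf.compact.comp_isClosedEmbedding hemb,
    (tsupport_comp_subset_preimage f (c.scale t).continuous).trans fun v hv =>
      (c.scale_mem ht).1 (hf.subset hv)⟩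

theorem zoomPush_apply (P : KernelDist nab) (hf : IsTest c.plot f) {t : ℝ} (ht : 0 < t)
    (b : Eu d × ℝ) : c.ev (zoomPush t ht P) f b =
      c.ev P (fun v => f (c.scale t v)) (b.1, t * b.2) := by
  rw [ev_eq c _ hf, ev_eq c _ (hf.scale c ht)]
  suffices e : pull _ _ _ (isPlotLinear_zoom nab t ht) (c.isGoodPlot.push hf) =
      c.isGoodPlot.push (hf.scale c ht) by
    rw [← e]; rfl
  refine CInf.ext fun γ => ?_
  change c.isGoodPlot.push hf (HTangent.zoom t ht γ) = _
  by_cases hγ : γ ∈ c.plot.map '' c.plot.dom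
  · obtain ⟨v, hv, rfl⟩ := hγ
    rw [c.isGoodPlot.push_map _ hv, c.zoom_plot ht hv, c.isGoodPlot.push_map _ ((c.scale_mem ht).2 hv)]
  · rw [c.isGoodPlot.push_of_notMem _ hγ, c.isGoodPlot.push_of_notMem]
    rintro ⟨w, hw, e⟩
    refine hγ ⟨c.scale t⁻¹ w, (c.scale_mem (inv_pos.2 ht)).2 hw, ?_⟩
    rw [← c.zoom_plot (inv_pos.2 ht) hw, e]
    cases γ with
    | zero x z =>
      simp only [HTangent.zoom]
      congr 1
      funext k
      change (t⁻¹) ^ ((k : ℕ) + 1) • t ^ ((k : ℕ) + 1) • z k = z k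
      rw [smul_smul, ← mul_pow, inv_mul_cancel₀ ht.ne', one_pow, one_smul]
    | pair x y h hh =>
      simp only [HTangent.zoom, inv_inv, HTangent.pair.injEq, true_and]
      rw [← mul_assoc, mul_inv_cancel₀ ht.ne', one_mul]

theorem tendsto_ev {ι : Type*} {l : Filter ι} {T : ι → KernelDist nab} {T₀ : KernelDist nab}
    (hT : Tendsto T l (𝓝 T₀)) {b : Eu d × ℝ} (hb : b.1 ∈ c.φ.target) (f : Coord d → ℂ) :
    Tendsto (fun i => c.ev (T i) f b) l (𝓝 (c.ev T₀ f b)) := by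
  by_cases hf : IsTest c.plot f
  · simp only [ev_eq c _ hf]
    have h1 : Tendsto (fun i => (T i).1) l (𝓝 T₀.1) :=
      (continuous_subtype_val.tendsto T₀).comp hT
    exact (tendstoUniformlyOn_eval h1 (c.isGoodPlot.push hf) (cylPlot_mem c.φ_mem)
      (isCompact_singleton (x := b)) (singleton_subset_iff.2 ⟨hb, trivial⟩)).tendsto_at rfl
  · simp only [ev, dif_neg hf]
    exact tendsto_const_nhds

/-- The generator of the zoom action computes derivatives along its orbits. -/
theorem hasDerivAt_ev_scale {P : KernelDist nab}
    (hP : ∃ L, Tendsto (zoomSlope P) (𝓝[≠] (1 : ℝ)) (𝓝 L)) (hf : IsTest c.plot f) {b : Eu d × ℝ}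
    (hb : b.1 ∈ c.φ.target) {t : ℝ} (ht : 0 < t) :
    HasDerivAt (fun t : ℝ => c.ev P (fun v => f (c.scale t v)) (b.1, t * b.2))
      ((t : ℂ)⁻¹ * c.ev (lieZ P) (fun v => f (c.scale t v)) (b.1, t * b.2)) t := by
  have hlim : Tendsto (zoomSlope P) (𝓝[≠] (1 : ℝ)) (𝓝 (lieZ P)) := tendsto_nhds_limUnder hP
  have h1 : ∀ {f : Coord d → ℂ}, IsTest c.plot f → ∀ {b : Eu d × ℝ}, b.1 ∈ c.φ.target →
      HasDerivAt (fun t : ℝ => c.ev P (fun v => f (c.scale t v)) (b.1, t * b.2))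
        (c.ev (lieZ P) f b) 1 := fun {f} hf {b} hb => by
    rw [hasDerivAt_iff_tendsto_slope]
    refine (c.tendsto_ev hlim hb f).congr' ?_
    have hpos : ∀ᶠ l : ℝ in 𝓝[≠] 1, 0 < l :=
      eventually_nhdsWithin_of_eventually_nhds (lt_mem_nhds one_pos)
    filter_upwards [hpos] with l hl
    rw [zoomSlope, dif_pos hl, sub_eq_add_neg (zoomPush l hl P), ← neg_one_smul ℂ P, c.ev_smul_left _ _ hf,
      c.ev_add_left _ _ hf, c.ev_smul_left _ _ hf, c.zoomPush_apply P hf hl, slope_def_module,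
      Complex.real_smul]
    simp only [scale_one, one_mul, Prod.mk.eta]
    ring
  have h2 := h1 (hf.scale c ht) (b := (b.1, t * b.2)) hb
  have h3 : HasDerivAt (fun τ : ℝ => t⁻¹ * τ) t⁻¹ t := by
    simpa using (hasDerivAt_id t).const_mul t⁻¹
  have e1 : t⁻¹ * t = 1 := inv_mul_cancel₀ ht.ne'
  rw [← e1] at h2
  have h4 := h2.scomp t h3
  rw [Complex.real_smul, Complex.ofReal_inv] at h4
  refine h4.congr_of_eventuallyEq (Eventually.of_forall fun τ => ?_)
  simp only [Function.comp_apply, scale_scale]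
  have e2 : t * (t⁻¹ * τ) = τ := by rw [← mul_assoc, mul_inv_cancel₀ ht.ne', one_mul]
  have e3 : t⁻¹ * τ * (t * b.2) = τ * b.2 := by
    rw [mul_comm t⁻¹ τ, mul_assoc, ← mul_assoc t⁻¹, e1, one_mul]
  rw [e2, e3]

/-- Densities in the chart, as integrals over all of the model space. -/
theorem ev_eq_integral {K : KernelDist nab} {k : Coord d → ℂ}
    (hk : IsDensityOn K c.φ c.plot k) (hf : IsTest c.plot f) {b : Eu d × ℝ}
    (hb : b.1 ∈ c.φ.target) :
    c.ev K f b = ∫ z, k (b.1, z, b.2) * f (b.1, z, b.2) := by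
  rw [ev_eq c _ hf, hk _ (c.isGoodPlot.push_support hf) b.1 hb b.2]
  have h1 : ∀ z ∉ {z | (b.1, z, b.2) ∈ c.plot.dom}, k (b.1, z, b.2) * f (b.1, z, b.2) = 0 :=
    fun z hz => by
      rw [image_eq_zero_of_notMem_tsupport fun h => hz (hf.subset h), mul_zero]
  have hm : MeasurableSet {z | (b.1, z, b.2) ∈ c.plot.dom} :=
    (c.plot.isOpen_dom.preimage (by fun_prop : Continuous fun z : Eu d =>
      ((b.1, z, b.2) : Coord d))).measurableSet
  rw [← setIntegral_eq_integral_of_forall_compl_eq_zero h1]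
  refine setIntegral_congr_fun hm fun z hz => ?_
  rw [c.isGoodPlot.push_map hf hz]

theorem ev_scale_eq_integral {K : KernelDist nab} {k : Coord d → ℂ}
    (hk : IsDensityOn K c.φ c.plot k) (hf : IsTest c.plot f) {b : Eu d × ℝ}
    (hb : b.1 ∈ c.φ.target) {t : ℝ} (ht : 0 < t) :
    c.ev K (fun v => f (c.scale t v)) (b.1, t * b.2) =
      (((t ^ ∑ i, (c.wt i + 1))⁻¹ : ℝ) : ℂ) *
        ∫ z, k (c.scale t⁻¹ (b.1, z, b.2)) * f (b.1, z, b.2) := by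
  rw [c.ev_eq_integral hk (hf.scale c ht) (b := (b.1, t * b.2)) hb, ← integral_comp_dilE c.wt ht]
  refine integral_congr_ae (Eventually.of_forall fun z => ?_)
  simp only [scale_apply, dilE_dilE, inv_mul_cancel₀ ht.ne', dilE_one, inv_inv]
  rw [← mul_assoc, inv_mul_cancel₀ ht.ne', one_mul]

/-- Multiplication by a test function extends a function that is continuous on the domain. -/
theorem _root_.Carnot.IsTest.continuousAt_mul {𝔼 : Type*} [NormedAddCommGroup 𝔼] [NormedSpace ℝ 𝔼]
    {X : Type*} {p : Plot 𝔼 X} {f : 𝔼 → ℂ} (hf : IsTest p f) {Z : Type*} [TopologicalSpace Z]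
    {k : Z → ℂ} {θ : Z → 𝔼} {z : Z} (hθ : ContinuousAt θ z)
    (hk : θ z ∈ p.dom → ContinuousAt k z) : ContinuousAt (fun z => k z * f (θ z)) z := by
  by_cases h : θ z ∈ tsupport f
  · exact (hk (hf.subset h)).mul (hf.contDiff.continuous.continuousAt.comp hθ)
  · refine continuousAt_const.congr (f := fun _ => (0 : ℂ)) ?_
    filter_upwards [hθ.eventually ((isClosed_tsupport f).isOpen_compl.mem_nhds h)] with w hw
    rw [image_eq_zero_of_notMem_tsupport hw, mul_zero]

end ExpChart

/-! ### Proper supports and uniqueness of densities -/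

theorem CInf.continuousOn_jet {𝔼 : Type*} [NormedAddCommGroup 𝔼] [NormedSpace ℝ 𝔼] {X : Type*}
    {A : Set (Plot 𝔼 X)} (f : CInf A) {p : Plot 𝔼 X} (hp : p ∈ A) (k : ℕ) :
    ContinuousOn (iteratedFDeriv ℝ k (f ∘ p.map)) p.dom :=
  continuousOn_iff_continuous_domRestrict.2 (jet A ⟨p, hp⟩ k f).continuous

namespace ExpChart

variable (c : ExpChart nab) {f g : Coord d → ℂ}

/-- A kernel vanishes on test functions that are supported in a slab and far out in the direction of
`z`. Otherwise there would be such functions on which it takes arbitrarily large values, but only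
finitely many of them meet a given compact set. -/
theorem exists_ev_eq_zero (P : KernelDist nab) {C : Set (Eu d × Eu d)} (hC : IsCompact C)
    (hCD : C ⊆ c.D) (R : ℝ) : ∃ ρ : ℝ, ∀ f, IsTest c.plot f → tsupport f ⊆ c.slab C R →
      (∀ v ∈ tsupport f, ρ ≤ ‖v.2.1‖) → ∀ b : Eu d × ℝ, b.1 ∈ c.φ.target → c.ev P f b = 0 := by
  by_contra! hcon
  choose f hf hfs hfr b hb hne using fun n : ℕ => hcon n
  set L : Set (Eu d × ℝ) := (Prod.fst '' C) ×ˢ Icc (-R) R with hL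
  have hLc : IsCompact L := (hC.image continuous_fst).prod isCompact_Icc
  have hLt : L ⊆ (cylPlot c.φ).dom := by
    rintro ⟨u, h⟩ ⟨⟨q, hq, rfl⟩, -⟩
    exact ⟨c.D_subset q (hCD hq), trivial⟩
  have hbL : ∀ n, b n ∈ L := fun n => by
    by_contra h
    refine hne n (c.ev_eq_zero P (hf n) (hb n) fun z => ?_)
    by_contra hz
    have h1 := hfs n (subset_tsupport _ hz)
    exact h ⟨⟨_, h1.1, rfl⟩, abs_le.1 h1.2⟩
  set a : ℕ → ℂ := fun n => n / c.ev P (f n) (b n) with ha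
  have hG : ∀ n, IsTest c.plot fun v => a n * f n v := fun n =>
    (hf n).smooth_mul (η := fun _ => a n) contDiff_const
  have hbd : Bornology.IsVonNBounded ℂ (range fun n => c.isGoodPlot.push (hG n)) := by
    refine CInf.isVonNBounded_of_jets fun p hp k K hK hKp => ?_
    obtain ⟨K', hK', hKK', hK'p⟩ := exists_compact_between hK p.isOpen_dom hKp
    obtain ⟨ρ, hρ⟩ := c.exists_bound_slab hC hCD R hp hK' hK'p
    obtain ⟨N, hN⟩ := exists_nat_gt ρ
    have hfin : ∀ n, ∃ B : ℝ, ∀ u ∈ K,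
        ‖iteratedFDeriv ℝ k (c.isGoodPlot.push (hG n) ∘ p.map) u‖ ≤ B := fun n =>
      hK.exists_bound_of_continuousOn ((CInf.continuousOn_jet _ hp k).mono hKp)
    choose B hB using hfin
    refine ⟨∑ n ∈ Finset.range N, |B n|, ?_⟩
    rintro _ ⟨n, rfl⟩ u hu
    by_cases hn : n < N
    · exact ((hB n u hu).trans (le_abs_self _)).trans
        (Finset.single_le_sum (f := fun n => |B n|) (fun _ _ => abs_nonneg _) (Finset.mem_range.2 hn))
    · have h0 : (c.isGoodPlot.push (hG n) ∘ p.map) =ᶠ[𝓝 u] fun _ => 0 := by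
        filter_upwards [isOpen_interior.mem_nhds (hKK' hu)] with w hw
        by_contra hwne
        obtain ⟨v, ⟨hv, hvd⟩, e⟩ := IsGoodPlot.mem_of_pushFun_ne_zero
          (p := c.plot) (F := fun v => a n * f n v) (x := p.map w) hwne
        have hvs : v ∈ tsupport (f n) := subset_tsupport _ (right_ne_zero_of_mul hv)
        have h1 := hρ v (hfs n hvs) ⟨w, interior_subset hw, e.symm⟩
        have h2 := hfr n v hvs
        have h3 : (N : ℝ) ≤ n := by exact_mod_cast not_lt.1 hn
        linarith
      have h0' : iteratedFDeriv ℝ k (c.isGoodPlot.push (hG n) ∘ p.map) u = 0 :=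
        (h0.iteratedFDeriv (𝕜 := ℝ) k).self_of_nhds.trans (by rw [iteratedFDeriv_fun_zero]; rfl)
      rw [h0', norm_zero]
      exact Finset.sum_nonneg fun _ _ => abs_nonneg _
  obtain ⟨B, hB⟩ := exists_bound_of_continuousAt (T := fun _ : ℂ => P.1) (z₀ := 0)
    continuousAt_const hbd (cylPlot_mem c.φ_mem) hLc hLt
  have hB' := hB.self_of_nhds
  obtain ⟨n, hn⟩ := exists_nat_gt B
  have h1 := hB' _ ⟨n, rfl⟩ (b n) (hbL n)
  have h2 : P.1 (c.isGoodPlot.push (hG n)) ((cylPlot c.φ).map (b n)) = n := by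
    have h3 := c.ev_const_mul P (hf n) (a n) (b n)
    rw [c.ev_eq P (hG n)] at h3
    refine h3.trans ?_
    rw [ha, div_mul_cancel₀ _ (hne n)]
  simp only at h1
  rw [h2, Complex.norm_natCast] at h1
  linarith

/-- A continuous function that integrates to zero along the fibres against all test functions
supported in an open set vanishes there. -/
theorem eq_zero_of_integral_eq_zero {U : Set (Coord d)} (hU : IsOpen U)
    {k : Coord d → ℂ} (hk : ContinuousOn k U) {v : Coord d} (hv : v ∈ U)
    (h : ∀ f : Coord d → ℂ, ContDiff ℝ ∞ f → HasCompactSupport f → tsupport f ⊆ U →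
      ∫ z, k (v.1, z, v.2.2) * f (v.1, z, v.2.2) = 0) : k v = 0 := by
  obtain ⟨u, z₀, t⟩ := v
  set ι : Eu d → Coord d := fun z => (u, z, t) with hι
  have hιc : Continuous ι := by fun_prop
  set V : Set (Eu d) := ι ⁻¹' U with hV
  have hVo : IsOpen V := hU.preimage hιc
  have hkc : ContinuousOn (fun z => k (ι z)) V := hk.comp hιc.continuousOn fun z hz => hz
  have hae : ∀ᵐ z ∂volume, z ∈ V → k (ι z) = 0 := by
    refine hVo.ae_eq_zero_of_integral_contDiff_smul_eq_zero
      (hkc.locallyIntegrableOn hVo.measurableSet) fun g hg hgc hgs => ?_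
    obtain ⟨β, hβs, hβc, hβU, hβ1⟩ := exists_bump ((show IsCompact (tsupport g) from hgc).image hιc)
      hU (by rintro _ ⟨z, hz, rfl⟩; exact hgs hz)
    have h1 := h (fun v => (g v.2.1 : ℂ) * β v)
      ((Complex.ofRealCLM.contDiff.comp (hg.comp (contDiff_fst.comp contDiff_snd))).mul hβs)
      hβc.mul_left (tsupport_mul_subset_right.trans hβU)
    rw [← h1]
    refine integral_congr_ae (Eventually.of_forall fun z => ?_)
    by_cases hz : z ∈ tsupport g
    · simp only [Complex.real_smul]
      rw [hβ1.self_of_nhdsSet (u, z, t) ⟨z, hz, rfl⟩, mul_one, mul_comm]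
    · simp [image_eq_zero_of_notMem_tsupport hz]
  have h2 := Measure.eqOn_open_of_ae_eq (μ := volume) (f := fun z => k (ι z)) (g := fun _ => 0)
    ((ae_restrict_iff' hVo.measurableSet).2 hae) hVo hkc continuousOn_const
  exact h2 hv

theorem isDensityOn_iff {P : KernelDist nab} {a : Coord d → ℂ} :
    IsDensityOn P c.φ c.plot a ↔ ∀ f, IsTest c.plot f → ∀ b : Eu d × ℝ, b.1 ∈ c.φ.target →
      c.ev P f b = ∫ z, a (b.1, z, b.2) * f (b.1, z, b.2) := by
  refine ⟨fun h f hf b hb => c.ev_eq_integral h hf hb, fun h f hf u hu t => ?_⟩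
  obtain ⟨K, hK, hKp, hfK⟩ := hf
  obtain ⟨G, hG, -, rfl, hGv⟩ := c.isGoodPlot.exists_eq_push c.mem_hAtlas f hK hKp hfK
  have h1 := h G hG (u, t) hu
  rw [ev_eq c _ hG] at h1
  rw [h1]
  have h2 : ∀ z ∉ {z | (u, z, t) ∈ c.plot.dom}, a (u, z, t) * G (u, z, t) = 0 :=
    fun z hz => by
      rw [image_eq_zero_of_notMem_tsupport fun h => hz (hG.subset h), mul_zero]
  have hm : MeasurableSet {z | (u, z, t) ∈ c.plot.dom} :=
    (c.plot.isOpen_dom.preimage (by fun_prop : Continuous fun z : Eu d =>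
      ((u, z, t) : Coord d))).measurableSet
  rw [← setIntegral_eq_integral_of_forall_compl_eq_zero h2]
  exact setIntegral_congr_fun hm fun z hz => by rw [hGv _ hz]

theorem integrable_mul {a : Coord d → ℂ} (ha : ContinuousOn a c.plot.dom)
    (hf : IsTest c.plot f) (u : Eu d) (t : ℝ) :
    Integrable fun z => a (u, z, t) * f (u, z, t) := by
  have hιc : Continuous fun z : Eu d => ((u, z, t) : Coord d) := by fun_prop
  have hc : Continuous fun z => a (u, z, t) * f (u, z, t) :=
    continuous_iff_continuousAt.2 fun z => hf.continuousAt_mul hιc.continuousAt fun hz =>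
      ContinuousAt.comp (g := a) (ha.continuousAt (c.plot.isOpen_dom.mem_nhds hz)) hιc.continuousAt
  refine hc.integrable_of_hasCompactSupport ?_
  refine HasCompactSupport.intro (K := (fun v : Coord d => v.2.1) '' tsupport f)
    ((show IsCompact (tsupport f) from hf.compact).image (by fun_prop)) fun z hz => ?_
  rw [image_eq_zero_of_notMem_tsupport fun h => hz ⟨_, h, rfl⟩, mul_zero]

/-- Two fibred distributions that agree on a fibre have the same continuous density there. -/
theorem density_eq_of_eq {P P' : KernelDist nab} {a a' : Coord d → ℂ}
    (ha : ContinuousOn a c.plot.dom) (ha' : ContinuousOn a' c.plot.dom)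
    (h : IsDensityOn P c.φ c.plot a) (h' : IsDensityOn P' c.φ c.plot a') {v : Coord d}
    (hv : v ∈ c.plot.dom)
    (hPP' : ∀ f, P.1 f (c.φ.symm v.1, v.2.2) = P'.1 f (c.φ.symm v.1, v.2.2)) : a v = a' v := by
  refine sub_eq_zero.1 (eq_zero_of_integral_eq_zero c.plot.isOpen_dom (k := a - a') (ha.sub ha') hv
    fun f hf hfc hfs => ?_)
  have hft : IsTest c.plot f := ⟨hf, hfc, hfs⟩
  have hu := c.mem_target hv
  have e : ∀ z, (a - a') (v.1, z, v.2.2) * f (v.1, z, v.2.2) =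
      a (v.1, z, v.2.2) * f (v.1, z, v.2.2) - a' (v.1, z, v.2.2) * f (v.1, z, v.2.2) :=
    fun z => sub_mul _ _ _
  simp only [e]
  rw [integral_sub (c.integrable_mul ha hft v.1 v.2.2) (c.integrable_mul ha' hft v.1 v.2.2),
    ← c.isDensityOn_iff.1 h f hft (v.1, v.2.2) hu, ← c.isDensityOn_iff.1 h' f hft (v.1, v.2.2) hu,
    c.ev_eq _ hft, c.ev_eq _ hft, hPP', sub_self]

theorem density_unique {P : KernelDist nab} {a a' : Coord d → ℂ}
    (ha : ContinuousOn a c.plot.dom) (ha' : ContinuousOn a' c.plot.dom)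
    (h : IsDensityOn P c.φ c.plot a) (h' : IsDensityOn P c.φ c.plot a') {v : Coord d}
    (hv : v ∈ c.plot.dom) : a v = a' v :=
  c.density_eq_of_eq ha ha' h h' hv fun _ => rfl

theorem continuous_conj : Continuous fun q : Coord d => (q.1, dilE c.wt q.2.2 q.2.1) :=
  continuous_fst.prodMk ((continuous_dilE c.wt).comp continuous_snd)

theorem conj_scale {t : ℝ} (ht : 0 < t) (v : Coord d) :
    dilE c.wt (c.scale t v).2.2 (c.scale t v).2.1 = dilE c.wt v.2.2 v.2.1 :=
  dilE_mul c.wt ht _ _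

/-- A continuous density is bounded along the inverse zoom action. -/
theorem exists_bound_scale {K : KernelDist nab} {k : Coord d → ℂ}
    (hk : ContinuousOn k c.plot.dom) (hkd : IsDensityOn K c.φ c.plot k)
    {Z : Set (Coord d)} (hZ : IsCompact Z) (hZd : Z ⊆ c.plot.dom) :
    ∃ B : ℝ, ∀ v ∈ Z, ∀ t ∈ Ioc (0 : ℝ) 1, ‖k (c.scale t⁻¹ v)‖ ≤ B := by
  set C : Set (Eu d × Eu d) := (fun q : Coord d => (q.1, dilE c.wt q.2.2 q.2.1)) '' Z with hC
  have hCc : IsCompact C := hZ.image c.continuous_conj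
  have hCD : C ⊆ c.D := by rintro _ ⟨q, hq, rfl⟩; exact hZd hq
  obtain ⟨C', hC', hCC', hC'D⟩ := exists_compact_between hCc c.isOpen_D hCD
  obtain ⟨R, hR⟩ := hZ.exists_bound_of_continuousOn (f := fun v : Coord d => v.2.2)
    (by fun_prop)
  obtain ⟨ρ, hρ⟩ := c.exists_ev_eq_zero K hC' hC'D (R + 1)
  set U : Set (Coord d) := {q | (q.1, dilE c.wt q.2.2 q.2.1) ∈ interior C' ∧
    |q.2.2| < R + 1 ∧ ρ < ‖q.2.1‖} with hU
  have hUo : IsOpen U := (isOpen_interior.preimage c.continuous_conj).inter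
    ((isOpen_lt (continuous_snd.comp continuous_snd).abs continuous_const).inter
      (isOpen_lt continuous_const (continuous_fst.comp continuous_snd).norm))
  have hUd : U ⊆ c.plot.dom := fun q hq => hC'D (interior_subset hq.1)
  have h0 : ∀ v ∈ U, k v = 0 := fun v hv =>
    eq_zero_of_integral_eq_zero hUo (hk.mono hUd) hv fun f hf hfc hfs => by
      have hft : IsTest c.plot f := ⟨hf, hfc, hfs.trans hUd⟩
      have hu := c.mem_target (hUd hv)
      rw [← c.isDensityOn_iff.1 hkd f hft (v.1, v.2.2) hu]
      exact hρ f hft (fun w hw => ⟨interior_subset (hfs hw).1, (hfs hw).2.1.le⟩)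
        (fun w hw => (hfs hw).2.2.le) _ hu
  obtain ⟨B, hB⟩ := (c.isCompact_slab hCc R ρ).exists_bound_of_continuousOn
    (hk.mono (inter_subset_left.trans (c.slab_subset hCD R)))
  refine ⟨max B 0, fun v hv t ht => ?_⟩
  have hmem : ((c.scale t⁻¹ v).1, dilE c.wt (c.scale t⁻¹ v).2.2 (c.scale t⁻¹ v).2.1) ∈ C := by
    rw [c.conj_scale (inv_pos.2 ht.1)]; exact ⟨v, hv, rfl⟩
  have hh : |(c.scale t⁻¹ v).2.2| ≤ R := by
    rw [scale_apply, inv_inv]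
    change |t * v.2.2| ≤ R
    rw [abs_mul, abs_of_pos ht.1]
    exact (mul_le_of_le_one_left (abs_nonneg _) ht.2).trans (hR v hv)
  by_cases hz : ‖(c.scale t⁻¹ v).2.1‖ ≤ ρ
  · exact (hB _ ⟨⟨hmem, hh⟩, hz⟩).trans (le_max_left _ _)
  · rw [h0 _ ⟨hCC' hmem, by linarith, not_le.1 hz⟩, norm_zero]
    exact le_max_right _ _

theorem norm_dilE_le (w : Fin d → ℕ) {t B : ℝ} (hB : 1 ≤ B) (ht : |t| ≤ B) :
    ‖dilE w t‖ ≤ B ^ ∑ i, (w i + 1) := by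
  refine ContinuousLinearMap.opNorm_le_bound _ (by positivity) fun z => ?_
  rw [EuclideanSpace.norm_eq, EuclideanSpace.norm_eq,
    ← Real.sqrt_sq (by positivity : 0 ≤ B ^ ∑ i, (w i + 1)), ← Real.sqrt_mul (by positivity)]
  refine Real.sqrt_le_sqrt ?_
  rw [Finset.mul_sum]
  refine Finset.sum_le_sum fun i _ => ?_
  rw [← mul_pow, dilE_apply, norm_mul, norm_pow, Real.norm_eq_abs]
  gcongr
  calc |t| ^ (w i + 1) ≤ B ^ (w i + 1) := by gcongr
    _ ≤ _ := pow_le_pow_right₀ hB (Finset.single_le_sum (f := fun i => w i + 1)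
      (fun _ _ => Nat.zero_le _) (Finset.mem_univ i))

/-- The values of a kernel along an orbit of the zoom action are bounded as `t` tends to `0`. -/
theorem exists_bound_ev_scale (P : KernelDist nab) (hf : IsTest c.plot f) {b : Eu d × ℝ}
    (hb : b.1 ∈ c.φ.target) : ∃ B : ℝ, ∀ t ∈ Ioc (0 : ℝ) 1,
      ‖c.ev P (fun v => f (c.scale t v)) (b.1, t * b.2)‖ ≤ B := by
  have hfc : IsCompact (tsupport f) := hf.compact
  set C : Set (Eu d × Eu d) :=
    (fun q : Coord d => (q.1, dilE c.wt q.2.2 q.2.1)) '' tsupport f with hC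
  have hCc : IsCompact C := hfc.image c.continuous_conj
  have hCD : C ⊆ c.D := by rintro _ ⟨q, hq, rfl⟩; exact hf.subset hq
  obtain ⟨R, hR⟩ := hfc.exists_bound_of_continuousOn (f := fun v : Coord d => v.2.2)
    (by fun_prop)
  have hslab : ∀ t ∈ Ioc (0 : ℝ) 1, ∀ v, c.scale t v ∈ tsupport f → v ∈ c.slab C R :=
    fun t ht v hv => by
      refine ⟨⟨_, hv, Prod.ext rfl (c.conj_scale ht.1 v)⟩, ?_⟩
      have h1 : v.2.2 = t * (c.scale t v).2.2 := by
        rw [scale_apply]; simp [mul_inv_cancel_left₀ ht.1.ne']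
      rw [h1, abs_mul, abs_of_pos ht.1]
      exact (mul_le_of_le_one_left (abs_nonneg _) ht.2).trans (hR _ hv)
  obtain ⟨ρ, hρ⟩ := c.exists_ev_eq_zero P hCc hCD R
  obtain ⟨χ, hχs, hχc, -, hχ1⟩ := exists_bump (isCompact_closedBall (0 : Eu d) ρ) isOpen_univ
    (subset_univ _)
  obtain ⟨ρ', hρ'⟩ := (show IsCompact (tsupport χ) from hχc).exists_bound_of_continuousOn
    (f := fun z => z) continuousOn_id
  obtain ⟨Θ, hΘs, hΘc, hΘd, hΘ1⟩ := exists_bump (c.isCompact_slab hCc R ρ') c.plot.isOpen_dom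
    (inter_subset_left.trans (c.slab_subset hCD R))
  have hΘ : IsTest c.plot Θ := ⟨hΘs, hΘc, hΘd⟩
  have hχs' : ContDiff ℝ ∞ fun v : Coord d => χ v.2.1 :=
    hχs.comp (contDiff_fst.comp contDiff_snd)
  have hΘχ : IsTest c.plot fun v => χ v.2.1 * Θ v := hΘ.smooth_mul hχs'
  set J : Eu d × Eu d → ℂ := fun q => f (q.1, q.2, b.2) with hJ
  have hJs : ContDiff ℝ ∞ J := hf.contDiff.comp
    (contDiff_fst.prodMk (contDiff_snd.prodMk contDiff_const))
  have hJc : HasCompactSupport J := by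
    refine HasCompactSupport.intro (K := (fun v : Coord d => (v.1, v.2.1)) '' tsupport f)
      (hfc.image (by fun_prop)) fun q hq => ?_
    change f (q.1, q.2, b.2) = 0
    exact image_eq_zero_of_notMem_tsupport fun h => hq ⟨(q.1, q.2, b.2), h, rfl⟩
  set T : Ioc (0 : ℝ) 1 → (Coord d) →L[ℝ] Eu d × Eu d := fun t =>
    (ContinuousLinearMap.fst ℝ (Eu d) (Eu d × ℝ)).prod
      ((dilE c.wt t).comp ((ContinuousLinearMap.fst ℝ (Eu d) ℝ).comp
        (ContinuousLinearMap.snd ℝ (Eu d) (Eu d × ℝ)))) with hT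
  have hTn : ∀ t, ‖T t‖ ≤ Real.exp (0 * (1 : ℝ)) := fun t => by
    rw [zero_mul, Real.exp_zero]
    refine ContinuousLinearMap.opNorm_le_bound _ zero_le_one fun v => ?_
    have h1 : ‖dilE c.wt t v.2.1‖ ≤ 1 * ‖v.2.1‖ := (dilE c.wt t).le_of_opNorm_le (by
      simpa using norm_dilE_le c.wt le_rfl (by rw [abs_of_pos t.2.1]; exact t.2.2)) _
    rw [one_mul] at h1 ⊢
    exact max_le (norm_fst_le v) (h1.trans ((norm_fst_le v.2).trans (norm_snd_le v)))
  set G : Ioc (0 : ℝ) 1 → Coord d → ℂ := fun t v => (χ v.2.1 * Θ v) * J (T t v) with hG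
  have hGs : ∀ t : Ioc (0 : ℝ) 1, ContDiff ℝ ∞ fun v => J (T t v) := fun t => hJs.comp (T t).contDiff
  have hGt : ∀ t, IsTest c.plot (G t) := fun t => by
    have := hΘχ.smooth_mul (hGs t)
    simpa only [hG, mul_comm] using this
  have hjets : ExpJets (fun _ : Ioc (0 : ℝ) 1 => (1 : ℝ)) G :=
    ExpJets.mul (fun _ => le_rfl) (ExpJets.of_test (fun _ => le_rfl) hΘχ.contDiff hΘχ.compact)
      ((ExpJets.of_test (fun _ => le_rfl) hJs hJc).comp (fun _ => hJs) T hTn)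
      (fun _ => hΘχ.contDiff) hGs
  have hbd := c.isGoodPlot.isVonNBounded_push (K := tsupport Θ) hΘc hΘd hGt
    (fun t => tsupport_mul_subset_left.trans tsupport_mul_subset_right) fun i => by
      obtain ⟨a, ha⟩ := hjets i
      exact ⟨_, ha⟩
  obtain ⟨B, hB⟩ := exists_bound_of_continuousAt (T := fun _ : ℂ => P.1) (z₀ := 0)
    continuousAt_const hbd (cylPlot_mem c.φ_mem) (L := {b.1} ×ˢ Icc (-|b.2|) |b.2|)
    (isCompact_singleton.prod isCompact_Icc) (fun q hq => ⟨by rw [hq.1]; exact hb, trivial⟩)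
  refine ⟨B, fun t ht => ?_⟩
  have hft := hf.scale c ht.1
  have hmem : ((b.1, t * b.2) : Eu d × ℝ) ∈ ({b.1} ×ˢ Icc (-|b.2|) |b.2| : Set (Eu d × ℝ)) := by
    refine ⟨rfl, abs_le.1 ?_⟩
    rw [abs_mul, abs_of_pos ht.1]
    exact mul_le_of_le_one_left (abs_nonneg _) ht.2
  have h1 := hB.self_of_nhds _ ⟨⟨t, ht⟩, rfl⟩ _ hmem
  refine le_of_eq_of_le (congrArg norm ?_) h1
  have h2 : c.ev P (G ⟨t, ht⟩) (b.1, t * b.2) =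
      P.1 (c.isGoodPlot.push (hGt ⟨t, ht⟩)) (c.φ.symm b.1, t * b.2) := c.ev_eq P (hGt _) _
  refine Eq.trans ?_ h2
  -- only the part of the test function with `‖z‖` near `[0, ρ]` contributes
  have hcut : IsTest c.plot fun v => χ v.2.1 * f (c.scale t v) := hft.smooth_mul hχs'
  have hfar : IsTest c.plot fun v => (1 - χ v.2.1) * f (c.scale t v) :=
    hft.smooth_mul (contDiff_const.sub hχs')
  have h3 : c.ev P (fun v => (1 - χ v.2.1) * f (c.scale t v)) (b.1, t * b.2) = 0 := by
    refine hρ _ hfar (fun v hv => hslab t ht v ?_) (fun v hv => ?_) _ hb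
    · exact tsupport_comp_subset_preimage f (c.scale t).continuous (tsupport_mul_subset_right hv)
    · by_contra hlt
      refine notMem_tsupport_iff_eventuallyEq.2 ?_ hv
      have h4 : ∀ᶠ z in 𝓝 v.2.1, χ z = 1 := hχ1.filter_mono
        (nhds_le_nhdsSet (by rw [mem_closedBall_zero_iff]; exact (not_le.1 hlt).le))
      have h5 : Tendsto (fun v : Coord d => v.2.1) (𝓝 v) (𝓝 v.2.1) :=
        (continuous_fst.comp continuous_snd).tendsto v
      filter_upwards [h5.eventually h4] with w hw
      simp [hw]
  have h6 := c.ev_add P hcut hfar (b.1, t * b.2)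
  rw [h3, add_zero] at h6
  have h7 : (fun v => χ v.2.1 * f (c.scale t v) + (1 - χ v.2.1) * f (c.scale t v)) =
      fun v => f (c.scale t v) := by
    funext v; ring
  rw [h7] at h6
  rw [h6]
  refine c.ev_congr P hcut (hGt _) hb fun z => ?_
  have h8 : c.scale t (b.1, z, t * b.2) = (b.1, dilE c.wt t z, b.2) := by
    rw [scale_apply]; simp [inv_mul_cancel_left₀ ht.1.ne']
  change χ z * f (c.scale t (b.1, z, t * b.2)) =
    (χ z * Θ (b.1, z, t * b.2)) * f (b.1, dilE c.wt t z, b.2)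
  rw [h8]
  by_cases hz : f (b.1, dilE c.wt t z, b.2) = 0
  · rw [hz, mul_zero, mul_zero]
  by_cases hz' : χ z = 0
  · rw [hz', zero_mul, zero_mul, zero_mul]
  rw [hΘ1.self_of_nhdsSet, mul_one]
  exact ⟨hslab t ht _ (by rw [h8]; exact subset_tsupport _ hz), hρ' z (subset_tsupport _ hz')⟩

/-! ### Kernels of low order have continuous densities -/

/-- The sum of the degrees of the frame. -/
def totalDeg : ℕ := ∑ i, (c.wt i + 1)

/-- The fibre integral of the density `k`, moved by the zoom action, against `f`. -/
def orbitIntegral (k f : Coord d → ℂ) (b : Eu d × ℝ) (t : ℝ) : ℂ :=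
  ∫ z, k (c.scale t⁻¹ (b.1, z, b.2)) * f (b.1, z, b.2)

theorem continuousAt_scale_inv {t : ℝ} (ht : t ≠ 0) (v : Coord d) :
    ContinuousAt (fun q : ℝ × Coord d => c.scale q.1⁻¹ q.2) (t, v) := by
  have h1 : ContinuousAt (fun q : ℝ × Coord d => q.1⁻¹) (t, v) :=
    continuousAt_fst.inv₀ ht
  have h2 : ContinuousAt (fun q : ℝ × Coord d => dilE c.wt q.1⁻¹ q.2.2.1) (t, v) :=
    ContinuousAt.comp (x := (t, v)) (f := fun q : ℝ × Coord d => (q.1⁻¹, q.2.2.1))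
      (g := fun q : ℝ × Eu d => dilE c.wt q.1 q.2) (contDiff_dilE c.wt).continuous.continuousAt
      (h1.prodMk continuousAt_snd.snd.fst)
  have h3 : ContinuousAt (fun q : ℝ × Coord d => (q.1⁻¹)⁻¹ * q.2.2.2) (t, v) :=
    (h1.inv₀ (inv_ne_zero ht)).mul continuousAt_snd.snd.snd
  exact continuousAt_snd.fst.prodMk (h2.prodMk h3)

theorem continuousOn_orbit {k : Coord d → ℂ} (hk : ContinuousOn k c.plot.dom)
    (hf : IsTest c.plot f) (b : Eu d × ℝ) :
    ContinuousOn (fun q : ℝ × Eu d => k (c.scale q.1⁻¹ (b.1, q.2, b.2)) * f (b.1, q.2, b.2))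
      (Ioi 0 ×ˢ univ) := by
  rintro ⟨t, z⟩ ⟨ht, -⟩
  have ht' : (0 : ℝ) < t := ht
  have hι : ContinuousAt (fun q : ℝ × Eu d => ((b.1, q.2, b.2) : Coord d)) (t, z) := by
    fun_prop
  refine (hf.continuousAt_mul (z := (t, z)) hι fun hz => ?_).continuousWithinAt
  have h1 : ContinuousAt (fun q : ℝ × Eu d => c.scale q.1⁻¹ (b.1, q.2, b.2)) (t, z) :=
    ContinuousAt.comp (f := fun q : ℝ × Eu d => (q.1, ((b.1, q.2, b.2) : Coord d)))
      (g := fun q : ℝ × Coord d => c.scale q.1⁻¹ q.2)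
      (c.continuousAt_scale_inv ht'.ne' (b.1, z, b.2)) (continuousAt_fst.prodMk hι)
  exact ContinuousAt.comp (g := k) (hk.continuousAt (c.plot.isOpen_dom.mem_nhds
    ((c.scale_mem (inv_pos.2 ht')).2 hz))) h1

theorem continuousOn_orbitIntegral {k : Coord d → ℂ} (hk : ContinuousOn k c.plot.dom)
    (hf : IsTest c.plot f) (b : Eu d × ℝ) : ContinuousOn (c.orbitIntegral k f b) (Ioi 0) := by
  refine continuousOn_integral_of_compact_support
    (k := (fun v : Coord d => v.2.1) '' tsupport f)
    ((show IsCompact (tsupport f) from hf.compact).image (by fun_prop))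
    (c.continuousOn_orbit hk hf b) fun t z _ hz => ?_
  rw [image_eq_zero_of_notMem_tsupport fun h => hz ⟨_, h, rfl⟩, mul_zero]

theorem cpow_mul_pow_inv {t : ℝ} (ht : 0 < t) (m : ℂ) (N : ℕ) :
    (t : ℂ) ^ (-m - 1) * (((t ^ N)⁻¹ : ℝ) : ℂ) = (t : ℂ) ^ (-(N : ℂ) - m - 1) := by
  have h0 : (t : ℂ) ≠ 0 := by exact_mod_cast ht.ne'
  rw [show -(N : ℂ) - m - 1 = (-m - 1) - N by ring, Complex.cpow_sub (-m - 1) (N : ℂ) h0, Complex.cpow_natCast,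
    div_eq_mul_inv]
  push_cast
  rfl

/-- Integration of the homogeneity equation along the orbits of the zoom action. -/
theorem ev_scale_sub {P : KernelDist nab} {m : ℂ}
    (hP : ∃ L, Tendsto (zoomSlope P) (𝓝[≠] (1 : ℝ)) (𝓝 L)) {k : Coord d → ℂ}
    (hk : ContinuousOn k c.plot.dom) (hkd : IsDensityOn (lieZ P - m • P) c.φ c.plot k)
    (hf : IsTest c.plot f) {b : Eu d × ℝ} (hb : b.1 ∈ c.φ.target) {a₁ a₂ : ℝ} (h1 : 0 < a₁)
    (h2 : 0 < a₂) :
    (a₂ : ℂ) ^ (-m) * c.ev P (fun v => f (c.scale a₂ v)) (b.1, a₂ * b.2) -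
      (a₁ : ℂ) ^ (-m) * c.ev P (fun v => f (c.scale a₁ v)) (b.1, a₁ * b.2) =
      ∫ t in a₁..a₂, (t : ℂ) ^ (-(c.totalDeg : ℂ) - m - 1) * c.orbitIntegral k f b t := by
  have hpos : ∀ t ∈ uIcc a₁ a₂, 0 < t := fun t ht => (lt_min h1 h2).trans_le ht.1
  refine (intervalIntegral.integral_eq_sub_of_hasDerivAt (f := fun t : ℝ =>
    (t : ℂ) ^ (-m) * c.ev P (fun v => f (c.scale t v)) (b.1, t * b.2)) (fun t ht => ?_)
    (ContinuousOn.intervalIntegrable ?_)).symm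
  · have ht0 := hpos t ht
    have hc0 : (t : ℂ) ≠ 0 := by exact_mod_cast ht0.ne'
    have e1 : HasDerivAt (fun t : ℝ => (t : ℂ) ^ (-m)) (-m * (t : ℂ) ^ (-m - 1)) t := by
      have h : HasDerivAt (fun z : ℂ => z ^ (-m)) (-m * (t : ℂ) ^ (-m - 1)) (t : ℂ) := by
        simpa using (hasDerivAt_id (t : ℂ)).cpow_const (c := -m) (Or.inl (by simpa using ht0))
      exact h.comp_ofReal
    refine (e1.mul (c.hasDerivAt_ev_scale hP hf hb ht0)).congr_deriv ?_
    have e2 : lieZ P = (lieZ P - m • P) + m • P := by rw [sub_add_cancel]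
    have e3 : c.ev (lieZ P) (fun v => f (c.scale t v)) (b.1, t * b.2) =
        c.ev (lieZ P - m • P) (fun v => f (c.scale t v)) (b.1, t * b.2) +
          m * c.ev P (fun v => f (c.scale t v)) (b.1, t * b.2) := by
      conv_lhs => rw [e2]
      rw [c.ev_add_left _ _ (hf.scale c ht0), c.ev_smul_left _ _ (hf.scale c ht0)]
    rw [e3, c.ev_scale_eq_integral hkd hf hb ht0, ← cpow_mul_pow_inv ht0]
    have e4 : (t : ℂ) ^ (-m) = (t : ℂ) ^ (-m - 1) * t := by
      rw [Complex.cpow_sub _ _ hc0, Complex.cpow_one, div_mul_cancel₀ _ hc0]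
    rw [e4]
    simp only [orbitIntegral, totalDeg]
    field_simp
    ring
  · refine ContinuousOn.mul (fun t ht => ?_)
      ((c.continuousOn_orbitIntegral hk hf b).mono fun t ht => hpos t ht)
    exact (Complex.continuousAt_ofReal_cpow_const t _ (Or.inr (hpos t ht).ne')).continuousWithinAt

/-- The density of a kernel of order `m` with `Re m < -d_H` whose image under `𝓛_Z - m` has the
density `k`. -/
def lowDensity (m : ℂ) (k : Coord d → ℂ) (v : Coord d) : ℂ :=
  ∫ t in (0 : ℝ)..1, (t : ℂ) ^ (-(c.totalDeg : ℂ) - m - 1) * k (c.scale t⁻¹ v)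

theorem norm_cpow_mul_le {t : ℝ} {r : ℂ} {x : ℂ} {B : ℝ} (hx : ‖x‖ ≤ B) :
    ‖(t : ℂ) ^ r * x‖ ≤ B * ‖(t : ℂ) ^ r‖ := by
  rw [norm_mul, mul_comm]
  exact mul_le_mul_of_nonneg_right hx (norm_nonneg _)

theorem continuousOn_cpow_Ioc (r : ℂ) :
    ContinuousOn (fun t : ℝ => (t : ℂ) ^ r) (Ioi 0) := fun t ht =>
  (Complex.continuousAt_ofReal_cpow_const t _ (Or.inr (ne_of_gt ht))).continuousWithinAt

theorem continuousOn_scale_inv {k : Coord d → ℂ} (hk : ContinuousOn k c.plot.dom)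
    {v : Coord d} (hv : v ∈ c.plot.dom) :
    ContinuousOn (fun t : ℝ => k (c.scale t⁻¹ v)) (Ioi 0) := by
  intro t ht
  have h1 : ContinuousAt (fun t : ℝ => c.scale t⁻¹ v) t :=
    ContinuousAt.comp (f := fun t : ℝ => (t, v))
      (g := fun q : ℝ × Coord d => c.scale q.1⁻¹ q.2)
      (c.continuousAt_scale_inv (ne_of_gt ht) v) (by fun_prop)
  exact (ContinuousAt.comp (g := k) (f := fun t : ℝ => c.scale t⁻¹ v)
    (hk.continuousAt (c.plot.isOpen_dom.mem_nhds
      ((c.scale_mem (inv_pos.2 ht)).2 hv))) h1).continuousWithinAt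

theorem continuousOn_lowDensity {K : KernelDist nab} {m : ℂ} (hm : m.re < -(c.totalDeg : ℝ))
    {k : Coord d → ℂ} (hk : ContinuousOn k c.plot.dom) (hkd : IsDensityOn K c.φ c.plot k) :
    ContinuousOn (c.lowDensity m k) c.plot.dom := by
  intro v hv
  have hre : -1 < (-(c.totalDeg : ℂ) - m - 1).re := by simp; linarith
  obtain ⟨Z, hZ, hvZ, hZd⟩ := exists_compact_between isCompact_singleton c.plot.isOpen_dom
    (singleton_subset_iff.2 hv)
  have hvZ' : interior Z ∈ 𝓝 v := isOpen_interior.mem_nhds (singleton_subset_iff.1 hvZ)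
  obtain ⟨B, hB⟩ := c.exists_bound_scale hk hkd hZ hZd
  refine ContinuousAt.continuousWithinAt ?_
  refine intervalIntegral.continuousAt_of_dominated_interval
    (bound := fun t => B * ‖(t : ℂ) ^ (-(c.totalDeg : ℂ) - m - 1)‖) ?_ ?_ ?_ ?_
  · filter_upwards [hvZ'] with w hw
    rw [uIoc_of_le zero_le_one]
    exact (((continuousOn_cpow_Ioc _).mul (c.continuousOn_scale_inv hk
      (hZd (interior_subset hw)))).mono fun t ht => ht.1).aestronglyMeasurable measurableSet_Ioc
  · filter_upwards [hvZ'] with w hw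
    refine Eventually.of_forall fun t ht => ?_
    rw [uIoc_of_le zero_le_one] at ht
    exact norm_cpow_mul_le (hB w (interior_subset hw) t ht)
  · exact (intervalIntegral.intervalIntegrable_cpow' hre).norm.const_mul B
  · refine Eventually.of_forall fun t ht => ?_
    rw [uIoc_of_le zero_le_one] at ht
    refine continuousAt_const.mul (ContinuousAt.comp (g := k) (hk.continuousAt
      (c.plot.isOpen_dom.mem_nhds ((c.scale_mem (inv_pos.2 ht.1)).2 hv))) ?_)
    exact (c.scale t⁻¹).continuous.continuousAt

/-- A kernel of order `m` with `Re m < -d_H` is given by a continuous density. -/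
theorem isDensityOn_lowDensity {P : KernelDist nab} {m : ℂ} (hm : m.re < -(c.totalDeg : ℝ))
    (hP : ∃ L, Tendsto (zoomSlope P) (𝓝[≠] (1 : ℝ)) (𝓝 L)) {k : Coord d → ℂ}
    (hk : ContinuousOn k c.plot.dom) (hkd : IsDensityOn (lieZ P - m • P) c.φ c.plot k) :
    IsDensityOn P c.φ c.plot (c.lowDensity m k) := by
  rw [c.isDensityOn_iff]
  intro f hf b hb
  set r : ℂ := -(c.totalDeg : ℂ) - m - 1 with hr
  have hre : -1 < r.re := by simp [hr]; linarith
  obtain ⟨B, hB⟩ := c.exists_bound_ev_scale P hf hb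
  obtain ⟨B', hB'⟩ := c.exists_bound_scale hk hkd hf.compact hf.subset
  have hfz : Integrable fun z => f (b.1, z, b.2) := by
    have := c.integrable_mul (a := fun _ => 1) continuousOn_const hf b.1 b.2
    simpa using this
  have hpt : ∀ t ∈ Ioc (0 : ℝ) 1, ∀ z,
      ‖k (c.scale t⁻¹ (b.1, z, b.2)) * f (b.1, z, b.2)‖ ≤ B' * ‖f (b.1, z, b.2)‖ := fun t ht z => by
    by_cases hz : ((b.1, z, b.2) : Coord d) ∈ tsupport f
    · rw [norm_mul]
      exact mul_le_mul_of_nonneg_right (hB' _ hz t ht) (norm_nonneg _)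
    · rw [image_eq_zero_of_notMem_tsupport hz]; simp
  have hI : ∀ t ∈ Ioc (0 : ℝ) 1, ‖c.orbitIntegral k f b t‖ ≤ ∫ z, B' * ‖f (b.1, z, b.2)‖ :=
    fun t ht => norm_integral_le_of_norm_le (hfz.norm.const_mul B') (Eventually.of_forall (hpt t ht))
  have hint : IntervalIntegrable (fun t : ℝ => (t : ℂ) ^ r * c.orbitIntegral k f b t) volume 0 1 := by
    refine ((intervalIntegral.intervalIntegrable_cpow' hre).norm.const_mul
      (∫ z, B' * ‖f (b.1, z, b.2)‖)).mono_fun' ?_ ?_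
    · rw [uIoc_of_le zero_le_one]
      exact (((continuousOn_cpow_Ioc r).mul (c.continuousOn_orbitIntegral hk hf b)).mono
        fun t ht => ht.1).aestronglyMeasurable measurableSet_Ioc
    · rw [uIoc_of_le zero_le_one]
      filter_upwards [ae_restrict_mem measurableSet_Ioc] with t ht
      exact norm_cpow_mul_le (hI t ht)
  -- the contribution of small `t` vanishes in the limit since `Re m < -d_H ≤ 0`
  have hlim1 : Tendsto (fun ε : ℝ => (ε : ℂ) ^ (-m) *
      c.ev P (fun v => f (c.scale ε v)) (b.1, ε * b.2)) (𝓝[>] 0) (𝓝 0) := by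
    have hmre : 0 < (-m).re := by
      have : (0 : ℝ) ≤ c.totalDeg := Nat.cast_nonneg _
      simp; linarith
    have h1 : Tendsto (fun ε : ℝ => B * ε ^ (-m).re) (𝓝[>] 0) (𝓝 0) := by
      have := ((Real.continuousAt_rpow_const 0 (-m).re (Or.inr hmre.le)).tendsto.mono_left
        (nhdsWithin_le_nhds (s := Ioi 0))).const_mul B
      rwa [Real.zero_rpow hmre.ne', mul_zero] at this
    refine squeeze_zero_norm' ?_ h1
    filter_upwards [Ioc_mem_nhdsGT (zero_lt_one (α := ℝ))] with ε hε
    rw [← Complex.norm_cpow_eq_rpow_re_of_pos hε.1]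
    exact norm_cpow_mul_le (hB ε hε)
  have hlim2 : Tendsto (fun ε : ℝ => ∫ t in ε..1, (t : ℂ) ^ r * c.orbitIntegral k f b t) (𝓝[>] 0)
      (𝓝 (∫ t in (0 : ℝ)..1, (t : ℂ) ^ r * c.orbitIntegral k f b t)) := by
    have h1 := intervalIntegral.continuousOn_primitive_interval' hint
      (right_mem_uIcc (a := (0 : ℝ)) (b := 1))
    have h2 : Tendsto (fun ε : ℝ => -∫ t in (1 : ℝ)..ε, (t : ℂ) ^ r * c.orbitIntegral k f b t)
        (𝓝[uIcc 0 1] 0) (𝓝 (-∫ t in (1 : ℝ)..0, (t : ℂ) ^ r * c.orbitIntegral k f b t)) :=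
      (h1 0 left_mem_uIcc).neg
    have h3 : 𝓝[>] (0 : ℝ) ≤ 𝓝[uIcc 0 1] 0 := by
      rw [uIcc_of_le zero_le_one, ← nhdsWithin_Ioc_eq_nhdsGT (zero_lt_one (α := ℝ))]
      exact nhdsWithin_mono _ Ioc_subset_Icc_self
    have h4 := Tendsto.mono_left h2 h3
    rw [← intervalIntegral.integral_symm] at h4
    refine h4.congr fun ε => ?_
    rw [← intervalIntegral.integral_symm]
  have hone : c.ev P f b = ∫ t in (0 : ℝ)..1, (t : ℂ) ^ r * c.orbitIntegral k f b t := by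
    refine tendsto_nhds_unique (f := fun ε : ℝ => c.ev P f b - (ε : ℂ) ^ (-m) *
      c.ev P (fun v => f (c.scale ε v)) (b.1, ε * b.2)) (l := 𝓝[>] (0 : ℝ)) ?_ (hlim2.congr' ?_)
    · simpa using tendsto_const_nhds.sub hlim1
    · filter_upwards [self_mem_nhdsWithin] with ε hε
      rw [hr, ← c.ev_scale_sub hP hk hkd hf hb hε one_pos]
      simp only [scale_one, one_mul, Complex.ofReal_one, Complex.one_cpow, Prod.mk.eta]
  rw [hone, intervalIntegral.integral_of_le zero_le_one]
  have hswap : Integrable (Function.uncurry fun (t : ℝ) (z : Eu d) =>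
      (t : ℂ) ^ r * (k (c.scale t⁻¹ (b.1, z, b.2)) * f (b.1, z, b.2)))
      ((volume.restrict (Ioc 0 1)).prod volume) := by
    have h1 : Integrable (fun t : ℝ => ‖(t : ℂ) ^ r‖) (volume.restrict (Ioc 0 1)) := by
      have := (intervalIntegral.intervalIntegrable_cpow' (a := 0) (b := 1) hre).norm
      rwa [intervalIntegrable_iff_integrableOn_Ioc_of_le zero_le_one] at this
    refine (h1.mul_prod (hfz.norm.const_mul B')).mono' ?_ ?_
    · have h2 : (volume.restrict (Ioc (0 : ℝ) 1)).prod (volume : Measure (Eu d)) =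
          (volume.prod volume).restrict (Ioc 0 1 ×ˢ univ) := by
        rw [← Measure.prod_restrict, Measure.restrict_univ]
      rw [h2]
      refine ContinuousOn.aestronglyMeasurable ?_ (measurableSet_Ioc.prod MeasurableSet.univ)
      refine ContinuousOn.mul ((continuousOn_cpow_Ioc r).comp continuousOn_fst fun q hq => hq.1.1) ?_
      exact (c.continuousOn_orbit hk hf b).mono (prod_mono_left fun t ht => ht.1)
    · have h3 : ∀ᵐ q : ℝ × Eu d ∂((volume.restrict (Ioc 0 1)).prod volume), q.1 ∈ Ioc (0 : ℝ) 1 :=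
        Measure.quasiMeasurePreserving_fst.ae (ae_restrict_mem measurableSet_Ioc)
      filter_upwards [h3] with q hq
      change ‖(q.1 : ℂ) ^ r * (k (c.scale q.1⁻¹ (b.1, q.2, b.2)) * f (b.1, q.2, b.2))‖ ≤
        ‖(q.1 : ℂ) ^ r‖ * (B' * ‖f (b.1, q.2, b.2)‖)
      rw [norm_mul]
      exact mul_le_mul_of_nonneg_left (hpt _ hq _) (norm_nonneg _)
  calc ∫ t in Ioc (0 : ℝ) 1, (t : ℂ) ^ r * c.orbitIntegral k f b t
      = ∫ t in Ioc (0 : ℝ) 1, ∫ z, (t : ℂ) ^ r *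
          (k (c.scale t⁻¹ (b.1, z, b.2)) * f (b.1, z, b.2)) := by
        simp only [orbitIntegral, integral_const_mul]
    _ = ∫ z, ∫ t in Ioc (0 : ℝ) 1, (t : ℂ) ^ r *
          (k (c.scale t⁻¹ (b.1, z, b.2)) * f (b.1, z, b.2)) := integral_integral_swap hswap
    _ = _ := by
        refine integral_congr_ae (Eventually.of_forall fun z => ?_)
        simp only [← mul_assoc, lowDensity, hr, integral_mul_const,
          intervalIntegral.integral_of_le zero_le_one]

end ExpChart

end KernelsInCharts

/-! ### Holomorphic dependence of the smooth densities on the parameter -/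

section Approximation

/-- A product is smooth if its second factor is smooth on the support of the first. -/
theorem contDiff_mul_of_tsupport {E : Type*} [NormedAddCommGroup E] [NormedSpace ℝ E]
    {χ f : E → ℂ} (hχ : ContDiff ℝ ∞ χ) (hf : ∀ v ∈ tsupport χ, ContDiffAt ℝ ∞ f v) :
    ContDiff ℝ ∞ fun v => χ v * f v := by
  refine contDiff_iff_contDiffAt.2 fun v => ?_
  by_cases hv : v ∈ tsupport χ
  · exact hχ.contDiffAt.mul (hf v hv)
  · refine (contDiffAt_const (c := (0 : ℂ))).congr_of_eventuallyEq ?_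
    filter_upwards [notMem_tsupport_iff_eventuallyEq.1 hv] with w hw
    rw [hw, Pi.zero_apply, zero_mul]

/-- A continuously differentiable function is Lipschitz continuous on compact sets. -/
theorem exists_lipschitz_bound {E : Type*} [NormedAddCommGroup E] [NormedSpace ℝ E]
    [FiniteDimensional ℝ E] {f : E → ℂ} {U K : Set E} (hU : IsOpen U) (hf : ContDiffOn ℝ ∞ f U)
    (hK : IsCompact K) (hKU : K ⊆ U) : ∃ C : ℝ, 0 ≤ C ∧ ∀ x ∈ K, ∀ y ∈ K,
      ‖f x - f y‖ ≤ C * ‖x - y‖ := by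
  obtain ⟨χ, hχ, hχc, hχU, hχ1⟩ := exists_bump hK hU hKU
  have hsm : ContDiff ℝ ∞ fun v => χ v * f v :=
    contDiff_mul_of_tsupport hχ fun v hv => hf.contDiffAt (hU.mem_nhds (hχU hv))
  obtain ⟨C, hC⟩ := (hsm.of_le (by simp) : ContDiff ℝ 1 _).lipschitzWith_of_hasCompactSupport
    hχc.mul_right one_ne_zero
  refine ⟨C, C.2, fun x hx y hy => ?_⟩
  have h1 := hC.dist_le_mul x y
  rw [dist_eq_norm, dist_eq_norm] at h1
  have hone : ∀ v ∈ K, χ v = 1 := fun v hv => hχ1.self_of_nhdsSet v hv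
  simpa [hone x hx, hone y hy] using h1

/-- Approximations of the delta function on `ℝ^d` at the scales `ε 2⁻ⁿ`. -/
theorem exists_mollifier (d : ℕ) {ε : ℝ} (hε : 0 < ε) :
    ∃ (χ : ℕ → Eu d → ℂ) (B : ℝ), (∀ n, ContDiff ℝ ∞ (χ n)) ∧
      (∀ n, ∀ z, χ n z ≠ 0 → ‖z‖ ≤ ε * 2⁻¹ ^ n) ∧ (∀ n, ∫ z, χ n z = 1) ∧
      (∀ n, Integrable (χ n)) ∧ (∀ n, ∫ z, ‖χ n z‖ = B) ∧
      ExpJets (fun n : ℕ => (n : ℝ) + 1) χ := by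
  let b : ContDiffBump (0 : Eu d) := ⟨ε / 2, ε, by positivity, by linarith⟩
  let χ₀ : Eu d → ℂ := fun z => (b.normed volume z : ℂ)
  have hχ₀ : ContDiff ℝ ∞ χ₀ := Complex.ofRealCLM.contDiff.comp b.contDiff_normed
  have hc₀ : HasCompactSupport χ₀ :=
    (b.hasCompactSupport_normed (μ := volume)).comp_left (g := fun x : ℝ => (x : ℂ)) (by simp)
  have hi₀ : Integrable χ₀ := hχ₀.continuous.integrable_of_hasCompactSupport hc₀
  have hone : ∫ z, χ₀ z = 1 := by
    simp only [χ₀, integral_complex_ofReal, b.integral_normed, Complex.ofReal_one]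
  have h2 : ∀ n : ℕ, (0 : ℝ) < 2 ^ n := fun n => by positivity
  have hfr : ∀ n : ℕ, |(((2 : ℝ) ^ n) ^ Module.finrank ℝ (Eu d))⁻¹| = (((2 : ℝ) ^ n) ^ d)⁻¹ :=
    fun n => by rw [finrank_euclideanSpace_fin, abs_of_pos (by positivity)]
  refine ⟨fun n z => ((((2 : ℝ) ^ n) ^ d : ℝ) : ℂ) * χ₀ ((2 : ℝ) ^ n • z), ∫ z, ‖χ₀ z‖,
    fun n => contDiff_const.mul (hχ₀.comp (contDiff_const_smul _)), fun n z hz => ?_, fun n => ?_,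
    fun n => (hi₀.comp_smul (h2 n).ne').const_mul _, fun n => ?_, ?_⟩
  · have h1 : (2 : ℝ) ^ n • z ∈ Metric.ball (0 : Eu d) ε := by
      have h3 : b.normed volume ((2 : ℝ) ^ n • z) ≠ 0 := fun h => hz (by simp [χ₀, h])
      have h4 := b.support_normed_eq (μ := volume)
      exact h4 ▸ (Function.mem_support.2 h3)
    rw [mem_ball_zero_iff, norm_smul, Real.norm_of_nonneg (h2 n).le] at h1
    rw [inv_pow, ← div_eq_mul_inv, le_div_iff₀ (h2 n), mul_comm]
    exact h1.le
  · rw [integral_const_mul, Measure.integral_comp_smul, hfr, hone, Complex.real_smul, mul_one,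
      ← Complex.ofReal_mul, mul_inv_cancel₀ (by positivity), Complex.ofReal_one]
  · have h1 : (fun z : Eu d => ‖((((2 : ℝ) ^ n) ^ d : ℝ) : ℂ) * χ₀ ((2 : ℝ) ^ n • z)‖) =
        fun z => ((2 : ℝ) ^ n) ^ d * (fun y => ‖χ₀ y‖) ((2 : ℝ) ^ n • z) := by
      funext z
      rw [norm_mul, Complex.norm_of_nonneg (by positivity)]
    rw [h1, integral_const_mul, Measure.integral_comp_smul volume (fun y => ‖χ₀ y‖), hfr, smul_eq_mul, ← mul_assoc,
      mul_inv_cancel₀ (by positivity), one_mul]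
  · have hexp : ∀ n : ℕ, (2 : ℝ) ^ n ≤ Real.exp ((n : ℝ) + 1) := fun n => by
      have h3 : (2 : ℝ) ≤ Real.exp 1 := by have := Real.add_one_le_exp 1; linarith
      calc (2 : ℝ) ^ n ≤ Real.exp 1 ^ n := pow_le_pow_left₀ (by norm_num) h3 n
        _ = Real.exp n := by rw [← Real.exp_nat_mul, mul_one]
        _ ≤ Real.exp ((n : ℝ) + 1) := Real.exp_le_exp.2 (by linarith)
    refine ExpJets.const_mul (b := d) ?_ (fun n => hχ₀.comp (contDiff_const_smul _)) fun n => ?_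
    · refine ExpJets.comp (F := fun _ : ℕ => χ₀) (b := 1)
        (ExpJets.of_test (fun n => by simp) hχ₀ hc₀) (fun _ => hχ₀)
        (fun n => (2 : ℝ) ^ n • ContinuousLinearMap.id ℝ (Eu d)) fun n => ?_
      rw [one_mul, norm_smul, Real.norm_of_nonneg (h2 n).le]
      exact (mul_le_of_le_one_right (h2 n).le ContinuousLinearMap.norm_id_le).trans (hexp n)
    · rw [Complex.norm_of_nonneg (by positivity), Real.exp_nat_mul]
      exact pow_le_pow_left₀ (h2 n).le (hexp n) d

theorem IsHolomorphicOn.continuousAt {V : Type*} [AddCommGroup V] [Module ℂ V] [TopologicalSpace V]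
    [ContinuousAdd V] [ContinuousSMul ℂ V] {f : ℂ → V} {U : Set ℂ} (hf : IsHolomorphicOn f U)
    {s : ℂ} (hs : s ∈ U) : ContinuousAt f s := by
  obtain ⟨D, hD⟩ := hf s hs
  rw [continuousAt_iff_punctured_nhds]
  have h1 : Tendsto (fun w : ℂ => w - s) (𝓝[≠] s) (𝓝 0) := by
    have : ContinuousAt (fun w : ℂ => w - s) s := by fun_prop
    simpa using this.tendsto.mono_left nhdsWithin_le_nhds
  have h2 := ((h1.smul hD).add_const (f s))
  rw [zero_smul, zero_add] at h2
  refine h2.congr' ?_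
  filter_upwards [self_mem_nhdsWithin] with w hw
  rw [smul_smul, mul_inv_cancel₀ (sub_ne_zero.2 hw), one_smul, sub_add_cancel]

end Approximation

section SmoothDensities

variable {d : ℕ} {M : Type*} [TopologicalSpace M] [T2Space M] [ChartedSpace (Eu d) M]
  [IsManifold 𝓘(ℝ, Eu d) ∞ M] {F : LieFiltration d M} {S : F.Splitting} {nab : GradedConnection S}

namespace ExpChart

variable (c : ExpChart nab) {f : Coord d → ℂ}

theorem isHolFamily_ev {Ω : Set ℂ} {P : ℂ → KernelDist nab}
    (hP : IsHolomorphicOn P Ω) (hf : IsTest c.plot f) {β : Eu d × ℝ → ℂ} (hβ : Continuous β)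
    (hβt : tsupport β ⊆ c.φ.target ×ˢ univ) (a : ℝ) :
    IsHolFamily Ω fun s b => β b * c.ev (P s) f (b.1, a * b.2) where
  cont := by
    rintro ⟨s, b⟩ ⟨hs, -⟩
    refine ContinuousAt.continuousWithinAt ?_
    by_cases hb : b ∈ tsupport β
    · have hbt : b.1 ∈ c.φ.target := (hβt hb).1
      refine (hβ.continuousAt.comp continuousAt_snd).mul ?_
      have hPc : Tendsto (fun s => (P s).1) (𝓝 s) (𝓝 (P s).1) :=
        (continuous_subtype_val.tendsto (P s)).comp (hP.continuousAt hs)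
      obtain ⟨L, hL, hbL, hLt⟩ := exists_compact_between (isCompact_singleton (x := (b.1, a * b.2)))
        (c.φ.open_target.prod isOpen_univ) (singleton_subset_iff.2 (show (b.1, a * b.2) ∈
          c.φ.target ×ˢ (univ : Set ℝ) from ⟨hbt, trivial⟩))
      have hu := tendstoUniformlyOn_eval hPc (c.isGoodPlot.push hf) (cylPlot_mem c.φ_mem) hL hLt
      have hθ : ContinuousAt (fun b : Eu d × ℝ => (b.1, a * b.2)) b := by fun_prop
      have hcont : ContinuousAt (fun b : Eu d × ℝ => c.ev (P s) f (b.1, a * b.2)) b := by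
        have h1 := ((P s).1 (c.isGoodPlot.push hf)).contDiffAt (cylPlot_mem c.φ_mem)
          (u := (b.1, a * b.2)) ⟨hbt, trivial⟩
        have h2 := ContinuousAt.comp (g := (P s).1 (c.isGoodPlot.push hf) ∘ (cylPlot c.φ).map)
          (f := fun b : Eu d × ℝ => (b.1, a * b.2)) h1.continuousAt hθ
        refine h2.congr (Eventually.of_forall fun b' => ?_)
        exact (c.ev_eq _ hf _).symm
      rw [ContinuousAt, Metric.tendsto_nhds]
      intro ε hε
      have e1 := (Metric.tendstoUniformlyOn_iff.1 hu (ε / 2) (half_pos hε))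
      have e2 : ∀ᶠ b' in 𝓝 b, (b'.1, a * b'.2) ∈ L :=
        hθ.eventually (mem_of_superset (isOpen_interior.mem_nhds (singleton_subset_iff.1 hbL))
          interior_subset)
      have e3 := Metric.tendsto_nhds.1 hcont (ε / 2) (half_pos hε)
      filter_upwards [e1.prod_nhds (e2.and e3)] with p hp
      have h1 := hp.1 _ hp.2.1
      have h2 := hp.2.2
      rw [dist_comm] at h1
      simp only [c.ev_eq _ hf] at h2 ⊢
      exact (dist_triangle _ _ _).trans_lt ((add_lt_add h1 h2).trans_eq (add_halves ε))
    · have h0 : ∀ᶠ p : ℂ × (Eu d × ℝ) in 𝓝 (s, b), (0 : ℂ) =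
          β p.2 * c.ev (P p.1) f (p.2.1, a * p.2.2) := by
        have h1 : ∀ᶠ b' in 𝓝 b, β b' = 0 := notMem_tsupport_iff_eventuallyEq.1 hb
        filter_upwards [continuousAt_snd.eventually h1] with p hp
        rw [hp, zero_mul]
      exact continuousAt_const.congr h0
  hol b s hs := by
    by_cases hb : b ∈ tsupport β
    · obtain ⟨D, hD⟩ := hP s hs
      have h1 := c.tendsto_ev hD (b := (b.1, a * b.2)) (hβt hb).1 f
      refine (HasDerivAt.differentiableAt (f' := c.ev D f (b.1, a * b.2)) ?_).const_mul _
        |>.differentiableWithinAt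
      rw [hasDerivAt_iff_tendsto_slope]
      refine h1.congr fun w => ?_
      have e1 := c.ev_add_left (P w - P s) (P s) hf (b.1, a * b.2)
      rw [sub_add_cancel] at e1
      rw [c.ev_smul_left _ _ hf, slope_def_field, e1, add_sub_cancel_right, div_eq_inv_mul]
    · simp only [image_eq_zero_of_notMem_tsupport hb, zero_mul]
      exact differentiableWithinAt_const _

/-- A test function that equals `1` near the part of the zero section over a compact set. -/
theorem exists_unit_bump {Z : Set (Eu d × ℝ)} (hZ : IsCompact Z) (hZt : Z ⊆ c.φ.target ×ˢ univ) :
    ∃ (Θ : Coord d → ℂ) (ε : ℝ), 0 < ε ∧ IsTest c.plot Θ ∧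
      ∀ b ∈ Z, ∀ z : Eu d, ‖z‖ ≤ ε → Θ (b.1, z, b.2) = 1 := by
  have hK : IsCompact ((fun b : Eu d × ℝ => ((b.1, 0, b.2) : Coord d)) '' Z) :=
    hZ.image (by fun_prop)
  have hKd : (fun b : Eu d × ℝ => ((b.1, 0, b.2) : Coord d)) '' Z ⊆ c.plot.dom := by
    rintro _ ⟨b, hb, rfl⟩
    rw [mem_plot_dom, map_zero]
    exact c.zero_mem_D _ (hZt hb).1
  obtain ⟨Θ, hΘ, hΘc, hΘd, hΘ1⟩ := exists_bump hK c.plot.isOpen_dom hKd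
  obtain ⟨ε, hε, hεs⟩ := (Metric.hasBasis_nhdsSet_cthickening hK).mem_iff.1 hΘ1
  refine ⟨Θ, ε, hε, ⟨hΘ, hΘc, hΘd⟩, fun b hb z hz => hεs ?_⟩
  refine Metric.mem_cthickening_of_dist_le _ (b.1, 0, b.2) _ _ ⟨b, hb, rfl⟩ ?_
  simp only [Prod.dist_eq, dist_self, dist_zero_right]
  exact max_le hε.le (max_le hz hε.le)

theorem contDiffOn_cpow_mul_scale {k : Coord d → ℂ} (hk : ContDiffOn ℝ ∞ k c.plot.dom)
    (r : ℂ) : ContDiffOn ℝ ∞ (fun q : ℝ × Coord d => (q.1 : ℂ) ^ r * k (c.scale q.1⁻¹ q.2))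
      (Ioi 0 ×ˢ c.plot.dom) := by
  rintro ⟨t, v⟩ ⟨ht, hv⟩
  have ht0 : (0 : ℝ) < t := ht
  refine ContDiffAt.contDiffWithinAt ?_
  have h1 : ContDiffAt ℝ ∞ (fun q : ℝ × Coord d => (q.1 : ℂ) ^ r) (t, v) := by
    have hlog : ContDiffAt ℝ ∞ (fun q : ℝ × Coord d => Real.log q.1) (t, v) :=
      contDiffAt_fst.log ht0.ne'
    have hexp : ContDiffAt ℝ ∞ (fun q : ℝ × Coord d =>
        Complex.exp ((Real.log q.1 : ℂ) * r)) (t, v) :=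
      ((Complex.ofRealCLM.contDiff.contDiffAt.comp (t, v) hlog).mul contDiffAt_const).cexp
    refine hexp.congr_of_eventuallyEq ?_
    filter_upwards [continuousAt_fst.eventually (lt_mem_nhds ht0)] with q hq
    rw [Complex.cpow_def_of_ne_zero (by exact_mod_cast (ne_of_gt hq)), Complex.ofReal_log hq.le]
  have h2 : ContDiffAt ℝ ∞ (fun q : ℝ × Coord d => c.scale q.1⁻¹ q.2) (t, v) := by
    have h3 : ContDiffAt ℝ ∞ (fun q : ℝ × Coord d => q.1⁻¹) (t, v) :=
      contDiffAt_fst.inv ht0.ne'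
    have h4 : ContDiffAt ℝ ∞ (fun q : ℝ × Coord d => dilE c.wt q.1⁻¹ q.2.2.1) (t, v) :=
      ContDiffAt.comp (g := fun q : ℝ × Eu d => dilE c.wt q.1 q.2)
        (f := fun q : ℝ × Coord d => (q.1⁻¹, q.2.2.1)) (t, v)
        (contDiff_dilE c.wt).contDiffAt (h3.prodMk (by fun_prop))
    have h5 : ContDiffAt ℝ ∞ (fun q : ℝ × Coord d => (q.1⁻¹)⁻¹ * q.2.2.2) (t, v) :=
      (h3.inv (inv_ne_zero ht0.ne')).mul (by fun_prop)
    exact (by fun_prop : ContDiffAt ℝ ∞ (fun q : ℝ × Coord d => q.2.1) (t, v)).prodMk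
      (h4.prodMk h5)
  exact h1.mul (ContDiffAt.comp (g := k) (f := fun q : ℝ × Coord d => c.scale q.1⁻¹ q.2)
    (t, v) (hk.contDiffAt (c.plot.isOpen_dom.mem_nhds ((c.scale_mem (inv_pos.2 ht0)).2 hv))) h2)

theorem exists_orbit_bound {k : Coord d → ℂ} (hk : ContDiffOn ℝ ∞ k c.plot.dom) (r : ℂ)
    {Z : Set (Eu d × ℝ)} (hZ : IsCompact Z) {ε : ℝ}
    (hZd : ∀ b ∈ Z, ∀ z : Eu d, ‖z‖ ≤ ε → (b.1, z, b.2) ∈ c.plot.dom) :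
    ∃ C : ℝ, 0 ≤ C ∧ ∀ b ∈ Z, ∀ z : Eu d, ‖z‖ ≤ ε → ∀ t ∈ Icc (1 : ℝ) 2,
      ‖(t : ℂ) ^ r * k (c.scale t⁻¹ (b.1, z, b.2)) - k (b.1, 0, b.2)‖ ≤ C * (|t - 1| + ‖z‖) := by
  let ι : ℝ × (Eu d × ℝ) × Eu d → ℝ × Coord d := fun q => (q.1, q.2.1.1, q.2.2, q.2.1.2)
  have hKc : IsCompact (ι '' (Icc 1 2 ×ˢ Z ×ˢ Metric.closedBall 0 ε)) :=
    (isCompact_Icc.prod (hZ.prod (isCompact_closedBall 0 ε))).image (by fun_prop)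
  have hmem : ∀ b ∈ Z, ∀ z : Eu d, ‖z‖ ≤ ε → ∀ t ∈ Icc (1 : ℝ) 2, (t, b.1, z, b.2) ∈
      ι '' (Icc 1 2 ×ˢ Z ×ˢ Metric.closedBall 0 ε) := fun b hb z hz t ht =>
    ⟨(t, b, z), ⟨ht, hb, mem_closedBall_zero_iff.2 hz⟩, rfl⟩
  obtain ⟨C, hC, h⟩ := exists_lipschitz_bound (isOpen_Ioi.prod c.plot.isOpen_dom)
    (c.contDiffOn_cpow_mul_scale hk r) hKc (by
      rintro _ ⟨⟨t, b, z⟩, ⟨ht, hb, hz⟩, rfl⟩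
      exact ⟨lt_of_lt_of_le one_pos ht.1, hZd b hb z (mem_closedBall_zero_iff.1 hz)⟩)
  refine ⟨C, hC, fun b hb z hz t ht => ?_⟩
  have h1 := h _ (hmem b hb z hz t ht) _
    (hmem b hb 0 (by simpa using (norm_nonneg z).trans hz) 1 ⟨le_rfl, one_le_two⟩)
  simp only [Complex.ofReal_one, Complex.one_cpow, one_mul, inv_one, scale_one] at h1
  refine h1.trans (mul_le_mul_of_nonneg_left ?_ hC)
  simp only [Prod.mk_sub_mk, Prod.norm_def, sub_self, norm_zero, sub_zero, Real.norm_eq_abs]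
  have := abs_nonneg (t - 1)
  have := norm_nonneg z
  refine max_le (by linarith) (max_le (by linarith) (max_le (by linarith) (by linarith)))

/-- The difference quotients along the zoom action, evaluated at approximations of the delta
function, approximate the density on the units. -/
theorem norm_integral_orbit_sub_le {k Θ : Coord d → ℂ} (hk : ContDiffOn ℝ ∞ k c.plot.dom)
    {r : ℂ} {ε C B δ : ℝ} (hC : 0 ≤ C) (hδ : 0 < δ) (hδ1 : δ ≤ 1) (hε : 0 < ε) {b : Eu d × ℝ}
    (hΘ : ∀ z : Eu d, ‖z‖ ≤ ε → Θ (b.1, z, b.2) = 1)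
    (hb : ∀ z : Eu d, ‖z‖ ≤ ε → ∀ t ∈ Icc (1 : ℝ) 2,
      ‖(t : ℂ) ^ r * k (c.scale t⁻¹ (b.1, z, b.2)) - k (b.1, 0, b.2)‖ ≤ C * (|t - 1| + ‖z‖))
    {χ : Eu d → ℂ} (hχ : ∀ z, χ z ≠ 0 → ‖z‖ ≤ ε * δ) (hχ1 : ∫ z, χ z = 1) (hχi : Integrable χ)
    (hχB : ∫ z, ‖χ z‖ = B) (hF : IsTest c.plot fun v => Θ v * χ v.2.1) :
    ‖((δ⁻¹ : ℝ) : ℂ) * (∫ t in (1 : ℝ)..1 + δ, (t : ℂ) ^ r *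
      c.orbitIntegral k (fun v => Θ v * χ v.2.1) b t) - k (b.1, 0, b.2)‖ ≤
      C * (1 + ε) * B * δ := by
  have hle : (1 : ℝ) ≤ 1 + δ := by linarith
  have hpt : ∀ t ∈ Icc (1 : ℝ) (1 + δ), ‖(t : ℂ) ^ r *
      c.orbitIntegral k (fun v => Θ v * χ v.2.1) b t - k (b.1, 0, b.2)‖ ≤ C * (1 + ε) * B * δ := by
    intro t ht
    have ht0 : 0 < t := lt_of_lt_of_le one_pos ht.1
    have hi : Integrable fun z => k (c.scale t⁻¹ (b.1, z, b.2)) * (Θ (b.1, z, b.2) * χ z) := by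
      refine c.integrable_mul (a := fun v => k (c.scale t⁻¹ v)) ?_ hF b.1 b.2
      exact hk.continuousOn.comp (c.scale t⁻¹).continuous.continuousOn
        fun v hv => (c.scale_mem (inv_pos.2 ht0)).2 hv
    have e1 : (t : ℂ) ^ r * c.orbitIntegral k (fun v => Θ v * χ v.2.1) b t - k (b.1, 0, b.2) =
        ∫ z, ((t : ℂ) ^ r * (k (c.scale t⁻¹ (b.1, z, b.2)) * (Θ (b.1, z, b.2) * χ z)) -
          k (b.1, 0, b.2) * χ z) := by
      rw [integral_sub (hi.const_mul _) (hχi.const_mul _), integral_const_mul, integral_const_mul,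
        hχ1, mul_one]
      rfl
    have hbd : ∀ z, ‖(t : ℂ) ^ r * (k (c.scale t⁻¹ (b.1, z, b.2)) * (Θ (b.1, z, b.2) * χ z)) -
        k (b.1, 0, b.2) * χ z‖ ≤ C * (1 + ε) * δ * ‖χ z‖ := by
      intro z
      by_cases hz : χ z = 0
      · simp [hz]
      · have hz1 := hχ z hz
        have hz2 : ‖z‖ ≤ ε := hz1.trans (mul_le_of_le_one_right hε.le hδ1)
        rw [hΘ z hz2, one_mul, ← mul_assoc, ← sub_mul, norm_mul]
        refine mul_le_mul_of_nonneg_right ?_ (norm_nonneg _)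
        refine (hb z hz2 t ⟨ht.1, ht.2.trans (by linarith)⟩).trans ?_
        rw [mul_assoc]
        refine mul_le_mul_of_nonneg_left ?_ hC
        have : |t - 1| ≤ δ := by rw [abs_of_nonneg (by linarith [ht.1])]; linarith [ht.2]
        linarith
    rw [e1]
    refine (norm_integral_le_of_norm_le (hχi.norm.const_mul _) (Eventually.of_forall hbd)).trans_eq ?_
    rw [integral_const_mul, hχB]
    ring
  have hint : IntervalIntegrable (fun t : ℝ => (t : ℂ) ^ r *
      c.orbitIntegral k (fun v => Θ v * χ v.2.1) b t) volume 1 (1 + δ) := by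
    refine (((continuousOn_cpow_Ioc r).mul (c.continuousOn_orbitIntegral hk.continuousOn hF b)).mono
      fun t ht => ?_).intervalIntegrable
    rw [uIcc_of_le hle] at ht
    exact lt_of_lt_of_le one_pos ht.1
  have e2 : ((δ⁻¹ : ℝ) : ℂ) * (∫ t in (1 : ℝ)..1 + δ, (t : ℂ) ^ r *
      c.orbitIntegral k (fun v => Θ v * χ v.2.1) b t) - k (b.1, 0, b.2) =
      ((δ⁻¹ : ℝ) : ℂ) * ∫ t in (1 : ℝ)..1 + δ, ((t : ℂ) ^ r *
        c.orbitIntegral k (fun v => Θ v * χ v.2.1) b t - k (b.1, 0, b.2)) := by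
    rw [intervalIntegral.integral_sub hint intervalIntegrable_const,
      intervalIntegral.integral_const, add_sub_cancel_left, mul_sub, Complex.real_smul, ← mul_assoc,
      ← Complex.ofReal_mul, inv_mul_cancel₀ hδ.ne', Complex.ofReal_one, one_mul]
  rw [e2, norm_mul, Complex.norm_of_nonneg (by positivity)]
  have h3 := intervalIntegral.norm_integral_le_of_norm_le_const (a := 1) (b := 1 + δ)
    fun t ht => hpt t (by rw [uIoc_of_le hle] at ht; exact Ioc_subset_Icc_self ht)
  rw [add_sub_cancel_left, abs_of_pos hδ] at h3
  calc _ ≤ δ⁻¹ * (C * (1 + ε) * B * δ * δ) := mul_le_mul_of_nonneg_left h3 (by positivity)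
    _ = _ := by field_simp

end ExpChart

theorem norm_cpow_le_exp {t : ℝ} (ht : t ∈ Icc (1 : ℝ) 2) (z : ℂ) :
    ‖(t : ℂ) ^ z‖ ≤ Real.exp ‖z‖ := by
  have ht0 : 0 < t := lt_of_lt_of_le one_pos ht.1
  rw [Complex.norm_cpow_eq_rpow_re_of_pos ht0, Real.rpow_def_of_pos ht0]
  refine Real.exp_le_exp.2 ?_
  have h1 : |Real.log t| ≤ 1 := by
    rw [abs_of_nonneg (Real.log_nonneg ht.1)]
    linarith [Real.log_le_sub_one_of_pos ht0, ht.2]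
  calc Real.log t * z.re ≤ |Real.log t| * |z.re| := by rw [← abs_mul]; exact le_abs_self _
    _ ≤ 1 * ‖z‖ := mul_le_mul h1 (Complex.abs_re_le_norm z) (abs_nonneg _) zero_le_one
    _ = ‖z‖ := one_mul _

theorem two_pow_mul_add_le_exp {a b c₁ c₂ x y : ℝ} (n : ℕ) (ha : 0 ≤ a) (hb : 0 ≤ b) (hx0 : 0 ≤ x)
    (hy0 : 0 ≤ y) (hx : x ≤ Real.exp (c₁ * (n + 1))) (hy : y ≤ Real.exp (c₂ * (n + 1))) :
    2 ^ n * (a * (b * x) + b * y) ≤ Real.exp ((a + b + |c₁| + |c₂| + 2) * (n + 1)) := by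
  have hn : (1 : ℝ) ≤ (n : ℝ) + 1 := by simp
  have h1 : ∀ x : ℝ, 0 ≤ x → x ≤ Real.exp (x * (n + 1)) := fun x hx =>
    (by linarith [Real.add_one_le_exp x] : x ≤ Real.exp x).trans
      (Real.exp_le_exp.2 (le_mul_of_one_le_right hx hn))
  have h2 : (2 : ℝ) ^ n * 2 ≤ Real.exp (2 * (n + 1)) := by
    have h3 : (2 : ℝ) ≤ Real.exp 2 := by linarith [Real.add_one_le_exp 2]
    calc (2 : ℝ) ^ n * 2 = 2 ^ (n + 1) := (pow_succ _ _).symm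
      _ ≤ Real.exp 2 ^ (n + 1) := pow_le_pow_left₀ (by norm_num) h3 _
      _ = _ := by rw [← Real.exp_nat_mul]; push_cast; ring_nf
  have hE : ∀ c : ℝ, Real.exp (c * (n + 1)) ≤ Real.exp (|c| * (n + 1)) := fun c =>
    Real.exp_le_exp.2 (mul_le_mul_of_nonneg_right (le_abs_self c) (by linarith))
  have hone : ∀ c : ℝ, 0 ≤ c → 1 ≤ Real.exp (c * (n + 1)) := fun c hc =>
    Real.one_le_exp (by positivity)
  set A := Real.exp (a * (n + 1))
  set B := Real.exp (b * (n + 1))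
  set X := Real.exp (|c₁| * (n + 1))
  set Y := Real.exp (|c₂| * (n + 1))
  have hA := hone a ha
  have hX := hone _ (abs_nonneg c₁)
  have hY := hone _ (abs_nonneg c₂)
  have e1 : a * (b * x) ≤ A * B * X * Y := by
    calc a * (b * x) ≤ A * (B * X) := mul_le_mul (h1 a ha) (mul_le_mul (h1 b hb) (hx.trans (hE c₁))
          hx0 (by positivity)) (by positivity) (by positivity)
      _ = A * B * X * 1 := by ring
      _ ≤ A * B * X * Y := mul_le_mul_of_nonneg_left hY (by positivity)
  have e2 : b * y ≤ A * B * X * Y := by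
    calc b * y ≤ B * Y := mul_le_mul (h1 b hb) (hy.trans (hE c₂)) hy0 (by positivity)
      _ = 1 * 1 * (B * Y) := by ring
      _ ≤ A * X * (B * Y) := mul_le_mul_of_nonneg_right (mul_le_mul hA hX zero_le_one (by positivity))
          (by positivity)
      _ = A * B * X * Y := by ring
  calc 2 ^ n * (a * (b * x) + b * y) ≤ 2 ^ n * (A * B * X * Y + A * B * X * Y) :=
        mul_le_mul_of_nonneg_left (add_le_add e1 e2) (by positivity)
    _ = 2 ^ n * 2 * (A * B * X * Y) := by ring
    _ ≤ Real.exp (2 * (n + 1)) * (A * B * X * Y) := mul_le_mul_of_nonneg_right h2 (by positivity)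
    _ = _ := by simp only [A, B, X, Y, ← Real.exp_add]; ring_nf

namespace ExpChart

variable (c : ExpChart nab) {f : Coord d → ℂ}

theorem norm_scale_le {t : ℝ} (ht : t ∈ Icc (1 : ℝ) 2) : ‖c.scale t‖ ≤ 2 ^ c.totalDeg := by
  have h1 : (1 : ℝ) ≤ 2 ^ c.totalDeg := one_le_pow₀ one_le_two
  refine ContinuousLinearMap.opNorm_le_bound _ (by positivity) fun v => ?_
  have hv1 : ‖v.1‖ ≤ ‖v‖ := norm_fst_le v
  have hv2 : ‖v.2.1‖ ≤ ‖v‖ := (norm_fst_le v.2).trans (norm_snd_le v)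
  have hv3 : ‖v.2.2‖ ≤ ‖v‖ := (norm_snd_le v.2).trans (norm_snd_le v)
  have hge : ‖v‖ ≤ 2 ^ c.totalDeg * ‖v‖ := le_mul_of_one_le_left (norm_nonneg _) h1
  rw [scale_apply]
  refine max_le (hv1.trans hge) (max_le ?_ ?_)
  · refine (ContinuousLinearMap.le_opNorm _ _).trans (mul_le_mul ?_ hv2 (norm_nonneg _)
      (by positivity))
    exact norm_dilE_le c.wt one_le_two (by rw [abs_of_nonneg] <;> linarith [ht.1, ht.2])
  · rw [norm_mul, Real.norm_of_nonneg (inv_nonneg.2 (by linarith [ht.1]))]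
    exact (mul_le_of_le_one_left (norm_nonneg _) (inv_le_one_of_one_le₀ ht.1)).trans (hv3.trans hge)

/-- The density on the units of `(𝓛_Z - μ(s)) P(s)` depends holomorphically on `s`, although only
`P(s)` is assumed to do so. -/
theorem isHolFamily_unit_density {Ω : Set ℂ} (hΩ : IsOpen Ω) {P : ℂ → KernelDist nab}
    (hP : IsHolomorphicOn P Ω) {μ : ℂ → ℂ} (hμ : DifferentiableOn ℂ μ Ω)
    (hlie : ∀ s ∈ Ω, ∃ L, Tendsto (zoomSlope (P s)) (𝓝[≠] (1 : ℝ)) (𝓝 L))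
    {k : ℂ → Coord d → ℂ} (hk : ∀ s ∈ Ω, ContDiffOn ℝ ∞ (k s) c.plot.dom)
    (hkd : ∀ s ∈ Ω, IsDensityOn (lieZ (P s) - μ s • P s) c.φ c.plot (k s))
    {β : Eu d × ℝ → ℂ} (hβ : Continuous β) (hβc : HasCompactSupport β)
    (hβt : tsupport β ⊆ c.φ.target ×ˢ univ) :
    IsHolFamily Ω fun s b => β b * k s (b.1, 0, b.2) := by
  obtain ⟨Θ, ε, hε, hΘ, hΘ1⟩ := c.exists_unit_bump hβc hβt
  obtain ⟨χ, B, hχ, hχs, hχ1, hχi, hχB, hχe⟩ := exists_mollifier d hε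
  obtain ⟨Cβ, hCβ⟩ := hβ.bounded_above_of_compact_support hβc
  have hCβ0 : 0 ≤ Cβ := (norm_nonneg _).trans (hCβ 0)
  let δ : ℕ → ℝ := fun n => 2⁻¹ ^ n
  have hδ : ∀ n, 0 < δ n := fun n => by positivity
  have hδ1 : ∀ n, δ n ≤ 1 := fun n => pow_le_one₀ (by norm_num) (by norm_num)
  have hl : ∀ n, 1 + δ n ∈ Icc (1 : ℝ) 2 := fun n =>
    ⟨by linarith [hδ n], by linarith [hδ1 n]⟩
  have hl0 : ∀ n, 0 < 1 + δ n := fun n => by linarith [hδ n]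
  let f : ℕ → Coord d → ℂ := fun n v => Θ v * χ n v.2.1
  have hχ' : ∀ n, ContDiff ℝ ∞ fun v : Coord d => χ n v.2.1 := fun n =>
    (hχ n).comp (by fun_prop)
  have hf : ∀ n, IsTest c.plot (f n) := fun n =>
    ⟨hΘ.contDiff.mul (hχ' n), hΘ.compact.mul_right, tsupport_mul_subset_left.trans hΘ.subset⟩
  let f' : ℕ → Coord d → ℂ := fun n v => f n (c.scale (1 + δ n) v)
  have hf' : ∀ n, IsTest c.plot (f' n) := fun n => (hf n).scale c (hl0 n)
  let X : ℕ → ℂ → Eu d × ℝ → ℂ := fun n s b => β b * c.ev (P s) (f' n) (b.1, (1 + δ n) * b.2)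
  let Y : ℕ → ℂ → Eu d × ℝ → ℂ := fun n s b => β b * c.ev (P s) (f n) (b.1, 1 * b.2)
  -- Difference quotients of `λ ↦ λ ^ (-μ) (α_λ)_* P` at `λ = 1`, tested on approximate
  -- delta functions.
  let A : ℕ → ℂ → Eu d × ℝ → ℂ := fun n s b =>
    (((δ n)⁻¹ : ℝ) : ℂ) * (((1 + δ n : ℝ) : ℂ) ^ (-μ s) * X n s b + (-1) * Y n s b)
  have hW : ∀ n : ℕ, (1 : ℝ) ≤ (n : ℝ) + 1 := fun n => by simp
  have hfe : ExpJets (fun n : ℕ => (n : ℝ) + 1) f := by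
    refine ExpJets.mul hW (ExpJets.of_test hW hΘ.contDiff hΘ.compact) ?_ (fun _ => hΘ.contDiff) hχ'
    refine ExpJets.comp (b := 1) hχe hχ (fun _ => (ContinuousLinearMap.fst ℝ (Eu d) ℝ).comp
      (ContinuousLinearMap.snd ℝ (Eu d) (Eu d × ℝ))) fun n => ?_
    refine (ContinuousLinearMap.opNorm_comp_le _ _).trans ?_
    refine (mul_le_one₀ (ContinuousLinearMap.norm_fst_le ..) (norm_nonneg _)
      (ContinuousLinearMap.norm_snd_le ..)).trans (Real.one_le_exp ?_)
    have := hW n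
    positivity
  have hfe' : ExpJets (fun n : ℕ => (n : ℝ) + 1) f' := by
    refine ExpJets.comp (b := c.totalDeg) hfe (fun n => (hf n).contDiff)
      (fun n => c.scale (1 + δ n)) fun n => (c.norm_scale_le (hl n)).trans ?_
    have h3 : (2 : ℝ) ≤ Real.exp 1 := by linarith [Real.add_one_le_exp 1]
    calc (2 : ℝ) ^ c.totalDeg ≤ Real.exp 1 ^ c.totalDeg := pow_le_pow_left₀ (by norm_num) h3 _
      _ = Real.exp c.totalDeg := by rw [← Real.exp_nat_mul, mul_one]
      _ ≤ _ := Real.exp_le_exp.2 (le_mul_of_one_le_right (Nat.cast_nonneg _) (hW n))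
  -- compact sets that contain the supports and the points of evaluation for all `n`
  have hKc : IsCompact ((fun q : ℝ × Coord d => c.scale q.1⁻¹ q.2) ''
      (Icc 1 2 ×ˢ tsupport Θ)) := by
    refine (isCompact_Icc.prod hΘ.compact).image_of_continuousOn fun q hq => ?_
    exact (c.continuousAt_scale_inv (ne_of_gt (lt_of_lt_of_le one_pos hq.1.1))
      q.2).continuousWithinAt
  have hKd : (fun q : ℝ × Coord d => c.scale q.1⁻¹ q.2) '' (Icc 1 2 ×ˢ tsupport Θ) ⊆
      c.plot.dom := by
    rintro _ ⟨⟨t, v⟩, ⟨ht, hv⟩, rfl⟩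
    exact (c.scale_mem (inv_pos.2 (lt_of_lt_of_le one_pos ht.1))).2 (hΘ.subset hv)
  have hinv : ∀ (t : ℝ), 0 < t → ∀ v, c.scale t⁻¹ (c.scale t v) = v := fun t ht v => by
    rw [scale_scale, inv_mul_cancel₀ ht.ne', scale_one]
  have hfK : ∀ n, tsupport (f' n) ⊆ (fun q : ℝ × Coord d => c.scale q.1⁻¹ q.2) ''
      (Icc 1 2 ×ˢ tsupport Θ) := fun n => by
    refine closure_minimal (fun v hv => ⟨(1 + δ n, c.scale (1 + δ n) v), ⟨hl n, ?_⟩,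
      hinv _ (hl0 n) v⟩) hKc.isClosed
    refine subset_tsupport _ fun h0 => hv ?_
    change Θ _ * _ = 0
    rw [h0, zero_mul]
  have hLc : IsCompact ((fun q : ℝ × (Eu d × ℝ) => (q.2.1, q.1 * q.2.2)) ''
      (Icc 1 2 ×ˢ tsupport β)) := (isCompact_Icc.prod hβc).image (by fun_prop)
  have hLd : (fun q : ℝ × (Eu d × ℝ) => (q.2.1, q.1 * q.2.2)) '' (Icc 1 2 ×ˢ tsupport β) ⊆
      (cylPlot c.φ).dom := by
    rintro _ ⟨⟨t, b⟩, ⟨-, hb⟩, rfl⟩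
    exact ⟨(hβt hb).1, trivial⟩
  refine IsHolFamily.of_tendsto (F := A) (fun n => ?_) hΩ (fun s hs L _ => ?_) fun s hs L _ => ?_
  · refine (IsHolFamily.of_continuous continuous_const).mul (IsHolFamily.add (IsHolFamily.mul
      (IsHolFamily.of_differentiableOn ?_) (c.isHolFamily_ev hP (hf' n) hβ hβt _))
      ((IsHolFamily.of_continuous continuous_const).mul (c.isHolFamily_ev hP (hf n) hβ hβt _)))
    refine hμ.neg.const_cpow (Or.inl ?_)
    exact_mod_cast (hl0 n).ne'
  · have hPc : ContinuousAt (fun s => (P s).1) s :=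
      continuous_subtype_val.continuousAt.comp (hP.continuousAt hs)
    obtain ⟨R₁, hR₁, C₁, h₁⟩ := exists_exp_bound hPc c.isGoodPlot hKc hKd hf' hfK hfe'
      (cylPlot_mem c.φ_mem) hLc hLd
    obtain ⟨R₂, hR₂, C₂, h₂⟩ := exists_exp_bound hPc c.isGoodPlot hΘ.compact hΘ.subset hf
      (fun n => tsupport_mul_subset_left) hfe (cylPlot_mem c.φ_mem) hLc hLd
    have hμc : ContinuousAt μ s := (hμ.differentiableAt (hΩ.mem_nhds hs)).continuousAt
    obtain ⟨R₃, hR₃, h₃⟩ := Metric.eventually_nhds_iff_ball.1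
      (hμc.norm.eventually (gt_mem_nhds (lt_add_one ‖μ s‖)))
    refine ⟨min R₁ (min R₂ R₃), by positivity,
      Real.exp (‖μ s‖ + 1) + Cβ + |C₁| + |C₂| + 2, fun n z hz b _ => ?_⟩
    have hz1 : z ∈ Metric.ball s R₁ := Metric.ball_subset_ball (min_le_left _ _) hz
    have hz2 : z ∈ Metric.ball s R₂ :=
      Metric.ball_subset_ball ((min_le_right _ _).trans (min_le_left _ _)) hz
    have hz3 : z ∈ Metric.ball s R₃ :=
      Metric.ball_subset_ball ((min_le_right _ _).trans (min_le_right _ _)) hz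
    by_cases hb : b ∈ tsupport β
    · have hx := h₁ n z hz1 (b.1, (1 + δ n) * b.2) ⟨(1 + δ n, b), ⟨hl n, hb⟩, rfl⟩
      have hy := h₂ n z hz2 (b.1, 1 * b.2) ⟨(1, b), ⟨⟨le_rfl, one_le_two⟩, hb⟩, rfl⟩
      refine le_trans ?_ (two_pow_mul_add_le_exp n (Real.exp_nonneg (‖μ s‖ + 1)) hCβ0
        (norm_nonneg _) (norm_nonneg _) hx hy)
      have hd2 : (((δ n)⁻¹ : ℝ) : ℂ) = 2 ^ n := by simp [δ]
      simp only [A, X, Y, c.ev_eq _ (hf' n), c.ev_eq _ (hf n), hd2]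
      rw [norm_mul, norm_pow, Complex.norm_ofNat]
      refine mul_le_mul_of_nonneg_left ((norm_add_le _ _).trans (add_le_add ?_ ?_)) (by positivity)
      · rw [norm_mul, norm_mul]
        refine mul_le_mul ?_ (mul_le_mul_of_nonneg_right (hCβ b) (norm_nonneg _)) (by positivity)
          (Real.exp_nonneg _)
        refine (norm_cpow_le_exp (hl n) _).trans (Real.exp_le_exp.2 ?_)
        rw [norm_neg]
        exact (h₃ z hz3).le
      · rw [norm_mul, norm_neg, norm_one, one_mul, norm_mul]
        exact mul_le_mul_of_nonneg_right (hCβ b) (norm_nonneg _)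
    · have hβ0 : β b = 0 := image_eq_zero_of_notMem_tsupport hb
      simp only [A, X, Y, hβ0, zero_mul, mul_zero, add_zero, norm_zero]
      exact Real.exp_nonneg _
  · have hdom : ∀ b ∈ tsupport β, ∀ z : Eu d, ‖z‖ ≤ ε → (b.1, z, b.2) ∈ c.plot.dom :=
      fun b hb z hz => hΘ.subset (subset_tsupport _ (by
        rw [Function.mem_support, hΘ1 b hb z hz]; exact one_ne_zero))
    obtain ⟨C, hC, hCb⟩ := c.exists_orbit_bound (hk s hs) (-(c.totalDeg : ℂ) - μ s - 1) hβc hdom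
    refine ⟨Cβ * (C * (1 + ε) * B), fun n b _ => ?_⟩
    by_cases hb : b ∈ tsupport β
    · have h1 := c.norm_integral_orbit_sub_le (hk s hs) hC (hδ n) (hδ1 n) hε (hΘ1 b hb)
        (hCb b hb) (hχs n) (hχ1 n) (hχi n) (hχB n) (hf n)
      have h2 := c.ev_scale_sub (hlie s hs) (hk s hs).continuousOn (hkd s hs) (hf n) (b := b)
        (hβt hb).1 one_pos (hl0 n)
      rw [← h2] at h1
      simp only [scale_one, Complex.ofReal_one, Complex.one_cpow, one_mul] at h1
      have h3 : A n s b - β b * k s (b.1, 0, b.2) = β b * ((((δ n)⁻¹ : ℝ) : ℂ) *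
          (((1 + δ n : ℝ) : ℂ) ^ (-μ s) * c.ev (P s) (f' n) (b.1, (1 + δ n) * b.2) -
            c.ev (P s) (f n) (b.1, b.2)) - k s (b.1, 0, b.2)) := by
        simp only [A, X, Y, one_mul]
        ring
      rw [h3, norm_mul, mul_assoc]
      exact mul_le_mul (hCβ b) h1 (norm_nonneg _) hCβ0
    · have hβ0 : β b = 0 := image_eq_zero_of_notMem_tsupport hb
      have hB : 0 ≤ B := by rw [← hχB 0]; exact integral_nonneg fun _ => norm_nonneg _
      simp only [A, X, Y, hβ0, zero_mul, mul_zero, add_zero, sub_zero, norm_zero]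
      positivity

end ExpChart

/-- On the units, the density of `(𝓛_Z - μ(s)) P(s)` and all its derivatives in the direction of
`h` depend holomorphically on `s`. -/
theorem ExpChart.exists_jetFamily (c : ExpChart nab) {Ω : Set ℂ} (hΩ : IsOpen Ω)
    {P : ℂ → KernelDist nab} (hP : IsHolomorphicOn P Ω) {μ : ℂ → ℂ} (hμ : DifferentiableOn ℂ μ Ω)
    (hlie : ∀ s ∈ Ω, ∃ L, Tendsto (zoomSlope (P s)) (𝓝[≠] (1 : ℝ)) (𝓝 L))
    {k : ℂ → Coord d → ℂ} (hk : ∀ s ∈ Ω, ContDiffOn ℝ ∞ (k s) c.plot.dom)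
    (hkd : ∀ s ∈ Ω, IsDensityOn (lieZ (P s) - μ s • P s) c.φ c.plot (k s))
    {ρ : Eu d → ℂ} (hρ : ContDiff ℝ ∞ ρ) (hρc : HasCompactSupport ρ)
    (hρt : tsupport ρ ⊆ c.φ.target) :
    ∃ g : ℕ → ℂ → Eu d × ℝ → ℂ, IsJetFamily Ω g ∧
      ∀ s ∈ Ω, ∀ q, g 0 s q = ρ q.1 * k s (q.1, 0, q.2) := by
  let m : ℂ → Eu d × ℝ → ℂ := fun s q => ρ q.1 * k s (q.1, 0, q.2)
  let D : (Eu d × ℝ → ℂ) → Eu d × ℝ → ℂ := fun f q => fderiv ℝ f q (0, 1)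
  have hsm : ∀ s ∈ Ω, ContDiff ℝ ∞ (m s) := fun s hs => by
    refine contDiff_mul_of_tsupport (hρ.comp contDiff_fst) fun q hq => ?_
    have hq1 : q.1 ∈ c.φ.target := hρt (tsupport_comp_subset_preimage ρ continuous_fst hq)
    have hq2 : ((q.1, 0, q.2) : Coord d) ∈ c.plot.dom := by
      rw [mem_plot_dom, map_zero]
      exact c.zero_mem_D _ hq1
    exact ContDiffAt.comp (g := k s) (f := fun q : Eu d × ℝ => ((q.1, 0, q.2) : Coord d)) q
      ((hk s hs).contDiffAt (c.plot.isOpen_dom.mem_nhds hq2)) (by fun_prop)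
  have hD : ∀ f, ContDiff ℝ ∞ f → ContDiff ℝ ∞ (D f) := fun f hf =>
    (hf.fderiv_right (m := ∞) (by simp)).clm_apply contDiff_const
  have hDj : ∀ s ∈ Ω, ∀ j, ContDiff ℝ ∞ (D^[j] (m s)) := fun s hs j => by
    induction j with
    | zero => exact hsm s hs
    | succ j ih => rw [Function.iterate_succ_apply']; exact hD _ ih
  refine ⟨fun j s => D^[j] (m s), IsJetFamily.of_smooth hΩ ?_ (fun j s hs => (hDj s hs j).continuous)
    fun j s hs u h => ?_, fun s _ q => rfl⟩
  · refine IsHolFamily.of_locally fun s hs b => ?_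
    obtain ⟨σ, hσ, hσc, -, hσ1⟩ := exists_bump (isCompact_singleton (x := b.2)) isOpen_univ
      (subset_univ _)
    rw [nhdsSet_singleton] at hσ1
    have hβc : HasCompactSupport fun q : Eu d × ℝ => ρ q.1 * σ q.2 := by
      refine HasCompactSupport.intro (hρc.prod hσc) fun q hq => ?_
      by_cases h1 : q.1 ∈ tsupport ρ
      · rw [image_eq_zero_of_notMem_tsupport fun h2 => hq ⟨h1, h2⟩, mul_zero]
      · rw [image_eq_zero_of_notMem_tsupport h1, zero_mul]
    have hfam := c.isHolFamily_unit_density hΩ hP hμ hlie hk hkd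
      (β := fun q : Eu d × ℝ => ρ q.1 * σ q.2)
      ((hρ.continuous.comp continuous_fst).mul (hσ.continuous.comp continuous_snd)) hβc
      (fun q hq => ⟨hρt (tsupport_comp_subset_preimage ρ continuous_fst
        (tsupport_mul_subset_left hq)), trivial⟩)
    have heq : ∀ s, ∀ q ∈ {q : Eu d × ℝ | σ q.2 = 1}, m s q =
        ρ q.1 * σ q.2 * k s (q.1, 0, q.2) := fun s q hq => by
      rw [show σ q.2 = 1 from hq, mul_one]
    refine ⟨Ω, hΩ.mem_nhds hs, {q : Eu d × ℝ | σ q.2 = 1}, continuousAt_snd.eventually hσ1, ?_, ?_⟩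
    · exact (hfam.cont.mono (prod_mono_right (subset_univ _))).congr fun p hp => heq p.1 p.2 hp.2
    · exact fun q hq => (hfam.hol q).congr fun s _ => heq s q hq
  · have h1 := ((hDj s hs j).differentiable (by simp) (u, h)).hasFDerivAt
    have h2 : HasDerivAt (fun h : ℝ => ((u, h) : Eu d × ℝ)) (0, 1) h :=
      (hasDerivAt_const h u).prodMk (hasDerivAt_id h)
    have h3 := h1.comp_hasDerivAt h h2
    have h4 : D^[j + 1] (m s) (u, h) = fderiv ℝ (D^[j] (m s)) (u, h) (0, 1) := by
      rw [Function.iterate_succ_apply']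
    exact h3.congr_deriv h4.symm

end SmoothDensities

/-! ### Analytic continuation of the Mellin integral of a family of smooth functions -/

section Regularization

/-- The function `(f(h) - f(0)) / h`. -/
def taylorQuot (f : ℝ → ℂ) (h : ℝ) : ℂ := ∫ t in (0 : ℝ)..1, deriv f (t * h)

theorem taylorQuot_const_mul (a : ℂ) (f : ℝ → ℂ) :
    taylorQuot (fun h => a * f h) = fun h => a * taylorQuot f h := by
  funext h
  simp only [taylorQuot, deriv_const_mul_field, intervalIntegral.integral_const_mul]

theorem taylorQuot_iterate_const_mul (a : ℂ) (f : ℝ → ℂ) (j : ℕ) :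
    taylorQuot^[j] (fun h => a * f h) = fun h => a * taylorQuot^[j] f h := by
  induction j with
  | zero => rfl
  | succ j ih =>
    rw [Function.iterate_succ_apply', Function.iterate_succ_apply', ih, taylorQuot_const_mul]

/-- The remainder `h ^ J ∫₀¹ t ^ (w + J - 1) q(t h) dt` for the Taylor quotient `q` of order `J`. -/
def regRemainder (J : ℕ) (w : ℂ) (f : ℝ → ℂ) (h : ℝ) : ℂ :=
  (h : ℂ) ^ J * ∫ t in (0 : ℝ)..1, (t : ℂ) ^ (w + J - 1) * taylorQuot^[J] f (t * h)

/-- The continuation to `Re w > -J` of the integral `∫₀¹ t ^ (w - 1) f(t h) dt`, obtained by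
splitting off the Taylor polynomial of `f`. -/
def reg (J : ℕ) (w : ℂ) (f : ℝ → ℂ) (h : ℝ) : ℂ :=
  ∑ j ∈ Finset.range J, (w + j)⁻¹ * ((h : ℂ) ^ j * taylorQuot^[j] f 0) + regRemainder J w f h

/-- The product of `reg J w f` with `w (w + 1) ⋯ (w + J - 1)`, without denominators. -/
def regNum (J : ℕ) (w : ℂ) (f : ℝ → ℂ) (h : ℝ) : ℂ :=
  ∑ j ∈ Finset.range J, (∏ i ∈ (Finset.range J).erase j, (w + i)) *
    ((h : ℂ) ^ j * taylorQuot^[j] f 0) + (∏ i ∈ Finset.range J, (w + i)) * regRemainder J w f h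

theorem regRemainder_const_mul (J : ℕ) (w a : ℂ) (f : ℝ → ℂ) (h : ℝ) :
    regRemainder J w (fun h => a * f h) h = a * regRemainder J w f h := by
  simp only [regRemainder, taylorQuot_iterate_const_mul, mul_left_comm _ a,
    intervalIntegral.integral_const_mul]

theorem reg_const_mul (J : ℕ) (w a : ℂ) (f : ℝ → ℂ) (h : ℝ) :
    reg J w (fun h => a * f h) h = a * reg J w f h := by
  simp only [reg, regRemainder_const_mul, taylorQuot_iterate_const_mul, mul_left_comm _ a, mul_add,
    Finset.mul_sum]

theorem regNum_const_mul (J : ℕ) (w a : ℂ) (f : ℝ → ℂ) (h : ℝ) :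
    regNum J w (fun h => a * f h) h = a * regNum J w f h := by
  simp only [regNum, regRemainder_const_mul, taylorQuot_iterate_const_mul, mul_left_comm _ a,
    mul_add, Finset.mul_sum]

theorem regNum_eq_prod_mul {J : ℕ} {w : ℂ} (hw : ∀ j < J, w + j ≠ 0) (f : ℝ → ℂ) (h : ℝ) :
    regNum J w f h = (∏ i ∈ Finset.range J, (w + i)) * reg J w f h := by
  rw [reg, mul_add, Finset.mul_sum, regNum]
  congr 1
  refine Finset.sum_congr rfl fun j hj => ?_
  rw [← Finset.mul_prod_erase _ _ hj, mul_comm (w + (j : ℂ)), mul_assoc, ← mul_assoc (w + (j : ℂ)),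
    mul_inv_cancel₀ (hw j (Finset.mem_range.1 hj)), one_mul]

variable {Y : Type*} [TopologicalSpace Y] [FirstCountableTopology Y] {Ω : Set ℂ}
  {g : ℕ → ℂ → Y × ℝ → ℂ}

theorem IsJetFamily.iterate_hadQuot (hg : IsJetFamily Ω g) (hΩ : IsOpen Ω) (j : ℕ) :
    IsJetFamily Ω (Carnot.hadQuot^[j] g) := by
  induction j with
  | zero => exact hg
  | succ j ih => rw [Function.iterate_succ_apply']; exact ih.hadQuot hΩ

theorem IsJetFamily.iterate_hadQuot_eq (hg : IsJetFamily Ω g) (hΩ : IsOpen Ω) {s : ℂ} (hs : s ∈ Ω)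
    (y : Y) (j : ℕ) : (fun h => Carnot.hadQuot^[j] g 0 s (y, h)) =
      taylorQuot^[j] fun h => g 0 s (y, h) := by
  induction j with
  | zero => rfl
  | succ j ih =>
    rw [Function.iterate_succ_apply', Function.iterate_succ_apply', ← ih]
    funext h
    have h1 : ∀ t : ℝ, _root_.deriv (fun h => Carnot.hadQuot^[j] g 0 s (y, h)) t =
        Carnot.hadQuot^[j] g 1 s (y, t) := fun t =>
      ((hg.iterate_hadQuot hΩ j).deriv 0 s hs y t).deriv
    simp [taylorQuot, Carnot.hadQuot, h1]

theorem IsJetFamily.regRemainder_eq (hg : IsJetFamily Ω g) (hΩ : IsOpen Ω) {s : ℂ} (hs : s ∈ Ω)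
    (J : ℕ) (w : ℂ) (y : Y) (h : ℝ) : regRemainder J w (fun h => g 0 s (y, h)) h =
      (h : ℂ) ^ J * Carnot.mellinPart (w + J) (Carnot.hadQuot^[J] g 0 s) (y, h) := by
  rw [regRemainder, ← hg.iterate_hadQuot_eq hΩ hs y J]
  rfl

theorem IsJetFamily.reg_succ (hg : IsJetFamily Ω g) (hΩ : IsOpen Ω) {s : ℂ} (hs : s ∈ Ω) {J : ℕ}
    {w : ℂ} (hw : 0 < (w + J).re) (y : Y) (h : ℝ) :
    reg (J + 1) w (fun h => g 0 s (y, h)) h = reg J w (fun h => g 0 s (y, h)) h := by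
  have h1 := (hg.iterate_hadQuot hΩ J).mellinPart_eq hΩ hs hw y h
  rw [reg, reg, Finset.sum_range_succ, add_assoc, hg.regRemainder_eq hΩ hs,
    hg.regRemainder_eq hΩ hs, h1, ← hg.iterate_hadQuot_eq hΩ hs y J, Function.iterate_succ_apply']
  push_cast
  rw [← add_assoc w]
  ring

/-- The regularized integral does not depend on the number of Taylor coefficients split off. -/
theorem IsJetFamily.reg_eq (hg : IsJetFamily Ω g) (hΩ : IsOpen Ω) {s : ℂ} (hs : s ∈ Ω) {J J' : ℕ}
    {w : ℂ} (hw : 0 < (w + J).re) (hw' : 0 < (w + J').re) (y : Y) (h : ℝ) :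
    reg J w (fun h => g 0 s (y, h)) h = reg J' w (fun h => g 0 s (y, h)) h := by
  have key : ∀ (J n : ℕ), 0 < (w + J).re →
      reg (J + n) w (fun h => g 0 s (y, h)) h = reg J w (fun h => g 0 s (y, h)) h := fun J n hJ => by
    induction n with
    | zero => rfl
    | succ n ih =>
      rw [← ih, ← add_assoc]
      refine hg.reg_succ hΩ hs ?_ y h
      have : (0 : ℝ) ≤ n := Nat.cast_nonneg n
      simp at hJ ⊢
      linarith
  rcases le_total J J' with hle | hle
  · rw [← Nat.add_sub_cancel' hle, key J _ hw]
  · rw [← Nat.add_sub_cancel' hle, key J' _ hw']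

theorem IsJetFamily.isHolFamily_regRemainder (hg : IsJetFamily Ω g) (hΩ : IsOpen Ω) {w : ℂ → ℂ}
    (hw : DifferentiableOn ℂ w Ω) {J : ℕ} (hre : ∀ s ∈ Ω, 0 < (w s + J).re) :
    IsHolFamily Ω fun s (q : Y × ℝ) => regRemainder J (w s) (fun h => g 0 s (q.1, h)) q.2 := by
  refine IsHolFamily.congr ((IsHolFamily.of_continuous (f := fun q : Y × ℝ => (q.2 : ℂ) ^ J)
    (by fun_prop)).mul (IsHolFamily.mellinPart ((hg.iterate_hadQuot hΩ J).hol 0) hΩ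
      (ζ := fun s => w s + J) (hw.add_const _) hre)) fun s hs q => ?_
  exact hg.regRemainder_eq hΩ hs J (w s) q.1 q.2

theorem IsJetFamily.isHolFamily_regNum (hg : IsJetFamily Ω g) (hΩ : IsOpen Ω) {w : ℂ → ℂ}
    (hw : DifferentiableOn ℂ w Ω) {J : ℕ} (hre : ∀ s ∈ Ω, 0 < (w s + J).re) :
    IsHolFamily Ω fun s (q : Y × ℝ) => regNum J (w s) (fun h => g 0 s (q.1, h)) q.2 := by
  have hprod : ∀ I : Finset ℕ, DifferentiableOn ℂ (fun s => ∏ i ∈ I, (w s + i)) Ω := fun I =>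
    DifferentiableOn.fun_finsetProd fun i _ => hw.add_const _
  have hsum : ∀ I : Finset ℕ, IsHolFamily Ω fun s (q : Y × ℝ) => ∑ j ∈ I,
      (∏ i ∈ (Finset.range J).erase j, (w s + i)) *
        ((q.2 : ℂ) ^ j * Carnot.hadQuot^[j] g 0 s (q.1, 0)) := fun I => by
    induction I using Finset.induction_on with
    | empty => simpa using IsHolFamily.of_continuous (Y := Y × ℝ) (f := fun _ => 0) continuous_const
    | insert a I ha ih =>
      simp only [Finset.sum_insert ha]
      refine IsHolFamily.add ((IsHolFamily.of_differentiableOn (hprod _)).mul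
        ((IsHolFamily.of_continuous (f := fun q : Y × ℝ => (q.2 : ℂ) ^ a) (by fun_prop)).mul ?_)) ih
      exact IsHolFamily.comp ((hg.iterate_hadQuot hΩ a).hol 0) (φ := fun q : Y × ℝ => (q.1, 0))
        (by fun_prop)
  refine IsHolFamily.congr ((hsum (Finset.range J)).add ((IsHolFamily.of_differentiableOn
    (hprod (Finset.range J))).mul (hg.isHolFamily_regRemainder hΩ hw hre))) fun s hs q => ?_
  have h1 : ∀ j, taylorQuot^[j] (fun h => g 0 s (q.1, h)) 0 = Carnot.hadQuot^[j] g 0 s (q.1, 0) :=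
    fun j => by rw [← hg.iterate_hadQuot_eq hΩ hs q.1 j]
  simp only [regNum, h1]

end Regularization

/-! ### Densities and local traces -/

section Densities

variable {d : ℕ} {M : Type*} [TopologicalSpace M] [ChartedSpace (Eu d) M]
  [IsManifold 𝓘(ℝ, Eu d) ∞ M] {F : LieFiltration d M} {S : F.Splitting} {nab : GradedConnection S}

theorem integral_comp_continuousLinearEquiv (L : Eu d ≃L[ℝ] Eu d) (f : Eu d → ℂ) :
    ∫ z, f z = ((|(L : Eu d →L[ℝ] Eu d).det| : ℝ) : ℂ) * ∫ z, f (L z) := by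
  have hdet : LinearMap.det (L.toLinearEquiv : Eu d →ₗ[ℝ] Eu d) ≠ 0 :=
    (LinearEquiv.isUnit_det' L.toLinearEquiv).ne_zero
  have hmap := Measure.map_linearMap_addHaar_eq_smul_addHaar (volume : Measure (Eu d))
    (f := (L.toLinearEquiv : Eu d →ₗ[ℝ] Eu d)) hdet
  have h1 := L.toHomeomorph.measurableEmbedding.integral_map (μ := volume) f
  change ∫ y, f y ∂(Measure.map (L.toLinearEquiv : Eu d →ₗ[ℝ] Eu d) volume) = ∫ z, f (L z) at h1
  rw [← h1, hmap, integral_smul_measure, ENNReal.toReal_ofReal (abs_nonneg _), Complex.real_smul,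
    ← mul_assoc, ← Complex.ofReal_mul]
  change _ = ((|LinearMap.det (L.toLinearEquiv : Eu d →ₗ[ℝ] Eu d)| * _ : ℝ) : ℂ) * _
  rw [← abs_mul, mul_inv_cancel₀ hdet, abs_one, Complex.ofReal_one, one_mul]

theorem density_apply_frame {φ : OpenPartialHomeomorph M (Eu d)} (hφ : φ ∈ charts d M) {u : Eu d}
    (hu : u ∈ φ.target) (Y : Fin d → ∀ x : M, TangentSpace 𝓘(ℝ, Eu d) x)
    (ν : DensityAt d (φ.symm u)) :
    ν.1 (fun i => Y i (φ.symm u)) = ((|(frameMap φ Y u).det| : ℝ) : ℂ) * densityCoeff φ u ν := by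
  have hx := φ.map_target hu
  let E : TangentSpace 𝓘(ℝ, Eu d) (φ.symm u) ≃ₗ[ℝ] Eu d :=
    LinearEquiv.ofBijective (coordVec φ (φ.symm u)).toLinearMap
      ⟨coordVec_injective hφ hx, fun w => ⟨_, coordVec_chartField hφ hx w⟩⟩
  have hE : ∀ v, E v = coordVec φ (φ.symm u) v := fun _ => rfl
  let A : TangentSpace 𝓘(ℝ, Eu d) (φ.symm u) →ₗ[ℝ] TangentSpace 𝓘(ℝ, Eu d) (φ.symm u) :=
    (E.symm : Eu d →ₗ[ℝ] _) ∘ₗ (frameMap φ Y u).toLinearMap ∘ₗ (E : _ →ₗ[ℝ] Eu d)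
  have hdet : LinearMap.det A = (frameMap φ Y u).det :=
    LinearMap.det_conj (frameMap φ Y u).toLinearMap E.symm
  have hA : ∀ i, A (mfderiv 𝓘(ℝ, Eu d) 𝓘(ℝ, Eu d) φ.symm u
      (EuclideanSpace.single i (1 : ℝ) : Eu d)) = Y i (φ.symm u) := fun i => by
    apply E.injective
    have h1 : coordVec φ (φ.symm u) (mfderiv 𝓘(ℝ, Eu d) 𝓘(ℝ, Eu d) φ.symm u
        (EuclideanSpace.single i (1 : ℝ) : Eu d)) = EuclideanSpace.single i (1 : ℝ) := by
      have h := (charts.mdifferentiable hφ).comp_symm_deriv hu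
      exact DFunLike.congr_fun h _
    have h2 : E (A (mfderiv 𝓘(ℝ, Eu d) 𝓘(ℝ, Eu d) φ.symm u
        (EuclideanSpace.single i (1 : ℝ) : Eu d))) = frameMap φ Y u (coordVec φ (φ.symm u)
        (mfderiv 𝓘(ℝ, Eu d) 𝓘(ℝ, Eu d) φ.symm u (EuclideanSpace.single i (1 : ℝ) : Eu d))) :=
      E.apply_symm_apply _
    rw [h2, h1, frameMap_apply, hE]
    congr 1
    simp
  have h3 := ν.2 A fun i => mfderiv 𝓘(ℝ, Eu d) 𝓘(ℝ, Eu d) φ.symm u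
    (EuclideanSpace.single i (1 : ℝ) : Eu d)
  simp only [hA, hdet] at h3
  exact_mod_cast h3

theorem exists_density {x : M} (b : Module.Basis (Fin d) ℝ (TangentSpace 𝓘(ℝ, Eu d) x)) (a : ℂ) :
    ∃ ν : DensityAt d x, ν.1 b = a := by
  refine ⟨⟨fun v => ((|b.det v| : ℝ) : ℂ) * a, fun A v => ?_⟩, ?_⟩
  · have h1 := b.det_comp A v
    change b.det (fun i => A (v i)) = _ at h1
    simp only [h1, abs_mul, Complex.ofReal_mul, mul_assoc]
  · change ((|b.det b| : ℝ) : ℂ) * a = a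
    rw [b.det_self, abs_one, Complex.ofReal_one, one_mul]

theorem det_ne_zero_of_isUnit {A : Eu d →L[ℝ] Eu d} (hA : IsUnit A) : A.det ≠ 0 := by
  have h1 : IsUnit (A : Eu d →ₗ[ℝ] Eu d) :=
    hA.map (ContinuousLinearMap.toLinearMapRingHom (R₁ := ℝ) (M₁ := Eu d))
  exact (h1.map LinearMap.det).ne_zero

namespace ExpChart

variable (c c' : ExpChart nab)

theorem det_frameMap_ne_zero {φ : OpenPartialHomeomorph M (Eu d)} (hφ : φ ∈ charts d M) {u : Eu d}
    (hu : u ∈ φ.target) (hx : φ.symm u ∈ c.φ.source) : (frameMap φ c.field u).det ≠ 0 :=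
  det_ne_zero_of_isUnit ((isUnit_frameMap_iff hφ hu).2 (c.field_indep hx))

theorem densityCoeff_eq {φ : OpenPartialHomeomorph M (Eu d)} (hφ : φ ∈ charts d M) {u : Eu d}
    (hu : u ∈ φ.target) (hx : φ.symm u ∈ c.φ.source) (ν : DensityAt d (φ.symm u)) :
    densityCoeff φ u ν = (((|(frameMap φ c.field u).det|)⁻¹ : ℝ) : ℂ) *
      ν.1 fun i => c.field i (φ.symm u) := by
  have h0 : |(frameMap φ c.field u).det| ≠ 0 :=
    abs_ne_zero.2 (c.det_frameMap_ne_zero hφ hu hx)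
  rw [density_apply_frame hφ hu, ← mul_assoc, ← Complex.ofReal_mul, inv_mul_cancel₀ h0,
    Complex.ofReal_one, one_mul]

theorem exists_apply_eq_mul {x : M} (hx : x ∈ c.φ.source)
    (v : Fin d → TangentSpace 𝓘(ℝ, Eu d) x) :
    ∃ κ : ℂ, ∀ ν : DensityAt d x, ν.1 v = κ * ν.1 fun i => c.field i x := by
  obtain ⟨u, hu, rfl⟩ : ∃ u ∈ c.φ.target, c.φ.symm u = x := ⟨c.φ x, c.φ.map_source hx, c.φ.left_inv hx⟩
  let Y : Fin d → ∀ x : M, TangentSpace 𝓘(ℝ, Eu d) x := fun i _ => (v i : Eu d)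
  refine ⟨((|(frameMap c.φ Y u).det| : ℝ) : ℂ) * (((|(frameMap c.φ c.field u).det|)⁻¹ : ℝ) : ℂ),
    fun ν => ?_⟩
  rw [mul_assoc, ← c.densityCoeff_eq c.φ_mem hu hx]
  exact density_apply_frame c.φ_mem hu Y ν

/-- A density is determined by its value on the frame of an exponential chart. -/
theorem density_ext {x : M} (hx : x ∈ c.φ.source) {ν ν' : DensityAt d x}
    (h : (ν.1 fun i => c.field i x) = ν'.1 fun i => c.field i x) : ν = ν' := by
  refine Subtype.ext (funext fun v => ?_)
  obtain ⟨κ, hκ⟩ := c.exists_apply_eq_mul hx v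
  rw [hκ, hκ, h]

theorem frame_change {x : M} (hx : x ∈ c.φ.source) (hx' : x ∈ c'.φ.source) (ν : DensityAt d x) :
    (ν.1 fun i => c'.field i x) =
      ((|(c.change c' (c.φ x)).det| : ℝ) : ℂ) * ν.1 fun i => c.field i x := by
  obtain ⟨u, hu, rfl⟩ : ∃ u ∈ c.φ.target, c.φ.symm u = x := ⟨c.φ x, c.φ.map_source hx, c.φ.left_inv hx⟩
  rw [c.φ.right_inv hu, density_apply_frame c.φ_mem hu, density_apply_frame c.φ_mem hu]
  have h1 : frameMap c.φ c'.field u = frameMap c.φ c.field u * c.change c' u := by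
    rw [change, ← mul_assoc, Ring.mul_inverse_cancel _ (c.isUnit_frameMap c hu hx), one_mul]
  have h2 : (frameMap c.φ c'.field u).det = (frameMap c.φ c.field u).det * (c.change c' u).det := by
    rw [h1]
    exact LinearMap.det_comp _ _
  rw [h2, abs_mul, Complex.ofReal_mul]
  ring

theorem exists_density_frame {x : M} (hx : x ∈ c.φ.source) (a : ℂ) :
    ∃ ν : DensityAt d x, (ν.1 fun i => c.field i x) = a := by
  have hcard : Fintype.card (Fin d) = Module.finrank ℝ (TangentSpace 𝓘(ℝ, Eu d) x) := by
    rw [Fintype.card_fin]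
    exact finrank_euclideanSpace_fin.symm
  obtain ⟨ν, hν⟩ := exists_density (Module.Basis.mk (c.field_indep hx)
    ((c.field_indep hx).span_eq_top_of_card_eq_finrank' hcard).ge) a
  refine ⟨ν, ?_⟩
  rwa [Module.Basis.coe_mk] at hν

end ExpChart

end Densities

section LocalTraces

variable {d : ℕ} {M : Type*} [TopologicalSpace M] [T2Space M] [ChartedSpace (Eu d) M]
  [IsManifold 𝓘(ℝ, Eu d) ∞ M] {F : LieFiltration d M} {S : F.Splitting} {nab : GradedConnection S}

/-- Since `|dz|` transforms with the change of frame, so do the densities of a kernel in two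
exponential charts. -/
theorem ExpChart.density_transZero (c c' : ExpChart nab) {P : KernelDist nab}
    {a a' : Coord d → ℂ} (ha : ContinuousOn a c.plot.dom)
    (ha' : ContinuousOn a' c'.plot.dom) (h : IsDensityOn P c.φ c.plot a)
    (h' : IsDensityOn P c'.φ c'.plot a') {q : Coord d} (hq : q ∈ c'.plot.dom)
    (hx : c'.φ.symm q.1 ∈ c.φ.source) (hD : c.transZero c' q ∈ c.plot.dom) :
    a' q = ((|(c.change c' (c.φ (c'.φ.symm q.1))).det| : ℝ) : ℂ) * a (c.transZero c' q) := by
  let U : Set (Coord d) :=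
    {w | w ∈ c'.plot.dom ∧ c'.φ.symm w.1 ∈ c.φ.source ∧ c.transZero c' w ∈ c.plot.dom}
  have hsymm : ∀ w ∈ c'.plot.dom, ContinuousAt (fun w : Coord d => c'.φ.symm w.1) w :=
    fun w hw => ContinuousAt.comp (g := c'.φ.symm) (f := fun w : Coord d => w.1)
      (c'.φ.continuousAt_symm (c'.mem_target hw)) continuousAt_fst
  have hUo : IsOpen U := isOpen_iff_mem_nhds.2 fun w hw => by
    filter_upwards [c'.plot.isOpen_dom.mem_nhds hw.1,
      (hsymm w hw.1).eventually (c.φ.open_source.mem_nhds hw.2.1),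
      c.eventually_transZero c' hw.1 hw.2.1 hw.2.2] with w' h1 h2 h3 using ⟨h1, h2, h3.1⟩
  have hk : ContinuousOn (fun w => a' w - ((|(c.change c' (c.φ (c'.φ.symm w.1))).det| : ℝ) : ℂ) *
      a (c.transZero c' w)) U := fun w hw => by
    have hu : c.φ (c'.φ.symm w.1) ∈ c.φ.target := c.φ.map_source hw.2.1
    have h1 : ContinuousAt (fun w : Coord d => c.φ (c'.φ.symm w.1)) w :=
      ContinuousAt.comp (g := c.φ) (f := fun w : Coord d => c'.φ.symm w.1)
        (c.φ.continuousAt hw.2.1) (hsymm w hw.1)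
    have h2 : ContinuousAt (fun w : Coord d => c.change c' (c.φ (c'.φ.symm w.1))) w :=
      ContinuousAt.comp (g := c.change c') (f := fun w : Coord d => c.φ (c'.φ.symm w.1))
        (c.contDiffAt_change c' hu (by
          rw [c.φ.left_inv hw.2.1]; exact c'.φ.map_target (c'.mem_target hw.1))).continuousAt h1
    have h3 : ContinuousAt (fun w : Coord d =>
        ((|(c.change c' (c.φ (c'.φ.symm w.1))).det| : ℝ) : ℂ)) w :=
      Complex.continuous_ofReal.continuousAt.comp
        ((ContinuousLinearMap.continuous_det.continuousAt.comp h2).abs)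
    exact ((ha'.continuousAt (c'.plot.isOpen_dom.mem_nhds hw.1)).sub (h3.mul
      (ContinuousAt.comp (g := a) (f := c.transZero c')
        (ha.continuousAt (c.plot.isOpen_dom.mem_nhds hw.2.2))
        (c.contDiffAt_transZero c' hw.1 hw.2.1).continuousAt))).continuousWithinAt
  refine sub_eq_zero.1 (eq_zero_of_integral_eq_zero hUo hk (v := q) ⟨hq, hx, hD⟩
    fun f hf hfc hfs => ?_)
  obtain ⟨u', z₀, t⟩ := q
  have hu' : u' ∈ c'.φ.target := c'.mem_target hq
  have hft : IsTest c'.plot f := ⟨hf, hfc, fun w hw => (hfs hw).1⟩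
  set u : Eu d := c.φ (c'.φ.symm u') with hu_def
  have hu : u ∈ c.φ.target := c.φ.map_source hx
  have hsu : c.φ.symm u = c'.φ.symm u' := c.φ.left_inv hx
  obtain ⟨L', hL'⟩ : IsUnit (c.change c' u) := c.isUnit_change c' hu (by
    rw [hsu]; exact c'.φ.map_target hu')
  let L : Eu d ≃L[ℝ] Eu d := ContinuousLinearEquiv.unitsEquiv ℝ (Eu d) L'
  have hLdet : (L : Eu d →L[ℝ] Eu d) = c.change c' u := hL'
  have hL : ∀ z, L z = c.change c' u z := fun z => DFunLike.congr_fun hL' z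
  have htr : ∀ z, c.transZero c' (u', z, t) = (u, L z, t) := fun z => by rw [hL]; rfl
  set g := c'.isGoodPlot.push hft with hg
  -- the function `g` in the coordinates of the other chart
  have hgz : ∀ z, (u, L z, t) ∈ c.plot.dom → g (c.plot.map (u, L z, t)) = f (u', z, t) :=
    fun z hz => by
    by_cases hzU : ((u', z, t) : Coord d) ∈ c'.plot.dom
    · rw [← htr, c.plot_map_transZero c' hzU hx (by rw [htr]; exact hz)]
      exact c'.isGoodPlot.push_map hft hzU
    · rw [image_eq_zero_of_notMem_tsupport fun hw => hzU (hfs hw).1]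
      by_contra hne
      obtain ⟨w, ⟨hwf, hwd⟩, hw⟩ := IsGoodPlot.mem_of_pushFun_ne_zero hne
      have hwU := hfs (subset_tsupport _ hwf)
      rw [← c.plot_map_transZero c' hwd hwU.2.1 hwU.2.2] at hw
      have e1 := c.injOn_plot hwU.2.2 hz hw
      have e2 : w.1 = u' := by
        have e3 : c.φ (c'.φ.symm w.1) = c.φ (c'.φ.symm u') := (Prod.ext_iff.1 e1).1
        exact c'.φ.symm.injOn (c'.mem_target hwd) hu' (c.φ.injOn hwU.2.1 hx e3)
      obtain ⟨w₁, w₂, w₃⟩ := w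
      obtain rfl : w₁ = u' := e2
      obtain rfl : w₃ = t := (Prod.ext_iff.1 (Prod.ext_iff.1 e1).2).2
      have e4 := (Prod.ext_iff.1 (Prod.ext_iff.1 ((htr w₂).symm.trans e1)).2).1
      exact hzU (L.injective e4 ▸ hwd)
  have h1 := h g ⟨c.transZero c' '' tsupport f, (show IsCompact (tsupport f) from
    hfc).image_of_continuousOn fun w hw => (c.contDiffAt_transZero c' (hfs hw).1
      (hfs hw).2.1).continuousAt.continuousWithinAt, by
        rintro _ ⟨w, hw, rfl⟩; exact (hfs hw).2.2, fun γ hγ => by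
        obtain ⟨w, ⟨hwf, hwd⟩, rfl⟩ := IsGoodPlot.mem_of_pushFun_ne_zero hγ
        have hwU := hfs (subset_tsupport _ hwf)
        exact ⟨_, ⟨w, subset_tsupport _ hwf, rfl⟩,
          c.plot_map_transZero c' hwd hwU.2.1 hwU.2.2⟩⟩ u hu t
  have h2 : ∫ z in {z | (u, z, t) ∈ c.plot.dom}, a (u, z, t) * g (c.plot.map (u, z, t)) =
      ∫ z, a (u, z, t) * f (u', L.symm z, t) := by
    have hm : MeasurableSet {z | (u, z, t) ∈ c.plot.dom} :=
      (c.plot.isOpen_dom.preimage (by fun_prop : Continuous fun z : Eu d =>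
        ((u, z, t) : Coord d))).measurableSet
    have h0 : ∀ z ∉ {z | (u, z, t) ∈ c.plot.dom}, a (u, z, t) * f (u', L.symm z, t) = 0 :=
      fun z hz => by
        have h4 : f (u', L.symm z, t) = 0 := image_eq_zero_of_notMem_tsupport fun hw => hz (by
          have h3 := (hfs hw).2.2
          rwa [htr, L.apply_symm_apply] at h3)
        rw [h4, mul_zero]
    rw [← setIntegral_eq_integral_of_forall_compl_eq_zero h0]
    refine setIntegral_congr_fun hm fun z hz => ?_
    have h3 := hgz (L.symm z) (by rw [L.apply_symm_apply]; exact hz)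
    rw [L.apply_symm_apply] at h3
    simp only [h3]
  have h5 : c'.ev P f (u', t) = ∫ z, a' (u', z, t) * f (u', z, t) := c'.ev_eq_integral h' hft hu'
  rw [h2, hsu, integral_comp_continuousLinearEquiv L, hLdet] at h1
  rw [c'.ev_eq _ hft, ← hg, h1] at h5
  simp only [L.symm_apply_apply] at h5
  have hi : Integrable fun z => a (u, L z, t) * f (u', z, t) := by
    have hfU : IsTest (⟨U, hUo, c'.plot.map⟩ : Plot (Coord d) (HTangent F)) f :=
      ⟨hf, hfc, hfs⟩
    have hac : Continuous fun z => a (u, L z, t) * f (u', z, t) :=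
      continuous_iff_continuousAt.2 fun z => hfU.continuousAt_mul
        (θ := fun z => ((u', z, t) : Coord d)) (by fun_prop) fun hz => by
          have hz2 := hz.2.2
          rw [htr] at hz2
          exact ContinuousAt.comp (g := a) (f := fun z : Eu d => ((u, L z, t) : Coord d))
            (ha.continuousAt (c.plot.isOpen_dom.mem_nhds hz2)) (by fun_prop)
    refine hac.integrable_of_hasCompactSupport (HasCompactSupport.intro
      ((show IsCompact (tsupport f) from hfc).image (f := fun v : Coord d => v.2.1)
        (by fun_prop)) fun z hz => ?_)
    rw [image_eq_zero_of_notMem_tsupport fun hw => hz ⟨_, hw, rfl⟩, mul_zero]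
  change ∫ z, (a' (u', z, t) - ((|(c.change c' u).det| : ℝ) : ℂ) * a (c.transZero c' (u', z, t))) *
    f (u', z, t) = 0
  simp only [htr, sub_mul, mul_assoc]
  rw [integral_sub (c'.integrable_mul ha' hft u' t) (hi.const_mul _), integral_const_mul, ← h5,
    sub_self]

theorem ExpChart.zero_mem_dom (c : ExpChart nab) {u : Eu d} (hu : u ∈ c.φ.target) (h : ℝ) :
    ((u, 0, h) : Coord d) ∈ c.plot.dom := by
  rw [mem_plot_dom, map_zero]
  exact c.zero_mem_D _ hu

/-- A kernel with continuous densities in the exponential charts has a local trace. -/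
theorem exists_isLocalTrace {P : KernelDist nab}
    (H : ∀ c : ExpChart nab, ∃ a, ContinuousOn a c.plot.dom ∧ IsDensityOn P c.φ c.plot a) :
    ∃ τ, IsLocalTrace P τ := by
  choose a ha hd using H
  choose c hc using exists_expChart nab
  choose ν hν using fun (x : M) (h : ℝ) => (c x).exists_density_frame (hc x)
    (a (c x) ((c x).φ x, 0, h))
  refine ⟨ν, fun c' => ⟨a c', ha c', hd c', fun u hu h => ?_⟩⟩
  have hx' : c'.φ.symm u ∈ c'.φ.source := c'.φ.map_target hu
  have h1 := (c (c'.φ.symm u)).density_transZero c' (ha _) (ha c') (hd _) (hd c')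
    (c'.zero_mem_dom hu h) (hc _) (by
      simp only [ExpChart.transZero, map_zero]
      exact ExpChart.zero_mem_dom _ ((c _).φ.map_source (hc _)) h)
  simp only [ExpChart.transZero, map_zero] at h1
  rw [h1, ← hν]
  exact (c (c'.φ.symm u)).frame_change c' (hc _) hx' _

theorem IsLocalTrace.apply_frame {P : KernelDist nab} {τ : ∀ x : M, ℝ → DensityAt d x}
    (hτ : IsLocalTrace P τ) (c : ExpChart nab) {a : Coord d → ℂ}
    (ha : ContinuousOn a c.plot.dom) (hd : IsDensityOn P c.φ c.plot a) {u : Eu d}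
    (hu : u ∈ c.φ.target) (h : ℝ) :
    ((τ (c.φ.symm u) h).1 fun i => c.field i (c.φ.symm u)) = a (u, 0, h) := by
  obtain ⟨a', ha', hd', h'⟩ := hτ c
  rw [c.density_unique ha ha' hd hd' (c.zero_mem_dom hu h)]
  exact h' u hu h

/-- Local traces of two distributions that agree on the fibres over `M × {h}` agree at `h`. -/
theorem IsLocalTrace.eq_of_eq {P P' : KernelDist nab} {τ τ' : ∀ x : M, ℝ → DensityAt d x}
    (hτ : IsLocalTrace P τ) (hτ' : IsLocalTrace P' τ') {h : ℝ}
    (hPP' : ∀ f x, P.1 f (x, h) = P'.1 f (x, h)) (x : M) : τ x h = τ' x h := by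
  obtain ⟨c, hx⟩ := exists_expChart nab x
  obtain ⟨u, hu, rfl⟩ : ∃ u ∈ c.φ.target, c.φ.symm u = x := ⟨c.φ x, c.φ.map_source hx, c.φ.left_inv hx⟩
  obtain ⟨a, ha, hd, h1⟩ := hτ c
  obtain ⟨a', ha', hd', h2⟩ := hτ' c
  refine c.density_ext hx (((h1 u hu h).trans ?_).trans (h2 u hu h).symm)
  exact c.density_eq_of_eq ha ha' hd hd' (c.zero_mem_dom hu h) fun f => hPP' f _

theorem IsLocalTrace.unique {P : KernelDist nab} {τ τ' : ∀ x : M, ℝ → DensityAt d x}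
    (hτ : IsLocalTrace P τ) (hτ' : IsLocalTrace P τ') : τ = τ' :=
  funext fun x => funext fun _ => hτ.eq_of_eq hτ' (fun _ _ => rfl) x

theorem isLocalTrace_localTrace {P : KernelDist nab} (h : ∃ τ, IsLocalTrace P τ) :
    IsLocalTrace P (localTrace P) := by
  rw [localTrace, dif_pos h]
  exact h.choose_spec

theorem isLocalTrace_of_isSmoothProperDensity {P : KernelDist nab} (h : IsSmoothProperDensity P) :
    IsLocalTrace P (localTrace P) :=
  isLocalTrace_localTrace (exists_isLocalTrace fun c => by
    obtain ⟨a, ha, hd⟩ := h.exp c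
    exact ⟨a, ha.continuousOn, hd⟩)

end LocalTraces

/-! ### Holomorphic families of continuous sections of the density bundle -/

section Sections

variable {d : ℕ} {M : Type*} [TopologicalSpace M] [ChartedSpace (Eu d) M]
  [IsManifold 𝓘(ℝ, Eu d) ∞ M] {U : Set ℂ} {τ : ℂ → ∀ x : M, ℝ → DensityAt d x}

/-- The coefficients of the sections `τ s` of the density bundle in the charts of `M` are
continuous and depend holomorphically on `s`. -/
def IsHolSection (U : Set ℂ) (τ : ℂ → ∀ x : M, ℝ → DensityAt d x) : Prop :=
  ∀ φ ∈ charts d M, IsHolFamily U fun s (y : (φ.target ×ˢ univ : Set (Eu d × ℝ))) =>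
    densityCoeff φ y.1.1 (τ s (φ.symm y.1.1) y.1.2)

namespace IsHolSection

theorem mono {U' : Set ℂ} (h : IsHolSection U τ) (hU : U' ⊆ U) : IsHolSection U' τ :=
  fun φ hφ => (h φ hφ).mono hU

theorem smul (h : IsHolSection U τ) {a : ℂ → ℂ} (ha : DifferentiableOn ℂ a U) :
    IsHolSection U fun s x t => a s • τ s x t :=
  fun φ hφ => (IsHolFamily.of_differentiableOn ha).mul (h φ hφ)

theorem mem_contSubmodule (h : IsHolSection U τ) {s : ℂ} (hs : s ∈ U) :
    τ s ∈ contSubmodule d M := fun φ hφ =>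
  continuousOn_iff_continuous_domRestrict.2 ((h φ hφ).continuous hs)

theorem differentiableOn_apply (h : IsHolSection U τ) (x : M) (t : ℝ)
    (v : Fin d → TangentSpace 𝓘(ℝ, Eu d) x) : DifferentiableOn ℂ (fun s => (τ s x t).1 v) U := by
  have hφ : chartAt (Eu d) x ∈ charts d M := IsManifold.chart_mem_maximalAtlas x
  obtain ⟨u, hu, hux⟩ : ∃ u ∈ (chartAt (Eu d) x).target, (chartAt (Eu d) x).symm u = x :=
    ⟨_, mem_chart_target _ x, (chartAt (Eu d) x).left_inv (mem_chart_source _ x)⟩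
  generalize chartAt (Eu d) x = φ at hφ hu hux
  subst hux
  let Y : Fin d → ∀ x : M, TangentSpace 𝓘(ℝ, Eu d) x := fun i _ => (v i : Eu d)
  exact (((h φ hφ).hol ⟨(u, t), hu, trivial⟩).const_mul
    ((|(frameMap φ Y u).det| : ℝ) : ℂ)).congr fun s _ => density_apply_frame hφ hu Y (τ s _ t)

/-- A family of sections with holomorphic coefficients is a holomorphic map into `C(M × ℝ, ΩM)`. -/
theorem isHolomorphicOn (h : IsHolSection U τ) (hU : IsOpen U) {T : ℂ → ContDensity d M}
    (hT : ∀ s ∈ U, ∀ x t, T s x t = τ s x t) : IsHolomorphicOn T U := by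
  intro s hs
  let D : ∀ x : M, ℝ → DensityAt d x := fun x t =>
    ⟨fun v => deriv (fun s => (τ s x t).1 v) s, fun A v => by
      have h1 : ∀ s, (τ s x t).1 (fun i => A (v i)) = |LinearMap.det A| * (τ s x t).1 v :=
        fun s => (τ s x t).2 A v
      simp only [h1, deriv_const_mul_field]⟩
  have hlc : ∀ φ : charts d M, LocallyCompactSpace (φ.1.target ×ˢ univ : Set (Eu d × ℝ)) :=
    fun φ => (φ.1.open_target.prod isOpen_univ).locallyCompactSpace
  have hD : D ∈ contSubmodule d M := fun φ hφ => by
    have := hlc ⟨φ, hφ⟩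
    exact continuousOn_iff_continuous_domRestrict.2 ((h φ hφ).continuous_deriv hU hs)
  obtain ⟨D', hD'⟩ : ∃ D' : ContDensity d M, D'.1 = D := ⟨⟨D, hD⟩, rfl⟩
  refine ⟨D', ?_⟩
  rw [nhds_iInf, tendsto_iInf]
  intro φ
  rw [nhds_induced, tendsto_comap_iff,
    ContinuousMap.tendsto_iff_forall_isCompact_tendstoUniformlyOn]
  intro L hL
  have hco : ⇑(ContDensity.coeff φ D') = fun y => deriv (fun s =>
      densityCoeff φ.1 y.1.1 (τ s (φ.1.symm y.1.1) y.1.2)) s := funext fun y => by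
    change densityCoeff φ.1 y.1.1 (D'.1 (φ.1.symm y.1.1) y.1.2) = _
    rw [hD']
    rfl
  rw [hco]
  refine ((h φ.1 φ.2).tendsto_slope hU hs hL).congr ?_
  filter_upwards [eventually_nhdsWithin_of_eventually_nhds (hU.mem_nhds hs)] with w hw y _
  have h1 : ∀ s ∈ U, (T s).1 = τ s := fun s hs => funext fun x => funext fun t => hT s hs x t
  change (w - s)⁻¹ • (densityCoeff φ.1 y.1.1 (τ w (φ.1.symm y.1.1) y.1.2) -
    densityCoeff φ.1 y.1.1 (τ s (φ.1.symm y.1.1) y.1.2)) = densityCoeff φ.1 y.1.1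
      ((w - s)⁻¹ • ((T w).1 (φ.1.symm y.1.1) y.1.2 - (T s).1 (φ.1.symm y.1.1) y.1.2))
  rw [h1 w hw, h1 s hs]
  rfl

end IsHolSection

theorem isHolSection_of_expChart [T2Space M] {F : LieFiltration d M} {S : F.Splitting}
    (nab : GradedConnection S) (hU : IsOpen U)
    (H : ∀ (c : ExpChart nab) (ρ : Eu d → ℂ), ContDiff ℝ ∞ ρ → HasCompactSupport ρ →
      tsupport ρ ⊆ c.φ.target → ∃ G : ℂ → Eu d × ℝ → ℂ, IsHolFamily U G ∧
        ∀ s ∈ U, ∀ u ∈ c.φ.target, ∀ t, G s (u, t) =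
          ρ u * (τ s (c.φ.symm u) t).1 fun i => c.field i (c.φ.symm u)) :
    IsHolSection U τ := by
  refine fun φ hφ => IsHolFamily.of_locally fun s hs y₀ => ?_
  have hφs : ∀ y : (φ.target ×ˢ univ : Set (Eu d × ℝ)), y.1.1 ∈ φ.target := fun y => y.2.1
  obtain ⟨c, hc⟩ := exists_expChart nab (φ.symm y₀.1.1)
  obtain ⟨ρ, hρ, hρc, hρt, hρ1⟩ := exists_bump (isCompact_singleton (x := c.φ (φ.symm y₀.1.1)))
    c.φ.open_target (singleton_subset_iff.2 (c.φ.map_source hc))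
  rw [nhdsSet_singleton] at hρ1
  obtain ⟨G, hG, hGτ⟩ := H c ρ hρ hρc hρt
  let V : Set (φ.target ×ˢ univ : Set (Eu d × ℝ)) :=
    {y | φ.symm y.1.1 ∈ c.φ.source ∧ ρ (c.φ (φ.symm y.1.1)) = 1}
  have hfst : Continuous fun y : (φ.target ×ˢ univ : Set (Eu d × ℝ)) => y.1.1 := by fun_prop
  have hsymm : Continuous fun y : (φ.target ×ˢ univ : Set (Eu d × ℝ)) => φ.symm y.1.1 :=
    φ.continuousOn_symm.comp_continuous hfst hφs
  have hV : V ∈ 𝓝 y₀ := by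
    have h1 : ContinuousAt (fun y : (φ.target ×ˢ univ : Set (Eu d × ℝ)) => c.φ (φ.symm y.1.1)) y₀ :=
      ContinuousAt.comp (g := c.φ) (f := fun y : (φ.target ×ˢ univ : Set (Eu d × ℝ)) =>
        φ.symm y.1.1) (c.φ.continuousAt hc) hsymm.continuousAt
    exact (hsymm.continuousAt.eventually (c.φ.open_source.mem_nhds hc)).and (h1.eventually hρ1)
  have hGV : ∀ s ∈ U, ∀ y ∈ V, densityCoeff φ y.1.1 (τ s (φ.symm y.1.1) y.1.2) =
      (((|(frameMap φ c.field y.1.1).det|)⁻¹ : ℝ) : ℂ) * G s (c.φ (φ.symm y.1.1), y.1.2) := by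
    intro s hs y hy
    rw [hGτ s hs _ (c.φ.map_source hy.1), hy.2, one_mul, c.densityCoeff_eq hφ (hφs y) hy.1,
      c.φ.left_inv hy.1]
  have hB : ContinuousOn (fun y : (φ.target ×ˢ univ : Set (Eu d × ℝ)) =>
      (((|(frameMap φ c.field y.1.1).det|)⁻¹ : ℝ) : ℂ)) V := by
    have h1 : ContinuousOn (fun y : (φ.target ×ˢ univ : Set (Eu d × ℝ)) =>
        frameMap φ c.field y.1.1) V :=
      (contDiffOn_frameMap c.frame_smooth hφ).continuousOn.comp hfst.continuousOn
        fun y hy => ⟨hφs y, hy.1⟩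
    refine Complex.continuous_ofReal.comp_continuousOn (ContinuousOn.inv₀
      (ContinuousLinearMap.continuous_det.comp_continuousOn h1).abs fun y hy => ?_)
    exact abs_ne_zero.2 (c.det_frameMap_ne_zero hφ (hφs y) hy.1)
  have hθ : ContinuousOn (fun y : (φ.target ×ˢ univ : Set (Eu d × ℝ)) =>
      (c.φ (φ.symm y.1.1), y.1.2)) V :=
    (c.φ.continuousOn.comp hsymm.continuousOn fun y hy => hy.1).prodMk (by fun_prop)
  refine ⟨U, hU.mem_nhds hs, V, hV, ?_, fun y hy => ?_⟩
  · refine ContinuousOn.congr (f := fun p : ℂ × (φ.target ×ˢ univ : Set (Eu d × ℝ)) =>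
      (((|(frameMap φ c.field p.2.1.1).det|)⁻¹ : ℝ) : ℂ) *
        G p.1 (c.φ (φ.symm p.2.1.1), p.2.1.2)) ?_ fun p hp => hGV p.1 hp.1 p.2 hp.2
    exact (hB.comp continuousOn_snd fun p hp => hp.2).mul (hG.cont.comp
      (continuousOn_fst.prodMk (hθ.comp continuousOn_snd fun p hp => hp.2))
      fun p hp => ⟨hp.1, trivial⟩)
  · exact ((hG.hol _).const_mul _).congr fun s hs => hGV s hs y hy

/-- A homogeneous operation on functions of `h`, applied to a section. -/
def mapSection (Φ : (ℝ → ℂ) → ℝ → ℂ) (hΦ : ∀ a f h, Φ (fun h => a * f h) h = a * Φ f h)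
    (τ : ∀ x : M, ℝ → DensityAt d x) (x : M) (h : ℝ) : DensityAt d x :=
  ⟨fun v => Φ (fun h => (τ x h).1 v) h, fun A v => by
    have h1 : ∀ h, (τ x h).1 (fun i => A (v i)) = |LinearMap.det A| * (τ x h).1 v :=
      fun h => (τ x h).2 A v
    simp only [h1, hΦ]⟩

open Classical in
/-- The element of `C(M × ℝ, ΩM)` given by a section, `0` if the section is not continuous. -/
def toContDensity (τ : ∀ x : M, ℝ → DensityAt d x) : ContDensity d M :=
  if h : τ ∈ contSubmodule d M then ⟨τ, h⟩ else 0

theorem toContDensity_val {τ : ∀ x : M, ℝ → DensityAt d x} (h : τ ∈ contSubmodule d M) :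
    (toContDensity τ).1 = τ := by
  have h1 : toContDensity τ = (⟨τ, h⟩ : contSubmodule d M) := dif_pos h
  exact congrArg Subtype.val h1

end Sections

/-! ### Integration over a compact manifold -/

section Functionals

variable {d : ℕ} {M : Type*} [TopologicalSpace M] [T2Space M] [ChartedSpace (Eu d) M]
  [IsManifold 𝓘(ℝ, Eu d) ∞ M]

/-- `Λ` is linear on continuous sections and maps holomorphic families to holomorphic functions. -/
structure IsHolFunctional (Λ : (∀ x : M, ℝ → DensityAt d x) → ℂ) : Prop where
  add : ∀ τ ∈ contSubmodule d M, ∀ τ' ∈ contSubmodule d M, Λ (τ + τ') = Λ τ + Λ τ'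
  smul : ∀ (a : ℂ) (τ), Λ (a • τ) = a * Λ τ
  differentiableOn : ∀ (U : Set ℂ) (τ : ℂ → ∀ x : M, ℝ → DensityAt d x), IsOpen U →
    IsHolSection U τ → DifferentiableOn ℂ (fun s => Λ (τ s)) U

theorem isHolFunctional_apply (x : M) (h : ℝ) (v : Fin d → TangentSpace 𝓘(ℝ, Eu d) x) :
    IsHolFunctional fun τ : ∀ x : M, ℝ → DensityAt d x => (τ x h).1 v where
  add _ _ _ _ := rfl
  smul _ _ := rfl
  differentiableOn _ _ _ hτ := hτ.differentiableOn_apply x h v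

theorem exists_densityIntegral_eq [SigmaCompactSpace M] [CompactSpace M] :
    ∃ (I : Finset M) (K : M → Set (Eu d)) (r : M → Eu d → ℂ),
      (∀ y, IsCompact (K y) ∧ K y ⊆ (chartAt (Eu d) y).target ∧ ContinuousOn (r y) (K y)) ∧
      ∀ ν : ∀ x : M, DensityAt d x, densityIntegral ν = ∑ y ∈ I, ∫ u in K y, r y u *
        densityCoeff (chartAt (Eu d) y) u (ν ((chartAt (Eu d) y).symm u)) := by
  have hex := SmoothPartitionOfUnity.exists_isSubordinate_chartAt_source 𝓘(ℝ, Eu d) M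
  set ρ := hex.choose with hρ
  have hρs : ρ.IsSubordinate fun x => (chartAt (Eu d) x).source := hex.choose_spec
  have hsub : ∀ y, chartAt (Eu d) y '' tsupport (ρ y) ⊆ (chartAt (Eu d) y).target := by
    rintro y _ ⟨x, hx, rfl⟩
    exact (chartAt (Eu d) y).map_source (hρs y hx)
  refine ⟨ρ.locallyFinite.finite_nonempty_of_compact.toFinset,
    fun y => chartAt (Eu d) y '' tsupport (ρ y),
    fun y u => (ρ y ((chartAt (Eu d) y).symm u) : ℂ), fun y => ⟨?_, hsub y, ?_⟩, fun ν => ?_⟩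
  · exact (isClosed_tsupport _).isCompact.image_of_continuousOn
      ((chartAt (Eu d) y).continuousOn.mono (hρs y))
  · exact Complex.continuous_ofReal.comp_continuousOn ((ρ y).contMDiff.continuous.comp_continuousOn
      ((chartAt (Eu d) y).continuousOn_symm.mono (hsub y)))
  · rw [densityIntegral, finsum_eq_sum_of_support_subset]
    · refine Finset.sum_congr rfl fun y _ => ?_
      refine setIntegral_eq_of_subset_of_forall_sdiff_eq_zero
        (chartAt (Eu d) y).open_target.measurableSet (hsub y) fun u hu => ?_
      have h1 : ρ y ((chartAt (Eu d) y).symm u) = 0 := image_eq_zero_of_notMem_tsupport fun h =>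
        hu.2 ⟨_, h, (chartAt (Eu d) y).right_inv hu.1⟩
      rw [← hρ, h1, Complex.ofReal_zero, zero_mul]
    · intro y hy
      by_contra hne
      have h1 : ∀ x, ρ y x = 0 := fun x => by
        by_contra hx
        exact hne ((Set.Finite.mem_toFinset _).2 ⟨x, hx⟩)
      refine hy ?_
      rw [← hρ]
      simp [h1]

theorem isHolFunctional_densityIntegral [SigmaCompactSpace M] [CompactSpace M] (h : ℝ) :
    IsHolFunctional fun τ : ∀ x : M, ℝ → DensityAt d x => densityIntegral fun x => τ x h := by
  obtain ⟨I, K, r, hK, hI⟩ := exists_densityIntegral_eq (d := d) (M := M)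
  have hch : ∀ y : M, chartAt (Eu d) y ∈ charts d M := IsManifold.chart_mem_maximalAtlas
  have hint : ∀ τ ∈ contSubmodule d M, ∀ y, IntegrableOn (fun u => r y u *
      densityCoeff (chartAt (Eu d) y) u (τ ((chartAt (Eu d) y).symm u) h)) (K y) := fun τ hτ y =>
    ((hK y).2.2.mul (ContinuousOn.comp (f := fun u : Eu d => (u, h)) (hτ _ (hch y)) (by fun_prop)
      fun u hu => ⟨(hK y).2.1 hu, trivial⟩)).integrableOn_compact (hK y).1
  refine ⟨fun τ hτ τ' hτ' => ?_, fun a τ => ?_, fun U τ hU hτ s hs => ?_⟩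
  · simp only [hI]
    rw [← Finset.sum_add_distrib]
    refine Finset.sum_congr rfl fun y _ => ?_
    rw [← integral_add (hint τ hτ y) (hint τ' hτ' y)]
    refine integral_congr_ae (Eventually.of_forall fun u => ?_)
    exact mul_add _ _ _
  · simp only [hI]
    rw [Finset.mul_sum]
    refine Finset.sum_congr rfl fun y _ => ?_
    rw [← integral_const_mul]
    refine integral_congr_ae (Eventually.of_forall fun u => ?_)
    exact mul_left_comm _ _ _
  · simp only [hI]
    refine (DifferentiableAt.fun_sum fun y _ => ?_).differentiableWithinAt
    have hfam := (hτ _ (hch y)).comp (φ := fun u : (chartAt (Eu d) y).target =>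
      (⟨(u.1, h), u.2, trivial⟩ : ((chartAt (Eu d) y).target ×ˢ univ : Set (Eu d × ℝ))))
      (by fun_prop)
    have hlc : LocallyCompactSpace (chartAt (Eu d) y).target :=
      (chartAt (Eu d) y).open_target.locallyCompactSpace
    have hL : IsCompact ((↑) ⁻¹' K y : Set (chartAt (Eu d) y).target) := by
      rw [Subtype.isCompact_iff, Subtype.image_preimage_coe, inter_eq_right.2 (hK y).2.1]
      exact (hK y).1
    obtain ⟨R₁, hR₁, C, hC⟩ := hfam.exists_bound hU hs hL
    obtain ⟨R₂, hR₂, hRU⟩ := Metric.isOpen_iff.1 hU s hs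
    obtain ⟨C', hC'⟩ := ((hK y).1.image_of_continuousOn (hK y).2.2.norm).bddAbove
    have hmem : ∀ᵐ u ∂(volume.restrict (K y)), u ∈ K y :=
      ae_restrict_mem (hK y).1.measurableSet
    refine differentiableAt_integral_of_dominated (lt_min hR₁ hR₂) (bound := fun _ => C' * C)
      (fun z hz => (hint _ (hτ.mem_contSubmodule (hRU (Metric.ball_subset_ball
        (min_le_right _ _) hz))) y).aestronglyMeasurable) ?_ ?_ ?_
    · filter_upwards [hmem] with u hu
      exact ((hfam.hol ⟨u, (hK y).2.1 hu⟩).mono ((Metric.ball_subset_ball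
        (min_le_right _ _)).trans hRU)).const_mul (r y u)
    · filter_upwards [hmem] with u hu z hz
      have h1 : ‖r y u‖ ≤ C' := hC' ⟨u, hu, rfl⟩
      rw [norm_mul]
      exact mul_le_mul h1 (hC z (Metric.ball_subset_ball (min_le_left _ _) hz)
        ⟨u, (hK y).2.1 hu⟩ hu) (norm_nonneg _) ((norm_nonneg _).trans h1)
    · have := isFiniteMeasure_restrict (μ := (volume : Measure (Eu d))).2 (hK y).1.measure_lt_top.ne
      exact integrable_const _

end Functionals

/-! ### The continuation of the local trace -/

section Continuation

variable {d : ℕ} {M : Type*} [TopologicalSpace M] [T2Space M] [ChartedSpace (Eu d) M]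
  [IsManifold 𝓘(ℝ, Eu d) ∞ M] {F : LieFiltration d M} {S : F.Splitting} {nab : GradedConnection S}
  {Ω U : Set ℂ} {L : ℂ → ∀ x : M, ℝ → DensityAt d x} {w : ℂ → ℂ}

theorem IsJetFamily.mono {Y : Type*} [TopologicalSpace Y] {g : ℕ → ℂ → Y × ℝ → ℂ}
    (hg : IsJetFamily Ω g) (hU : U ⊆ Ω) : IsJetFamily U g :=
  ⟨fun j => (hg.hol j).mono hU, fun j s hs => hg.deriv j s (hU hs)⟩

variable (nab) in
/-- In exponential charts, the coefficients of `L s` on `M × ℝ` and all their derivatives in the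
direction of `ℝ` are continuous and depend holomorphically on `s`. -/
def HasJets (Ω : Set ℂ) (L : ℂ → ∀ x : M, ℝ → DensityAt d x) : Prop :=
  ∀ (c : ExpChart nab) (ρ : Eu d → ℂ), ContDiff ℝ ∞ ρ → HasCompactSupport ρ →
    tsupport ρ ⊆ c.φ.target → ∃ g, IsJetFamily Ω g ∧ ∀ s ∈ Ω, ∀ u ∈ c.φ.target, ∀ t,
      g 0 s (u, t) = ρ u * (L s (c.φ.symm u) t).1 fun i => c.field i (c.φ.symm u)

theorem hasJets_localTrace {μ : ℂ → ℂ} {P : ℂ → KernelDist nab} (hΩ : IsOpen Ω)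
    (hP : IsHolomorphicKernelFamily Ω μ P) (hμ : DifferentiableOn ℂ μ Ω) :
    HasJets nab Ω fun s => localTrace (lieZ (P s) - μ s • P s) := by
  intro c ρ hρ hρc hρt
  choose! k hk using fun s (hs : s ∈ Ω) => (hP.psido s hs).2.exp c
  obtain ⟨g, hg, hg0⟩ := c.exists_jetFamily hΩ hP.holomorphic hμ (fun s hs => (hP.psido s hs).1)
    (fun s hs => (hk s hs).1) (fun s hs => (hk s hs).2) hρ hρc hρt
  refine ⟨g, hg, fun s hs u hu t => ?_⟩
  rw [hg0 s hs, (isLocalTrace_of_isSmoothProperDensity (hP.psido s hs).2).apply_frame c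
    (hk s hs).1.continuousOn (hk s hs).2 hu t]

/-- The section obtained from `τ` by the regularized integral in the direction of `ℝ`. -/
def regSection (J : ℕ) (w : ℂ) (τ : ∀ x : M, ℝ → DensityAt d x) : ∀ x : M, ℝ → DensityAt d x :=
  mapSection (reg J w) (reg_const_mul J w) τ

namespace HasJets

theorem isHolSection_mapSection (hL : HasJets nab Ω L) (hU : IsOpen U) (hUΩ : U ⊆ Ω)
    {Φ : ℂ → (ℝ → ℂ) → ℝ → ℂ} (hΦ : ∀ s a f h, Φ s (fun h => a * f h) h = a * Φ s f h)
    (H : ∀ g : ℕ → ℂ → Eu d × ℝ → ℂ, IsJetFamily U g →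
      IsHolFamily U fun s (q : Eu d × ℝ) => Φ s (fun h => g 0 s (q.1, h)) q.2) :
    IsHolSection U fun s => mapSection (Φ s) (hΦ s) (L s) := by
  refine isHolSection_of_expChart nab hU fun c ρ hρ hρc hρt => ?_
  obtain ⟨g, hg, hg0⟩ := hL c ρ hρ hρc hρt
  refine ⟨_, H g (hg.mono hUΩ), fun s hs u hu t => ?_⟩
  simp only [hg0 s (hUΩ hs) u hu, hΦ]
  rfl

/-- The integral section does not depend on the number of Taylor coefficients split off. -/
theorem regSection_eq (hL : HasJets nab Ω L) (hΩ : IsOpen Ω) {s : ℂ} (hs : s ∈ Ω) {J J' : ℕ}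
    {z : ℂ} (hJ : 0 < (z + J).re) (hJ' : 0 < (z + J').re) :
    regSection J z (L s) = regSection J' z (L s) := by
  funext x h
  refine Subtype.ext (funext fun v => ?_)
  obtain ⟨c, hc⟩ := exists_expChart nab x
  obtain ⟨ρ, hρ, hρc, hρt, hρ1⟩ := exists_bump (isCompact_singleton (x := c.φ x))
    c.φ.open_target (singleton_subset_iff.2 (c.φ.map_source hc))
  rw [nhdsSet_singleton] at hρ1
  obtain ⟨g, hg, hg0⟩ := hL c ρ hρ hρc hρt
  obtain ⟨κ, hκ⟩ := c.exists_apply_eq_mul hc v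
  have h1 : (fun h => (L s x h).1 v) = fun h => κ * g 0 s (c.φ x, h) := funext fun h => by
    rw [hg0 s hs _ (c.φ.map_source hc), hρ1.self_of_nhds, one_mul, c.φ.left_inv hc]
    exact hκ _
  change reg J z (fun h => (L s x h).1 v) h = reg J' z (fun h => (L s x h).1 v) h
  rw [h1, reg_const_mul, reg_const_mul, hg.reg_eq hΩ hs hJ hJ']

end HasJets

/-- The local trace of a kernel of low order is an integral along the orbits of the zoom action. -/
theorem isLocalTrace_regSection {P : KernelDist nab} {m : ℂ} (hm : m.re < -(F.homDim : ℝ))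
    (hP : IsPsidoKernel m P) :
    IsLocalTrace P (regSection 0 (-(F.homDim : ℂ) - m) (localTrace (lieZ P - m • P))) := by
  intro c
  obtain ⟨k, hk, hkd⟩ := hP.2.exp c
  by_cases hne : c.φ.target.Nonempty
  · obtain ⟨u₀, hu₀⟩ := hne
    have hdim : F.homDim = c.totalDeg := c.homDim_eq (c.φ.map_target hu₀)
    rw [hdim] at hm ⊢
    refine ⟨c.lowDensity m k, c.continuousOn_lowDensity hm hk.continuousOn hkd,
      c.isDensityOn_lowDensity hm hP.1 hk.continuousOn hkd, fun u hu h => ?_⟩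
    have h1 : ∀ h, ((localTrace (lieZ P - m • P) (c.φ.symm u) h).1 fun i =>
        S.ψ (c.φ.symm u) (c.frame i (c.φ.symm u))) = k (u, 0, h) :=
      (isLocalTrace_of_isSmoothProperDensity hP.2).apply_frame c hk.continuousOn hkd hu
    change reg 0 _ (fun h => (localTrace (lieZ P - m • P) (c.φ.symm u) h).1 fun i =>
        S.ψ (c.φ.symm u) (c.frame i (c.φ.symm u))) h = _
    simp only [h1, reg, regRemainder, ExpChart.lowDensity, ExpChart.scale_apply, map_zero, inv_inv,
      Finset.range_zero, Finset.sum_empty, pow_zero, one_mul, zero_add, Nat.cast_zero, add_zero,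
      Function.iterate_zero_apply]
  · refine ⟨0, continuousOn_const, fun f _ u hu => (hne ⟨u, hu⟩).elim, fun u hu => (hne ⟨u, hu⟩).elim⟩

/-- The continuation of the local trace, as an element of `C(M × ℝ, ΩM)`. -/
def regTrace (z : ℂ) (τ : ∀ x : M, ℝ → DensityAt d x) : ContDensity d M :=
  toContDensity (regSection (⌈|z.re|⌉₊ + 1) z τ)

theorem re_add_ceil_pos (z : ℂ) : 0 < (z + ((⌈|z.re|⌉₊ + 1 : ℕ) : ℂ)).re := by
  have h1 := Nat.le_ceil |z.re|
  have h2 := neg_abs_le z.re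
  simp only [Complex.add_re, Complex.natCast_re, Nat.cast_add, Nat.cast_one, Complex.one_re]
  linarith

theorem isOpen_re_pos (hΩ : IsOpen Ω) (hw : DifferentiableOn ℂ w Ω) (J : ℕ) :
    IsOpen {s ∈ Ω | 0 < (w s + J).re} :=
  (Complex.continuous_re.comp_continuousOn (hw.continuousOn.add continuousOn_const)).isOpen_inter_preimage
    hΩ isOpen_Ioi

/-- Multiplied with `w (w + 1) ⋯ (w + J - 1)`, the continuation of the local trace is holomorphic
where `Re w > -J`. -/
theorem HasJets.exists_regNum (hL : HasJets nab Ω L) (hΩ : IsOpen Ω)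
    (hw : DifferentiableOn ℂ w Ω) (J : ℕ) :
    ∃ σ : ℂ → ∀ x : M, ℝ → DensityAt d x, IsHolSection {s ∈ Ω | 0 < (w s + J).re} σ ∧
      ∀ s ∈ Ω, 0 < (w s + J).re → (∀ j < J, w s + j ≠ 0) →
        (regTrace (w s) (L s)).1 = regSection J (w s) (L s) ∧
        regSection J (w s) (L s) = (∏ i ∈ Finset.range J, (w s + i))⁻¹ • σ s := by
  have hnum : IsHolSection {s ∈ Ω | 0 < (w s + J).re} fun s =>
      mapSection (regNum J (w s)) (regNum_const_mul J (w s)) (L s) :=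
    hL.isHolSection_mapSection (isOpen_re_pos hΩ hw J) (fun s hs => hs.1)
      (fun s => regNum_const_mul J (w s)) fun g hg =>
        hg.isHolFamily_regNum (isOpen_re_pos hΩ hw J) (hw.mono fun s hs => hs.1) fun s hs => hs.2
  refine ⟨_, hnum, fun s hs hJ hj => ?_⟩
  have hprod : (∏ i ∈ Finset.range J, (w s + i)) ≠ 0 :=
    Finset.prod_ne_zero_iff.2 fun i hi => hj i (Finset.mem_range.1 hi)
  have h1 : regSection J (w s) (L s) = (∏ i ∈ Finset.range J, (w s + i))⁻¹ •
      mapSection (regNum J (w s)) (regNum_const_mul J (w s)) (L s) := by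
    funext x h
    refine Subtype.ext (funext fun v => ?_)
    change reg J (w s) _ h = (∏ i ∈ Finset.range J, (w s + i))⁻¹ * regNum J (w s) _ h
    rw [regNum_eq_prod_mul hj, inv_mul_cancel_left₀ hprod]
  have h2 := hL.regSection_eq hΩ hs (re_add_ceil_pos (w s)) hJ
  have h3 : regSection J (w s) (L s) ∈ contSubmodule d M := by
    rw [h1]
    exact (contSubmodule d M).smul_mem _ (hnum.mem_contSubmodule ⟨hs, hJ⟩)
  rw [regTrace, h2]
  exact ⟨toContDensity_val h3, h1⟩

theorem IsHolSection.congr {τ τ' : ℂ → ∀ x : M, ℝ → DensityAt d x} (h : IsHolSection U τ)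
    (h' : ∀ s ∈ U, τ' s = τ s) : IsHolSection U τ' :=
  fun φ hφ => (h φ hφ).congr fun s hs y => by rw [h' s hs]

theorem HasJets.isHolSection_regTrace (hL : HasJets nab Ω L) (hΩ : IsOpen Ω)
    (hw : DifferentiableOn ℂ w Ω) {s₀ : ℂ} (hs₀ : s₀ ∈ Ω) (hw0 : ∀ j : ℕ, w s₀ + j ≠ 0) :
    ∃ U, IsOpen U ∧ s₀ ∈ U ∧ IsHolSection U fun s => (regTrace (w s) (L s)).1 := by
  obtain ⟨σ, hσ, h⟩ := hL.exists_regNum hΩ hw (⌈|(w s₀).re|⌉₊ + 1)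
  generalize hJ : ⌈|(w s₀).re|⌉₊ + 1 = J at h hσ
  have hp : DifferentiableOn ℂ (fun s => ∏ i ∈ Finset.range J, (w s + i))
      {s ∈ Ω | 0 < (w s + J).re} :=
    DifferentiableOn.fun_finsetProd fun i _ => (hw.mono fun s hs => hs.1).add_const _
  refine ⟨_, hp.continuousOn.isOpen_inter_preimage (isOpen_re_pos hΩ hw J)
    (isOpen_compl_singleton (x := 0)),
    ⟨⟨hs₀, hJ ▸ re_add_ceil_pos _⟩, Finset.prod_ne_zero_iff.2 fun i _ => hw0 i⟩, ?_⟩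
  refine ((hσ.mono inter_subset_left).smul ((hp.mono inter_subset_left).inv fun s hs => hs.2)).congr
    fun s hs => ?_
  obtain ⟨h1, h2⟩ := h s hs.1.1 hs.1.2 fun j hj =>
    Finset.prod_ne_zero_iff.1 hs.2 j (Finset.mem_range.2 hj)
  rw [h1, h2]
  rfl

theorem HasJets.exists_pow_smul_regTrace (hL : HasJets nab Ω L) (hΩ : IsOpen Ω)
    (hw : DifferentiableOn ℂ w Ω) {s₀ : ℂ} (hs₀ : s₀ ∈ Ω)
    (hne : ∀ j : ℕ, ¬ ∀ᶠ s in 𝓝 s₀, w s + j = 0) :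
    ∃ (n : ℕ) (U : Set ℂ) (σ : ℂ → ∀ x : M, ℝ → DensityAt d x), IsOpen U ∧ s₀ ∈ U ∧
      IsHolSection U σ ∧ ∀ s ∈ U, s ≠ s₀ → (s - s₀) ^ n • (regTrace (w s) (L s)).1 = σ s := by
  obtain ⟨σ, hσ, h⟩ := hL.exists_regNum hΩ hw (⌈|(w s₀).re|⌉₊ + 1)
  generalize hJ : ⌈|(w s₀).re|⌉₊ + 1 = J at h hσ
  have hwa : ∀ i : ℕ, AnalyticAt ℂ (fun s => w s + i) s₀ := fun i =>
    (hw.add_const _).analyticAt (hΩ.mem_nhds hs₀)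
  have hp : AnalyticAt ℂ (fun s => ∏ i ∈ Finset.range J, (w s + i)) s₀ :=
    Finset.analyticAt_fun_prod _ fun i _ => hwa i
  have hp0 : ¬ ∀ᶠ s in 𝓝 s₀, ∏ i ∈ Finset.range J, (w s + i) = 0 := fun h0 => by
    have h1 : ∀ᶠ s in 𝓝[≠] s₀, ∀ i ∈ Finset.range J, w s + i ≠ 0 :=
      (Finset.eventually_all _).2 fun i _ =>
        (hwa i).eventually_eq_zero_or_eventually_ne_zero.resolve_left (hne i)
    obtain ⟨s, h2, h3⟩ := (h1.and (h0.filter_mono nhdsWithin_le_nhds)).exists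
    exact Finset.prod_ne_zero_iff.2 h2 h3
  obtain ⟨n, g, hg, hg0, hpg⟩ := hp.exists_eventuallyEq_pow_smul_nonzero_iff.2 hp0
  obtain ⟨U, hU, hUo, hsU⟩ := eventually_nhds_iff.1 (((hpg.and hg.eventually_analyticAt).and
    (hg.continuousAt.eventually_ne hg0)).and ((isOpen_re_pos hΩ hw J).eventually_mem
      ⟨hs₀, hJ ▸ re_add_ceil_pos _⟩))
  have hgU : DifferentiableOn ℂ g U := fun s hs =>
    (hU s hs).1.1.2.differentiableAt.differentiableWithinAt
  refine ⟨n, U, _, hUo, hsU, (hσ.mono fun s hs => (hU s hs).2).smul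
    (hgU.inv fun s hs => (hU s hs).1.2), fun s hs hss => ?_⟩
  obtain ⟨⟨⟨h1, -⟩, h2⟩, h3, h4⟩ := hU s hs
  have h5 : (s - s₀) ^ n ≠ 0 := pow_ne_zero _ (sub_ne_zero.2 hss)
  obtain ⟨h6, h7⟩ := h s h3 h4 fun j hj => Finset.prod_ne_zero_iff.1
    (h1.trans_ne (smul_ne_zero h5 h2)) j (Finset.mem_range.2 hj)
  rw [h6, h7, h1, smul_smul, smul_eq_mul, mul_inv, mul_inv_cancel_left₀ h5]
  rfl

/-- At a point where `w` vanishes, the singular part of the continuation is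
`w(s)⁻¹ • L s` at `h = 0`. -/
theorem HasJets.exists_regTrace_eq (hL : HasJets nab Ω L) (hΩ : IsOpen Ω)
    (hw : DifferentiableOn ℂ w Ω) :
    ∃ R : ℂ → ∀ x : M, ℝ → DensityAt d x, IsHolSection {s ∈ Ω | 0 < (w s + (1 : ℕ)).re} R ∧
      IsHolSection {s ∈ Ω | 0 < (w s + (1 : ℕ)).re} (fun s x _ => L s x 0) ∧
      ∀ s ∈ Ω, 0 < (w s + (1 : ℕ)).re → w s ≠ 0 →
        (regTrace (w s) (L s)).1 = (w s)⁻¹ • (fun x _ => L s x 0) + R s := by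
  have hU := isOpen_re_pos hΩ hw 1
  have hsub : {s ∈ Ω | 0 < (w s + (1 : ℕ)).re} ⊆ Ω := fun s hs => hs.1
  have hrem := hL.isHolSection_mapSection hU hsub
    (fun s => regRemainder_const_mul 1 (w s)) fun g hg =>
      hg.isHolFamily_regRemainder hU (hw.mono hsub) fun s hs => hs.2
  have hzero := hL.isHolSection_mapSection hU hsub (Φ := fun _ f _ => f 0) (fun _ _ _ _ => rfl)
    fun g hg => (hg.hol 0).comp (φ := fun q : Eu d × ℝ => (q.1, 0)) (by fun_prop)
  refine ⟨_, hrem, hzero, fun s hs hre hws => ?_⟩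
  obtain ⟨σ, -, h⟩ := hL.exists_regNum hΩ hw 1
  rw [(h s hs hre fun j hj => by obtain rfl : j = 0 := by omega
                                 simpa using hws).1]
  funext x h
  refine Subtype.ext (funext fun v => ?_)
  change reg 1 (w s) (fun h => (L s x h).1 v) h =
    (w s)⁻¹ * (L s x 0).1 v + regRemainder 1 (w s) (fun h => (L s x h).1 v) h
  simp [reg]

variable {Λ : (∀ x : M, ℝ → DensityAt d x) → ℂ}

theorem HasJets.meromorphicAt (hL : HasJets nab Ω L) (hΩ : IsOpen Ω)
    (hw : DifferentiableOn ℂ w Ω) {s₀ : ℂ} (hs₀ : s₀ ∈ Ω)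
    (hne : ∀ j : ℕ, ¬ ∀ᶠ s in 𝓝 s₀, w s + j = 0) (hΛ : IsHolFunctional Λ) :
    MeromorphicAt (fun s => Λ (regTrace (w s) (L s)).1) s₀ := by
  obtain ⟨n, U, σ, hU, hsU, hσ, h⟩ := hL.exists_pow_smul_regTrace hΩ hw hs₀ hne
  have h1 : MeromorphicAt (fun s => ((s - s₀) ^ n)⁻¹ * Λ (σ s)) s₀ :=
    (((MeromorphicAt.id s₀).sub (MeromorphicAt.const s₀ s₀)).pow n).inv.mul
      ((hΛ.differentiableOn U σ hU hσ).analyticAt (hU.mem_nhds hsU)).meromorphicAt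
  refine h1.congr ?_
  filter_upwards [self_mem_nhdsWithin, mem_nhdsWithin_of_mem_nhds (hU.mem_nhds hsU)] with s hs hsU
  rw [← h s hsU hs, hΛ.smul, inv_mul_cancel_left₀ (pow_ne_zero _ (sub_ne_zero.2 hs))]

theorem HasJets.hasResidue (hL : HasJets nab Ω L) (hΩ : IsOpen Ω)
    (hw : DifferentiableOn ℂ w Ω) {s₀ : ℂ} (hs₀ : s₀ ∈ Ω)
    (hne : ¬ ∀ᶠ s in 𝓝 s₀, w s = 0) (hw0 : w s₀ = 0) (hΛ : IsHolFunctional Λ) :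
    (∃ c, HasResidue (fun s => Λ (regTrace (w s) (L s)).1) s₀ c ∧
      HasResidue (fun s => (w s)⁻¹ * Λ fun x _ => L s x 0) s₀ c) ∧
    (deriv w s₀ ≠ 0 → HasResidue (fun s => Λ (regTrace (w s) (L s)).1) s₀
      ((deriv w s₀)⁻¹ * Λ fun x _ => L s₀ x 0)) := by
  obtain ⟨R, hR, h0, h⟩ := hL.exists_regTrace_eq hΩ hw
  have hU := isOpen_re_pos hΩ hw 1
  have hsU : s₀ ∈ {s ∈ Ω | 0 < (w s + (1 : ℕ)).re} := ⟨hs₀, by simp [hw0]⟩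
  have hwa : AnalyticAt ℂ w s₀ := hw.analyticAt (hΩ.mem_nhds hs₀)
  have hRa := (hΛ.differentiableOn _ _ hU hR).analyticAt (hU.mem_nhds hsU)
  have h0a := (hΛ.differentiableOn _ _ hU h0).analyticAt (hU.mem_nhds hsU)
  have heq : ∀ᶠ s in 𝓝[≠] s₀, Λ (regTrace (w s) (L s)).1 =
      (w s)⁻¹ * Λ (fun x _ => L s x 0) + Λ (R s) := by
    filter_upwards [hwa.eventually_eq_zero_or_eventually_ne_zero.resolve_left hne,
      mem_nhdsWithin_of_mem_nhds (hU.mem_nhds hsU)] with s h1 h2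
    rw [h s h2.1 h2.2 h1, hΛ.add _ ((contSubmodule d M).smul_mem _ (h0.mem_contSubmodule h2)) _
      (hR.mem_contSubmodule h2), hΛ.smul]
  refine ⟨?_, fun hd => ?_⟩
  · obtain ⟨c, hc⟩ := exists_hasResidue_div h0a hwa hw0 hne
    exact ⟨c, (hc.add_analytic hRa).congr heq, hc⟩
  · exact ((hasResidue_div_of_deriv_ne_zero h0a hwa hw0 hd).add_analytic hRa).congr heq

end Continuation

/-! ### Kernels with the same restriction to `h = 1` -/

section Restriction

variable {d : ℕ} {M : Type*} [TopologicalSpace M] [ChartedSpace (Eu d) M]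
  [IsManifold 𝓘(ℝ, Eu d) ∞ M] {F : LieFiltration d M} {S : F.Splitting} {nab : GradedConnection S}

theorem IsRestriction.apply_eq {P P' : KernelDist nab} {Q : OperatorDist d M}
    (h : IsRestriction P Q) (h' : IsRestriction P' Q) (f : CInf (hAtlas nab)) (x : M) :
    P.1 f (x, 1) = P'.1 f (x, 1) := by
  have hg : (fun p : M × M => f (HTangent.pair p.1 p.2 1 one_ne_zero)) ∈
      smoothSubmodule (squareAtlas d M) := by
    rintro _ ⟨φ, hφ, φ', hφ', rfl⟩
    have h1 := f.2 _ (Or.inl ⟨φ, hφ, φ', hφ', rfl⟩)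
    refine (h1.comp (f := fun q : Eu d × Eu d => ((q.1, q.2, 1) : Coord d))
      (by fun_prop) fun q hq => ⟨hq.1, hq.2, one_ne_zero⟩).congr fun q _ => ?_
    simp [pairPlot]
  rw [← h f ⟨_, hg⟩ fun _ _ => rfl, ← h' f ⟨_, hg⟩ fun _ _ => rfl]

end Restriction

/-! ### The two trace formulas -/

section TraceFormulas

variable {d : ℕ} {M : Type*} [TopologicalSpace M] [T2Space M] [ChartedSpace (Eu d) M]
  [IsManifold 𝓘(ℝ, Eu d) ∞ M] {F : LieFiltration d M} {S : F.Splitting} {nab : GradedConnection S}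
  {Ω : Set ℂ} {μ : ℂ → ℂ} {P : ℂ → KernelDist nab}

/-- The continuation of the local trace of a family of kernels. -/
def traceFamily (μ : ℂ → ℂ) (P : ℂ → KernelDist nab) (s : ℂ) : ContDensity d M :=
  regTrace (-(F.homDim : ℂ) - μ s) (localTrace (lieZ (P s) - μ s • P s))

theorem isLocalTrace_iff_eq_traceFamily (hΩ : IsOpen Ω) (hμ : DifferentiableOn ℂ μ Ω)
    (hP : IsHolomorphicKernelFamily Ω μ P) {s : ℂ} (hs : s ∈ Ω)
    (hre : (μ s).re < -(F.homDim : ℝ)) (τ : ∀ x : M, ℝ → DensityAt d x) :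
    IsLocalTrace (P s) τ ↔ τ = (traceFamily μ P s).1 := by
  obtain ⟨σ, -, h⟩ := (hasJets_localTrace hΩ hP hμ).exists_regNum hΩ
    (hμ.const_sub (-(F.homDim : ℂ))) 0
  have h1 := isLocalTrace_regSection hre (hP.psido s hs)
  rw [← (h s hs (by simp; linarith) (by simp)).1] at h1
  exact ⟨fun h => h.unique h1, fun h => h ▸ h1⟩

theorem not_eventually_eq_zero (hΩ : IsOpen Ω) (hΩc : IsPreconnected Ω)
    (hμ : DifferentiableOn ℂ μ Ω) {N : ℕ} (hne : ∃ s ∈ Ω, (μ s).re < -(N : ℝ)) {s₀ : ℂ}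
    (hs₀ : s₀ ∈ Ω) (j : ℕ) : ¬ ∀ᶠ s in 𝓝 s₀, -(N : ℂ) - μ s + j = 0 := fun h => by
  obtain ⟨s, hs, hre⟩ := hne
  have h1 : AnalyticOnNhd ℂ (fun s => -(N : ℂ) - μ s + j) Ω :=
    ((hμ.const_sub _).add_const _).analyticOnNhd hΩ
  have h2 := congrArg Complex.re (h1.eqOn_of_preconnected_of_eventuallyEq
    (analyticOnNhd_const (v := (0 : ℂ))) hΩc hs₀ h hs)
  have h3 : (0 : ℝ) ≤ j := Nat.cast_nonneg j
  simp at h2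
  linarith

theorem lieZ_sub_smul_of_eq {P : KernelDist nab} {m : ℂ} (hm : m = -(F.homDim : ℂ)) :
    lieZ P - m • P = lieZ P + (F.homDim : ℂ) • P := by
  refine Subtype.ext (ContinuousLinearMap.ext fun f => ?_)
  change (lieZ P).1 f - m • P.1 f = (lieZ P).1 f + (F.homDim : ℂ) • P.1 f
  rw [hm, neg_smul, sub_neg_eq_add]

/-- The residues of the local trace, tested against a functional. -/
theorem hasResidue_traceFamily (hΩ : IsOpen Ω) (hΩc : IsPreconnected Ω)
    (hμ : DifferentiableOn ℂ μ Ω) (hne : ∃ s ∈ Ω, (μ s).re < -(F.homDim : ℝ))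
    (hP : IsHolomorphicKernelFamily Ω μ P) {s₀ : ℂ} (hs₀ : s₀ ∈ Ω)
    (h0 : μ s₀ = -(F.homDim : ℂ)) {Λ : (∀ x : M, ℝ → DensityAt d x) → ℂ}
    (hΛ : IsHolFunctional Λ) :
    (∃ c, HasResidue (fun s => Λ (traceFamily μ P s).1) s₀ c ∧
      HasResidue (fun s => (-(F.homDim : ℂ) - μ s)⁻¹ *
        Λ fun x _ => localTrace (lieZ (P s) - μ s • P s) x 0) s₀ c) ∧
    (deriv μ s₀ ≠ 0 → HasResidue (fun s => Λ (traceFamily μ P s).1) s₀ (-(deriv μ s₀)⁻¹ *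
      Λ fun x _ => localTrace (lieZ (P s₀) + (F.homDim : ℂ) • P s₀) x 0)) := by
  have h := (hasJets_localTrace hΩ hP hμ).hasResidue hΩ (hμ.const_sub (-(F.homDim : ℂ))) hs₀
    (by simpa using not_eventually_eq_zero hΩ hΩc hμ hne hs₀ 0) (by simp [h0]) hΛ
  refine ⟨h.1, fun hd => ?_⟩
  have h2 := h.2 (by rw [deriv_const_sub]; exact neg_ne_zero.2 hd)
  rw [deriv_const_sub, inv_neg, lieZ_sub_smul_of_eq h0] at h2
  exact h2

theorem meromorphicAt_traceFamily (hΩ : IsOpen Ω) (hΩc : IsPreconnected Ω)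
    (hμ : DifferentiableOn ℂ μ Ω) (hne : ∃ s ∈ Ω, (μ s).re < -(F.homDim : ℝ))
    (hP : IsHolomorphicKernelFamily Ω μ P) {s₀ : ℂ} (hs₀ : s₀ ∈ Ω)
    {Λ : (∀ x : M, ℝ → DensityAt d x) → ℂ} (hΛ : IsHolFunctional Λ) :
    MeromorphicAt (fun s => Λ (traceFamily μ P s).1) s₀ :=
  (hasJets_localTrace hΩ hP hμ).meromorphicAt hΩ (hμ.const_sub (-(F.homDim : ℂ))) hs₀
    (not_eventually_eq_zero hΩ hΩc hμ hne hs₀) hΛ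

theorem isMeromorphicAt_traceFamily (hΩ : IsOpen Ω) (hΩc : IsPreconnected Ω)
    (hμ : DifferentiableOn ℂ μ Ω) (hne : ∃ s ∈ Ω, (μ s).re < -(F.homDim : ℝ))
    (hP : IsHolomorphicKernelFamily Ω μ P) {s₀ : ℂ} (hs₀ : s₀ ∈ Ω) :
    IsMeromorphicAt (traceFamily μ P) s₀ := by
  obtain ⟨n, U, σ, hU, hsU, hσ, h⟩ := (hasJets_localTrace hΩ hP hμ).exists_pow_smul_regTrace hΩ
    (hμ.const_sub (-(F.homDim : ℂ))) hs₀ (not_eventually_eq_zero hΩ hΩc hμ hne hs₀)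
  have h1 : ∀ s ∈ U, (toContDensity (σ s)).1 = σ s := fun s hs =>
    toContDensity_val (hσ.mem_contSubmodule hs)
  refine ⟨n, U, fun s => toContDensity (σ s), hU, hsU,
    hσ.isHolomorphicOn hU fun s hs x t => by rw [h1 s hs], fun s hs hss => ?_⟩
  exact Subtype.ext ((h s hs hss).trans (h1 s hs).symm)

theorem exists_isHolSection_traceFamily (hΩ : IsOpen Ω) (hμ : DifferentiableOn ℂ μ Ω)
    (hP : IsHolomorphicKernelFamily Ω μ P) {s₀ : ℂ} (hs₀ : s₀ ∈ Ω)
    (h0 : ¬ ∃ j : ℕ, μ s₀ = -(F.homDim : ℂ) + j) :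
    ∃ U, IsOpen U ∧ s₀ ∈ U ∧ IsHolSection U fun s => (traceFamily μ P s).1 :=
  (hasJets_localTrace hΩ hP hμ).isHolSection_regTrace hΩ (hμ.const_sub (-(F.homDim : ℂ))) hs₀
    fun j hj => h0 ⟨j, by linear_combination -hj⟩

theorem isGlobalTrace_iff [SigmaCompactSpace M] {Q : ℂ → OperatorDist d M} (hΩ : IsOpen Ω)
    (hμ : DifferentiableOn ℂ μ Ω) (hP : Represents Ω μ P Q) {s : ℂ} (hs : s ∈ Ω)
    (hre : (μ s).re < -(F.homDim : ℝ)) (t : ℂ) :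
    IsGlobalTrace nab (μ s) (Q s) t ↔ t = densityIntegral fun x => (traceFamily μ P s).1 x 1 := by
  have h1 : IsLocalTrace (P s) (traceFamily μ P s).1 :=
    (isLocalTrace_iff_eq_traceFamily hΩ hμ hP.1 hs hre _).2 rfl
  refine ⟨?_, fun h => ⟨P s, hP.1.psido s hs, hP.2 s hs, _, h1, h⟩⟩
  rintro ⟨A, -, hAQ, τ, hτ, rfl⟩
  exact congrArg densityIntegral (funext fun x =>
    hτ.eq_of_eq h1 (fun f x => hAQ.apply_eq (hP.2 s hs) f x) x)

/-- The continuation of the global trace depends only on the family of operators. -/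
theorem eventually_densityIntegral_eq [SigmaCompactSpace M] [CompactSpace M]
    {Q : ℂ → OperatorDist d M} {P' : ℂ → KernelDist nab} (hΩ : IsOpen Ω) (hΩc : IsPreconnected Ω)
    (hμ : DifferentiableOn ℂ μ Ω) (hne : ∃ s ∈ Ω, (μ s).re < -(F.homDim : ℝ))
    (hP : Represents Ω μ P Q) (hP' : Represents Ω μ P' Q) {s₀ : ℂ} (hs₀ : s₀ ∈ Ω) :
    ∀ᶠ s in 𝓝[≠] s₀, (densityIntegral fun x => (traceFamily μ P s).1 x 1) =
      densityIntegral fun x => (traceFamily μ P' s).1 x 1 := by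
  have hΛ := isHolFunctional_densityIntegral (d := d) (M := M) 1
  obtain ⟨s₁, hs₁, hre⟩ := hne
  have hmero : MeromorphicOn (fun s => (densityIntegral fun x => (traceFamily μ P s).1 x 1) -
      densityIntegral fun x => (traceFamily μ P' s).1 x 1) Ω := fun s hs =>
    (meromorphicAt_traceFamily hΩ hΩc hμ ⟨s₁, hs₁, hre⟩ hP.1 hs hΛ).sub
      (meromorphicAt_traceFamily hΩ hΩc hμ ⟨s₁, hs₁, hre⟩ hP'.1 hs hΛ)
  have h1 : ∀ᶠ s in 𝓝[≠] s₁, (densityIntegral fun x => (traceFamily μ P s).1 x 1) -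
      (densityIntegral fun x => (traceFamily μ P' s).1 x 1) = 0 := by
    have h2 := Complex.continuous_re.continuousAt.comp
      (hμ.continuousOn.continuousAt (hΩ.mem_nhds hs₁))
    filter_upwards [mem_nhdsWithin_of_mem_nhds (hΩ.mem_nhds hs₁),
      (h2.eventually (gt_mem_nhds hre)).filter_mono nhdsWithin_le_nhds] with s hs hsre
    exact sub_eq_zero.2 ((isGlobalTrace_iff hΩ hμ hP' hs hsre _).1
      ((isGlobalTrace_iff hΩ hμ hP hs hsre _).2 rfl))
  by_contra h3
  have h4 := (hmero.exists_meromorphicOrderAt_ne_top_iff_forall ⟨⟨s₁, hs₁⟩, hΩc⟩).1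
    ⟨⟨s₀, hs₀⟩, fun h => h3 ((meromorphicOrderAt_eq_top_iff.1 h).mono fun s => sub_eq_zero.1)⟩
  exact h4 ⟨s₁, hs₁⟩ (meromorphicOrderAt_eq_top_iff.2 h1)

end TraceFormulas

end Carnot
end

theorem proposition3p2 {d : ℕ} {M : Type*} [TopologicalSpace M] [T2Space M] [SigmaCompactSpace M]
    [ChartedSpace (Carnot.Eu d) M] [IsManifold 𝓘(ℝ, Carnot.Eu d) ∞ M]
    (F : Carnot.LieFiltration d M) (S : F.Splitting) (nab : Carnot.GradedConnection S)
    (Ω : Set ℂ) (hΩ : IsOpen Ω) (hΩc : IsPreconnected Ω)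
    (μ : ℂ → ℂ) (hμ : DifferentiableOn ℂ μ Ω)
    (hne : ∃ s ∈ Ω, (μ s).re < -(F.homDim : ℝ)) :
    -- the local trace
    (∀ P : ℂ → Carnot.KernelDist nab, Carnot.IsHolomorphicKernelFamily Ω μ P →
      ∃ T : ℂ → Carnot.ContDensity d M,
        (∀ s ∈ Ω, (μ s).re < -(F.homDim : ℝ) →
          ∀ τ, Carnot.IsLocalTrace (P s) τ ↔ τ = fun x h => T s x h) ∧
        Carnot.IsHolomorphicOn T (Ω \ {s | ∃ j : ℕ, μ s = -(F.homDim : ℂ) + j}) ∧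
        (∀ s₀ ∈ Ω, Carnot.IsMeromorphicAt T s₀) ∧
        ∀ s₀ ∈ Ω, μ s₀ = -(F.homDim : ℂ) →
          ∀ (h : ℝ) (x : M) (v : Fin d → TangentSpace 𝓘(ℝ, Carnot.Eu d) x),
            (∃ c : ℂ,
              Carnot.HasResidue (fun s => (T s x h).1 v) s₀ c ∧
              Carnot.HasResidue (fun s => (-(F.homDim : ℂ) - μ s)⁻¹ *
                (Carnot.localTrace (Carnot.lieZ (P s) - μ s • P s) x 0).1 v) s₀ c) ∧
            (deriv μ s₀ ≠ 0 →
              Carnot.HasResidue (fun s => (T s x h).1 v) s₀ (-(deriv μ s₀)⁻¹ *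
                (Carnot.localTrace
                  (Carnot.lieZ (P s₀) + (F.homDim : ℂ) • P s₀) x 0).1 v))) ∧
    -- the global trace on a compact manifold
    (CompactSpace M → ∀ Q : ℂ → Carnot.OperatorDist d M,
      (∃ P : ℂ → Carnot.KernelDist nab, Carnot.Represents Ω μ P Q) →
      ∃ G : ℂ → ℂ,
        (∀ s ∈ Ω, (μ s).re < -(F.homDim : ℝ) →
          ∀ t, Carnot.IsGlobalTrace nab (μ s) (Q s) t ↔ t = G s) ∧
        (∀ s ∈ Ω, (¬ ∃ j : ℕ, μ s = -(F.homDim : ℂ) + j) → AnalyticAt ℂ G s) ∧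
        (∀ s₀ ∈ Ω, MeromorphicAt G s₀) ∧
        ∀ s₀ ∈ Ω, μ s₀ = -(F.homDim : ℂ) →
          ∀ P : ℂ → Carnot.KernelDist nab, Carnot.Represents Ω μ P Q →
            (∃ c : ℂ,
              Carnot.HasResidue G s₀ c ∧
              Carnot.HasResidue (fun s => (-(F.homDim : ℂ) - μ s)⁻¹ *
                Carnot.densityIntegral fun x =>
                  Carnot.localTrace (Carnot.lieZ (P s) - μ s • P s) x 0) s₀ c) ∧
            (deriv μ s₀ ≠ 0 →
              Carnot.HasResidue G s₀ (-(deriv μ s₀)⁻¹ *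
                Carnot.densityIntegral fun x =>
                  Carnot.localTrace (Carnot.lieZ (P s₀) + (F.homDim : ℂ) • P s₀) x 0))) := by
  refine ⟨fun P hP => ?_, fun hM Q hQ => ?_⟩
  · refine ⟨Carnot.traceFamily μ P,
      fun s hs hre τ => Carnot.isLocalTrace_iff_eq_traceFamily hΩ hμ hP hs hre τ,
      fun s hs => ?_, fun s₀ hs₀ => Carnot.isMeromorphicAt_traceFamily hΩ hΩc hμ hne hP hs₀,
      fun s₀ hs₀ h0 h x v => Carnot.hasResidue_traceFamily hΩ hΩc hμ hne hP hs₀ h0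
        (Carnot.isHolFunctional_apply x h v)⟩
    obtain ⟨U, hU, hsU, hσ⟩ := Carnot.exists_isHolSection_traceFamily hΩ hμ hP hs.1 hs.2
    exact hσ.isHolomorphicOn hU (fun _ _ _ _ => rfl) s hsU
  · obtain ⟨P, hP⟩ := hQ
    have hΛ := Carnot.isHolFunctional_densityIntegral (d := d) (M := M) 1
    refine ⟨fun s => Carnot.densityIntegral fun x => Carnot.traceFamily μ P s x 1,
      fun s hs hre t => Carnot.isGlobalTrace_iff hΩ hμ hP hs hre t, fun s hs h0 => ?_,
      fun s₀ hs₀ => Carnot.meromorphicAt_traceFamily hΩ hΩc hμ hne hP.1 hs₀ hΛ,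
      fun s₀ hs₀ h0 P' hP' => ?_⟩
    · obtain ⟨U, hU, hsU, hσ⟩ := Carnot.exists_isHolSection_traceFamily hΩ hμ hP.1 hs h0
      exact (hΛ.differentiableOn U _ hU hσ).analyticAt (hU.mem_nhds hsU)
    · obtain ⟨⟨c, h1, h2⟩, h3⟩ := Carnot.hasResidue_traceFamily hΩ hΩc hμ hne hP'.1 hs₀ h0 hΛ
      have heq := Carnot.eventually_densityIntegral_eq hΩ hΩc hμ hne hP hP' hs₀
      exact ⟨⟨c, h1.congr heq, h2⟩, fun hd => (h3 hd).congr heq⟩
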